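/- **Setting.** For $0<\epsilon$ let $K=\{(x,y): 0<y<x\}$, $\theta=\arctan\epsilon$, and use polar coordinates $(x,\epsilon y)=r(\cos\varphi,\sin\varphi)$, in which $K$ is $\{0<\varphi<\theta\}$. Write $\mu=\min\{|\lambda|,1/\epsilon\}$ and let $\hat F(\lambda)=\int_0^\infty r^{-\lambda}F(r)\,\frac{dr}{r}$ be the Mellin transform (on a line $\mathrm{Re}\,\lambda=\beta$ in the $L^2$ sense; for functions on $K$ it is taken in $r$ for fixed $\varphi$). Fix smooth cut-offs $\zeta,\eta$ with $\zeta=1$ on $[0,\frac18]$, $\zeta=0$ on $[\frac14,\infty)$, $\eta=1$ on $[0,1]$, $\eta=0$ on $[2,\infty)$. $\|P\|$ denotes the $\ell^2$ norm of the coefficients of a polynomial $P$. * For $f:(0,\infty)\to\mathbb R$ write $f=\zeta P+f_0$ with $P$ a polynomial of degree $<\lceil 3k-\frac12\rceil$ and put $$\|f\|_{X^k}=\|P\|+\|f_0\|_{L^2(0,\infty)}+\big\||\lambda|^{3k+1}\mu^k\hat f_0\big\|_{L^2(\mathrm{Re}\lambda=3k-\frac12)}.$$ * For $q:K\to\mathbb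 R$, $w\in[0,\frac12]$ and real $a\ge 0$, $\ell,\beta$ put $$[q]_{a,\ell,\beta}=\sum_{j=0}^{\lfloor a\rfloor}\Big\|\sup_{0<\varphi<\theta}e^{w|\lambda|(\theta-\varphi)}|\lambda|^{a-j}\mu^\ell\,|\partial_\varphi^j\hat q(\lambda,\varphi)|\Big\|_{L^2(\mathrm{Re}\lambda=\beta)} .$$ * $\|q\|_{Y^k}=\|P\|+\sup_{2/3\le\ell\le k}[q_0]_{3\ell,\ell,3\ell-3/2}$, where $q=\zeta(r)P+q_0$ with a polynomial $P(x,y)$ of degree $<\lceil 3k-\frac32\rceil$. * $\|g\|_{Z^k}=\|P\|+\sup_{2/3\le\ell\le k}[g_0]_{3\ell-2,\ell,3\ell-7/2}$, where $g=\eta(r)P+g_0$ with a polynomial $P(x,y)$ of degree $<\lceil 3k-\frac72\rceil$. In each case there is at most one $P$ for which the expression is finite; the norm is $\infty$ if there is none, and the space consists of the functions of finite norm. **Lemma.** Let $k\ge 1$ be real. There is a constant $C$, depending only on $k$ and the fixed cut-offs, such that for all $\epsilon\in(0,\frac{\pi}{3(2k+1)})$ and all $w\in[0,\frac12]$ the following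 holds. Let $p\in Y^k$ be a solution, $C^2$ on $\overline K\setminus\{(0,0)\}$, of $$p_{xx}+\epsilon^{-2}p_{yy}=g\ \text{ in }K,\qquad p(x,x)=f_x(x)\ \ (x>0),\qquad p_y(x,0)=0\ \ (x>0),$$ with $f$ differentiable on $(0,\infty)$. Then $$\Big\|\tfrac{d}{dx}\big(p_x(x,x)\big)\Big\|_{X^k}+\epsilon^{-2}\Big\|\tfrac{d}{dx}\big(p_y(x,x)\big)\Big\|_{X^k}\le C\big(\|f\|_{X^{k+1}}+\|g\|_{Z^{k+1}}\big).$$ In particular $\epsilon^{-2}p_y$ is bounded on the free boundary $y=x$ uniformly in $\epsilon$ in the following sense: for all $x>0$, $$\epsilon^{-2}|p_y(x,x)|\le C\sqrt{x}\,\big(\|f\|_{X^{k+1}}+\|g\|_{Z^{k+1}}\big),$$ and if $k<4$, then also $\epsilon^{-2}|p_y(x,x)|\le C\big(\|f\|_{X^{k+1}}+\|g\|_{Z^{k+1}}\big)$ for all $x>0$. -/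

import Mathlib

open MeasureTheory Set
open scoped ENNReal NNReal FourierTransform ContDiff

noncomputable section

/-- A smooth cut-off equal to `1` on `[0,a]` and to `0` on `[b,∞)`. -/
structure IsCutoff (a b : ℝ) (ζ : ℝ → ℝ) : Prop where
  smooth : ContDiff ℝ ∞ ζ
  eq_one : ∀ r, r ≤ a → ζ r = 1
  eq_zero : ∀ r, b ≤ r → ζ r = 0

/-! ### The Mellin transform -/

/-- The point `λ = β + 2πiξ` of the line `Re λ = β`. With this parametrization and Lebesgue
measure in `ξ`, Plancherel's identity for the Mellin transform holds without a constant. -/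
def linePt (β ξ : ℝ) : ℂ := (β : ℂ) + 2 * Real.pi * ξ * Complex.I

/-- `u ↦ e^{-βu} F(e^u)`. -/
def logWeight (β : ℝ) (F : ℝ → ℝ) : ℝ → ℂ := fun u => ((Real.exp (-β * u) * F (Real.exp u) : ℝ) : ℂ)

/-- `h ξ` is the Mellin transform `∫₀^∞ x^{-λ} F(x) dx/x` at `λ = β + 2πiξ`, in the `L²` sense:
`u ↦ e^{-βu} F(e^u)` is square integrable and `h` is its (Plancherel) Fourier transform. -/
def IsMellinOn (β : ℝ) (F : ℝ → ℝ) (h : ℝ → ℂ) : Prop :=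
  ∃ hF : MemLp (logWeight β F) 2 (volume : Measure ℝ),
    h =ᵐ[volume] ((𝓕 (hF.toLp (logWeight β F)) : Lp ℂ 2 (volume : Measure ℝ)) : ℝ → ℂ)

/-- `μ = min {|λ|, 1/ε}`. -/
def muMin (ε : ℝ) (z : ℂ) : ℝ := min ‖z‖ (1 / ε)

/-- The `L²` norm over `ξ ∈ ℝ` of a nonnegative extended function. -/
def lineL2 (F : ℝ → ℝ≥0∞) : ℝ≥0∞ := (∫⁻ ξ, F ξ ^ (2 : ℝ)) ^ (1 / 2 : ℝ)

/-! ### Norms for functions on the half line -/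

/-- The homogeneous norm `‖ |λ|^{3k+1} μ^k f̂ ‖_{L²(Re λ = 3k - 1/2)}`, with value `∞` when `f` has
no `L²` Mellin transform on this line (the infimum is over representatives of one class). -/
def xHom (ε k : ℝ) (f : ℝ → ℝ) : ℝ≥0∞ :=
  ⨅ (h : ℝ → ℂ) (_ : IsMellinOn (3 * k - 1 / 2) f h),
    lineL2 fun ξ =>
      let z := linePt (3 * k - 1 / 2) ξ
      ENNReal.ofReal (‖z‖ ^ (3 * k + 1) * muMin ε z ^ k * ‖h ξ‖)

/-- The `ℓ²` norm of the coefficients. -/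
def polyNorm (P : Polynomial ℝ) : ℝ := Real.sqrt (∑ i ∈ P.support, P.coeff i ^ 2)

/-- The norm of `X^k_ε` on `(0,∞)`: `‖P‖ + ‖f₀‖_{L²} + [f₀]_k` where `f = ζ P + f₀` and `P` is the
Taylor polynomial of `f` at `0` of order `n_k = ⌈3k - 3/2⌉`, that is, of degree `< ⌈3k - 1/2⌉`.
It is the only polynomial of this degree for which the expression can be finite, since then `f₀`
is square integrable with respect to `x^{-6k} dx`. Elements of `X^k_ε` are the functions of finite
norm. -/
def xNorm (ζ : ℝ → ℝ) (ε k : ℝ) (f : ℝ → ℝ) : ℝ≥0∞ :=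
  ⨅ (P : Polynomial ℝ) (_ : P ∈ Polynomial.degreeLT ℝ ⌈3 * k - 1 / 2⌉₊),
    ENNReal.ofReal (polyNorm P)
      + eLpNorm (fun x => f x - ζ x * P.eval x) 2 (volume.restrict (Ioi (0 : ℝ)))
      + xHom ε k (fun x => f x - ζ x * P.eval x)

/-! ### Norms for functions on the wedge -/

/-- The wedge `0 < y < x`. -/
def wedge : Set (ℝ × ℝ) := {z | 0 < z.2 ∧ z.2 < z.1}

/-- The wedge with its two sides, without the corner. -/
def wedgeBar : Set (ℝ × ℝ) := {z | 0 < z.1 ∧ 0 ≤ z.2 ∧ z.2 ≤ z.1}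

/-- The radius `|(x, εy)|`. -/
def wedgeRadius (ε x y : ℝ) : ℝ := Real.sqrt (x ^ 2 + (ε * y) ^ 2)

/-- `r ↦ q(x,y)` on the ray `(x, εy) = r (cos φ, sin φ)`. In these coordinates the wedge is
`0 < φ < arctan ε`. -/
def polarSlice (ε : ℝ) (q : ℝ × ℝ → ℝ) (φ : ℝ) : ℝ → ℝ :=
  fun r => q (r * Real.cos φ, ε⁻¹ * (r * Real.sin φ))

/-- `H ξ φ` is the Mellin transform of `q` in the radial variable at `λ = β + 2πiξ` and angle `φ`,
`m` times continuously differentiable in `φ`. -/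
def IsWedgeMellin (ε : ℝ) (m : ℕ) (β : ℝ) (q : ℝ × ℝ → ℝ) (H : ℝ → ℝ → ℂ) : Prop :=
  (∀ φ ∈ Ioo 0 (Real.arctan ε), IsMellinOn β (polarSlice ε q φ) fun ξ => H ξ φ) ∧
  ∀ᵐ ξ ∂(volume : Measure ℝ), ContDiffOn ℝ m (H ξ) (Ioo 0 (Real.arctan ε))

/-- The homogeneous norm
`∑_{α₁+α₂=a} ‖ sup_φ e^{w|λ|(θ-φ)} |λ^{α₁} ∂_φ^{α₂} μ^ℓ q̂(λ,φ)| ‖_{L²(Re λ = β)}`, `θ = arctan ε`,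
over real `α₁ ≥ 0` and integers `α₂ ≥ 0`. In the variable `v = φ/ε` one has `∂_φ = ε⁻¹ ∂_v`. -/
def wedgeHom (ε w a ℓ β : ℝ) (q : ℝ × ℝ → ℝ) : ℝ≥0∞ :=
  ⨅ (H : ℝ → ℝ → ℂ) (_ : IsWedgeMellin ε ⌊a⌋₊ β q H),
    ∑ j ∈ Finset.range (⌊a⌋₊ + 1),
      lineL2 fun ξ =>
        let z := linePt β ξ
        ⨆ φ ∈ Ioo 0 (Real.arctan ε),
          ENNReal.ofReal (Real.exp (w * ‖z‖ * (Real.arctan ε - φ)) * ‖z‖ ^ (a - j) * muMin ε z ^ ℓ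
            * ‖iteratedDeriv j (H ξ) φ‖)

/-- The `ℓ²` norm of the coefficients. -/
def polyNorm₂ (P : MvPolynomial (Fin 2) ℝ) : ℝ :=
  Real.sqrt (∑ d ∈ P.support, P.coeff d ^ 2)

/-- `q - ζ(r) P`, `r = |(x, εy)|`. -/
def subPoly (ζ : ℝ → ℝ) (ε : ℝ) (P : MvPolynomial (Fin 2) ℝ) (q : ℝ × ℝ → ℝ) : ℝ × ℝ → ℝ :=
  fun z => q z - ζ (wedgeRadius ε z.1 z.2) * MvPolynomial.eval ![z.1, z.2] P

/-- All monomials of `P` have total degree `< m`. -/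
def DegLT (m : ℕ) (P : MvPolynomial (Fin 2) ℝ) : Prop := ∀ d ∈ P.support, d.degree < m

/-- The norm of `Y^k_ε` with angular weight `e^{w|λ|(θ-φ)}`:
`‖P‖ + sup_{2/3 ≤ ℓ ≤ k} [q₀]_ℓ` where `q = ζ P + q₀` and `P` has order `n_k - 1`, that is,
degree `< ⌈3k - 3/2⌉`. -/
def yNorm (ζ : ℝ → ℝ) (ε w k : ℝ) (q : ℝ × ℝ → ℝ) : ℝ≥0∞ :=
  ⨅ (P : MvPolynomial (Fin 2) ℝ) (_ : DegLT ⌈3 * k - 3 / 2⌉₊ P),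
    ENNReal.ofReal (polyNorm₂ P) +
      ⨆ ℓ ∈ Icc (2 / 3) k, wedgeHom ε w (3 * ℓ) ℓ (3 * ℓ - 3 / 2) (subPoly ζ ε P q)

/-- The norm of `Z^k_ε` with angular weight `e^{w|λ|(θ-φ)}`:
`‖P‖ + sup_{2/3 ≤ ℓ ≤ k} [g₀]_ℓ` where `g = ζ P + g₀` and `P` has order `n_k - 3`, that is,
degree `< ⌈3k - 7/2⌉`. -/
def zNorm (ζ : ℝ → ℝ) (ε w k : ℝ) (g : ℝ × ℝ → ℝ) : ℝ≥0∞ :=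
  ⨅ (P : MvPolynomial (Fin 2) ℝ) (_ : DegLT ⌈3 * k - 7 / 2⌉₊ P),
    ENNReal.ofReal (polyNorm₂ P) +
      ⨆ ℓ ∈ Icc (2 / 3) k, wedgeHom ε w (3 * ℓ - 2) ℓ (3 * ℓ - 7 / 2) (subPoly ζ ε P g)

/-! ### The linear pressure problem -/

/-- `∂_x p`, up to the sides of the wedge. -/
def dX (p : ℝ × ℝ → ℝ) : ℝ × ℝ → ℝ := fun z => fderivWithin ℝ p wedgeBar z (1, 0)

/-- `∂_y p`, up to the sides of the wedge. -/
def dY (p : ℝ × ℝ → ℝ) : ℝ × ℝ → ℝ := fun z => fderivWithin ℝ p wedgeBar z (0, 1)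

/-- `p` solves `p_xx + ε⁻² p_yy = g` in the wedge, `p = f_x` on the side `y = x`, `p_y = 0` on the
side `y = 0`. -/
structure IsWedgeSolution (ε : ℝ) (f : ℝ → ℝ) (g p : ℝ × ℝ → ℝ) : Prop where
  regular : ContDiffOn ℝ 2 p wedgeBar
  equation : ∀ z ∈ wedge, dX (dX p) z + (1 / ε) ^ 2 * dY (dY p) z = g z
  dirichlet : ∀ x, 0 < x → HasDerivAt f (p (x, x)) x
  neumann : ∀ x, 0 < x → dY p (x, 0) = 0

end

/-! ### The Plancherel transform on the line -/

noncomputable section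

/-! In the coordinates r = e^u and φ the wedge is the strip ℝ × (0, θ), the equation reads U_uu +
U_φφ = r² g, and the Mellin transform turns it into an ordinary differential equation in φ. If D is
the transform of the Dirichlet data at φ = θ and h that of the right-hand side, then formally Û_φ(θ)
= -λ tan(λθ) D + ∫_0^θ (cos(λφ) / cos(λθ)) h dφ. The zeros of cos(λθ) are avoided as long as |Re λ|
θ ≤ c₀ < π/2. The largest line needed is Re λ = 3k + 3/2, and this is what the restriction on ε is
for (`exists_angle_bound`). There |tan(λθ)| ≤ C min {1, |λ|θ} ≤ C ε μ (`norm_tan_le`), and the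
integral of |cos(λφ) / cos(λθ)| is at most C min {θ, 1/|λ|} ≤ C ε μ / |λ|
(`integral_norm_cos_div_cos_le`). Hence ε⁻¹ Û_φ(θ) is bounded by |λ| μ |D| + |λ|⁻¹ μ sup |h|,
uniformly in ε. On y = x the quantity (1 + ε²) ε⁻² x p_y is the sum of ε⁻¹ U_φ and of the derivative
in u of the trace of p, so ε⁻² x p_y obeys the same kind of bound (`exists_lineNorm_boundary`). The
factor μ spent here is the difference between the weights μ^{k+1} of the data and μ^k of the result.

The formula cannot simply be read off from the transform of p, which is not known to exist on all
these lines. `IsStripC2.isFT_normal_deriv` proves it by duality: Green's identity is applied to U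
and to the function that is harmonic in the strip, has zero normal derivative at φ = 0 and equals a
test function at φ = θ. Shifting its contour shows that this function decays like e^{-|u|}. The
finite Y-norm is used only to know that U times e^{-|u|} is integrable (`exists_growth_bound`), so
that truncation in u is harmless; this excludes nontrivial solutions of the homogeneous problem.

High lines require that polynomial parts be removed first. `exists_biPoly_solution` solves the
problem for polynomial data: a particular solution by recursion in powers of y, plus harmonic
polynomials Re (x + iεy)^n. The trace of the latter on y = x is x^n cos(nθ) / cos(θ)^n, which is
nondegenerate under the same restriction on the angle. All coefficients of positive powers of y
carry a factor ε². The cut-off multiplying the polynomial depends on x alone, so it does not disturb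
the Neumann condition and produces only compactly supported sources.

The corrected solution is estimated on two lines (`exists_boundary_bounds`). With G = x p_x or G =
ε⁻² x p_y, differentiating G/x along y = x gives x⁻² times G_u - G, so Re λ = 3k + 3/2 yields the
homogeneous part of the X-norm on 3k - 1/2, and Re λ = 3/2 yields plain L², which is the line -1/2
(`exists_xNorm_deriv_le`). On the lower line the data f are obtained by interpolating between their
L² norm and their top norm (`exists_interpolation`), with an arbitrarily small loss of powers of
|λ|.

For the pointwise bounds the transform of ε⁻² x p_y on Re λ = 3ℓ - 3/2 is shown to be integrable,
which needs slightly more than half a power of |λ| and gives the factor x^{3ℓ - 5/2}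
(`exists_pointwise_bound`). The value ℓ = 1 gives √x, and ℓ = 5/6 a constant; the power count of the
interpolation closes for ℓ = 5/6 exactly when k < 4. -/

/-- `h` is the Plancherel Fourier transform of the square integrable function `a`. -/
def IsFT (a h : ℝ → ℂ) : Prop :=
  ∃ ha : MemLp a 2 (volume : Measure ℝ),
    h =ᵐ[volume] ((𝓕 (ha.toLp a) : Lp ℂ 2 (volume : Measure ℝ)) : ℝ → ℂ)

theorem isMellinOn_iff {β : ℝ} {F : ℝ → ℝ} {h : ℝ → ℂ} :
    IsMellinOn β F h ↔ IsFT (logWeight β F) h := Iff.rfl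

namespace IsFT

variable {a b h k : ℝ → ℂ}

theorem memLp_left (H : IsFT a h) : MemLp a 2 volume := H.1

theorem memLp_right (H : IsFT a h) : MemLp h 2 volume := by
  obtain ⟨ha, hh⟩ := H
  exact (memLp_congr_ae hh).2 (Lp.memLp _)

theorem toLp_right (H : IsFT a h) : H.memLp_right.toLp h = 𝓕 (H.memLp_left.toLp a) := by
  obtain ⟨ha, hh⟩ := H
  apply Lp.ext
  exact (MemLp.coeFn_toLp _).trans hh

theorem eLpNorm_eq (H : IsFT a h) : eLpNorm h 2 volume = eLpNorm a 2 volume := by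
  have h1 : ‖H.memLp_right.toLp h‖ = ‖H.memLp_left.toLp a‖ := by
    rw [H.toLp_right, Lp.norm_fourier_eq]
  rw [Lp.norm_toLp, Lp.norm_toLp] at h1
  exact (ENNReal.toReal_eq_toReal_iff' H.memLp_right.2.ne H.memLp_left.2.ne).1 h1

theorem congr (H : IsFT a h) (hab : a =ᵐ[volume] b) (hhk : h =ᵐ[volume] k) : IsFT b k := by
  obtain ⟨ha, hh⟩ := H
  have hb : MemLp b 2 volume := (memLp_congr_ae hab).1 ha
  refine ⟨hb, ?_⟩
  have : hb.toLp b = ha.toLp a := (MemLp.toLp_eq_toLp_iff _ _).2 hab.symm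
  rw [this]
  exact hhk.symm.trans hh

theorem add (H : IsFT a h) (K : IsFT b k) : IsFT (fun u => a u + b u) (fun ξ => h ξ + k ξ) := by
  obtain ⟨ha, hh⟩ := H
  obtain ⟨hb, hk⟩ := K
  refine ⟨ha.add hb, ?_⟩
  have : (ha.add hb).toLp (a + b) = ha.toLp a + hb.toLp b := MemLp.toLp_add _ _
  change _ =ᵐ[volume] ((𝓕 ((ha.add hb).toLp (a + b)) : Lp ℂ 2 (volume : Measure ℝ)) : ℝ → ℂ)
  rw [this, FourierTransform.fourier_add]
  filter_upwards [hh, hk, Lp.coeFn_add (𝓕 (ha.toLp a)) (𝓕 (hb.toLp b))] with ξ h1 h2 h3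
  rw [h3, Pi.add_apply, h1, h2]

theorem const_mul (c : ℂ) (H : IsFT a h) : IsFT (fun u => c * a u) (fun ξ => c * h ξ) := by
  obtain ⟨ha, hh⟩ := H
  refine ⟨ha.const_mul c, ?_⟩
  have : (ha.const_smul c).toLp (c • a) = c • ha.toLp a := MemLp.toLp_const_smul _ _
  change _ =ᵐ[volume] ((𝓕 ((ha.const_smul c).toLp (c • a)) : Lp ℂ 2 (volume : Measure ℝ)) : ℝ → ℂ)
  rw [this, FourierTransform.fourier_smul]
  filter_upwards [hh, Lp.coeFn_smul c (𝓕 (ha.toLp a))] with ξ h1 h3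
  rw [h3, Pi.smul_apply, h1, smul_eq_mul]

theorem sub (H : IsFT a h) (K : IsFT b k) : IsFT (fun u => a u - b u) (fun ξ => h ξ - k ξ) := by
  refine (H.add (K.const_mul (-1))).congr ?_ ?_ <;> exact .of_forall fun _ => by ring

theorem exists_left (hh : MemLp h 2 volume) : ∃ a, IsFT a h := by
  refine ⟨(𝓕⁻ (hh.toLp h) : Lp ℂ 2 (volume : Measure ℝ)), Lp.memLp _, ?_⟩
  rw [Lp.toLp_coeFn, FourierTransform.fourier_fourierInv_eq]
  exact (MemLp.coeFn_toLp _).symm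

theorem exists_right (ha : MemLp a 2 volume) : ∃ h, IsFT a h := ⟨_, ha, .rfl⟩

end IsFT

theorem integral_mul_eq_inner_star (f g : Lp ℂ 2 (volume : Measure ℝ)) :
    ∫ x, f x * g x = inner ℂ (star f) g := by
  rw [L2.inner_def]
  apply integral_congr_ae
  filter_upwards [Lp.coeFn_star f] with x hx
  simp [hx, mul_comm]

/-- Both sides are continuous in g, so it is enough to take g from the dense Schwartz class; there
the identity is the definition of the Fourier transform of f as a tempered distribution. -/
theorem integral_fourier_mul_eq (f g : Lp ℂ 2 (volume : Measure ℝ)) :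
    ∫ x, (𝓕 f : Lp ℂ 2 (volume : Measure ℝ)) x * g x
      = ∫ x, f x * (𝓕 g : Lp ℂ 2 (volume : Measure ℝ)) x := by
  rw [integral_mul_eq_inner_star, integral_mul_eq_inner_star]
  revert g
  have hd : DenseRange (SchwartzMap.toLpCLM ℂ (E := ℝ) ℂ 2 volume) :=
    SchwartzMap.denseRange_toLpCLM ENNReal.ofNat_ne_top
  refine fun g => hd.induction_on (p := fun g => inner ℂ (star (𝓕 f)) g = inner ℂ (star f) (𝓕 g))
    g ?_ ?_
  · exact isClosed_eq (by fun_prop)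
      (continuous_const.inner (Lp.fourierTransformₗᵢ ℝ ℂ).continuous)
  · intro φ
    have h1 := congrArg (fun T : TemperedDistribution ℝ ℂ => T φ)
      (Lp.fourier_toTemperedDistribution_eq f)
    simp only [TemperedDistribution.fourier_apply, Lp.toTemperedDistribution_apply] at h1
    rw [← integral_mul_eq_inner_star, ← integral_mul_eq_inner_star]
    have e1 : (SchwartzMap.toLpCLM ℂ (E := ℝ) ℂ 2 volume) φ = φ.toLp 2 := rfl
    rw [e1, SchwartzMap.toLp_fourier_eq]
    have h2 := SchwartzMap.coeFn_toLp φ 2 (volume : Measure ℝ)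
    have h3 := SchwartzMap.coeFn_toLp (𝓕 φ) 2 (volume : Measure ℝ)
    calc _ = ∫ x, φ x • (𝓕 f : Lp ℂ 2 (volume : Measure ℝ)) x := by
          apply integral_congr_ae
          filter_upwards [h2] with x hx
          rw [hx, smul_eq_mul, mul_comm]
      _ = ∫ x, (𝓕 φ) x • f x := h1.symm
      _ = _ := by
          apply integral_congr_ae
          filter_upwards [h3] with x hx
          rw [hx, smul_eq_mul, mul_comm]

/-- The bilinear form, without conjugation, is the one that fits contour integrals: every later
identity between a function and its transform is an instance of it. -/
theorem IsFT.pairing {a b h k : ℝ → ℂ} (H : IsFT a h) (K : IsFT b k) :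
    ∫ x, h x * b x = ∫ x, a x * k x := by
  have := integral_fourier_mul_eq (H.memLp_left.toLp a) (K.memLp_left.toLp b)
  rw [← H.toLp_right, ← K.toLp_right] at this
  have e : ∀ {f g : ℝ → ℂ} (hf : MemLp f 2 volume) (hg : MemLp g 2 volume),
      ∫ x, hf.toLp f x * hg.toLp g x = ∫ x, f x * g x := fun hf hg => by
    apply integral_congr_ae
    filter_upwards [hf.coeFn_toLp, hg.coeFn_toLp] with x h1 h2
    rw [h1, h2]
  rwa [e, e] at this

theorem isFT_of_schwartz (φ : SchwartzMap ℝ ℂ) : IsFT φ (𝓕 (φ : ℝ → ℂ)) := by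
  refine ⟨φ.memLp 2 volume, ?_⟩
  have h1 : (φ.memLp 2 volume).toLp φ = φ.toLp 2 := rfl
  rw [h1, SchwartzMap.toLp_fourier_eq, ← SchwartzMap.fourier_coe]
  exact (SchwartzMap.coeFn_toLp _ _ _).symm

theorem ae_eq_of_integral_schwartz {f g : ℝ → ℂ} (hf : LocallyIntegrable f)
    (hg : LocallyIntegrable g) (h : ∀ φ : SchwartzMap ℝ ℂ, ∫ x, φ x * f x = ∫ x, φ x * g x) :
    f =ᵐ[volume] g := by
  apply ae_eq_of_integral_contDiff_smul_eq hf hg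
  intro ψ hψ hc
  have h1 : HasCompactSupport (Complex.ofRealCLM ∘ ψ) := hc.comp_left rfl
  have h2 : ContDiff ℝ ∞ (Complex.ofRealCLM ∘ ψ) := by fun_prop
  simpa using h (h1.toSchwartzMap h2)

/-- On integrable, square integrable functions the Plancherel transform is the integral. -/
theorem isFT_of_integrable {a : ℝ → ℂ} (ha : Integrable a) (ha2 : MemLp a 2 volume) :
    IsFT a (𝓕 a) := by
  obtain ⟨h, H⟩ := IsFT.exists_right ha2
  refine H.congr .rfl ?_
  have hc : Continuous (𝓕 a) :=
    VectorFourier.fourierIntegral_continuous Real.continuous_fourierChar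
      (by exact continuous_inner) ha
  refine ae_eq_of_integral_schwartz (H.memLp_right.locallyIntegrable (by norm_num))
    hc.locallyIntegrable fun φ => ?_
  have h1 := H.pairing (isFT_of_schwartz φ)
  have h2 := VectorFourier.integral_fourierIntegral_smul_eq_flip (μ := (volume : Measure ℝ))
    (ν := (volume : Measure ℝ)) (L := innerₗ ℝ) (f := a) (g := (φ : ℝ → ℂ))
    Real.continuous_fourierChar (by exact continuous_inner) ha φ.integrable
  simp only [smul_eq_mul] at h2
  have e : (innerₗ ℝ : ℝ →ₗ[ℝ] ℝ →ₗ[ℝ] ℝ).flip = innerₗ ℝ := by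
    ext; simp
  rw [e] at h2
  calc ∫ x, φ x * h x = ∫ x, h x * φ x := by simp_rw [mul_comm]
    _ = ∫ x, a x * (𝓕 (φ : ℝ → ℂ)) x := h1
    _ = ∫ x, (𝓕 a) x * φ x := h2.symm
    _ = _ := by simp_rw [mul_comm]

/-- A Plancherel transform is determined by testing against smooth functions. -/
theorem isFT_of_forall_test {a T : ℝ → ℂ} (ha : LocallyIntegrable a) (hT : MemLp T 2 volume)
    (h : ∀ ψ : ℝ → ℝ, ContDiff ℝ ∞ ψ → HasCompactSupport ψ →
      ∫ u, ψ u • a u = ∫ ξ, T ξ * 𝓕⁻ (fun u => (ψ u : ℂ)) ξ) : IsFT a T := by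
  obtain ⟨b, hb⟩ := IsFT.exists_left hT
  refine hb.congr ?_ .rfl
  apply ae_eq_of_integral_contDiff_smul_eq (hb.memLp_left.locallyIntegrable (by norm_num)) ha
  intro ψ hψ hc
  have h1 : HasCompactSupport (Complex.ofRealCLM ∘ ψ) := hc.comp_left rfl
  have h2 : ContDiff ℝ ∞ (Complex.ofRealCLM ∘ ψ) := by fun_prop
  set φ := h1.toSchwartzMap h2 with hφ
  have hφ' : ∀ u, φ u = (ψ u : ℂ) := fun u => rfl
  have h3 := hb.pairing (isFT_of_schwartz (𝓕⁻ φ))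
  have h4 : 𝓕 ((𝓕⁻ φ : SchwartzMap ℝ ℂ) : ℝ → ℂ) = φ := by
    rw [← SchwartzMap.fourier_coe, FourierTransform.fourier_fourierInv_eq]
  rw [h4] at h3
  rw [h ψ hψ hc]
  have h5 : ((𝓕⁻ φ : SchwartzMap ℝ ℂ) : ℝ → ℂ) = 𝓕⁻ (fun u => (ψ u : ℂ)) := by
    rw [SchwartzMap.fourierInv_coe]; rfl
  rw [h5] at h3
  rw [h3]
  congr 1; ext u
  rw [hφ', mul_comm, Complex.real_smul]

/-- Fourier inversion: `a` agrees almost everywhere with the transform of the reflected integrable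
function, and since both are continuous they agree everywhere. It converts norms on a line into
pointwise bounds. -/
theorem IsFT.continuous_bound {a T : ℝ → ℂ} (H : IsFT a T) (ha : Continuous a)
    (hT : Integrable T) (u : ℝ) : ‖a u‖ ≤ ∫ ξ, ‖T ξ‖ := by
  have h0 : (fun x => T (-x)) = T ∘ (fun x => -x) := rfl
  have hT2 : MemLp (fun x => T (-x)) 2 volume :=
    H.memLp_right.comp_measurePreserving (Measure.measurePreserving_neg volume)
  have h1 := isFT_of_integrable hT.comp_neg hT2
  have hc : Continuous (𝓕 (fun x => T (-x))) :=
    VectorFourier.fourierIntegral_continuous Real.continuous_fourierChar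
      (by exact continuous_inner) hT.comp_neg
  have key : a =ᵐ[volume] 𝓕 (fun x => T (-x)) := by
    refine ae_eq_of_integral_schwartz ha.locallyIntegrable hc.locallyIntegrable fun φ => ?_
    have h3 := H.pairing (isFT_of_schwartz (𝓕⁻ φ))
    have h4 : 𝓕 ((𝓕⁻ φ : SchwartzMap ℝ ℂ) : ℝ → ℂ) = φ := by
      rw [← SchwartzMap.fourier_coe, FourierTransform.fourier_fourierInv_eq]
    have h5 := h1.pairing (isFT_of_schwartz φ)
    rw [h4] at h3
    calc _ = ∫ x, a x * φ x := by simp_rw [mul_comm]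
      _ = ∫ x, T x * (𝓕⁻ φ : SchwartzMap ℝ ℂ) x := h3.symm
      _ = ∫ x, T (-x) * (𝓕⁻ φ : SchwartzMap ℝ ℂ) (-x) :=
          (integral_neg_eq_self (fun x => T x * (𝓕⁻ φ : SchwartzMap ℝ ℂ) x) volume).symm
      _ = ∫ x, T (-x) * (𝓕 (φ : ℝ → ℂ)) x := by
          congr 1; ext x
          rw [SchwartzMap.fourierInv_coe, Real.fourierInv_eq_fourier_neg, neg_neg]
      _ = _ := by rw [← h5]; simp_rw [mul_comm]
  have key' := (Continuous.ae_eq_iff_eq volume ha hc).1 key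
  rw [key']
  calc _ ≤ ∫ x, ‖T (-x)‖ := VectorFourier.norm_fourierIntegral_le_integral_norm _ _ _ _ _
    _ = _ := integral_neg_eq_self (fun x => ‖T x‖) volume

/-! ### Exponential weights and the two-sided Laplace transform -/

/-- `u ↦ e^{-βu} v(u)`. -/
def expWeight (β : ℝ) (v : ℝ → ℝ) : ℝ → ℂ := fun u => ((Real.exp (-β * u) * v u : ℝ) : ℂ)

theorem logWeight_eq (β : ℝ) (F : ℝ → ℝ) :
    logWeight β F = expWeight β (fun u => F (Real.exp u)) := rfl

/-- The two-sided Laplace transform `∫ ψ(u) e^{zu} du`. -/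
def expTransform (ψ : ℝ → ℝ) (z : ℂ) : ℂ := ∫ u : ℝ, (ψ u : ℂ) * Complex.exp (z * u)

@[simp] theorem linePt_re (β ξ : ℝ) : (linePt β ξ).re = β := by simp [linePt]

@[simp] theorem linePt_im (β ξ : ℝ) : (linePt β ξ).im = 2 * Real.pi * ξ := by simp [linePt]

theorem continuous_linePt (β : ℝ) : Continuous (linePt β) := by
  unfold linePt; fun_prop

theorem norm_exp_mul_ofReal (z : ℂ) (u : ℝ) : ‖Complex.exp (z * u)‖ = Real.exp (z.re * u) := by
  rw [Complex.norm_exp]; simp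

theorem fourierInv_real_eq (f : ℝ → ℂ) (ξ : ℝ) :
    𝓕⁻ f ξ = ∫ u, f u * Complex.exp (2 * Real.pi * ξ * Complex.I * u) := by
  rw [Real.fourierInv_eq']
  congr 1; ext u
  rw [smul_eq_mul, mul_comm]
  congr 2
  simp; ring

theorem fourier_real_eq' (f : ℝ → ℂ) (ξ : ℝ) :
    𝓕 f ξ = ∫ u, f u * Complex.exp (-(2 * Real.pi * ξ * Complex.I * u)) := by
  rw [Real.fourier_eq']
  congr 1; ext u
  rw [smul_eq_mul, mul_comm]
  congr 2
  simp; ring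

theorem expTransform_linePt (ψ : ℝ → ℝ) (β ξ : ℝ) :
    expTransform ψ (linePt β ξ) = 𝓕⁻ (fun u => ((Real.exp (β * u) * ψ u : ℝ) : ℂ)) ξ := by
  rw [fourierInv_real_eq, expTransform]
  congr 1; ext u
  rw [linePt, add_mul, Complex.exp_add]
  push_cast; ring

theorem expTransform_deriv {ψ : ℝ → ℝ} (hψ : ContDiff ℝ ∞ ψ) (hc : HasCompactSupport ψ) (z : ℂ) :
    expTransform (deriv ψ) z = -z * expTransform ψ z := by
  have h1 : ∀ u, HasDerivAt (fun u : ℝ => (ψ u : ℂ)) ((deriv ψ u : ℝ) : ℂ) u := fun u =>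
    ((hψ.differentiable (by simp)) u).hasDerivAt.ofReal_comp
  have h2 : ∀ u : ℝ, HasDerivAt (fun u : ℝ => Complex.exp (z * u)) (z * Complex.exp (z * u)) u := by
    intro u
    have := ((Complex.ofRealCLM.hasDerivAt (x := u)).const_mul z).cexp
    simpa [mul_comm] using this
  have hc' : HasCompactSupport (fun u : ℝ => (ψ u : ℂ)) := hc.comp_left (g := Complex.ofReal) rfl
  have hcd : HasCompactSupport (fun u : ℝ => ((deriv ψ u : ℝ) : ℂ)) :=
    (hc.deriv).comp_left (g := Complex.ofReal) rfl
  have hψc := hψ.continuous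
  have hψ'c : Continuous (deriv ψ) := hψ.continuous_deriv (by simp)
  have := integral_mul_deriv_eq_deriv_mul_of_integrable (u := fun u : ℝ => (ψ u : ℂ))
    (v := fun u : ℝ => Complex.exp (z * u)) (fun u _ => h1 u) (fun u _ => h2 u)
    (Continuous.integrable_of_hasCompactSupport (by fun_prop) hc'.mul_right)
    (Continuous.integrable_of_hasCompactSupport (by fun_prop) hcd.mul_right)
    (Continuous.integrable_of_hasCompactSupport (by fun_prop) hc'.mul_right)
  rw [expTransform, expTransform, eq_comm, ← neg_eq_iff_eq_neg.2 this, ← integral_const_mul,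
    ← integral_neg]
  congr 1; ext u; ring

/-- Testing against e^{βu} ψ instead of ψ cancels the weight e^{-βu}. The left side no longer
depends on the line, and β survives only in the points where the entire function `expTransform ψ` is
evaluated. Together with `isFT_of_integral_test` this characterizes the transform. -/
theorem IsFT.integral_test {β : ℝ} {v : ℝ → ℝ} {T : ℝ → ℂ} (H : IsFT (expWeight β v) T)
    {ψ : ℝ → ℝ} (hψ : ContDiff ℝ ∞ ψ) (hc : HasCompactSupport ψ) :
    ∫ u, ((ψ u * v u : ℝ) : ℂ) = ∫ ξ, T ξ * expTransform ψ (linePt β ξ) := by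
  have h1 : HasCompactSupport (fun u => ((Real.exp (β * u) * ψ u : ℝ) : ℂ)) :=
    (hc.mul_left (f := fun u => Real.exp (β * u))).comp_left (g := Complex.ofReal) rfl
  have h2 : ContDiff ℝ ∞ (fun u => ((Real.exp (β * u) * ψ u : ℝ) : ℂ)) :=
    Complex.ofRealCLM.contDiff.comp
      (by fun_prop : ContDiff ℝ ∞ fun u => Real.exp (β * u) * ψ u)
  set φ := h1.toSchwartzMap h2 with hφ
  have h3 := H.pairing (isFT_of_schwartz (𝓕⁻ φ))
  have h4 : 𝓕 ((𝓕⁻ φ : SchwartzMap ℝ ℂ) : ℝ → ℂ) = φ := by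
    rw [← SchwartzMap.fourier_coe, FourierTransform.fourier_fourierInv_eq]
  rw [h4] at h3
  have h5 : ∀ ξ, (𝓕⁻ φ : SchwartzMap ℝ ℂ) ξ = expTransform ψ (linePt β ξ) := fun ξ => by
    rw [expTransform_linePt, SchwartzMap.fourierInv_coe]; rfl
  simp_rw [h5] at h3
  rw [h3]
  congr 1; ext u
  have : φ u = ((Real.exp (β * u) * ψ u : ℝ) : ℂ) := rfl
  rw [this, expWeight, ← Complex.ofReal_mul]
  congr 1
  have : Real.exp (-β * u) * Real.exp (β * u) = 1 := by rw [← Real.exp_add]; simp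
  linear_combination (-(v u * ψ u)) * this

theorem isFT_of_integral_test {β : ℝ} {v : ℝ → ℝ} {T : ℝ → ℂ} (hv : LocallyIntegrable (expWeight β v))
    (hT : MemLp T 2 volume)
    (h : ∀ ψ : ℝ → ℝ, ContDiff ℝ ∞ ψ → HasCompactSupport ψ →
      ∫ u, ((ψ u * v u : ℝ) : ℂ) = ∫ ξ, T ξ * expTransform ψ (linePt β ξ)) :
    IsFT (expWeight β v) T := by
  refine isFT_of_forall_test hv hT fun ψ hψ hc => ?_
  have := h (fun u => Real.exp (-β * u) * ψ u) (by fun_prop) hc.mul_left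
  simp_rw [expTransform_linePt] at this
  calc _ = ∫ u, ((Real.exp (-β * u) * ψ u * v u : ℝ) : ℂ) := by
        congr 1; ext u; rw [expWeight, Complex.real_smul]; push_cast; ring
    _ = _ := this
    _ = _ := by
      simp_rw [← mul_assoc, ← Real.exp_add]; simp

theorem continuous_expWeight {β : ℝ} {v : ℝ → ℝ} (hv : Continuous v) :
    Continuous (expWeight β v) := by
  unfold expWeight; fun_prop

/-- The derivative is moved to the test function, so square integrability of the weighted derivative
is not assumed: it is part of the conclusion, and follows from that of λ times the transform. -/
theorem IsFT.hasDeriv {β : ℝ} {v v' : ℝ → ℝ} {T : ℝ → ℂ} (H : IsFT (expWeight β v) T)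
    (hv : ∀ u, HasDerivAt v (v' u) u) (hv' : Continuous v')
    (hT : MemLp (fun ξ => linePt β ξ * T ξ) 2 volume) :
    IsFT (expWeight β v') (fun ξ => linePt β ξ * T ξ) := by
  refine isFT_of_integral_test (continuous_expWeight hv').locallyIntegrable hT fun ψ hψ hc => ?_
  have hvc : Continuous v := continuous_iff_continuousAt.2 fun u => (hv u).continuousAt
  have h1 := H.integral_test (hψ.deriv' (n := ∞)) hc.deriv
  simp_rw [expTransform_deriv hψ hc] at h1
  have hψ'c : Continuous (deriv ψ) := hψ.continuous_deriv (by simp)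
  have hψc := hψ.continuous
  have h2 := integral_mul_deriv_eq_deriv_mul_of_integrable (u := ψ) (v := v)
    (fun u _ => (hψ.differentiable (by simp) u).hasDerivAt) (fun u _ => hv u)
    ((hψc.mul hv').integrable_of_hasCompactSupport hc.mul_right)
    ((hψ'c.mul hvc).integrable_of_hasCompactSupport hc.deriv.mul_right)
    ((hψc.mul hvc).integrable_of_hasCompactSupport hc.mul_right)
  rw [integral_complex_ofReal, h2, Complex.ofReal_neg, ← integral_complex_ofReal, h1,
    ← integral_neg]
  congr 1; ext ξ; ring

theorem IsFT.translate {β : ℝ} {v : ℝ → ℝ} {T : ℝ → ℂ} (H : IsFT (expWeight β v) T) (s : ℝ) :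
    IsFT (expWeight β (fun u => v (u + s))) (fun ξ => Complex.exp (linePt β ξ * s) * T ξ) := by
  have h0 : expWeight β (fun u => v (u + s))
      = fun u => (Real.exp (β * s) : ℂ) * expWeight β v (u + s) := by
    ext u; simp only [expWeight]
    rw [← Complex.ofReal_mul, ← mul_assoc, ← Real.exp_add]
    congr 3; ring
  have hm : MemLp (expWeight β (fun u => v (u + s))) 2 volume := by
    rw [h0]
    exact (H.memLp_left.comp_measurePreserving (measurePreserving_add_right volume s)).const_mul _
  have hb : MemLp (fun ξ => Complex.exp (linePt β ξ * s) * T ξ) 2 volume := by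
    refine (H.memLp_right.const_mul (Real.exp (β * s) : ℂ)).mono ?_ (.of_forall fun ξ => ?_)
    · refine AEStronglyMeasurable.mul ?_ H.memLp_right.1
      have := continuous_linePt β
      exact (by fun_prop : Continuous fun ξ => Complex.exp (linePt β ξ * s)).aestronglyMeasurable
    · rw [norm_mul, norm_mul, norm_exp_mul_ofReal, linePt_re, Complex.norm_real, Real.norm_eq_abs,
        abs_of_pos (Real.exp_pos _)]
  refine isFT_of_integral_test (hm.locallyIntegrable (by norm_num)) hb fun ψ hψ hc => ?_
  have h1 := H.integral_test (ψ := fun u => ψ (u - s)) (by fun_prop)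
    (hc.comp_homeomorph (Homeomorph.subRight s))
  rw [← integral_add_right_eq_self _ s] at h1
  simp only [add_sub_cancel_right] at h1
  rw [h1]
  congr 1; ext ξ
  have : expTransform (fun u => ψ (u - s)) (linePt β ξ)
      = Complex.exp (linePt β ξ * s) * expTransform ψ (linePt β ξ) := by
    rw [expTransform, expTransform, ← integral_const_mul, ← integral_add_right_eq_self _ s]
    congr 1; ext u
    rw [add_sub_cancel_right]
    push_cast
    rw [mul_add, Complex.exp_add]; ring
  rw [this]; ring

/-- Uniform rapid decay of the transform of a smooth family with uniformly compact support. -/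
theorem exists_expTransform_bound {E : Type*} [NormedAddCommGroup E] [NormedSpace ℝ E]
    {K : Set E} (hK : IsCompact K) (M B : ℝ) (m : ℕ) :
    ∀ F : E × ℝ → ℝ, ContDiff ℝ ∞ F → (∀ e ∈ K, ∀ u, M < |u| → F (e, u) = 0) →
      ∃ C : ℝ, 0 ≤ C ∧ ∀ e ∈ K, ∀ z : ℂ, |z.re| ≤ B →
        ‖z‖ ^ m * ‖expTransform (fun u => F (e, u)) z‖ ≤ C := by
  have hM : ∀ {F : E × ℝ → ℝ}, (∀ e ∈ K, ∀ u, M < |u| → F (e, u) = 0) → ∀ e ∈ K,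
      Function.support (fun u => F (e, u)) ⊆ Icc (-M) M := by
    intro F hF e he u hu
    by_contra h
    exact hu (hF e he u (by rwa [mem_Icc, ← abs_le, not_le] at h))
  induction m with
  | zero =>
    intro F hF hs
    obtain ⟨A, hA⟩ := (hK.prod (isCompact_Icc (a := -M) (b := M))).exists_bound_of_continuousOn
      hF.continuous.continuousOn
    refine ⟨∫ u in Icc (-M) M, |A| * Real.exp (|B| * |M|), integral_nonneg fun u => by positivity,
      fun e he z hz => ?_⟩
    rw [pow_zero, one_mul, expTransform]
    have h1 : ∫ u : ℝ, (F (e, u) : ℂ) * Complex.exp (z * u)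
        = ∫ u in Icc (-M) M, (F (e, u) : ℂ) * Complex.exp (z * u) := by
      rw [setIntegral_eq_integral_of_forall_compl_eq_zero]
      intro u hu
      have : F (e, u) = 0 := by
        by_contra h
        exact hu (hM hs e he h)
      simp [this]
    rw [h1]
    refine norm_integral_le_of_norm_le (integrable_const _) ?_
    filter_upwards [ae_restrict_mem measurableSet_Icc] with u hu
    rw [norm_mul, norm_exp_mul_ofReal]
    refine mul_le_mul ?_ (Real.exp_le_exp.2 ?_) (Real.exp_pos _).le (abs_nonneg _)
    · rw [Complex.norm_real]
      exact (hA (e, u) ⟨he, hu⟩).trans (le_abs_self _)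
    · calc z.re * u ≤ |z.re * u| := le_abs_self _
        _ = |z.re| * |u| := abs_mul _ _
        _ ≤ |B| * |M| := by
          exact mul_le_mul (hz.trans (le_abs_self _)) ((abs_le.2 hu).trans (le_abs_self _))
            (abs_nonneg _) (abs_nonneg _)
  | succ m ih =>
    intro F hF hs
    -- The partial derivative in u is again a smooth family that vanishes for |u| > M, and a factor
    -- z of the transform is worth one such derivative.
    have hG : ContDiff ℝ ∞ (fun p : E × ℝ => fderiv ℝ F p (0, 1)) :=
      (hF.fderiv_right (m := ∞) (by simp)).clm_apply contDiff_const
    have hd : ∀ e u, HasDerivAt (fun u => F (e, u)) (fderiv ℝ F (e, u) (0, 1)) u := by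
      intro e u
      have h1 : HasFDerivAt F (fderiv ℝ F (e, u)) (e, u) :=
        (hF.differentiable (by simp) _).hasFDerivAt
      have h2 : HasDerivAt (fun u : ℝ => (e, u)) ((0 : E), (1 : ℝ)) u :=
        (hasDerivAt_const u e).prodMk (hasDerivAt_id u)
      exact h1.comp_hasDerivAt u h2
    obtain ⟨C, hC0, hC⟩ := ih _ hG (fun e he u hu => by
      rw [← (hd e u).deriv]
      have : (fun u => F (e, u)) =ᶠ[nhds u] fun _ => 0 := by
        filter_upwards [(continuous_abs.isOpen_preimage _ isOpen_Ioi).mem_nhds hu] with t ht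
        exact hs e he t ht
      rw [this.deriv_eq, deriv_const])
    refine ⟨C, hC0, fun e he z hz => ?_⟩
    have h1 : (fun u => fderiv ℝ F (e, u) (0, 1)) = deriv (fun u => F (e, u)) := by
      ext u; exact (hd e u).deriv.symm
    have h2 := hC e he z hz
    rw [h1, expTransform_deriv (by fun_prop) (HasCompactSupport.of_support_subset_isCompact isCompact_Icc
      (hM hs e he)), norm_mul, norm_neg] at h2
    calc _ = _ := by rw [pow_succ]; ring
      _ ≤ C := h2

theorem exists_expTransform_decay {ψ : ℝ → ℝ} (hψ : ContDiff ℝ ∞ ψ) (hc : HasCompactSupport ψ)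
    (B : ℝ) (m : ℕ) :
    ∃ C : ℝ, 0 ≤ C ∧ ∀ z : ℂ, |z.re| ≤ B → (1 + ‖z‖) ^ m * ‖expTransform ψ z‖ ≤ C := by
  obtain ⟨M, hM⟩ := hc.isCompact.isBounded.exists_norm_le
  have key : ∀ m : ℕ, ∃ C : ℝ, 0 ≤ C ∧ ∀ z : ℂ, |z.re| ≤ B → ‖z‖ ^ m * ‖expTransform ψ z‖ ≤ C := by
    intro m
    obtain ⟨C, hC0, hC⟩ := exists_expTransform_bound (isCompact_singleton (x := (0 : ℝ))) M B m
      (fun p => ψ p.2) (by fun_prop) (fun e _ u hu => by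
        by_contra h
        exact absurd (hM u (subset_tsupport _ h)) (not_le.2 (by simpa using hu)))
    exact ⟨C, hC0, fun z hz => hC 0 rfl z hz⟩
  obtain ⟨C0, hC00, hC0⟩ := key 0
  obtain ⟨C1, hC10, hC1⟩ := key m
  refine ⟨2 ^ (m - 1) * (C0 + C1), by positivity, fun z hz => ?_⟩
  have h1 := hC0 z hz
  have h2 := hC1 z hz
  have h3 := add_pow_le (zero_le_one) (norm_nonneg z) m
  rw [pow_zero, one_mul] at h1
  calc _ ≤ 2 ^ (m - 1) * (1 ^ m + ‖z‖ ^ m) * ‖expTransform ψ z‖ := by gcongr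
    _ = 2 ^ (m - 1) * (‖expTransform ψ z‖ + ‖z‖ ^ m * ‖expTransform ψ z‖) := by ring
    _ ≤ _ := by gcongr

theorem differentiable_expTransform {ψ : ℝ → ℝ} (hψ : Continuous ψ) (hc : HasCompactSupport ψ) :
    Differentiable ℂ (expTransform ψ) := by
  intro z0
  obtain ⟨M, hM⟩ := hc.isCompact.isBounded.exists_norm_le
  have hc' : HasCompactSupport (fun u : ℝ => ‖ψ u‖ * |u| * Real.exp ((‖z0‖ + 1) * |u|)) :=
    hc.mono' fun u hu => by
      apply subset_tsupport
      intro h; exact hu (by simp [h])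
  have hmeas : ∀ z : ℂ, AEStronglyMeasurable (fun u : ℝ => (ψ u : ℂ) * Complex.exp (z * u)) volume :=
    fun z => (by fun_prop : Continuous fun u : ℝ => (ψ u : ℂ) * Complex.exp (z * u)).aestronglyMeasurable
  have := hasDerivAt_integral_of_dominated_loc_of_deriv_le (𝕜 := ℂ) (μ := (volume : Measure ℝ))
    (F := fun z u => (ψ u : ℂ) * Complex.exp (z * u))
    (F' := fun z u => (ψ u : ℂ) * (Complex.exp (z * u) * u)) (x₀ := z0)
    (bound := fun u : ℝ => ‖ψ u‖ * |u| * Real.exp ((‖z0‖ + 1) * |u|))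
    (Metric.ball_mem_nhds z0 one_pos) (.of_forall hmeas)
    (Continuous.integrable_of_hasCompactSupport (by fun_prop)
      ((hc.comp_left (g := Complex.ofReal) rfl).mul_right))
    (by fun_prop) ?_
    (Continuous.integrable_of_hasCompactSupport (by fun_prop) hc') ?_
  · exact this.2.differentiableAt
  · refine .of_forall fun u z hz => ?_
    rw [norm_mul, norm_mul, norm_exp_mul_ofReal, Complex.norm_real, Complex.norm_real, mul_assoc,
      mul_comm |u|]
    gcongr ‖ψ u‖ * (?_ * _)
    rw [Real.exp_le_exp]
    have h1 : ‖z‖ ≤ ‖z0‖ + 1 := by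
      have := norm_sub_norm_le z z0
      rw [Metric.mem_ball, dist_eq_norm] at hz
      linarith
    calc z.re * u ≤ |z.re * u| := le_abs_self _
      _ = |z.re| * |u| := abs_mul _ _
      _ ≤ _ := by gcongr; exact (Complex.abs_re_le_norm z).trans h1
  · refine .of_forall fun u z hz => ?_
    have h1 : HasDerivAt (fun z : ℂ => z * u) (u : ℂ) z := by simpa using hasDerivAt_mul_const (u : ℂ)
    exact (h1.cexp).const_mul _

/-! ### Inversion and shift of contours -/

/-- Inversion of the two-sided Laplace transform on any vertical line. -/
theorem integral_expTransform_mul_exp {ψ : ℝ → ℝ} (hψ : ContDiff ℝ ∞ ψ) (hc : HasCompactSupport ψ)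
    (β u : ℝ) :
    ∫ ξ, expTransform ψ (linePt β ξ) * Complex.exp (-linePt β ξ * u) = ψ u := by
  have h1 : HasCompactSupport (fun u => ((Real.exp (β * u) * ψ u : ℝ) : ℂ)) :=
    (hc.mul_left (f := fun u => Real.exp (β * u))).comp_left (g := Complex.ofReal) rfl
  have h2 : ContDiff ℝ ∞ (fun u => ((Real.exp (β * u) * ψ u : ℝ) : ℂ)) :=
    Complex.ofRealCLM.contDiff.comp
      (by fun_prop : ContDiff ℝ ∞ fun u => Real.exp (β * u) * ψ u)
  set φ := h1.toSchwartzMap h2 with hφ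
  have h5 : ∀ ξ, (𝓕⁻ φ : SchwartzMap ℝ ℂ) ξ = expTransform ψ (linePt β ξ) := fun ξ => by
    rw [expTransform_linePt, SchwartzMap.fourierInv_coe]; rfl
  have h4 : 𝓕 ((𝓕⁻ φ : SchwartzMap ℝ ℂ) : ℝ → ℂ) u = φ u := by
    rw [← SchwartzMap.fourier_coe, FourierTransform.fourier_fourierInv_eq]
  rw [fourier_real_eq'] at h4
  simp_rw [h5] at h4
  have h6 : φ u = ((Real.exp (β * u) * ψ u : ℝ) : ℂ) := rfl
  calc _ = ∫ ξ, Complex.exp (-(β * u)) * (expTransform ψ (linePt β ξ)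
        * Complex.exp (-(2 * Real.pi * u * Complex.I * ξ))) := by
        congr 1; ext ξ
        rw [mul_left_comm, ← Complex.exp_add, linePt]
        congr 2; ring
    _ = ψ u := by
        rw [integral_const_mul, h4, h6]
        push_cast
        rw [← mul_assoc, ← Complex.exp_add]; simp

theorem integrable_of_norm_mul_le {f : ℝ → ℂ} (hf : AEStronglyMeasurable f volume) {C : ℝ}
    (hC : ∀ y, (1 + y ^ 2) * ‖f y‖ ≤ C) : Integrable f := by
  refine ((integrable_inv_one_add_sq).const_mul C).mono' hf (.of_forall fun y => ?_)
  have : 0 < 1 + y ^ 2 := by positivity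
  rw [← div_eq_mul_inv, le_div_iff₀ this, mul_comm]; exact hC y

/-- Integrals of a decaying holomorphic function over vertical lines in a strip agree. -/
theorem integral_linePt_eq {B C : ℝ} {F : ℂ → ℂ} (hd : DifferentiableOn ℂ F {z | |z.re| ≤ B})
    (hC : ∀ z : ℂ, |z.re| ≤ B → (1 + z.im ^ 2) * ‖F z‖ ≤ C) {β γ : ℝ} (hβ : |β| ≤ B) (hγ : |γ| ≤ B) :
    ∫ ξ, F (linePt β ξ) = ∫ ξ, F (linePt γ ξ) := by
  have hcont : ∀ {b : ℝ}, |b| ≤ B → Continuous fun y : ℝ => F (b + y * Complex.I) := by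
    intro b hb
    refine hd.continuousOn.comp_continuous (by fun_prop) fun y => by simpa using hb
  have hint : ∀ {b : ℝ}, |b| ≤ B → Integrable fun y : ℝ => F (b + y * Complex.I) := by
    intro b hb
    refine integrable_of_norm_mul_le (hcont hb).aestronglyMeasurable (C := C) fun y => ?_
    simpa using hC (b + y * Complex.I) (by simpa using hb)
  have hline : ∀ b, ∫ ξ, F (linePt b ξ)
      = |(2 * Real.pi)⁻¹| • ∫ y : ℝ, F (b + y * Complex.I) := by
    intro b
    rw [← Measure.integral_comp_mul_left (fun y : ℝ => F (b + y * Complex.I))]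
    simp [linePt]
  rw [hline, hline]
  congr 1
  have hlim : ∀ {b : ℝ}, |b| ≤ B → Filter.Tendsto (fun R : ℝ => ∫ y in (-R)..R,
      F (b + y * Complex.I)) Filter.atTop (nhds (∫ y : ℝ, F (b + y * Complex.I))) := fun hb =>
    intervalIntegral_tendsto_integral (hint hb) Filter.tendsto_neg_atTop_atBot Filter.tendsto_id
  have hseg : ∀ x ∈ uIcc β γ, |x| ≤ B := by
    intro x hx
    have := abs_le.1 hβ; have := abs_le.1 hγ
    rw [abs_le]
    rcases mem_uIcc.1 hx with h | h <;> constructor <;> linarith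
  have hrect : ∀ R : ℝ, ‖(∫ y in (-R)..R, F (β + y * Complex.I))
      - ∫ y in (-R)..R, F (γ + y * Complex.I)‖ ≤ 2 * (C * |γ - β|) * (1 + R ^ 2)⁻¹ := by
    intro R
    have h := Complex.integral_boundary_rect_eq_zero_of_differentiableOn F
      (β + (-R : ℝ) * Complex.I) (γ + R * Complex.I) (hd.mono fun z hz => by
        have := (Complex.mem_reProdIm.1 hz).1
        simpa using hseg z.re (by simpa using this))
    simp only [Complex.add_re, Complex.ofReal_re, Complex.mul_re, Complex.I_re, mul_zero,
      Complex.ofReal_im, Complex.I_im, mul_one, sub_self, add_zero, Complex.add_im,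
      Complex.mul_im, zero_add] at h
    -- Applied with S = R and S = -R: the horizontal sides of the rectangle contribute O(1/(1 +
    -- R²)), so only the two vertical lines remain in the limit.
    have hh : ∀ S : ℝ, S ^ 2 = R ^ 2 → ‖∫ x in β..γ, F (x + S * Complex.I)‖
        ≤ C * |γ - β| * (1 + R ^ 2)⁻¹ := by
      intro S hS
      calc _ ≤ (C * (1 + R ^ 2)⁻¹) * |γ - β| := by
            refine intervalIntegral.norm_integral_le_of_norm_le_const fun x hx => ?_
            have h1 := hC (x + S * Complex.I) (by simpa using hseg x (uIoc_subset_uIcc hx))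
            simp only [Complex.add_im, Complex.ofReal_im, Complex.mul_im, Complex.ofReal_re,
              Complex.I_im, mul_one, Complex.I_re, mul_zero, add_zero, zero_add, hS] at h1
            have : 0 < 1 + R ^ 2 := by positivity
            rw [← div_eq_mul_inv, le_div_iff₀ this, mul_comm]; exact h1
        _ = _ := by ring
    have h1 := hh (-R) (by ring)
    have h2 := hh R rfl
    have h3 : (∫ y in (-R)..R, F (β + y * Complex.I)) - ∫ y in (-R)..R, F (γ + y * Complex.I)
        = Complex.I * ((∫ x in β..γ, F (x + R * Complex.I))
          - ∫ x in β..γ, F (x + (-R : ℝ) * Complex.I)) := by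
      simp only [smul_eq_mul] at h
      linear_combination Complex.I * h + ((∫ y in (-R)..R, F (β + y * Complex.I))
        - ∫ y in (-R)..R, F (γ + y * Complex.I)) * Complex.I_sq
    rw [h3, norm_mul, Complex.norm_I, one_mul]
    refine (norm_sub_le _ _).trans ?_
    linarith
  have h0 : Filter.Tendsto (fun R : ℝ => 2 * (C * |γ - β|) * (1 + R ^ 2)⁻¹) Filter.atTop (nhds 0) := by
    rw [← mul_zero (2 * (C * |γ - β|))]
    refine Filter.Tendsto.const_mul _ (tendsto_inv_atTop_zero.comp ?_)
    exact Filter.tendsto_atTop_add_const_left _ _ (Filter.tendsto_pow_atTop two_ne_zero)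
  have := squeeze_zero_norm hrect h0
  exact sub_eq_zero.1 (tendsto_nhds_unique ((hlim hβ).sub (hlim hγ)) this)

/-! ### Trigonometric multipliers -/

theorem Complex.norm_cos_sq (w : ℂ) :
    ‖Complex.cos w‖ ^ 2 = Real.cos w.re ^ 2 + Real.sinh w.im ^ 2 := by
  have h : Complex.cos w = ((Real.cos w.re * Real.cosh w.im : ℝ) : ℂ)
      + ((-(Real.sin w.re * Real.sinh w.im) : ℝ) : ℂ) * Complex.I := by
    rw [Complex.cos_eq]; push_cast; ring
  rw [h, ← Complex.normSq_eq_norm_sq, Complex.normSq_add_mul_I]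
  have h1 := Real.cos_sq_add_sin_sq w.re
  have h2 := Real.cosh_sq w.im
  linear_combination (Real.cos w.re ^ 2) * h2 + (Real.sinh w.im ^ 2) * h1

theorem Complex.norm_sin_sq (w : ℂ) :
    ‖Complex.sin w‖ ^ 2 = Real.sin w.re ^ 2 + Real.sinh w.im ^ 2 := by
  have h : Complex.sin w = ((Real.sin w.re * Real.cosh w.im : ℝ) : ℂ)
      + ((Real.cos w.re * Real.sinh w.im : ℝ) : ℂ) * Complex.I := by
    rw [Complex.sin_eq]; push_cast; ring
  rw [h, ← Complex.normSq_eq_norm_sq, Complex.normSq_add_mul_I]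
  have h1 := Real.cos_sq_add_sin_sq w.re
  have h2 := Real.cosh_sq w.im
  linear_combination (Real.sin w.re ^ 2) * h2 + (Real.sinh w.im ^ 2) * h1

theorem Complex.norm_cos_le_cosh (w : ℂ) : ‖Complex.cos w‖ ≤ Real.cosh w.im := by
  refine (sq_le_sq₀ (norm_nonneg _) (Real.cosh_pos _).le).1 ?_
  rw [Complex.norm_cos_sq, Real.cosh_sq]
  nlinarith [Real.sin_sq_add_cos_sq w.re, sq_nonneg (Real.sin w.re)]

theorem Complex.norm_sin_le_cosh (w : ℂ) : ‖Complex.sin w‖ ≤ Real.cosh w.im := by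
  refine (sq_le_sq₀ (norm_nonneg _) (Real.cosh_pos _).le).1 ?_
  rw [Complex.norm_sin_sq, Real.cosh_sq]
  nlinarith [Real.sin_sq_add_cos_sq w.re, sq_nonneg (Real.cos w.re)]

theorem Real.sinh_le_mul_cosh {x : ℝ} (hx : 0 ≤ x) : Real.sinh x ≤ x * Real.cosh x := by
  have hm : MonotoneOn (fun x => x * Real.cosh x - Real.sinh x) (Ici 0) := by
    apply monotoneOn_of_deriv_nonneg (convex_Ici 0) (by fun_prop) (by fun_prop)
    intro x hx
    rw [interior_Ici] at hx
    have : HasDerivAt (fun x => x * Real.cosh x - Real.sinh x)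
        (1 * Real.cosh x + x * Real.sinh x - Real.cosh x) x :=
      ((hasDerivAt_id x).mul (Real.hasDerivAt_cosh x)).sub (Real.hasDerivAt_sinh x)
    rw [this.deriv]
    have := mul_nonneg (le_of_lt hx) (Real.sinh_nonneg_iff.2 (le_of_lt hx))
    linarith
  have := hm (mem_Ici.2 le_rfl) (mem_Ici.2 hx) hx
  simp at this
  linarith

theorem Complex.norm_sin_le_norm_mul_cosh (w : ℂ) :
    ‖Complex.sin w‖ ≤ ‖w‖ * Real.cosh w.im := by
  have h0 := Real.cosh_pos w.im
  refine (sq_le_sq₀ (norm_nonneg _) (by positivity)).1 ?_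
  rw [Complex.norm_sin_sq, mul_pow, ← Complex.normSq_eq_norm_sq, Complex.normSq_apply]
  have h1 : Real.sin w.re ^ 2 ≤ w.re ^ 2 := by
    rw [sq_le_sq]; exact Real.abs_sin_le_abs
  have h2 : Real.sinh w.im ^ 2 ≤ w.im ^ 2 * Real.cosh w.im ^ 2 := by
    have := Real.sinh_le_mul_cosh (abs_nonneg w.im)
    rw [Real.cosh_abs] at this
    rw [← mul_pow, sq_le_sq, abs_mul, abs_of_pos h0, Real.abs_sinh]
    exact this
  have h3 := Real.one_le_cosh w.im
  have h4 : w.re ^ 2 ≤ w.re ^ 2 * Real.cosh w.im ^ 2 :=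
    le_mul_of_one_le_right (sq_nonneg _) (one_le_pow₀ h3)
  nlinarith

/-- Since κ ≤ 1, the square cos² (Re w) + sinh² (Im w) is at least κ² (1 + sinh² (Im w)). -/
theorem Complex.le_norm_cos {κ : ℝ} (hκ : 0 ≤ κ) {w : ℂ} (hw : κ ≤ Real.cos w.re) :
    κ * Real.cosh w.im ≤ ‖Complex.cos w‖ := by
  refine (sq_le_sq₀ (mul_nonneg hκ (Real.cosh_pos _).le) (norm_nonneg _)).1 ?_
  rw [Complex.norm_cos_sq, mul_pow, Real.cosh_sq]
  have h1 : κ ^ 2 ≤ Real.cos w.re ^ 2 := by gcongr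
  have h2 : κ ^ 2 ≤ 1 := h1.trans (Real.cos_sq_le_one _)
  nlinarith [mul_nonneg (sub_nonneg.2 h2) (sq_nonneg (Real.sinh w.im))]

theorem cos_le_cos_mul {c θ b : ℝ} (hθ : 0 ≤ θ) (hc : c ≤ Real.pi) {B : ℝ} (hB : B * θ ≤ c)
    (hb : |b| ≤ B) : Real.cos c ≤ Real.cos (b * θ) := by
  rw [← Real.cos_abs (b * θ)]
  apply Real.cos_le_cos_of_nonneg_of_le_pi (abs_nonneg _) hc
  rw [abs_mul, abs_of_nonneg hθ]
  exact (by gcongr : |b| * θ ≤ B * θ).trans hB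

theorem cos_pos_of_strip {c θ B : ℝ} (hθ : 0 < θ) (hc : c < Real.pi / 2)
    (hB : B * θ ≤ c) {z : ℂ} (hz : |z.re| ≤ B) : 0 < Real.cos c := by
  apply Real.cos_pos_of_mem_Ioo ⟨?_, hc⟩
  have : 0 ≤ B := (abs_nonneg _).trans hz
  have := mul_nonneg this hθ.le
  linarith [Real.pi_pos]

/-- This is where the smallness of the opening enters: |Re z| θ ≤ c < π/2 keeps zθ away from the
zeros of the cosine, uniformly in θ. -/
theorem le_norm_cos_strip {c θ B : ℝ} (hθ : 0 < θ) (hc : c < Real.pi / 2)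
    (hB : B * θ ≤ c) {z : ℂ} (hz : |z.re| ≤ B) :
    Real.cos c * Real.cosh (z.im * θ) ≤ ‖Complex.cos (z * θ)‖ := by
  have h := Complex.le_norm_cos (cos_pos_of_strip hθ hc hB hz).le (w := z * θ)
    (by simpa using cos_le_cos_mul hθ.le (by linarith [Real.pi_pos]) hB hz)
  simpa using h

theorem cos_ne_zero_strip {c θ B : ℝ} (hθ : 0 < θ) (hc : c < Real.pi / 2)
    (hB : B * θ ≤ c) {z : ℂ} (hz : |z.re| ≤ B) : Complex.cos (z * θ) ≠ 0 := by
  have h1 := le_norm_cos_strip hθ hc hB hz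
  have h2 := mul_pos (cos_pos_of_strip hθ hc hB hz) (Real.cosh_pos (z.im * θ))
  exact norm_pos_iff.1 (h2.trans_le h1)

/-- The numerator grows like e^{|Im z|φ} and the denominator like e^{|Im z|θ}, so the quotient is
concentrated near the side φ = θ at distance 1/|Im z|. -/
theorem norm_cos_div_cos_le {c θ B : ℝ} (hθ : 0 < θ) (hc : c < Real.pi / 2)
    (hB : B * θ ≤ c) {z : ℂ} (hz : |z.re| ≤ B) {φ : ℝ} (hφ : φ ∈ Icc 0 θ) :
    ‖Complex.cos (z * φ) / Complex.cos (z * θ)‖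
      ≤ 2 / Real.cos c * Real.exp (-(|z.im| * (θ - φ))) := by
  have h0 := cos_pos_of_strip hθ hc hB hz
  have h1 := le_norm_cos_strip hθ hc hB hz
  have h2 := Complex.norm_cos_le_cosh (z * φ)
  have h2' : (z * φ).im = z.im * φ := by simp
  rw [h2'] at h2
  have h3 : Real.cosh (z.im * φ) ≤ Real.exp (|z.im| * φ) := by
    rw [← Real.cosh_abs, abs_mul, abs_of_nonneg hφ.1, Real.cosh_eq]
    have : Real.exp (-(|z.im| * φ)) ≤ Real.exp (|z.im| * φ) := by
      rw [Real.exp_le_exp]; have := mul_nonneg (abs_nonneg z.im) hφ.1; linarith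
    linarith
  have h4 : Real.exp (|z.im| * θ) / 2 ≤ Real.cosh (z.im * θ) := by
    rw [← Real.cosh_abs, abs_mul, abs_of_pos hθ, Real.cosh_eq]
    have := Real.exp_pos (-(|z.im| * θ))
    linarith
  have h5 : Real.cos c * (Real.exp (|z.im| * θ) / 2) ≤ ‖Complex.cos (z * θ)‖ :=
    le_trans (by gcongr) h1
  rw [norm_div, div_le_iff₀ (lt_of_lt_of_le (by positivity) h5)]
  calc _ ≤ Real.exp (|z.im| * φ) := h2.trans h3
    _ = 2 / Real.cos c * Real.exp (-(|z.im| * (θ - φ)))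
        * (Real.cos c * (Real.exp (|z.im| * θ) / 2)) := by
      have : Real.exp (|z.im| * φ)
          = Real.exp (-(|z.im| * (θ - φ))) * Real.exp (|z.im| * θ) := by
        rw [← Real.exp_add]; ring_nf
      rw [this]; field_simp
    _ ≤ _ := by gcongr

theorem norm_cos_div_cos_le' {c θ B : ℝ} (hθ : 0 < θ) (hc : c < Real.pi / 2)
    (hB : B * θ ≤ c) {z : ℂ} (hz : |z.re| ≤ B) {φ : ℝ} (hφ : φ ∈ Icc 0 θ) :
    ‖Complex.cos (z * φ) / Complex.cos (z * θ)‖ ≤ 2 / Real.cos c := by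
  have h0 := cos_pos_of_strip hθ hc hB hz
  refine (norm_cos_div_cos_le hθ hc hB hz hφ).trans (mul_le_of_le_one_right (by positivity) ?_)
  rw [Real.exp_le_one_iff]
  have := mul_nonneg (abs_nonneg z.im) (sub_nonneg.2 hφ.2)
  linarith

/-- The two entries of the minimum are the two elementary bounds of the sine by cosh and by |zθ|
cosh. With θ ≤ ε the minimum is at most εμ, which is the gain of a factor ε in the normal
derivative. -/
theorem norm_tan_le {c θ B : ℝ} (hθ : 0 < θ) (hc : c < Real.pi / 2)
    (hB : B * θ ≤ c) {z : ℂ} (hz : |z.re| ≤ B) :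
    ‖Complex.sin (z * θ) / Complex.cos (z * θ)‖ ≤ min 1 (‖z‖ * θ) / Real.cos c := by
  have h0 := cos_pos_of_strip hθ hc hB hz
  have h1 := le_norm_cos_strip hθ hc hB hz
  have hch := Real.cosh_pos (z.im * θ)
  have h2 := Complex.norm_sin_le_cosh (z * θ)
  have h3 := Complex.norm_sin_le_norm_mul_cosh (z * θ)
  have h2' : (z * θ).im = z.im * θ := by simp
  rw [h2'] at h2 h3
  rw [norm_mul, Complex.norm_real, Real.norm_of_nonneg hθ.le] at h3
  have hle : ‖Complex.sin (z * θ)‖ ≤ min 1 (‖z‖ * θ) * Real.cosh (z.im * θ) := by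
    rcases min_choice 1 (‖z‖ * θ) with h | h <;> rw [h]
    · rwa [one_mul]
    · exact h3
  have hm : 0 ≤ min 1 (‖z‖ * θ) := by positivity
  rw [norm_div, div_le_div_iff₀ (lt_of_lt_of_le (by positivity) h1) h0]
  calc _ ≤ min 1 (‖z‖ * θ) * Real.cosh (z.im * θ) * Real.cos c := by gcongr
    _ = min 1 (‖z‖ * θ) * (Real.cos c * Real.cosh (z.im * θ)) := by ring
    _ ≤ _ := by gcongr

/-- The Poisson multiplier has integral of order `min {θ, 1/|z|}` over the opening. -/
theorem integral_norm_cos_div_cos_le {c θ B : ℝ} (hθ : 0 < θ) (hc : c < Real.pi / 2)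
    (hB : B * θ ≤ c) {z : ℂ} (hz : |z.re| ≤ B)
    (hz0 : z ≠ 0) :
    ∫ φ in Ioo 0 θ, ‖Complex.cos (z * φ) / Complex.cos (z * θ)‖
      ≤ (8 / Real.cos c) * min θ (1 / ‖z‖) := by
  have h0 := cos_pos_of_strip hθ hc hB hz
  have hcont : Continuous fun φ : ℝ => ‖Complex.cos (z * φ) / Complex.cos (z * θ)‖ := by fun_prop
  have hint : ∀ {f : ℝ → ℝ}, Continuous f → IntegrableOn f (Ioo 0 θ) := fun hf =>
    (hf.continuousOn.integrableOn_compact isCompact_Icc).mono_set Ioo_subset_Icc_self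
  have h1 : ∫ φ in Ioo 0 θ, ‖Complex.cos (z * φ) / Complex.cos (z * θ)‖ ≤ 2 / Real.cos c * θ := by
    calc _ ≤ ∫ φ in Ioo 0 θ, 2 / Real.cos c :=
          setIntegral_mono_on (hint hcont) (hint continuous_const) measurableSet_Ioo fun φ hφ =>
            norm_cos_div_cos_le' hθ hc hB hz (Ioo_subset_Icc_self hφ)
      _ = _ := by simp [hθ.le, mul_comm]
  have hBc : B * θ ≤ Real.pi / 2 := by linarith
  -- If the real part dominates, then |z|θ is at most 2Bθ ≤ π ≤ 4, so θ ≤ 4/|z| and the bound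
  -- without decay is enough. Otherwise |z| ≤ 2 |Im z|, and the exponential integrates to at most
  -- 1/|Im z|.
  rcases le_or_gt (|z.im|) (|z.re|) with h | h
  · refine h1.trans ?_
    have h2 : ‖z‖ * θ ≤ 4 := by
      have := Complex.norm_le_abs_re_add_abs_im z
      have h3 : |z.re| * θ ≤ B * θ := by gcongr
      have := Real.pi_le_four
      nlinarith
    rw [div_mul_eq_mul_div, div_mul_eq_mul_div, div_le_div_iff_of_pos_right h0]
    rw [mul_min_of_nonneg _ _ (by norm_num)]
    have hz0 := norm_pos_iff.2 hz0
    refine le_min (by linarith) ?_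
    rw [mul_one_div, le_div_iff₀ hz0]
    linarith
  · have hz1 : 0 < |z.im| := (abs_nonneg _).trans_lt h
    have hzn : ‖z‖ ≤ 2 * |z.im| := by
      have := Complex.norm_le_abs_re_add_abs_im z
      linarith
    have hz0 : 0 < ‖z‖ := hz1.trans_le (Complex.abs_im_le_norm z)
    have h2 : ∫ φ in Ioo 0 θ, ‖Complex.cos (z * φ) / Complex.cos (z * θ)‖
        ≤ 2 / Real.cos c * (1 / |z.im|) := by
      calc _ ≤ ∫ φ in Ioo 0 θ, 2 / Real.cos c * Real.exp (-(|z.im| * (θ - φ))) :=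
            setIntegral_mono_on (hint hcont) (hint (by fun_prop)) measurableSet_Ioo fun φ hφ =>
              norm_cos_div_cos_le hθ hc hB hz (Ioo_subset_Icc_self hφ)
        _ = 2 / Real.cos c * ∫ φ in (0 : ℝ)..θ, Real.exp (-(|z.im| * (θ - φ))) := by
            rw [intervalIntegral.integral_of_le hθ.le, ← integral_Ioc_eq_integral_Ioo,
              integral_const_mul]
        _ ≤ _ := by
            gcongr
            have hd : ∀ φ ∈ uIcc 0 θ, HasDerivAt
                (fun φ => Real.exp (-(|z.im| * (θ - φ))) / |z.im|)
                (Real.exp (-(|z.im| * (θ - φ)))) φ := by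
              intro φ _
              have h1 : HasDerivAt (fun φ => -(|z.im| * (θ - φ))) |z.im| φ := by
                convert! (((hasDerivAt_id φ).const_sub θ).const_mul |z.im|).neg using 1
                ring
              have := h1.exp.div_const |z.im|
              rwa [mul_div_cancel_right₀ _ hz1.ne'] at this
            rw [intervalIntegral.integral_eq_sub_of_hasDerivAt hd
              (by apply Continuous.intervalIntegrable; fun_prop)]
            have := Real.exp_pos (-(|z.im| * (θ - 0)))
            rw [← sub_div]
            gcongr
            simp; positivity
    rw [mul_min_of_nonneg _ _ (by positivity)]
    refine le_min (h1.trans ?_) (h2.trans ?_)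
    · gcongr; norm_num
    · rw [div_mul_eq_mul_div, div_mul_eq_mul_div, div_le_div_iff_of_pos_right h0]
      rw [mul_one_div, mul_one_div, div_le_div_iff₀ hz1 hz0]
      linarith

/-! ### Functions on a strip -/

/-- `U` is twice continuously differentiable on `ℝ × [0,θ]`, with the given derivatives, and has
vanishing normal derivative on the lower side. -/
structure IsStripC2 (θ : ℝ) (U Uu Uφ Uuu Uφφ : ℝ → ℝ → ℝ) : Prop where
  cont : ContinuousOn (fun p : ℝ × ℝ => U p.1 p.2) (univ ×ˢ Icc 0 θ)
  cont_u : ContinuousOn (fun p : ℝ × ℝ => Uu p.1 p.2) (univ ×ˢ Icc 0 θ)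
  cont_φ : ContinuousOn (fun p : ℝ × ℝ => Uφ p.1 p.2) (univ ×ˢ Icc 0 θ)
  cont_uu : ContinuousOn (fun p : ℝ × ℝ => Uuu p.1 p.2) (univ ×ˢ Icc 0 θ)
  cont_φφ : ContinuousOn (fun p : ℝ × ℝ => Uφφ p.1 p.2) (univ ×ˢ Icc 0 θ)
  deriv_u : ∀ u, ∀ φ ∈ Ioo 0 θ, HasDerivAt (fun u => U u φ) (Uu u φ) u
  deriv_uu : ∀ u, ∀ φ ∈ Ioo 0 θ, HasDerivAt (fun u => Uu u φ) (Uuu u φ) u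
  deriv_φ : ∀ u, ∀ φ ∈ Ioo 0 θ, HasDerivAt (fun φ => U u φ) (Uφ u φ) φ
  deriv_φφ : ∀ u, ∀ φ ∈ Ioo 0 θ, HasDerivAt (fun φ => Uφ u φ) (Uφφ u φ) φ
  neumann : ∀ u, Uφ u 0 = 0

theorem integrable_box {θ M : ℝ} {A : ℝ × ℝ → ℂ} (hA : ContinuousOn A (univ ×ˢ Icc 0 θ)) :
    Integrable A ((volume.restrict (Icc (-M) M)).prod (volume.restrict (Ioo 0 θ))) := by
  rw [Measure.prod_restrict, ← Measure.volume_eq_prod]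
  have h1 : IntegrableOn A (Icc (-M) M ×ˢ Icc 0 θ) :=
    (hA.mono (prod_mono (subset_univ _) le_rfl)).integrableOn_compact (isCompact_Icc.prod isCompact_Icc)
  exact h1.mono_set (prod_mono le_rfl Ioo_subset_Icc_self)

theorem ContinuousOn.slice_right {θ : ℝ} {A : ℝ → ℝ → ℝ}
    (hA : ContinuousOn (fun p : ℝ × ℝ => A p.1 p.2) (univ ×ˢ Icc 0 θ)) {φ : ℝ} (hφ : φ ∈ Icc 0 θ) :
    Continuous fun u => A u φ :=
  hA.comp_continuous (f := fun u : ℝ => (u, φ)) (by fun_prop) fun u => ⟨trivial, hφ⟩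

theorem ContinuousOn.slice_left {θ : ℝ} {A : ℝ → ℝ → ℝ}
    (hA : ContinuousOn (fun p : ℝ × ℝ => A p.1 p.2) (univ ×ˢ Icc 0 θ)) (u : ℝ) :
    ContinuousOn (fun φ => A u φ) (Icc 0 θ) :=
  hA.comp (f := fun φ : ℝ => (u, φ)) (by fun_prop) fun φ hφ => ⟨trivial, hφ⟩

theorem integral_Ioo_eq_interval {θ : ℝ} (hθ : 0 < θ) (f : ℝ → ℂ) :
    ∫ φ in Ioo 0 θ, f φ = ∫ φ in (0 : ℝ)..θ, f φ := by
  rw [intervalIntegral.integral_of_le hθ.le, integral_Ioc_eq_integral_Ioo]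

theorem integral_Icc_eq_interval {M : ℝ} (hM : 0 ≤ M) (f : ℝ → ℂ) :
    ∫ u in Icc (-M) M, f u = ∫ u in (-M)..M, f u := by
  rw [intervalIntegral.integral_of_le (by linarith), integral_Icc_eq_integral_Ioc]

namespace IsStripC2

variable {θ : ℝ} {U Uu Uφ Uuu Uφφ : ℝ → ℝ → ℝ}

/-- Two integrations by parts in φ. The boundary terms at φ = 0 vanish, one by the Neumann condition
and the other because sin 0 = 0; those at φ = θ carry the normal derivative and the Dirichlet data.
-/
theorem angular_identity (hS : IsStripC2 θ U Uu Uφ Uuu Uφφ) (hθ : 0 < θ) (z : ℂ) (u : ℝ) :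
    ∫ φ in Ioo 0 θ, (Uφφ u φ : ℂ) * Complex.cos (z * φ)
      = Uφ u θ * Complex.cos (z * θ) + z * U u θ * Complex.sin (z * θ)
        - z ^ 2 * ∫ φ in Ioo 0 θ, (U u φ : ℂ) * Complex.cos (z * φ) := by
  have hco : ∀ φ : ℝ, HasDerivAt (fun φ : ℝ => Complex.cos (z * φ)) (-Complex.sin (z * φ) * z) φ := by
    intro φ
    have h1 : HasDerivAt (fun w : ℂ => z * w) z (φ : ℂ) := by
      simpa using (hasDerivAt_id (φ : ℂ)).const_mul z
    exact h1.ccos.comp_ofReal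
  have hsi : ∀ φ : ℝ, HasDerivAt (fun φ : ℝ => Complex.sin (z * φ)) (Complex.cos (z * φ) * z) φ := by
    intro φ
    have h1 : HasDerivAt (fun w : ℂ => z * w) z (φ : ℂ) := by
      simpa using (hasDerivAt_id (φ : ℂ)).const_mul z
    exact h1.csin.comp_ofReal
  have hI : ∀ {A : ℝ → ℝ → ℝ}, ContinuousOn (fun p : ℝ × ℝ => A p.1 p.2) (univ ×ˢ Icc 0 θ) →
      ContinuousOn (fun φ => (A u φ : ℂ)) (uIcc 0 θ) := fun hA => by
    rw [uIcc_of_le hθ.le]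
    exact Complex.continuous_ofReal.comp_continuousOn (hA.slice_left u)
  have hmem : ∀ φ ∈ Ioo (min 0 θ) (max 0 θ), φ ∈ Ioo 0 θ := fun φ hφ => by
    rwa [min_eq_left hθ.le, max_eq_right hθ.le] at hφ
  have e1 := intervalIntegral.integral_deriv_mul_eq_sub_of_hasDerivAt (a := 0) (b := θ)
    (u := fun φ => (Uφ u φ : ℂ)) (v := fun φ : ℝ => Complex.cos (z * φ))
    (u' := fun φ => (Uφφ u φ : ℂ)) (v' := fun φ : ℝ => -Complex.sin (z * φ) * z)
    (hI hS.cont_φ) (by fun_prop) (fun φ hφ => (hS.deriv_φφ u φ (hmem φ hφ)).ofReal_comp)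
    (fun φ _ => hco φ) (hI hS.cont_φφ).intervalIntegrable
    (by apply Continuous.intervalIntegrable; fun_prop)
  have e2 := intervalIntegral.integral_deriv_mul_eq_sub_of_hasDerivAt (a := 0) (b := θ)
    (u := fun φ => (U u φ : ℂ)) (v := fun φ : ℝ => Complex.sin (z * φ))
    (u' := fun φ => (Uφ u φ : ℂ)) (v' := fun φ : ℝ => Complex.cos (z * φ) * z)
    (hI hS.cont) (by fun_prop) (fun φ hφ => (hS.deriv_φ u φ (hmem φ hφ)).ofReal_comp)
    (fun φ _ => hsi φ) (hI hS.cont_φ).intervalIntegrable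
    (by apply Continuous.intervalIntegrable; fun_prop)
  have i1 : IntervalIntegrable (fun φ => (Uφφ u φ : ℂ) * Complex.cos (z * φ)) volume 0 θ :=
    ((hI hS.cont_φφ).mul (by fun_prop)).intervalIntegrable
  have i2 : IntervalIntegrable (fun φ => (Uφ u φ : ℂ) * Complex.sin (z * φ)) volume 0 θ :=
    ((hI hS.cont_φ).mul (by fun_prop)).intervalIntegrable
  have i3 : IntervalIntegrable (fun φ => (U u φ : ℂ) * Complex.cos (z * φ)) volume 0 θ :=
    ((hI hS.cont).mul (by fun_prop)).intervalIntegrable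
  have e1' : ∫ φ in (0 : ℝ)..θ, ((Uφφ u φ : ℂ) * Complex.cos (z * φ)
      + Uφ u φ * (-Complex.sin (z * φ) * z))
      = (∫ φ in (0 : ℝ)..θ, (Uφφ u φ : ℂ) * Complex.cos (z * φ))
        - z * ∫ φ in (0 : ℝ)..θ, (Uφ u φ : ℂ) * Complex.sin (z * φ) := by
    rw [← intervalIntegral.integral_const_mul, ← intervalIntegral.integral_sub i1 (i2.const_mul z)]
    congr 1; ext φ; ring
  have e2' : ∫ φ in (0 : ℝ)..θ, ((Uφ u φ : ℂ) * Complex.sin (z * φ)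
      + U u φ * (Complex.cos (z * φ) * z))
      = (∫ φ in (0 : ℝ)..θ, (Uφ u φ : ℂ) * Complex.sin (z * φ))
        + z * ∫ φ in (0 : ℝ)..θ, (U u φ : ℂ) * Complex.cos (z * φ) := by
    rw [← intervalIntegral.integral_const_mul, ← intervalIntegral.integral_add i2 (i3.const_mul z)]
    congr 1; ext φ; ring
  rw [e1'] at e1
  rw [e2'] at e2
  rw [integral_Ioo_eq_interval hθ, integral_Ioo_eq_interval hθ]
  simp only [hS.neumann, Complex.ofReal_zero, zero_mul, sub_zero, mul_zero, Complex.sin_zero] at e1 e2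
  linear_combination e1 + z * e2

theorem radial_identity (hS : IsStripC2 θ U Uu Uφ Uuu Uφφ) {M : ℝ} (hM : 0 ≤ M)
    {ρ ρ' ρ'' : ℝ → ℂ} (hρ : ∀ u, HasDerivAt ρ (ρ' u) u) (hρ' : ∀ u, HasDerivAt ρ' (ρ'' u) u)
    (hρ'' : Continuous ρ'') (h0 : ∀ u, M ≤ |u| → ρ u = 0 ∧ ρ' u = 0) {φ : ℝ} (hφ : φ ∈ Ioo 0 θ) :
    ∫ u in Icc (-M) M, (Uuu u φ : ℂ) * ρ u = ∫ u in Icc (-M) M, (U u φ : ℂ) * ρ'' u := by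
  have hφ' := Ioo_subset_Icc_self hφ
  have hc : ∀ {A : ℝ → ℝ → ℝ}, ContinuousOn (fun p : ℝ × ℝ => A p.1 p.2) (univ ×ˢ Icc 0 θ) →
      Continuous (fun u => (A u φ : ℂ)) := fun hA => Complex.continuous_ofReal.comp (hA.slice_right hφ')
  have cρ : Continuous ρ := continuous_iff_continuousAt.2 fun u => (hρ u).continuousAt
  have cρ' : Continuous ρ' := continuous_iff_continuousAt.2 fun u => (hρ' u).continuousAt
  have e1 := intervalIntegral.integral_deriv_mul_eq_sub (a := -M) (b := M)
    (u := fun u => (Uu u φ : ℂ)) (v := ρ) (u' := fun u => (Uuu u φ : ℂ)) (v' := ρ')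
    (fun u _ => (hS.deriv_uu u φ hφ).ofReal_comp) (fun u _ => hρ u)
    ((hc hS.cont_uu).intervalIntegrable _ _) (cρ'.intervalIntegrable _ _)
  have e2 := intervalIntegral.integral_deriv_mul_eq_sub (a := -M) (b := M)
    (u := fun u => (U u φ : ℂ)) (v := ρ') (u' := fun u => (Uu u φ : ℂ)) (v' := ρ'')
    (fun u _ => (hS.deriv_u u φ hφ).ofReal_comp) (fun u _ => hρ' u)
    ((hc hS.cont_u).intervalIntegrable _ _) (hρ''.intervalIntegrable _ _)
  have hp := h0 M (le_abs_self _)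
  have hn := h0 (-M) (by rw [abs_neg]; exact le_abs_self _)
  have hadd : ∀ {f g : ℝ → ℂ}, Continuous f → Continuous g → ∫ x in (-M)..M, (f x + g x)
      = (∫ x in (-M)..M, f x) + ∫ x in (-M)..M, g x := fun hf hg =>
    intervalIntegral.integral_add (hf.intervalIntegrable _ _) (hg.intervalIntegrable _ _)
  have a1 := hadd ((hc hS.cont_uu).mul cρ) ((hc hS.cont_u).mul cρ')
  have a2 := hadd ((hc hS.cont_u).mul cρ') ((hc hS.cont).mul hρ'')
  simp only [Pi.mul_apply] at a1 a2
  rw [a1] at e1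
  rw [a2] at e2
  rw [integral_Icc_eq_interval hM, integral_Icc_eq_interval hM]
  simp only [hp.1, hp.2, hn.1, hn.2, mul_zero, sub_zero] at e1 e2
  linear_combination e1 - e2

/-- Green's identity with the test function `χ(u) e^{-zu} cos(zφ)`. -/
theorem green_exp (hS : IsStripC2 θ U Uu Uφ Uuu Uφφ) (hθ : 0 < θ) {M : ℝ} (hM : 0 ≤ M)
    {χ χ' χ'' : ℝ → ℝ} (hχ : ∀ u, HasDerivAt χ (χ' u) u) (hχ' : ∀ u, HasDerivAt χ' (χ'' u) u)
    (hχ'' : Continuous χ'') (h0 : ∀ u, M ≤ |u| → χ u = 0 ∧ χ' u = 0) (z : ℂ) :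
    ∫ p, ((χ p.1 * (Uuu p.1 p.2 + Uφφ p.1 p.2) : ℝ) : ℂ)
        * (Complex.exp (-z * p.1) * Complex.cos (z * p.2))
        ∂((volume.restrict (Icc (-M) M)).prod (volume.restrict (Ioo 0 θ)))
      = (∫ u in Icc (-M) M, ((χ u * Uφ u θ : ℝ) : ℂ) * (Complex.exp (-z * u) * Complex.cos (z * θ)))
      + (∫ u in Icc (-M) M, ((χ u * U u θ : ℝ) : ℂ)
          * (Complex.exp (-z * u) * (z * Complex.sin (z * θ))))
      + ((∫ p, ((χ'' p.1 * U p.1 p.2 : ℝ) : ℂ) * (Complex.exp (-z * p.1) * Complex.cos (z * p.2))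
        ∂((volume.restrict (Icc (-M) M)).prod (volume.restrict (Ioo 0 θ))))
      - 2 * ∫ p, ((χ' p.1 * U p.1 p.2 : ℝ) : ℂ)
          * (Complex.exp (-z * p.1) * (z * Complex.cos (z * p.2)))
        ∂((volume.restrict (Icc (-M) M)).prod (volume.restrict (Ioo 0 θ)))) := by
  have cχ : Continuous χ := continuous_iff_continuousAt.2 fun u => (hχ u).continuousAt
  have cχ' : Continuous χ' := continuous_iff_continuousAt.2 fun u => (hχ' u).continuousAt
  set ν := (volume.restrict (Icc (-M) M)).prod (volume.restrict (Ioo 0 θ)) with hν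
  have hJ : ∀ {A : ℝ → ℝ → ℝ} (G : ℝ × ℝ → ℂ),
      ContinuousOn (fun p : ℝ × ℝ => A p.1 p.2) (univ ×ˢ Icc 0 θ) → Continuous G →
      Integrable (fun p : ℝ × ℝ => (A p.1 p.2 : ℂ) * G p) ν := fun G hA hG =>
    integrable_box ((Complex.continuous_ofReal.comp_continuousOn hA).mul hG.continuousOn)
  set E : ℝ → ℂ := fun u => Complex.exp (-z * u) with hE
  have hEd : ∀ u : ℝ, HasDerivAt E (-z * E u) u := by
    intro u
    have h1 : HasDerivAt (fun u : ℝ => -z * (u : ℂ)) (-z) u := by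
      simpa using (Complex.ofRealCLM.hasDerivAt (x := u)).const_mul (-z)
    have := h1.cexp
    rwa [mul_comm] at this
  have cE : Continuous E := by fun_prop
  have hρ : ∀ u, HasDerivAt (fun u => (χ u : ℂ) * E u) ((χ' u - z * χ u) * E u) u := fun u => by
    convert! (hχ u).ofReal_comp.mul (hEd u) using 1; ring
  have hρ' : ∀ u, HasDerivAt (fun u => ((χ' u : ℂ) - z * χ u) * E u)
      ((χ'' u - 2 * z * χ' u + z ^ 2 * χ u) * E u) u := fun u => by
    convert! ((hχ' u).ofReal_comp.sub ((hχ u).ofReal_comp.const_mul z)).mul (hEd u) using 1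
    simp only [Pi.sub_apply]; ring
  -- the radial part
  have hrad : ∫ p, (Uuu p.1 p.2 : ℂ) * (χ p.1 * E p.1 * Complex.cos (z * p.2)) ∂ν
      = ∫ p, (U p.1 p.2 : ℂ) * ((χ'' p.1 - 2 * z * χ' p.1 + z ^ 2 * χ p.1) * E p.1
          * Complex.cos (z * p.2)) ∂ν := by
    rw [hν, integral_prod_symm _ (hJ (fun p => χ p.1 * E p.1 * Complex.cos (z * p.2)) hS.cont_uu
      (by fun_prop)), integral_prod_symm _ (hJ (fun p => (χ'' p.1 - 2 * z * χ' p.1 + z ^ 2 * χ p.1)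
        * E p.1 * Complex.cos (z * p.2)) hS.cont (by fun_prop))]
    refine setIntegral_congr_fun measurableSet_Ioo fun φ hφ => ?_
    have := hS.radial_identity hM hρ hρ' (by fun_prop)
      (fun u hu => by simp [(h0 u hu).1, (h0 u hu).2]) hφ
    simp only
    simp_rw [← mul_assoc] at this ⊢
    rw [integral_mul_const, integral_mul_const, this]
  have hang : ∫ p, (Uφφ p.1 p.2 : ℂ) * (χ p.1 * E p.1 * Complex.cos (z * p.2)) ∂ν
      = (∫ u in Icc (-M) M, ((χ u * Uφ u θ : ℝ) : ℂ) * (E u * Complex.cos (z * θ)))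
      + (∫ u in Icc (-M) M, ((χ u * U u θ : ℝ) : ℂ) * (E u * (z * Complex.sin (z * θ))))
      - z ^ 2 * ∫ p, (U p.1 p.2 : ℂ) * (χ p.1 * E p.1 * Complex.cos (z * p.2)) ∂ν := by
    have hU := hJ (fun p => χ p.1 * E p.1 * Complex.cos (z * p.2)) hS.cont (by fun_prop)
    have hθm : θ ∈ Icc 0 θ := ⟨hθ.le, le_rfl⟩
    have c1 : Continuous fun u => Uφ u θ := hS.cont_φ.slice_right hθm
    have c2 : Continuous fun u => U u θ := hS.cont.slice_right hθm
    rw [hν] at hU ⊢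
    rw [integral_prod _ (hJ (fun p => χ p.1 * E p.1 * Complex.cos (z * p.2)) hS.cont_φφ
      (by fun_prop)), integral_prod _ hU, ← integral_const_mul, ← integral_add, ← integral_sub]
    · congr 1; ext u
      have := hS.angular_identity hθ z u
      have e : ∀ (A : ℝ → ℝ → ℝ), ∫ φ in Ioo 0 θ, (A u φ : ℂ) * (χ u * E u * Complex.cos (z * φ))
          = χ u * E u * ∫ φ in Ioo 0 θ, (A u φ : ℂ) * Complex.cos (z * φ) := fun A => by
        rw [← integral_const_mul]; congr 1; ext φ; ring
      simp only [e, this]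
      push_cast; ring
    · exact Continuous.integrableOn_Icc (by fun_prop)
    · exact (hU.integral_prod_left).const_mul _
    · exact Continuous.integrableOn_Icc (by fun_prop)
    · exact Continuous.integrableOn_Icc (by fun_prop)
  have i1 := hJ (fun p => χ p.1 * E p.1 * Complex.cos (z * p.2)) hS.cont_uu (by fun_prop)
  have i2 := hJ (fun p => χ p.1 * E p.1 * Complex.cos (z * p.2)) hS.cont_φφ (by fun_prop)
  have j1 := hJ (fun p => χ'' p.1 * E p.1 * Complex.cos (z * p.2)) hS.cont (by fun_prop)
  have j2 := hJ (fun p => χ' p.1 * E p.1 * (z * Complex.cos (z * p.2))) hS.cont (by fun_prop)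
  have j3 := hJ (fun p => χ p.1 * E p.1 * Complex.cos (z * p.2)) hS.cont (by fun_prop)
  have s1 : ∫ p, ((χ p.1 * (Uuu p.1 p.2 + Uφφ p.1 p.2) : ℝ) : ℂ) * (E p.1 * Complex.cos (z * p.2)) ∂ν
      = (∫ p, (Uuu p.1 p.2 : ℂ) * (χ p.1 * E p.1 * Complex.cos (z * p.2)) ∂ν)
        + ∫ p, (Uφφ p.1 p.2 : ℂ) * (χ p.1 * E p.1 * Complex.cos (z * p.2)) ∂ν := by
    rw [← integral_add i1 i2]; congr 1; ext p; push_cast; ring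
  have s2 : ∫ p, (U p.1 p.2 : ℂ) * ((χ'' p.1 - 2 * z * χ' p.1 + z ^ 2 * χ p.1) * E p.1
          * Complex.cos (z * p.2)) ∂ν
      = (∫ p, (U p.1 p.2 : ℂ) * (χ'' p.1 * E p.1 * Complex.cos (z * p.2)) ∂ν)
        - 2 * (∫ p, (U p.1 p.2 : ℂ) * (χ' p.1 * E p.1 * (z * Complex.cos (z * p.2))) ∂ν)
        + z ^ 2 * ∫ p, (U p.1 p.2 : ℂ) * (χ p.1 * E p.1 * Complex.cos (z * p.2)) ∂ν := by
    rw [← integral_const_mul, ← integral_const_mul, ← integral_sub j1 (j2.const_mul 2)]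
    refine Eq.trans ?_ (integral_add (j1.sub (j2.const_mul 2)) (j3.const_mul (z ^ 2)))
    congr 1; ext p; ring
  have t1 : ∫ p, ((χ'' p.1 * U p.1 p.2 : ℝ) : ℂ) * (E p.1 * Complex.cos (z * p.2)) ∂ν
      = ∫ p, (U p.1 p.2 : ℂ) * (χ'' p.1 * E p.1 * Complex.cos (z * p.2)) ∂ν := by
    congr 1; ext p; push_cast; ring
  have t2 : ∫ p, ((χ' p.1 * U p.1 p.2 : ℝ) : ℂ) * (E p.1 * (z * Complex.cos (z * p.2))) ∂ν
      = ∫ p, (U p.1 p.2 : ℂ) * (χ' p.1 * E p.1 * (z * Complex.cos (z * p.2))) ∂ν := by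
    congr 1; ext p; push_cast; ring
  rw [s1, t1, t2, hrad, hang, s2]
  ring

end IsStripC2

/-! ### Harmonic kernels in the strip and the formula for the normal derivative -/

theorem exists_smooth_truncation : ∃ (χ χ' χ'' : ℝ → ℝ) (C : ℝ), 0 ≤ C ∧
    (∀ u, HasDerivAt χ (χ' u) u) ∧ (∀ u, HasDerivAt χ' (χ'' u) u) ∧ Continuous χ'' ∧
    (∀ u, |χ u| ≤ 1) ∧ (∀ u, |χ' u| ≤ C) ∧ (∀ u, |χ'' u| ≤ C) ∧ (∀ u, |u| ≤ 1 → χ u = 1) ∧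
    (∀ u, 3 ≤ |u| → χ u = 0 ∧ χ' u = 0 ∧ χ'' u = 0) := by
  set χ : ℝ → ℝ := fun u => Real.smoothTransition (2 - u) * Real.smoothTransition (2 + u) with hχ
  have hs : ContDiff ℝ ∞ χ :=
    (Real.smoothTransition.contDiff.comp (by fun_prop)).mul
      (Real.smoothTransition.contDiff.comp (by fun_prop))
  have hs1 : ContDiff ℝ ∞ (deriv χ) := hs.deriv'
  have hs2 : ContDiff ℝ ∞ (deriv (deriv χ)) := hs1.deriv'
  have hz : ∀ u, 2 < |u| → χ u = 0 := by
    intro u hu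
    rcases lt_abs.1 hu with h | h
    · simp [hχ, Real.smoothTransition.zero_of_nonpos (show 2 - u ≤ 0 by linarith)]
    · simp [hχ, Real.smoothTransition.zero_of_nonpos (show 2 + u ≤ 0 by linarith)]
  have hder : ∀ {f : ℝ → ℝ}, (∀ u, 2 < |u| → f u = 0) → ∀ u, 2 < |u| → deriv f u = 0 := by
    intro f hf u hu
    have : f =ᶠ[nhds u] fun _ => 0 := by
      filter_upwards [(continuous_abs.isOpen_preimage _ isOpen_Ioi).mem_nhds hu] with t ht
      exact hf t ht
    rw [this.deriv_eq, deriv_const]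
  have hb : ∀ {f : ℝ → ℝ}, Continuous f → (∀ u, 2 < |u| → f u = 0) → ∃ C, ∀ u, |f u| ≤ C := by
    intro f hf h0
    have hc : HasCompactSupport f := HasCompactSupport.of_support_subset_isCompact
      (isCompact_Icc (a := -2) (b := 2)) fun u hu => by
        by_contra h
        exact hu (h0 u (by rwa [mem_Icc, ← abs_le, not_le] at h))
    exact hf.bounded_above_of_compact_support hc
  obtain ⟨C1, hC1⟩ := hb hs1.continuous (hder hz)
  obtain ⟨C2, hC2⟩ := hb hs2.continuous (hder (hder hz))
  refine ⟨χ, deriv χ, deriv (deriv χ), max C1 C2, ?_, ?_, ?_, hs2.continuous, ?_, ?_, ?_, ?_, ?_⟩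
  · exact le_max_of_le_left ((abs_nonneg _).trans (hC1 0))
  · exact fun u => (hs.differentiable (by simp) u).hasDerivAt
  · exact fun u => (hs1.differentiable (by simp) u).hasDerivAt
  · intro u
    rw [hχ, abs_mul]
    have h1 := Real.smoothTransition.nonneg (2 - u)
    have h2 := Real.smoothTransition.nonneg (2 + u)
    rw [abs_of_nonneg h1, abs_of_nonneg h2]
    exact mul_le_one₀ (Real.smoothTransition.le_one _) h2 (Real.smoothTransition.le_one _)
  · exact fun u => (hC1 u).trans (le_max_left _ _)
  · exact fun u => (hC2 u).trans (le_max_right _ _)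
  · intro u hu
    have := abs_le.1 hu
    simp [hχ, Real.smoothTransition.one_of_one_le (show 1 ≤ 2 - u by linarith),
      Real.smoothTransition.one_of_one_le (show 1 ≤ 2 + u by linarith)]
  · intro u hu
    have hu' : 2 < |u| := by linarith
    exact ⟨hz u hu', hder hz u hu', hder (hder hz) u hu'⟩

theorem integrable_line_prod {X : Type*} [MeasurableSpace X] {ν : Measure X} [SFinite ν] {a : X → ℂ}
    (ha : Integrable a ν) {k : ℝ → X → ℂ} {C : ℝ}
    (hk : AEStronglyMeasurable (fun p : ℝ × X => k p.1 p.2) (volume.prod ν))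
    (hC : ∀ᵐ x ∂ν, ∀ ξ, (1 + ξ ^ 2) * ‖k ξ x‖ ≤ C) :
    Integrable (fun p : ℝ × X => a p.2 * k p.1 p.2) (volume.prod ν) := by
  have h1 : Integrable (fun p : ℝ × X => (C * (1 + p.1 ^ 2)⁻¹) * ‖a p.2‖) (volume.prod ν) :=
    (integrable_inv_one_add_sq.const_mul C).mul_prod ha.norm
  refine h1.mono' (ha.1.comp_snd.mul hk) ?_
  filter_upwards [Measure.quasiMeasurePreserving_snd.ae hC] with p hp
  rw [norm_mul, mul_comm]
  gcongr
  have : 0 < 1 + p.1 ^ 2 := by positivity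
  rw [← div_eq_mul_inv, le_div_iff₀ this, mul_comm]; exact hp p.1

/-- Cauchy–Schwarz on each slice φ = const gives an L¹ bound that is uniform in φ, and the interval
of angles has finite length. This justifies exchanging the integrals over ξ (or u) and φ. -/
theorem integrable_mul_of_slices {θ : ℝ} {A K : ℝ × ℝ → ℂ} {a b : ℝ≥0∞} (ha : a ≠ ⊤) (hb : b ≠ ⊤)
    (hA : AEStronglyMeasurable A (volume.prod (volume.restrict (Ioo 0 θ))))
    (hK : AEStronglyMeasurable K (volume.prod (volume.restrict (Ioo 0 θ))))
    (hAa : ∀ φ ∈ Ioo 0 θ, AEStronglyMeasurable (fun x => A (x, φ)) volume ∧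
      eLpNorm (fun x => A (x, φ)) 2 volume ≤ a)
    (hKb : ∀ φ ∈ Ioo 0 θ, AEStronglyMeasurable (fun x => K (x, φ)) volume ∧
      eLpNorm (fun x => K (x, φ)) 2 volume ≤ b) :
    Integrable (fun p => A p * K p) (volume.prod (volume.restrict (Ioo 0 θ))) := by
  have hs : ∀ φ ∈ Ioo 0 θ, eLpNorm (fun x => A (x, φ) * K (x, φ)) 1 volume ≤ a * b := by
    intro φ hφ
    refine (eLpNorm_smul_le_mul_eLpNorm (p := 2) (q := 2) (r := 1) (hKb φ hφ).1 (hAa φ hφ).1).trans ?_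
    exact mul_le_mul' (hAa φ hφ).2 (hKb φ hφ).2
  have hab : a * b ≠ ⊤ := ENNReal.mul_ne_top ha hb
  have hint : ∀ φ ∈ Ioo 0 θ, Integrable (fun x => A (x, φ) * K (x, φ)) := fun φ hφ =>
    memLp_one_iff_integrable.1 ⟨(hAa φ hφ).1.mul (hKb φ hφ).1, (hs φ hφ).trans_lt hab.lt_top⟩
  have hm : AEStronglyMeasurable (fun p => A p * K p) (volume.prod (volume.restrict (Ioo 0 θ))) :=
    hA.mul hK
  rw [integrable_prod_iff' hm]
  refine ⟨(ae_restrict_mem measurableSet_Ioo).mono hint, ?_⟩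
  refine Integrable.of_bound ?_ (a * b).toReal ?_
  · exact hm.norm.prod_swap.integral_prod_right'
  · filter_upwards [ae_restrict_mem measurableSet_Ioo] with φ hφ
    rw [Real.norm_of_nonneg (integral_nonneg fun _ => norm_nonneg _),
      integral_norm_eq_lintegral_enorm (hint φ hφ).1]
    refine ENNReal.toReal_mono hab ?_
    have := hs φ hφ
    rwa [eLpNorm_one_eq_lintegral_enorm] at this

theorem integral_restrict_fst {θ M : ℝ} {f : ℝ × ℝ → ℂ} (hf : ∀ p, M < |p.1| → f p = 0) :
    ∫ p, f p ∂((volume.restrict (Icc (-M) M)).prod (volume.restrict (Ioo 0 θ)))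
      = ∫ p, f p ∂((volume : Measure ℝ).prod (volume.restrict (Ioo 0 θ))) := by
  have h1 : (volume.restrict (Icc (-M) M)).prod (volume.restrict (Ioo 0 θ))
      = ((volume : Measure ℝ).prod (volume.restrict (Ioo 0 θ))).restrict (Icc (-M) M ×ˢ univ) := by
    rw [← Measure.prod_restrict, Measure.restrict_univ]
  rw [h1]
  apply setIntegral_eq_integral_of_forall_compl_eq_zero
  intro p hp
  apply hf
  by_contra h
  exact hp ⟨abs_le.1 (not_lt.1 h), trivial⟩

theorem integral_restrict_Icc {M : ℝ} {f : ℝ → ℂ} (hf : ∀ u, M < |u| → f u = 0) :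
    ∫ u in Icc (-M) M, f u = ∫ u, f u := by
  apply setIntegral_eq_integral_of_forall_compl_eq_zero
  intro p hp
  apply hf
  by_contra h
  exact hp (abs_le.1 (not_lt.1 h))

/-- `λ^j ψ̌(λ) cos(λφ) / cos(λθ) · e^{-λu}`, an exponential harmonic function in the strip. -/
def stripMode (ψ : ℝ → ℝ) (θ : ℝ) (j : ℕ) (z : ℂ) (u φ : ℝ) : ℂ :=
  z ^ j * expTransform ψ z / Complex.cos (z * θ) * (Complex.exp (-z * u) * Complex.cos (z * φ))

/-- The superposition of `stripMode` over a vertical line. -/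
def stripKernel (ψ : ℝ → ℝ) (θ : ℝ) (j : ℕ) (β u φ : ℝ) : ℂ :=
  ∫ ξ, stripMode ψ θ j (linePt β ξ) u φ

/-- The conormal counterpart of `stripMode` on the side `φ = θ`. -/
def sideMode (ψ : ℝ → ℝ) (θ : ℝ) (z : ℂ) (u : ℝ) : ℂ :=
  z * expTransform ψ z / Complex.cos (z * θ) * (Complex.exp (-z * u) * Complex.sin (z * θ))

theorem one_add_sq_le_of_linePt (β ξ : ℝ) : 1 + ξ ^ 2 ≤ (1 + ‖linePt β ξ‖) ^ 2 := by
  have h1 : |2 * Real.pi * ξ| ≤ ‖linePt β ξ‖ := by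
    simpa using Complex.abs_im_le_norm (linePt β ξ)
  have h2 : |ξ| ≤ ‖linePt β ξ‖ := by
    refine le_trans ?_ h1
    rw [abs_mul, abs_of_pos Real.two_pi_pos]
    have := Real.pi_gt_three
    nlinarith [abs_nonneg ξ]
  have h3 : ξ ^ 2 = |ξ| ^ 2 := (sq_abs ξ).symm
  rw [h3]
  nlinarith [abs_nonneg ξ]

section
variable {ψ : ℝ → ℝ} {c θ B β : ℝ}

/-- The quotient of cosines is bounded on the strip of admissible Re z, and the transform of a test
function decays faster than any power. The two spare powers of 1 + |z| make the mode integrable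
along vertical lines. -/
theorem exists_stripMode_bound (hψ : ContDiff ℝ ∞ ψ) (hψc : HasCompactSupport ψ) (hθ : 0 < θ)
    (hc : c < Real.pi / 2) (hB : B * θ ≤ c) (j : ℕ) :
    ∃ D : ℝ, 0 ≤ D ∧ ∀ z : ℂ, |z.re| ≤ B → ∀ φ ∈ Icc 0 θ, ∀ u,
      (1 + ‖z‖) ^ 2 * ‖stripMode ψ θ j z u φ‖ ≤ D * Real.exp (-z.re * u) := by
  rcases lt_or_ge B 0 with hB0 | hB0
  · exact ⟨0, le_rfl, fun z hz => absurd ((abs_nonneg _).trans hz) (not_le.2 hB0)⟩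
  obtain ⟨D, hD0, hD⟩ := exists_expTransform_decay hψ hψc B (2 + j)
  have hcos : 0 < Real.cos c := cos_pos_of_strip hθ hc hB (z := 0) (by simpa using hB0)
  refine ⟨D * (2 / Real.cos c), by positivity, fun z hz φ hφ u => ?_⟩
  have h1 := norm_cos_div_cos_le' hθ hc hB hz hφ
  have h2 := hD z hz
  have e : stripMode ψ θ j z u φ = z ^ j * expTransform ψ z
      * (Complex.cos (z * φ) / Complex.cos (z * θ)) * Complex.exp (-z * u) := by
    rw [stripMode]; ring
  rw [e, norm_mul, norm_mul, norm_mul, norm_pow, norm_exp_mul_ofReal, Complex.neg_re]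
  calc _ = ((1 + ‖z‖) ^ 2 * (‖z‖ ^ j * ‖expTransform ψ z‖))
        * ‖Complex.cos (z * φ) / Complex.cos (z * θ)‖ * Real.exp (-z.re * u) := by ring
    _ ≤ ((1 + ‖z‖) ^ 2 * ((1 + ‖z‖) ^ j * ‖expTransform ψ z‖)) * (2 / Real.cos c)
        * Real.exp (-z.re * u) := by gcongr; linarith
    _ = ((1 + ‖z‖) ^ (2 + j) * ‖expTransform ψ z‖) * (2 / Real.cos c) * Real.exp (-z.re * u) := by
        ring
    _ ≤ _ := by gcongr

theorem exists_sideMode_bound (hψ : ContDiff ℝ ∞ ψ) (hψc : HasCompactSupport ψ) (hθ : 0 < θ)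
    (hc : c < Real.pi / 2) (hB : B * θ ≤ c) :
    ∃ D : ℝ, 0 ≤ D ∧ ∀ z : ℂ, |z.re| ≤ B → ∀ u,
      (1 + ‖z‖) ^ 2 * ‖sideMode ψ θ z u‖ ≤ D * Real.exp (-z.re * u) := by
  rcases lt_or_ge B 0 with hB0 | hB0
  · exact ⟨0, le_rfl, fun z hz => absurd ((abs_nonneg _).trans hz) (not_le.2 hB0)⟩
  obtain ⟨D, hD0, hD⟩ := exists_expTransform_decay hψ hψc B 3
  have hcos : 0 < Real.cos c := cos_pos_of_strip hθ hc hB (z := 0) (by simpa using hB0)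
  refine ⟨D * (1 / Real.cos c), by positivity, fun z hz u => ?_⟩
  have h1 := norm_tan_le hθ hc hB hz
  have h2 := hD z hz
  have e : sideMode ψ θ z u = z * expTransform ψ z
      * (Complex.sin (z * θ) / Complex.cos (z * θ)) * Complex.exp (-z * u) := by
    rw [sideMode]; ring
  rw [e, norm_mul, norm_mul, norm_mul, norm_exp_mul_ofReal, Complex.neg_re]
  calc _ = ((1 + ‖z‖) ^ 2 * (‖z‖ * ‖expTransform ψ z‖))
        * ‖Complex.sin (z * θ) / Complex.cos (z * θ)‖ * Real.exp (-z.re * u) := by ring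
    _ ≤ ((1 + ‖z‖) ^ 2 * ((1 + ‖z‖) * ‖expTransform ψ z‖)) * (1 / Real.cos c)
        * Real.exp (-z.re * u) := by
        gcongr
        · linarith
        · exact h1.trans (by gcongr; exact min_le_left _ _)
    _ = ((1 + ‖z‖) ^ 3 * ‖expTransform ψ z‖) * (1 / Real.cos c) * Real.exp (-z.re * u) := by
        ring
    _ ≤ _ := by gcongr

theorem continuous_stripMode (hψ : ContDiff ℝ ∞ ψ) (hψc : HasCompactSupport ψ) (hθ : 0 < θ)
    (hc : c < Real.pi / 2) (hB : B * θ ≤ c) (hβ : |β| ≤ B) (j : ℕ) :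
    Continuous fun p : ℝ × ℝ × ℝ => stripMode ψ θ j (linePt β p.1) p.2.1 p.2.2 := by
  have h1 := continuous_linePt β
  have h2 := (differentiable_expTransform hψ.continuous hψc).continuous
  unfold stripMode
  refine Continuous.mul (Continuous.div (by fun_prop) (by fun_prop) fun p => ?_) (by fun_prop)
  exact cos_ne_zero_strip hθ hc hB (by simpa using hβ)

theorem continuous_sideMode (hψ : ContDiff ℝ ∞ ψ) (hψc : HasCompactSupport ψ) (hθ : 0 < θ)
    (hc : c < Real.pi / 2) (hB : B * θ ≤ c) (hβ : |β| ≤ B) :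
    Continuous fun p : ℝ × ℝ => sideMode ψ θ (linePt β p.1) p.2 := by
  have h1 := continuous_linePt β
  have h2 := (differentiable_expTransform hψ.continuous hψc).continuous
  unfold sideMode
  refine Continuous.mul (Continuous.div (by fun_prop) (by fun_prop) fun p => ?_) (by fun_prop)
  exact cos_ne_zero_strip hθ hc hB (by simpa using hβ)

/-- Two-sided exponential decay of the superposition, by shifting the contour. -/
theorem exists_stripKernel_bound (hψ : ContDiff ℝ ∞ ψ) (hψc : HasCompactSupport ψ) (hθ : 0 < θ)
    (hc : c < Real.pi / 2) (hB : B * θ ≤ c) (hB1 : 1 ≤ B) (hβ : |β| ≤ B) (j : ℕ) :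
    ∃ D : ℝ, 0 ≤ D ∧ ∀ φ ∈ Icc 0 θ, ∀ u, ‖stripKernel ψ θ j β u φ‖ ≤ D * Real.exp (-|u|) := by
  obtain ⟨D, hD0, hD⟩ := exists_stripMode_bound hψ hψc hθ hc hB j
  refine ⟨D * Real.pi, by positivity, fun φ hφ u => ?_⟩
  have hbd : ∀ z : ℂ, |z.re| ≤ B → (1 + z.im ^ 2) * ‖stripMode ψ θ j z u φ‖
      ≤ D * Real.exp (B * |u|) := by
    intro z hz
    have h1 : 1 + z.im ^ 2 ≤ (1 + ‖z‖) ^ 2 := by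
      have := Complex.abs_im_le_norm z
      nlinarith [abs_nonneg z.im, sq_abs z.im]
    calc _ ≤ (1 + ‖z‖) ^ 2 * ‖stripMode ψ θ j z u φ‖ := by gcongr
      _ ≤ D * Real.exp (-z.re * u) := hD z hz φ hφ u
      _ ≤ _ := by
        refine mul_le_mul_of_nonneg_left (Real.exp_le_exp.2 ?_) hD0
        calc -z.re * u ≤ |-z.re * u| := le_abs_self _
          _ = |z.re| * |u| := by rw [abs_mul, abs_neg]
          _ ≤ _ := by gcongr
  have hdiff : DifferentiableOn ℂ (fun z => stripMode ψ θ j z u φ) {z | |z.re| ≤ B} := by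
    have h2 := differentiable_expTransform hψ.continuous hψc
    unfold stripMode
    refine DifferentiableOn.mul (DifferentiableOn.div (by fun_prop) (by fun_prop) fun z hz => ?_)
      (by fun_prop)
    exact cos_ne_zero_strip hθ hc hB hz
  -- The contour goes to Re z = 1 for u ≥ 0 and to Re z = -1 for u ≤ 0; both lie in the strip
  -- because B ≥ 1.
  obtain ⟨γ, hγ1, hγ⟩ : ∃ γ : ℝ, |γ| ≤ B ∧ -γ * u = -|u| := by
    rcases le_total 0 u with h | h
    · exact ⟨1, by simpa using hB1, by rw [abs_of_nonneg h]; ring⟩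
    · exact ⟨-1, by simpa using hB1, by rw [abs_of_nonpos h]; ring⟩
  rw [stripKernel, integral_linePt_eq (F := fun z => stripMode ψ θ j z u φ) hdiff hbd hβ hγ1]
  calc _ ≤ ∫ ξ : ℝ, D * Real.exp (-|u|) * (1 + ξ ^ 2)⁻¹ := by
        refine norm_integral_le_of_norm_le (integrable_inv_one_add_sq.const_mul _)
          (.of_forall fun ξ => ?_)
        have h1 := hD (linePt γ ξ) (by simpa using hγ1) φ hφ u
        rw [linePt_re, hγ] at h1
        have : 0 < 1 + ξ ^ 2 := by positivity
        rw [← div_eq_mul_inv, le_div_iff₀ this, mul_comm]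
        exact le_trans (by gcongr; exact one_add_sq_le_of_linePt γ ξ) h1
    _ = _ := by rw [integral_const_mul, integral_univ_inv_one_add_sq]; ring

end

/-- The superposition of `sideMode` over a vertical line. -/
def sideKernel (ψ : ℝ → ℝ) (θ β u : ℝ) : ℂ := ∫ ξ, sideMode ψ θ (linePt β ξ) u

theorem integral_line_swap {X : Type*} [MeasurableSpace X] {ν : Measure X} [SFinite ν] {a : X → ℂ}
    (ha : Integrable a ν) {k : ℝ → X → ℂ} {C : ℝ}
    (hk : AEStronglyMeasurable (fun p : ℝ × X => k p.1 p.2) (volume.prod ν))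
    (hC : ∀ᵐ x ∂ν, ∀ ξ, (1 + ξ ^ 2) * ‖k ξ x‖ ≤ C) :
    ∫ ξ : ℝ, (∫ x, a x * k ξ x ∂ν) = ∫ x, a x * (∫ ξ : ℝ, k ξ x) ∂ν := by
  rw [integral_integral_swap (integrable_line_prod ha hk hC)]
  congr 1; funext x
  rw [integral_const_mul]

theorem integral_add_add_sub {a b c d : ℝ → ℂ} (ha : Integrable a) (hb : Integrable b)
    (hc : Integrable c) (hd : Integrable d) :
    ∫ x, (a x + b x + (c x - 2 * d x))
      = (∫ x, a x) + (∫ x, b x) + ((∫ x, c x) - 2 * ∫ x, d x) := by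
  rw [← integral_const_mul, ← integral_sub hc (hd.const_mul 2), ← integral_add ha hb]
  exact integral_add (ha.add hb) (hc.sub (hd.const_mul 2))

section
variable {ψ : ℝ → ℝ} {c θ B β : ℝ} {U Uu Uφ Uuu Uφφ : ℝ → ℝ → ℝ}

theorem one_add_sq_mul_norm_stripMode_le {D : ℝ} (hD0 : 0 ≤ D) {j : ℕ}
    (hD : ∀ z : ℂ, |z.re| ≤ B → ∀ φ ∈ Icc 0 θ, ∀ u,
      (1 + ‖z‖) ^ 2 * ‖stripMode ψ θ j z u φ‖ ≤ D * Real.exp (-z.re * u)) (hβ : |β| ≤ B)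
    {φ M u : ℝ} (hφ : φ ∈ Icc 0 θ) (hu : u ∈ Icc (-M) M) (ξ : ℝ) :
    (1 + ξ ^ 2) * ‖stripMode ψ θ j (linePt β ξ) u φ‖ ≤ D * Real.exp (|β| * M) := by
  have h1 := hD (linePt β ξ) (by simpa using hβ) φ hφ u
  rw [linePt_re] at h1
  calc _ ≤ (1 + ‖linePt β ξ‖) ^ 2 * ‖stripMode ψ θ j (linePt β ξ) u φ‖ := by
        gcongr; exact one_add_sq_le_of_linePt β ξ
    _ ≤ _ := h1
    _ ≤ _ := by
        refine mul_le_mul_of_nonneg_left (Real.exp_le_exp.2 ?_) hD0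
        calc -β * u ≤ |-β * u| := le_abs_self _
          _ = |β| * |u| := by rw [abs_mul, abs_neg]
          _ ≤ |β| * M := by
            exact mul_le_mul_of_nonneg_left (abs_le.2 hu) (abs_nonneg _)

theorem ae_box {θ M : ℝ} : ∀ᵐ p : ℝ × ℝ ∂((volume.restrict (Icc (-M) M)).prod
    (volume.restrict (Ioo 0 θ))), p.1 ∈ Icc (-M) M ∧ p.2 ∈ Ioo 0 θ := by
  rw [Measure.prod_restrict]
  exact ae_restrict_mem (measurableSet_Icc.prod measurableSet_Ioo)

/-- `green_exp` is multiplied by the coefficient of the mode and integrated along the line; the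
truncation χ reduces everything to a compact box, where Fubini applies. The kernel with index 0 is
harmonic, that with index 1 is minus its derivative in u, and `sideKernel` is minus its normal
derivative at φ = θ. The last two integrals are what χ leaves over. -/
theorem IsStripC2.green_kernel (hS : IsStripC2 θ U Uu Uφ Uuu Uφφ) (hψ : ContDiff ℝ ∞ ψ)
    (hψc : HasCompactSupport ψ) (hθ : 0 < θ) (hc : c < Real.pi / 2) (hB : B * θ ≤ c)
    (hβ : |β| ≤ B) {M : ℝ} (hM : 0 ≤ M)
    {χ χ' χ'' : ℝ → ℝ} (hχ : ∀ u, HasDerivAt χ (χ' u) u) (hχ' : ∀ u, HasDerivAt χ' (χ'' u) u)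
    (hχ'' : Continuous χ'') (h0 : ∀ u, M ≤ |u| → χ u = 0 ∧ χ' u = 0 ∧ χ'' u = 0) :
    ∫ p, ((χ p.1 * (Uuu p.1 p.2 + Uφφ p.1 p.2) : ℝ) : ℂ) * stripKernel ψ θ 0 β p.1 p.2
        ∂((volume : Measure ℝ).prod (volume.restrict (Ioo 0 θ)))
      = (∫ u, ((χ u * Uφ u θ : ℝ) : ℂ) * ψ u)
      + (∫ u, ((χ u * U u θ : ℝ) : ℂ) * sideKernel ψ θ β u)
      + ((∫ p, ((χ'' p.1 * U p.1 p.2 : ℝ) : ℂ) * stripKernel ψ θ 0 β p.1 p.2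
        ∂((volume : Measure ℝ).prod (volume.restrict (Ioo 0 θ))))
      - 2 * ∫ p, ((χ' p.1 * U p.1 p.2 : ℝ) : ℂ) * stripKernel ψ θ 1 β p.1 p.2
        ∂((volume : Measure ℝ).prod (volume.restrict (Ioo 0 θ)))) := by
  have cχ : Continuous χ := continuous_iff_continuousAt.2 fun u => (hχ u).continuousAt
  have cχ' : Continuous χ' := continuous_iff_continuousAt.2 fun u => (hχ' u).continuousAt
  set ν := (volume.restrict (Icc (-M) M)).prod (volume.restrict (Ioo 0 θ)) with hν
  have hθm : θ ∈ Icc 0 θ := ⟨hθ.le, le_rfl⟩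
  have hcos : ∀ ξ, Complex.cos (linePt β ξ * θ) ≠ 0 := fun ξ =>
    cos_ne_zero_strip hθ hc hB (by simpa using hβ)
  obtain ⟨D0, hD00, hD0⟩ := exists_stripMode_bound hψ hψc hθ hc hB 0
  obtain ⟨D1, hD10, hD1⟩ := exists_stripMode_bound hψ hψc hθ hc hB 1
  obtain ⟨D2, hD20, hD2⟩ := exists_sideMode_bound hψ hψc hθ hc hB
  have hJ : ∀ {A : ℝ → ℝ → ℝ} {w : ℝ → ℝ},
      ContinuousOn (fun p : ℝ × ℝ => A p.1 p.2) (univ ×ˢ Icc 0 θ) → Continuous w →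
      Integrable (fun p : ℝ × ℝ => ((w p.1 * A p.1 p.2 : ℝ) : ℂ)) ν := fun hA hw =>
    integrable_box (Complex.continuous_ofReal.comp_continuousOn
      ((hw.comp continuous_fst).continuousOn.mul hA))
  have hkm : ∀ j, AEStronglyMeasurable (fun p : ℝ × ℝ × ℝ =>
      stripMode ψ θ j (linePt β p.1) p.2.1 p.2.2) (volume.prod ν) := fun j =>
    (continuous_stripMode hψ hψc hθ hc hB hβ j).aestronglyMeasurable
  have hk0 : ∀ᵐ p ∂ν, ∀ ξ, (1 + ξ ^ 2) * ‖stripMode ψ θ 0 (linePt β ξ) p.1 p.2‖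
      ≤ D0 * Real.exp (|β| * M) := ae_box.mono fun p hp ξ =>
    one_add_sq_mul_norm_stripMode_le hD00 hD0 hβ (Ioo_subset_Icc_self hp.2) hp.1 ξ
  have hk1 : ∀ᵐ p ∂ν, ∀ ξ, (1 + ξ ^ 2) * ‖stripMode ψ θ 1 (linePt β ξ) p.1 p.2‖
      ≤ D1 * Real.exp (|β| * M) := ae_box.mono fun p hp ξ =>
    one_add_sq_mul_norm_stripMode_le hD10 hD1 hβ (Ioo_subset_Icc_self hp.2) hp.1 ξ
  have hkN : ∀ᵐ u ∂(volume.restrict (Icc (-M) M)), ∀ ξ,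
      (1 + ξ ^ 2) * ‖stripMode ψ θ 0 (linePt β ξ) u θ‖ ≤ D0 * Real.exp (|β| * M) :=
    (ae_restrict_mem measurableSet_Icc).mono fun u hu ξ =>
      one_add_sq_mul_norm_stripMode_le hD00 hD0 hβ hθm hu ξ
  have hkD : ∀ᵐ u ∂(volume.restrict (Icc (-M) M)), ∀ ξ,
      (1 + ξ ^ 2) * ‖sideMode ψ θ (linePt β ξ) u‖ ≤ D2 * Real.exp (|β| * M) := by
    refine (ae_restrict_mem measurableSet_Icc).mono fun u hu ξ => ?_
    have h1 := hD2 (linePt β ξ) (by simpa using hβ) u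
    rw [linePt_re] at h1
    calc _ ≤ (1 + ‖linePt β ξ‖) ^ 2 * ‖sideMode ψ θ (linePt β ξ) u‖ := by
          gcongr; exact one_add_sq_le_of_linePt β ξ
      _ ≤ _ := h1
      _ ≤ _ := by
          refine mul_le_mul_of_nonneg_left (Real.exp_le_exp.2 ?_) hD20
          calc -β * u ≤ |-β * u| := le_abs_self _
            _ = |β| * |u| := by rw [abs_mul, abs_neg]
            _ ≤ |β| * M := mul_le_mul_of_nonneg_left (abs_le.2 hu) (abs_nonneg _)
  have hmN : AEStronglyMeasurable (fun p : ℝ × ℝ => stripMode ψ θ 0 (linePt β p.1) p.2 θ)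
      (volume.prod (volume.restrict (Icc (-M) M))) :=
    ((continuous_stripMode hψ hψc hθ hc hB hβ 0).comp
      (by fun_prop : Continuous fun p : ℝ × ℝ => (p.1, p.2, θ))).aestronglyMeasurable
  have hmD : AEStronglyMeasurable (fun p : ℝ × ℝ => sideMode ψ θ (linePt β p.1) p.2)
      (volume.prod (volume.restrict (Icc (-M) M))) :=
    (continuous_sideMode hψ hψc hθ hc hB hβ).aestronglyMeasurable
  have aN : Integrable (fun u => ((χ u * Uφ u θ : ℝ) : ℂ)) (volume.restrict (Icc (-M) M)) := by
    have := hS.cont_φ.slice_right hθm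
    exact Continuous.integrableOn_Icc (by fun_prop)
  have aD : Integrable (fun u => ((χ u * U u θ : ℝ) : ℂ)) (volume.restrict (Icc (-M) M)) := by
    have := hS.cont.slice_right hθm
    exact Continuous.integrableOn_Icc (by fun_prop)
  have ah : Integrable (fun p : ℝ × ℝ => ((χ p.1 * (Uuu p.1 p.2 + Uφφ p.1 p.2) : ℝ) : ℂ)) ν :=
    hJ (A := fun u φ => Uuu u φ + Uφφ u φ) (hS.cont_uu.add hS.cont_φφ) cχ
  have a2 := hJ hS.cont hχ''
  have a1 := hJ hS.cont cχ'
  -- the identity on the line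
  have key : ∀ ξ, ∫ p, ((χ p.1 * (Uuu p.1 p.2 + Uφφ p.1 p.2) : ℝ) : ℂ)
        * stripMode ψ θ 0 (linePt β ξ) p.1 p.2 ∂ν
      = (∫ u in Icc (-M) M, ((χ u * Uφ u θ : ℝ) : ℂ) * stripMode ψ θ 0 (linePt β ξ) u θ)
      + (∫ u in Icc (-M) M, ((χ u * U u θ : ℝ) : ℂ) * sideMode ψ θ (linePt β ξ) u)
      + ((∫ p, ((χ'' p.1 * U p.1 p.2 : ℝ) : ℂ) * stripMode ψ θ 0 (linePt β ξ) p.1 p.2 ∂ν)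
      - 2 * ∫ p, ((χ' p.1 * U p.1 p.2 : ℝ) : ℂ) * stripMode ψ θ 1 (linePt β ξ) p.1 p.2 ∂ν) := by
    intro ξ
    have h := hS.green_exp hθ hM hχ hχ' hχ'' (fun u hu => ⟨(h0 u hu).1, (h0 u hu).2.1⟩) (linePt β ξ)
    set z := linePt β ξ
    set r := expTransform ψ z / Complex.cos (z * θ) with hr
    have e0 : ∀ u φ, stripMode ψ θ 0 z u φ = r * (Complex.exp (-z * u) * Complex.cos (z * φ)) :=
      fun u φ => by rw [stripMode, hr]; ring
    have e1 : ∀ u φ, stripMode ψ θ 1 z u φ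
        = r * (Complex.exp (-z * u) * (z * Complex.cos (z * φ))) :=
      fun u φ => by rw [stripMode, hr]; ring
    have e2 : ∀ u, sideMode ψ θ z u = r * (Complex.exp (-z * u) * (z * Complex.sin (z * θ))) :=
      fun u => by rw [sideMode, hr]; ring
    simp_rw [e0, e1, e2, mul_left_comm _ r]
    rw [integral_const_mul, integral_const_mul, integral_const_mul, integral_const_mul,
      integral_const_mul, h]
    ring
  have iN := (integrable_line_prod aN hmN hkN).integral_prod_left
  have iD := (integrable_line_prod aD hmD hkD).integral_prod_left
  have i2 := (integrable_line_prod a2 (hkm 0) hk0).integral_prod_left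
  have i1 := (integrable_line_prod a1 (hkm 1) hk1).integral_prod_left
  have tot := congrArg (fun f : ℝ → ℂ => ∫ ξ, f ξ) (funext key)
  rw [integral_add_add_sub iN iD i2 i1, integral_line_swap aN hmN hkN,
    integral_line_swap aD hmD hkD, integral_line_swap a2 (hkm 0) hk0,
    integral_line_swap a1 (hkm 1) hk1, integral_line_swap ah (hkm 0) hk0] at tot
  -- At φ = θ the cosines cancel and Laplace inversion returns the test function itself.
  have hN : ∀ u, ∫ ξ, stripMode ψ θ 0 (linePt β ξ) u θ = ψ u := by
    intro u
    rw [← integral_expTransform_mul_exp hψ hψc β u]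
    congr 1; ext ξ
    have := hcos ξ
    rw [stripMode]; field_simp
  simp_rw [hN] at tot
  rw [integral_restrict_Icc fun u hu => by simp [(h0 u hu.le).1],
    integral_restrict_Icc fun u hu => by simp [(h0 u hu.le).1]] at tot
  rw [hν, integral_restrict_fst fun u hu => by simp [(h0 u.1 hu.le).1],
    integral_restrict_fst fun u hu => by simp [(h0 u.1 hu.le).2.2],
    integral_restrict_fst fun u hu => by simp [(h0 u.1 hu.le).2.1]] at tot
  exact tot

end

theorem memLp_inv_one_add_sq (D : ℝ) : MemLp (fun ξ : ℝ => D * (1 + ξ ^ 2)⁻¹) 2 volume := by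
  rw [memLp_two_iff_integrable_sq (by fun_prop)]
  refine (integrable_inv_one_add_sq.const_mul (D ^ 2)).mono' (by fun_prop) (.of_forall fun ξ => ?_)
  rw [Real.norm_of_nonneg (by positivity), mul_pow]
  gcongr
  exact pow_le_of_le_one (by positivity) (inv_le_one_of_one_le₀ (by nlinarith [sq_nonneg ξ])) two_ne_zero

theorem tendsto_integral_weight_mul {X : Type*} [MeasurableSpace X] {ν : Measure X} {f : X → ℂ}
    (hf : Integrable f ν) {w : ℕ → X → ℝ} {v : X → ℝ} {C : ℝ} (hw : ∀ n, AEStronglyMeasurable (w n) ν)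
    (hC : ∀ n x, |w n x| ≤ C) (hv : ∀ x, Filter.Tendsto (fun n => w n x) Filter.atTop (nhds (v x))) :
    Filter.Tendsto (fun n => ∫ x, (w n x : ℂ) * f x ∂ν) Filter.atTop
      (nhds (∫ x, (v x : ℂ) * f x ∂ν)) := by
  refine tendsto_integral_of_dominated_convergence (fun x => C * ‖f x‖) (fun n => ?_)
    (hf.norm.const_mul C) (fun n => .of_forall fun x => ?_) (.of_forall fun x => ?_)
  · exact (Complex.continuous_ofReal.comp_aestronglyMeasurable (hw n)).mul hf.1
  · rw [norm_mul, Complex.norm_real]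
    gcongr
    exact hC n x
  · exact ((Complex.continuous_ofReal.tendsto _).comp (hv x)).mul_const _

section
variable {ψ : ℝ → ℝ} {c θ B β : ℝ} {U Uu Uφ Uuu Uφφ : ℝ → ℝ → ℝ}

theorem stripMode_eq_mul (j : ℕ) (z : ℂ) (u φ : ℝ) :
    stripMode ψ θ j z u φ = stripMode ψ θ j z 0 φ * Complex.exp (-z * u) := by
  simp only [stripMode, Complex.ofReal_zero, mul_zero, Complex.exp_zero]; ring

theorem sideMode_eq_mul (z : ℂ) (u : ℝ) :
    sideMode ψ θ z u = sideMode ψ θ z 0 * Complex.exp (-z * u) := by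
  simp only [sideMode, Complex.ofReal_zero, mul_zero, Complex.exp_zero]; ring

/-- An absolutely convergent superposition of exponentials over the line is, up to the weight
e^{βu}, an ordinary Fourier integral. This lets the kernels enter `IsFT.pairing`. -/
theorem isFT_line {τ : ℝ → ℂ} (hτ : Continuous τ) {D : ℝ} (hD : ∀ ξ, (1 + ξ ^ 2) * ‖τ ξ‖ ≤ D)
    (β : ℝ) :
    IsFT τ (fun u => (Real.exp (β * u) : ℂ) * ∫ ξ, τ ξ * Complex.exp (-linePt β ξ * u)) := by
  have hle : ∀ ξ, ‖τ ξ‖ ≤ D * (1 + ξ ^ 2)⁻¹ := fun ξ => by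
    have : 0 < 1 + ξ ^ 2 := by positivity
    rw [← div_eq_mul_inv, le_div_iff₀ this, mul_comm]; exact hD ξ
  have h2 : MemLp τ 2 volume := (memLp_inv_one_add_sq D).mono' hτ.aestronglyMeasurable (.of_forall hle)
  refine (isFT_of_integrable (integrable_of_norm_mul_le hτ.aestronglyMeasurable hD) h2).congr .rfl
    (.of_forall fun u => ?_)
  simp only
  rw [fourier_real_eq', ← integral_const_mul]
  congr 1; ext ξ
  rw [Complex.ofReal_exp, mul_left_comm, ← Complex.exp_add, linePt]
  congr 2; push_cast; ring

theorem continuous_stripMode_right (hψ : ContDiff ℝ ∞ ψ) (hψc : HasCompactSupport ψ) (hθ : 0 < θ)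
    (hc : c < Real.pi / 2) (hB : B * θ ≤ c) (hβ : |β| ≤ B) (j : ℕ) (u : ℝ) :
    Continuous fun p : ℝ × ℝ => stripMode ψ θ j (linePt β p.1) u p.2 := by
  have h := (continuous_stripMode hψ hψc hθ hc hB hβ j).comp (by fun_prop : Continuous fun p : ℝ × ℝ => (p.1, u, p.2))
  simp only [Function.comp_def] at h
  exact h

theorem continuous_stripMode_left (hψ : ContDiff ℝ ∞ ψ) (hψc : HasCompactSupport ψ) (hθ : 0 < θ)
    (hc : c < Real.pi / 2) (hB : B * θ ≤ c) (hβ : |β| ≤ B) (j : ℕ) (u φ : ℝ) :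
    Continuous fun ξ : ℝ => stripMode ψ θ j (linePt β ξ) u φ := by
  have h := (continuous_stripMode hψ hψc hθ hc hB hβ j).comp (by fun_prop : Continuous fun ξ : ℝ => (ξ, u, φ))
  simp only [Function.comp_def] at h
  exact h

theorem continuous_sideMode_left (hψ : ContDiff ℝ ∞ ψ) (hψc : HasCompactSupport ψ) (hθ : 0 < θ)
    (hc : c < Real.pi / 2) (hB : B * θ ≤ c) (hβ : |β| ≤ B) (u : ℝ) :
    Continuous fun ξ : ℝ => sideMode ψ θ (linePt β ξ) u := by
  have h := (continuous_sideMode hψ hψc hθ hc hB hβ).comp (by fun_prop : Continuous fun ξ : ℝ => (ξ, u))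
  simp only [Function.comp_def] at h
  exact h

theorem isFT_stripMode (hψ : ContDiff ℝ ∞ ψ) (hψc : HasCompactSupport ψ) (hθ : 0 < θ)
    (hc : c < Real.pi / 2) (hB : B * θ ≤ c) (hβ : |β| ≤ B) {φ : ℝ} (hφ : φ ∈ Icc 0 θ) :
    IsFT (fun ξ => stripMode ψ θ 0 (linePt β ξ) 0 φ)
      (fun u => (Real.exp (β * u) : ℂ) * stripKernel ψ θ 0 β u φ) := by
  obtain ⟨D0, hD00, hD0⟩ := exists_stripMode_bound hψ hψc hθ hc hB 0
  have hcont : Continuous fun ξ => stripMode ψ θ 0 (linePt β ξ) 0 φ :=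
    continuous_stripMode_left hψ hψc hθ hc hB hβ 0 0 φ
  have hbd : ∀ ξ, (1 + ξ ^ 2) * ‖stripMode ψ θ 0 (linePt β ξ) 0 φ‖ ≤ D0 := fun ξ => by
    have := one_add_sq_mul_norm_stripMode_le hD00 hD0 hβ (M := 0) (u := 0) hφ (by simp) ξ
    rwa [mul_zero, Real.exp_zero, mul_one] at this
  have h1 := isFT_line hcont hbd β
  have h2 : ∀ u : ℝ, ∫ ξ, stripMode ψ θ 0 (linePt β ξ) 0 φ * Complex.exp (-linePt β ξ * u)
      = stripKernel ψ θ 0 β u φ := fun u => by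
    rw [stripKernel]
    exact integral_congr_ae (.of_forall fun ξ => (stripMode_eq_mul 0 (linePt β ξ) u φ).symm)
  simp_rw [h2] at h1
  exact h1

theorem isFT_sideMode (hψ : ContDiff ℝ ∞ ψ) (hψc : HasCompactSupport ψ) (hθ : 0 < θ)
    (hc : c < Real.pi / 2) (hB : B * θ ≤ c) (hβ : |β| ≤ B) :
    IsFT (fun ξ => sideMode ψ θ (linePt β ξ) 0)
      (fun u => (Real.exp (β * u) : ℂ) * sideKernel ψ θ β u) := by
  obtain ⟨D0, hD00, hD0⟩ := exists_sideMode_bound hψ hψc hθ hc hB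
  have hcont : Continuous fun ξ => sideMode ψ θ (linePt β ξ) 0 :=
    continuous_sideMode_left hψ hψc hθ hc hB hβ 0
  have hbd : ∀ ξ, (1 + ξ ^ 2) * ‖sideMode ψ θ (linePt β ξ) 0‖ ≤ D0 := fun ξ => by
    have := hD0 (linePt β ξ) (by simpa using hβ) 0
    rw [mul_zero, Real.exp_zero, mul_one] at this
    exact le_trans (by gcongr; exact one_add_sq_le_of_linePt β ξ) this
  have h1 := isFT_line hcont hbd β
  have h2 : ∀ u : ℝ, ∫ ξ, sideMode ψ θ (linePt β ξ) 0 * Complex.exp (-linePt β ξ * u)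
      = sideKernel ψ θ β u := fun u => by
    rw [sideKernel]
    exact integral_congr_ae (.of_forall fun ξ => (sideMode_eq_mul (linePt β ξ) u).symm)
  simp_rw [h2] at h1
  exact h1

theorem stronglyMeasurable_stripKernel (hψ : ContDiff ℝ ∞ ψ) (hψc : HasCompactSupport ψ) (hθ : 0 < θ)
    (hc : c < Real.pi / 2) (hB : B * θ ≤ c) (hβ : |β| ≤ B) (j : ℕ) :
    StronglyMeasurable fun p : ℝ × ℝ => stripKernel ψ θ j β p.1 p.2 := by
  have h := ((continuous_stripMode hψ hψc hθ hc hB hβ j).comp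
    (by fun_prop : Continuous fun q : (ℝ × ℝ) × ℝ => (q.2, q.1.1, q.1.2))).stronglyMeasurable
  exact h.integral_prod_right'

theorem aestronglyMeasurable_strip {A : ℝ → ℝ → ℝ}
    (hA : ContinuousOn (fun p : ℝ × ℝ => A p.1 p.2) (univ ×ˢ Icc 0 θ)) :
    AEStronglyMeasurable (fun p : ℝ × ℝ => (A p.1 p.2 : ℂ))
      ((volume : Measure ℝ).prod (volume.restrict (Ioo 0 θ))) := by
  have h1 : (volume : Measure ℝ).prod (volume.restrict (Ioo 0 θ))
      = ((volume : Measure ℝ).prod volume).restrict (univ ×ˢ Ioo 0 θ) := by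
    rw [← Measure.prod_restrict, Measure.restrict_univ]
  rw [h1]
  exact ((Complex.continuous_ofReal.comp_continuousOn hA).mono
    (prod_mono le_rfl Ioo_subset_Icc_self)).aestronglyMeasurable
      (MeasurableSet.univ.prod measurableSet_Ioo)

/-- The kernel decays like e^{-|u|}, and U times e^{-|u|} is integrable in u uniformly in φ. Neither
decay nor a transform of U on the line β is used. -/
theorem IsStripC2.integrable_mul_stripKernel (hS : IsStripC2 θ U Uu Uφ Uuu Uφφ)
    (hψ : ContDiff ℝ ∞ ψ) (hψc : HasCompactSupport ψ) (hθ : 0 < θ) (hc : c < Real.pi / 2)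
    (hB : B * θ ≤ c) (hB1 : 1 ≤ B) (hβ : |β| ≤ B) {A : ℝ≥0∞} (hA : A ≠ ⊤)
    (hU : ∀ φ ∈ Ioo 0 θ, ∫⁻ u, ENNReal.ofReal (|U u φ| * Real.exp (-|u|)) ≤ A) (j : ℕ) :
    Integrable (fun p : ℝ × ℝ => (U p.1 p.2 : ℂ) * stripKernel ψ θ j β p.1 p.2)
      ((volume : Measure ℝ).prod (volume.restrict (Ioo 0 θ))) := by
  obtain ⟨D, hD0, hD⟩ := exists_stripKernel_bound hψ hψc hθ hc hB hB1 hβ j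
  have hm : AEStronglyMeasurable (fun p : ℝ × ℝ => (U p.1 p.2 : ℂ) * stripKernel ψ θ j β p.1 p.2)
      ((volume : Measure ℝ).prod (volume.restrict (Ioo 0 θ))) :=
    (aestronglyMeasurable_strip hS.cont).mul
      (stronglyMeasurable_stripKernel hψ hψc hθ hc hB hβ j).aestronglyMeasurable
  refine ⟨hm, ?_⟩
  rw [hasFiniteIntegral_iff_enorm, lintegral_prod_symm _ hm.enorm]
  calc _ ≤ ∫⁻ _ in Ioo 0 θ, ENNReal.ofReal D * A := by
        refine setLIntegral_mono measurable_const fun φ hφ => ?_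
        calc _ ≤ ∫⁻ u, ENNReal.ofReal D * ENNReal.ofReal (|U u φ| * Real.exp (-|u|)) := by
              refine lintegral_mono fun u => ?_
              rw [← ENNReal.ofReal_mul hD0, ← ofReal_norm]
              apply ENNReal.ofReal_le_ofReal
              rw [norm_mul, Complex.norm_real, Real.norm_eq_abs, mul_left_comm]
              gcongr
              exact hD φ (Ioo_subset_Icc_self hφ) u
          _ ≤ _ := by
              rw [lintegral_const_mul' _ _ ENNReal.ofReal_ne_top]
              gcongr
              exact hU φ hφ
    _ < ⊤ := by
        rw [setLIntegral_const]
        exact ENNReal.mul_lt_top (ENNReal.mul_lt_top ENNReal.ofReal_lt_top hA.lt_top) (by simp)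

/-- Representation of the normal derivative on the side `φ = θ` of the strip. -/
theorem IsStripC2.isFT_normal_deriv (hS : IsStripC2 θ U Uu Uφ Uuu Uφφ) (hθ : 0 < θ)
    (hc : c < Real.pi / 2) (hB : B * θ ≤ c) (hB1 : 1 ≤ B) (hβ : |β| ≤ B) {A a : ℝ≥0∞} (hA : A ≠ ⊤)
    (hU : ∀ φ ∈ Ioo 0 θ, ∫⁻ u, ENNReal.ofReal (|U u φ| * Real.exp (-|u|)) ≤ A)
    {Dh : ℝ → ℂ} (hD : IsFT (expWeight β (fun u => U u θ)) Dh) {hh : ℝ → ℝ → ℂ} (ha : a ≠ ⊤)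
    (hm : AEStronglyMeasurable (fun p : ℝ × ℝ => hh p.1 p.2)
      ((volume : Measure ℝ).prod (volume.restrict (Ioo 0 θ))))
    (hha : ∀ φ ∈ Ioo 0 θ, eLpNorm (fun ξ => hh ξ φ) 2 volume ≤ a)
    (hh_ft : ∀ φ ∈ Ioo 0 θ,
      IsFT (expWeight β (fun u => Uuu u φ + Uφφ u φ)) (fun ξ => hh ξ φ))
    {T : ℝ → ℂ} (hT : MemLp T 2 volume)
    (hTeq : ∀ ξ, T ξ = -(linePt β ξ * (Complex.sin (linePt β ξ * θ) / Complex.cos (linePt β ξ * θ))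
        * Dh ξ) + ∫ φ in Ioo 0 θ,
          Complex.cos (linePt β ξ * φ) / Complex.cos (linePt β ξ * θ) * hh ξ φ) :
    IsFT (expWeight β (fun u => Uφ u θ)) T := by
  have hθm : θ ∈ Icc 0 θ := ⟨hθ.le, le_rfl⟩
  have cN := hS.cont_φ.slice_right hθm
  have cD := hS.cont.slice_right hθm
  refine isFT_of_integral_test (continuous_expWeight cN).locallyIntegrable hT fun ψ hψ hψc => ?_
  set P := (volume : Measure ℝ).prod (volume.restrict (Ioo 0 θ)) with hP
  obtain ⟨χ, χ', χ'', C, hC0, hχ, hχ', hχ'', bχ, bχ', bχ'', hχ1, hχ0⟩ := exists_smooth_truncation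
  have cχ : Continuous χ := continuous_iff_continuousAt.2 fun u => (hχ u).continuousAt
  have cχ' : Continuous χ' := continuous_iff_continuousAt.2 fun u => (hχ' u).continuousAt
  have hexp : ∀ u : ℝ, (Real.exp (-β * u) : ℂ) * (Real.exp (β * u) : ℂ) = 1 := fun u => by
    rw [← Complex.ofReal_mul, ← Real.exp_add]; simp
  -- integrability
  obtain ⟨D0, hD00, hD0⟩ := exists_stripMode_bound hψ hψc hθ hc hB 0
  have hK := fun {φ : ℝ} (hφ : φ ∈ Icc 0 θ) => isFT_stripMode hψ hψc hθ hc hB hβ hφ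
  have hτ : ∀ φ ∈ Ioo 0 θ, eLpNorm (fun ξ => stripMode ψ θ 0 (linePt β ξ) 0 φ) 2 volume
      ≤ eLpNorm (fun ξ : ℝ => D0 * (1 + ξ ^ 2)⁻¹) 2 volume := fun φ hφ => by
    refine eLpNorm_mono_real fun ξ => ?_
    have := one_add_sq_mul_norm_stripMode_le hD00 hD0 hβ (M := 0) (u := 0) (Ioo_subset_Icc_self hφ)
      (by simp) ξ
    rw [mul_zero, Real.exp_zero, mul_one] at this
    have h1 : 0 < 1 + ξ ^ 2 := by positivity
    rw [← div_eq_mul_inv, le_div_iff₀ h1, mul_comm]; exact this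
  have hb := (memLp_inv_one_add_sq D0).2.ne
  have hmh : AEStronglyMeasurable (fun p : ℝ × ℝ => ((Uuu p.1 p.2 + Uφφ p.1 p.2 : ℝ) : ℂ)) P :=
    aestronglyMeasurable_strip (A := fun u φ => Uuu u φ + Uφφ u φ) (hS.cont_uu.add hS.cont_φφ)
  have hmK := (stronglyMeasurable_stripKernel hψ hψc hθ hc hB hβ 0).aestronglyMeasurable (μ := P)
  have ih : Integrable (fun p : ℝ × ℝ => ((Uuu p.1 p.2 + Uφφ p.1 p.2 : ℝ) : ℂ)
      * stripKernel ψ θ 0 β p.1 p.2) P := by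
    have := integrable_mul_of_slices (θ := θ) ha hb
      (A := fun p => expWeight β (fun u => Uuu u p.2 + Uφφ u p.2) p.1)
      (K := fun p => (Real.exp (β * p.1) : ℂ) * stripKernel ψ θ 0 β p.1 p.2) ?_ ?_
      (fun φ hφ => ⟨(hh_ft φ hφ).memLp_left.1, ?_⟩) (fun φ hφ =>
        ⟨(hK (Ioo_subset_Icc_self hφ)).memLp_right.1, ?_⟩)
    · refine this.congr (.of_forall fun p => ?_)
      simp only [expWeight]
      rw [Complex.ofReal_mul]
      linear_combination (((Uuu p.1 p.2 + Uφφ p.1 p.2 : ℝ) : ℂ) * stripKernel ψ θ 0 β p.1 p.2)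
        * hexp p.1
    · simp only [expWeight, Complex.ofReal_mul]
      exact (by fun_prop : Continuous fun p : ℝ × ℝ =>
        (Real.exp (-β * p.1) : ℂ)).aestronglyMeasurable.mul hmh
    · exact (by fun_prop : Continuous fun p : ℝ × ℝ =>
        (Real.exp (β * p.1) : ℂ)).aestronglyMeasurable.mul hmK
    · rw [← (hh_ft φ hφ).eLpNorm_eq]; exact hha φ hφ
    · have := hτ φ hφ
      rwa [← (hK (Ioo_subset_Icc_self hφ)).eLpNorm_eq] at this
  have hSd := isFT_sideMode hψ hψc hθ hc hB hβ
  have iD : Integrable (fun u => (U u θ : ℂ) * sideKernel ψ θ β u) := by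
    refine (hD.memLp_left.integrable_mul hSd.memLp_right).congr (.of_forall fun u => ?_)
    simp only [expWeight, Pi.mul_apply]
    rw [Complex.ofReal_mul]
    linear_combination ((U u θ : ℂ) * sideKernel ψ θ β u) * hexp u
  have iN : Integrable (fun u => (Uφ u θ : ℂ) * (ψ u : ℂ)) := by
    have := hψ.continuous
    exact Continuous.integrable_of_hasCompactSupport (by fun_prop)
      ((hψc.comp_left (g := Complex.ofReal) rfl).mul_left)
  have i0 := hS.integrable_mul_stripKernel hψ hψc hθ hc hB hB1 hβ hA hU 0
  have i1 := hS.integrable_mul_stripKernel hψ hψc hθ hc hB hB1 hβ hA hU 1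
  -- truncated identities
  have hid : ∀ n : ℕ, ∫ p, ((χ (p.1 / (n + 1)) : ℝ) : ℂ) * (((Uuu p.1 p.2 + Uφφ p.1 p.2 : ℝ) : ℂ)
        * stripKernel ψ θ 0 β p.1 p.2) ∂P
      = (∫ u, ((χ (u / (n + 1)) : ℝ) : ℂ) * ((Uφ u θ : ℂ) * ψ u))
      + (∫ u, ((χ (u / (n + 1)) : ℝ) : ℂ) * ((U u θ : ℂ) * sideKernel ψ θ β u))
      + ((∫ p, ((χ'' (p.1 / (n + 1)) / (n + 1) / (n + 1) : ℝ) : ℂ) * ((U p.1 p.2 : ℂ)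
          * stripKernel ψ θ 0 β p.1 p.2) ∂P)
      - 2 * ∫ p, ((χ' (p.1 / (n + 1)) / (n + 1) : ℝ) : ℂ) * ((U p.1 p.2 : ℂ)
          * stripKernel ψ θ 1 β p.1 p.2) ∂P) := by
    intro n
    have hn : (0 : ℝ) < n + 1 := by positivity
    have hd : ∀ {f f' : ℝ → ℝ}, (∀ u, HasDerivAt f (f' u) u) → ∀ u : ℝ,
        HasDerivAt (fun u => f (u / (n + 1))) (f' (u / (n + 1)) / (n + 1)) u := fun hf u => by
      have := (hf (u / (n + 1))).comp u ((hasDerivAt_id u).div_const (n + 1 : ℝ))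
      rwa [mul_one_div] at this
    -- The function χ(u/(n+1)) vanishes for |u| ≥ 3(n+1). Each of its derivatives brings a factor
    -- 1/(n+1), which sends the two error terms to zero.
    have := hS.green_kernel hψ hψc hθ hc hB hβ (M := 3 * (n + 1)) (by positivity)
      (χ := fun u => χ (u / (n + 1))) (χ' := fun u => χ' (u / (n + 1)) / (n + 1))
      (χ'' := fun u => χ'' (u / (n + 1)) / (n + 1) / (n + 1)) (hd hχ)
      (fun u => (hd hχ' u).div_const _) (by fun_prop) (fun u hu => by
        have h3 : 3 ≤ |u / (n + 1)| := by
          rw [abs_div, abs_of_pos hn, le_div_iff₀ hn]; exact hu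
        obtain ⟨e1, e2, e3⟩ := hχ0 _ h3
        simp [e1, e2, e3])
    simp only [Complex.ofReal_mul, mul_assoc] at this ⊢
    exact this
  -- limits
  have hlim1 : ∀ u : ℝ, Filter.Tendsto (fun n : ℕ => χ (u / (n + 1))) Filter.atTop (nhds 1) := by
    intro u
    refine tendsto_const_nhds.congr' ?_
    filter_upwards [Filter.eventually_ge_atTop ⌈|u|⌉₊] with n hn
    have hn' : |u| ≤ n := (Nat.le_ceil _).trans (by exact_mod_cast hn)
    rw [hχ1]
    rw [abs_div, abs_of_pos (by positivity : (0 : ℝ) < n + 1), div_le_one (by positivity)]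
    linarith
  have hinv : Filter.Tendsto (fun n : ℕ => C * (1 / ((n : ℝ) + 1))) Filter.atTop (nhds 0) := by
    have := (tendsto_one_div_add_atTop_nhds_zero_nat (𝕜 := ℝ)).const_mul C
    rwa [mul_zero] at this
  have hb1 : ∀ (n : ℕ) (u : ℝ), |χ' (u / (n + 1)) / (n + 1)| ≤ C * (1 / ((n : ℝ) + 1)) := by
    intro n u
    rw [abs_div, abs_of_pos (by positivity : (0 : ℝ) < n + 1), mul_one_div]
    gcongr; exact bχ' _
  have hb2 : ∀ (n : ℕ) (u : ℝ), |χ'' (u / (n + 1)) / (n + 1) / (n + 1)| ≤ C * (1 / ((n : ℝ) + 1)) := by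
    intro n u
    rw [abs_div, abs_div, abs_of_pos (by positivity : (0 : ℝ) < n + 1), mul_one_div]
    refine (div_le_self (by positivity) (by linarith [(Nat.cast_nonneg n : (0 : ℝ) ≤ n)])).trans ?_
    gcongr; exact bχ'' _
  have hle : ∀ n : ℕ, C * (1 / ((n : ℝ) + 1)) ≤ C := fun n => by
    apply mul_le_of_le_one_right hC0
    rw [div_le_one (by positivity)]
    linarith [(Nat.cast_nonneg n : (0 : ℝ) ≤ n)]
  have hz : ∀ {w : ℕ → ℝ → ℝ}, (∀ n u, |w n u| ≤ C * (1 / ((n : ℝ) + 1))) → ∀ u,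
      Filter.Tendsto (fun n => w n u) Filter.atTop (nhds 0) := fun hw u =>
    squeeze_zero_norm (fun n => hw n u) hinv
  have L1 := tendsto_integral_weight_mul ih (w := fun n p => χ (p.1 / (n + 1))) (v := fun _ => 1)
    (fun n => (by fun_prop : Continuous fun p : ℝ × ℝ => χ (p.1 / (n + 1))).aestronglyMeasurable)
    (fun n p => bχ _) (fun p => hlim1 p.1)
  have L2 := tendsto_integral_weight_mul iN (w := fun n u => χ (u / (n + 1))) (v := fun _ => 1)
    (fun n => (by fun_prop : Continuous fun u : ℝ => χ (u / (n + 1))).aestronglyMeasurable)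
    (fun n p => bχ _) hlim1
  have L3 := tendsto_integral_weight_mul iD (w := fun n u => χ (u / (n + 1))) (v := fun _ => 1)
    (fun n => (by fun_prop : Continuous fun u : ℝ => χ (u / (n + 1))).aestronglyMeasurable)
    (fun n p => bχ _) hlim1
  have L4 := tendsto_integral_weight_mul i0 (w := fun n p => χ'' (p.1 / (n + 1)) / (n + 1) / (n + 1))
    (v := fun _ => 0) (fun n => (by fun_prop : Continuous fun p : ℝ × ℝ =>
      χ'' (p.1 / (n + 1)) / (n + 1) / (n + 1)).aestronglyMeasurable)
    (fun n p => (hb2 n p.1).trans (hle n)) (fun p => hz hb2 p.1)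
  have L5 := tendsto_integral_weight_mul i1 (w := fun n p => χ' (p.1 / (n + 1)) / (n + 1))
    (v := fun _ => 0) (fun n => (by fun_prop : Continuous fun p : ℝ × ℝ =>
      χ' (p.1 / (n + 1)) / (n + 1)).aestronglyMeasurable)
    (fun n p => (hb1 n p.1).trans (hle n)) (fun p => hz hb1 p.1)
  -- The limit is Green's identity on the whole strip: source against kernel equals ψ against the
  -- normal derivative plus the Dirichlet data against `sideKernel`.
  have main := tendsto_nhds_unique L1
    (((L2.add L3).add (L4.sub (L5.const_mul 2))).congr fun n => (hid n).symm)
  simp only [Complex.ofReal_one, one_mul, Complex.ofReal_zero, zero_mul, integral_zero, mul_zero,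
    sub_zero, add_zero] at main
  -- transfer to the line
  have eD : ∫ u, (U u θ : ℂ) * sideKernel ψ θ β u
      = ∫ ξ, Dh ξ * sideMode ψ θ (linePt β ξ) 0 := by
    rw [hD.pairing hSd]
    congr 1; ext u
    simp only [expWeight]
    rw [Complex.ofReal_mul]
    linear_combination (-((U u θ : ℂ) * sideKernel ψ θ β u)) * hexp u
  have iξ : Integrable (fun p : ℝ × ℝ => hh p.1 p.2 * stripMode ψ θ 0 (linePt β p.1) 0 p.2) P := by
    refine integrable_mul_of_slices (θ := θ) ha hb hm
      (continuous_stripMode_right hψ hψc hθ hc hB hβ 0 0).aestronglyMeasurable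
      (fun φ hφ => ⟨(hh_ft φ hφ).memLp_right.1, hha φ hφ⟩)
      (fun φ hφ => ⟨(hK (Ioo_subset_Icc_self hφ)).memLp_left.1, hτ φ hφ⟩)
  have eh : ∫ p, ((Uuu p.1 p.2 + Uφφ p.1 p.2 : ℝ) : ℂ) * stripKernel ψ θ 0 β p.1 p.2 ∂P
      = ∫ ξ, ∫ φ in Ioo 0 θ, hh ξ φ * stripMode ψ θ 0 (linePt β ξ) 0 φ := by
    rw [hP] at ih iξ ⊢
    rw [integral_prod_symm _ ih, ← integral_prod _ iξ, integral_prod_symm _ iξ]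
    refine setIntegral_congr_fun measurableSet_Ioo fun φ hφ => ?_
    simp only
    rw [(hh_ft φ hφ).pairing (hK (Ioo_subset_Icc_self hφ))]
    congr 1; ext u
    simp only [expWeight]
    rw [Complex.ofReal_mul]
    linear_combination (-(((Uuu u φ + Uφφ u φ : ℝ) : ℂ) * stripKernel ψ θ 0 β u φ)) * hexp u
  have e0 : ∫ u, ((ψ u * Uφ u θ : ℝ) : ℂ) = ∫ u, (Uφ u θ : ℂ) * (ψ u : ℂ) := by
    congr 1; ext u; push_cast; ring
  have iT1 : Integrable (fun ξ => Dh ξ * sideMode ψ θ (linePt β ξ) 0) :=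
    hD.memLp_right.integrable_mul hSd.memLp_left
  have iT2 : Integrable (fun ξ => ∫ φ in Ioo 0 θ, hh ξ φ * stripMode ψ θ 0 (linePt β ξ) 0 φ) :=
    iξ.integral_prod_left
  rw [e0, eq_sub_of_add_eq main.symm, eD, eh, ← integral_sub iT2 iT1]
  congr 1; ext ξ
  have hsm : ∀ φ, hh ξ φ * stripMode ψ θ 0 (linePt β ξ) 0 φ
      = Complex.cos (linePt β ξ * φ) / Complex.cos (linePt β ξ * θ) * hh ξ φ
        * expTransform ψ (linePt β ξ) := fun φ => by
    simp only [stripMode, Complex.ofReal_zero, mul_zero, Complex.exp_zero]; ring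
  simp only [hsm]
  rw [integral_mul_const, hTeq]
  simp only [sideMode, Complex.ofReal_zero, mul_zero, Complex.exp_zero]; ring

end

/-! ### Interpolation between vertical lines -/

/-- The weight `r^p min(r, 1/ε)^q`. -/
def powWeight (ε p q r : ℝ) : ℝ := r ^ p * min r (1 / ε) ^ q

theorem powWeight_mono {ε p q r s : ℝ} (hε : 0 < ε) (hp : 0 ≤ p) (hq : 0 ≤ q) (hr : 0 ≤ r)
    (hrs : r ≤ s) : powWeight ε p q r ≤ powWeight ε p q s := by
  have h1 : 0 ≤ min r (1 / ε) := le_min hr (by positivity)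
  have h2 : min r (1 / ε) ≤ min s (1 / ε) := min_le_min hrs le_rfl
  have h3 := Real.rpow_nonneg (hr.trans hrs) p
  unfold powWeight
  gcongr

theorem powWeight_nonneg {ε p q r : ℝ} (hε : 0 < ε) (hr : 0 ≤ r) : 0 ≤ powWeight ε p q r := by
  have h1 : 0 ≤ min r (1 / ε) := le_min hr (by positivity)
  unfold powWeight
  positivity

/-- The doubling property of the weight, with a constant that does not depend on ε. It is what
allows the weight to be treated as constant on dyadic shells. -/
theorem powWeight_mul_le {ε p q r a : ℝ} (hε : 0 < ε) (hq : 0 ≤ q) (hr : 0 ≤ r)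
    (ha : 1 ≤ a) : powWeight ε p q (a * r) ≤ a ^ (p + q) * powWeight ε p q r := by
  have ha0 : 0 < a := by linarith
  have h1 : 0 ≤ min r (1 / ε) := le_min hr (by positivity)
  have h1' : 0 ≤ min (a * r) (1 / ε) := le_min (by positivity) (by positivity)
  have h2 : min (a * r) (1 / ε) ≤ a * min r (1 / ε) := by
    rw [mul_min_of_nonneg _ _ ha0.le]
    refine min_le_min le_rfl (le_mul_of_one_le_left (by positivity) ha)
  unfold powWeight
  calc _ ≤ (a * r) ^ p * (a * min r (1 / ε)) ^ q := by gcongr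
    _ = _ := by
      rw [Real.mul_rpow ha0.le hr, Real.mul_rpow ha0.le h1, Real.rpow_add ha0]; ring

theorem sq_le_linePt_im_sq (β ξ : ℝ) : ξ ^ 2 ≤ (linePt β ξ).im ^ 2 := by
  rw [linePt_im, mul_pow]
  have : (1 : ℝ) ≤ (2 * Real.pi) ^ 2 := by nlinarith [Real.pi_gt_three]
  exact le_mul_of_one_le_left (sq_nonneg _) this

theorem abs_le_norm_linePt (β ξ : ℝ) : |β| ≤ ‖linePt β ξ‖ := by
  simpa using Complex.abs_re_le_norm (linePt β ξ)

/-- A holomorphic band-pass multiplier at frequency `1/s`. -/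
def bandPass (n : ℕ) (s : ℝ) (z : ℂ) : ℂ := (s * z) ^ n * Complex.exp ((s * z) ^ 2)

/-- Since Re z² = 2 (Re z)² - |z|², the multiplier is Gaussian in |z| on any strip of bounded width,
although it is entire. -/
theorem norm_bandPass (n : ℕ) {s : ℝ} (hs : 0 ≤ s) (z : ℂ) :
    ‖bandPass n s z‖ = (s * ‖z‖) ^ n * Real.exp (-(s * ‖z‖) ^ 2) * Real.exp (2 * (s * z.re) ^ 2) := by
  have h : ‖z‖ ^ 2 = z.re ^ 2 + z.im ^ 2 := by
    rw [← Complex.normSq_eq_norm_sq, Complex.normSq_apply]; ring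
  rw [bandPass, norm_mul, norm_pow, norm_mul, Complex.norm_real, Real.norm_of_nonneg hs,
    Complex.norm_exp, mul_assoc, ← Real.exp_add]
  congr 2
  have e : ((s : ℂ) * z) ^ 2 = ((s ^ 2 : ℝ) : ℂ) * (z * z) := by push_cast; ring
  rw [e, Complex.re_ofReal_mul, Complex.mul_re]
  have e' : (-(s * ‖z‖) ^ 2 : ℝ) = -(s ^ 2 * ‖z‖ ^ 2) := by ring
  rw [e', h]
  ring

theorem pow_mul_exp_neg_sq_le (m : ℕ) {X : ℝ} (hX : 0 ≤ X) :
    X ^ m * Real.exp (-X ^ 2) ≤ m.factorial * Real.exp 1 := by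
  have h1 : X ^ m ≤ m.factorial * Real.exp X := by
    have := Real.pow_div_factorial_le_exp X hX m
    rwa [div_le_iff₀' (by positivity)] at this
  calc _ ≤ m.factorial * Real.exp X * Real.exp (-X ^ 2) := by gcongr
    _ = m.factorial * Real.exp (X + -X ^ 2) := by rw [mul_assoc, ← Real.exp_add]
    _ ≤ _ := by
      gcongr
      nlinarith [sq_nonneg (X - 1)]

theorem exp_re_sq_le {s B : ℝ} {z : ℂ} (hz : |z.re| ≤ B) :
    Real.exp (2 * (s * z.re) ^ 2) ≤ Real.exp (2 * (s * B) ^ 2) := by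
  have : z.re ^ 2 ≤ B ^ 2 := sq_le_sq' (abs_le.1 hz).1 (abs_le.1 hz).2
  rw [Real.exp_le_exp, mul_pow, mul_pow]
  gcongr

theorem exists_bandPass_decay (n : ℕ) {s : ℝ} (hs : 0 < s) (B u : ℝ) :
    ∃ D, ∀ z : ℂ, |z.re| ≤ B →
      (1 + z.im ^ 2) * ‖bandPass n s z * Complex.exp (z * u)‖ ≤ D := by
  refine ⟨(n.factorial * Real.exp 1 + ((n + 2).factorial * Real.exp 1) / s ^ 2)
    * Real.exp (2 * (s * B) ^ 2) * Real.exp (B * |u|), fun z hz => ?_⟩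
  have h1 := pow_mul_exp_neg_sq_le n (X := s * ‖z‖) (by positivity)
  have h2 := pow_mul_exp_neg_sq_le (n + 2) (X := s * ‖z‖) (by positivity)
  have h3 : z.im ^ 2 ≤ ‖z‖ ^ 2 := by
    rw [← sq_abs z.im]; gcongr; exact Complex.abs_im_le_norm z
  have h4 : Real.exp (z.re * u) ≤ Real.exp (B * |u|) := by
    rw [Real.exp_le_exp]
    calc z.re * u ≤ |z.re * u| := le_abs_self _
      _ ≤ _ := by rw [abs_mul]; gcongr
  have h5 := exp_re_sq_le (s := s) hz
  rw [norm_mul, norm_exp_mul_ofReal, norm_bandPass n hs.le]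
  have h6 : (1 + z.im ^ 2) * ((s * ‖z‖) ^ n * Real.exp (-(s * ‖z‖) ^ 2))
      ≤ n.factorial * Real.exp 1 + ((n + 2).factorial * Real.exp 1) / s ^ 2 := by
    calc _ ≤ (1 + ‖z‖ ^ 2) * ((s * ‖z‖) ^ n * Real.exp (-(s * ‖z‖) ^ 2)) := by gcongr
      _ = (s * ‖z‖) ^ n * Real.exp (-(s * ‖z‖) ^ 2)
          + ((s * ‖z‖) ^ (n + 2) * Real.exp (-(s * ‖z‖) ^ 2)) / s ^ 2 := by
        field_simp; ring
      _ ≤ _ := by gcongr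
  calc _ = (1 + z.im ^ 2) * ((s * ‖z‖) ^ n * Real.exp (-(s * ‖z‖) ^ 2))
        * Real.exp (2 * (s * z.re) ^ 2) * Real.exp (z.re * u) := by ring
    _ ≤ _ := by gcongr

theorem differentiable_bandPass (n : ℕ) (s : ℝ) : Differentiable ℂ (bandPass n s) := by
  unfold bandPass; fun_prop

/-- The convolution of `v` with the inverse transform of `bandPass n s`. -/
def bandConv (n : ℕ) (s : ℝ) (v : ℝ → ℝ) (u : ℝ) : ℂ :=
  ∫ x, (v x : ℂ) * ∫ ξ, bandPass n s (linePt 0 ξ) * Complex.exp (linePt 0 ξ * (u - x : ℝ))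

/-- The multiplier is entire and decays in vertical strips, so the contour of its inverse transform
may be moved to Re z = 0. The localized function is therefore the same for every line on which v has
a transform. -/
theorem bandConv_eq {β : ℝ} {v : ℝ → ℝ} {h : ℝ → ℂ} (H : IsFT (expWeight β v) h) (n : ℕ) {s : ℝ}
    (hs : 0 < s) (u : ℝ) :
    ∫ ξ, h ξ * (bandPass n s (linePt β ξ) * Complex.exp (linePt β ξ * u)) = bandConv n s v u := by
  obtain ⟨D, hD⟩ := exists_bandPass_decay n hs |β| u
  have hc := continuous_linePt β
  have hb := (differentiable_bandPass n s).continuous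
  have hD' : ∀ ξ : ℝ, (1 + ξ ^ 2) *
      ‖bandPass n s (linePt β ξ) * Complex.exp (linePt β ξ * u)‖ ≤ D := fun ξ => by
    refine le_trans ?_ (hD (linePt β ξ) (by simp))
    exact mul_le_mul_of_nonneg_right (by linarith [sq_le_linePt_im_sq β ξ]) (norm_nonneg _)
  have hτ : Continuous fun ξ => bandPass n s (linePt β ξ) * Complex.exp (linePt β ξ * u) := by
    have := hb.comp hc
    simp only [Function.comp_def] at this
    fun_prop
  rw [H.pairing (isFT_line hτ hD' β), bandConv]
  congr 1; funext x
  obtain ⟨D', hD'⟩ := exists_bandPass_decay n hs |β| (u - x)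
  have e := integral_linePt_eq (F := fun z => bandPass n s z * Complex.exp (z * (u - x : ℝ)))
    (B := |β|) (Differentiable.differentiableOn (by
      have := differentiable_bandPass n s
      fun_prop)) (fun z hz => hD' z hz) (β := 0) (γ := β) (by simp) le_rfl
  rw [e, expWeight, ← mul_assoc, ← Complex.ofReal_mul]
  congr 1
  · congr 1
    rw [mul_right_comm, ← Real.exp_add]; simp
  · congr 1; funext ξ
    rw [mul_assoc, ← Complex.exp_add]
    congr 2; push_cast; ring

/-- Plancherel on the line β. All lines are now seen as weighted L² norms, with weights e^{-2βu}, of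
one and the same function. -/
theorem lintegral_bandPass {β : ℝ} {v : ℝ → ℝ} {h : ℝ → ℂ} (H : IsFT (expWeight β v) h) (n : ℕ)
    {s : ℝ} (hs : 0 < s) :
    ∫⁻ ξ, ‖bandPass n s (linePt β ξ) * h ξ‖ₑ ^ (2 : ℝ)
      = ∫⁻ u, ENNReal.ofReal (Real.exp (-β * u)) ^ (2 : ℝ) * ‖bandConv n s v u‖ₑ ^ (2 : ℝ) := by
  obtain ⟨D, hD⟩ := exists_bandPass_decay n hs |β| 0
  have hc := continuous_linePt β
  have hb : Continuous fun ξ => bandPass n s (linePt β ξ) := by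
    have := (differentiable_bandPass n s).continuous.comp hc
    simpa only [Function.comp_def] using this
  have hD' : ∀ ξ : ℝ, (1 + ξ ^ 2) * ‖bandPass n s (linePt β ξ)‖ ≤ D := fun ξ => by
    have h0 := hD (linePt β ξ) (by simp)
    simp only [Complex.ofReal_zero, mul_zero, Complex.exp_zero, mul_one] at h0
    refine le_trans ?_ h0
    exact mul_le_mul_of_nonneg_right (by linarith [sq_le_linePt_im_sq β ξ]) (norm_nonneg _)
  have hle : ∀ ξ, ‖bandPass n s (linePt β ξ)‖ ≤ D * (1 + ξ ^ 2)⁻¹ := fun ξ => by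
    have : 0 < 1 + ξ ^ 2 := by positivity
    rw [← div_eq_mul_inv, le_div_iff₀ this, mul_comm]; exact hD' ξ
  have hb2 : MemLp (fun ξ => bandPass n s (linePt β ξ)) 2 volume :=
    (memLp_inv_one_add_sq D).mono' hb.aestronglyMeasurable (.of_forall hle)
  have hbD : ∀ ξ, ‖bandPass n s (linePt β ξ)‖ ≤ D := fun ξ => by
    refine le_trans ?_ (hD' ξ)
    exact le_mul_of_one_le_left (norm_nonneg _) (by nlinarith [sq_nonneg ξ])
  have h2 := H.memLp_right
  have hT1 : Integrable fun ξ => bandPass n s (linePt β ξ) * h ξ := hb2.integrable_mul h2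
  have hT2 : MemLp (fun ξ => bandPass n s (linePt β ξ) * h ξ) 2 volume := by
    refine (h2.norm.const_mul D).mono' (hb.aestronglyMeasurable.mul h2.1) (.of_forall fun ξ => ?_)
    rw [norm_mul]; gcongr; exact hbD ξ
  have K := (isFT_of_integrable hT1 hT2).eLpNorm_eq
  have key : ∀ u, 𝓕 (fun ξ => bandPass n s (linePt β ξ) * h ξ) (-u)
      = (Real.exp (-β * u) : ℂ) * bandConv n s v u := fun u => by
    rw [← bandConv_eq H n hs u, fourier_real_eq', ← integral_const_mul]
    congr 1; funext ξ
    have : Complex.exp (linePt β ξ * u) = Complex.exp (β * u)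
        * Complex.exp (2 * Real.pi * ξ * Complex.I * u) := by
      rw [linePt, add_mul, Complex.exp_add]
    rw [this, Complex.ofReal_exp]
    have e1 : Complex.exp ((-β * u : ℝ) : ℂ) * Complex.exp (β * u) = 1 := by
      rw [← Complex.exp_add]; simp
    have e2 : (-(2 * (Real.pi : ℂ) * u * Complex.I * ((-u : ℝ) : ℂ))) = 2 * Real.pi * u * Complex.I * u := by
      push_cast; ring
    have e3 : (-(2 * (Real.pi : ℂ) * ((-u : ℝ) : ℂ) * Complex.I * ξ)) = 2 * Real.pi * ξ * Complex.I * u := by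
      push_cast; ring
    rw [e3]
    linear_combination (-(bandPass n s (linePt β ξ) * h ξ
      * Complex.exp (2 * Real.pi * ξ * Complex.I * u))) * e1
  have e2 : ∀ T : ℝ → ℂ, ∫⁻ ξ, ‖T ξ‖ₑ ^ (2 : ℝ) = (eLpNorm T 2 volume) ^ (2 : ℝ) := fun T => by
    rw [eLpNorm_eq_lintegral_rpow_enorm_toReal (by simp) (by simp)]
    simp only [ENNReal.toReal_ofNat]
    rw [← ENNReal.rpow_mul]; norm_num
  rw [e2, ← K, ← e2, ← (Measure.measurePreserving_neg volume).lintegral_comp_emb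
    (MeasurableEquiv.neg ℝ).measurableEmbedding]
  congr 1; funext u
  rw [key, enorm_mul, ENNReal.mul_rpow_of_nonneg _ _ (by norm_num), ← ofReal_norm,
    Complex.norm_real, Real.norm_of_nonneg (Real.exp_pos _).le]

theorem norm_bandPass_le (n : ℕ) {s B : ℝ} (hs : 0 ≤ s) (hs1 : s ≤ 1) {z : ℂ} (hz : |z.re| ≤ B) :
    ‖bandPass n s z‖ ≤ n.factorial * Real.exp 1 * Real.exp (2 * B ^ 2) := by
  rw [norm_bandPass n hs]
  have h1 := pow_mul_exp_neg_sq_le n (X := s * ‖z‖) (by positivity)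
  have hB : 0 ≤ B := (abs_nonneg _).trans hz
  have h2 : Real.exp (2 * (s * z.re) ^ 2) ≤ Real.exp (2 * B ^ 2) := by
    refine (exp_re_sq_le hz).trans (Real.exp_le_exp.2 ?_)
    gcongr
    exact mul_le_of_le_one_left hB hs1
  gcongr

/-- For |z| ≥ 1/s the weight at 1/s is the smaller one. For |z| ≤ 1/s doubling costs
(1/(s|z|))^{p+q}, which the zero of order n ≥ p + q of the multiplier at the origin pays for. -/
theorem powWeight_mul_norm_bandPass_le {ε p q s B : ℝ} {n : ℕ} (hε : 0 < ε) (hp : 0 ≤ p) (hq : 0 ≤ q)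
    (hn : p + q ≤ n) (hs : 0 < s) (hs1 : s ≤ 1) {z : ℂ} (hz : |z.re| ≤ B) (hz0 : z ≠ 0) :
    powWeight ε p q (1 / s) * ‖bandPass n s z‖
      ≤ n.factorial * Real.exp 1 * Real.exp (2 * B ^ 2) * powWeight ε p q ‖z‖ := by
  have hB : 0 ≤ B := (abs_nonneg _).trans hz
  have hz1 : 0 < ‖z‖ := norm_pos_iff.2 hz0
  have hw := powWeight_nonneg (p := p) (q := q) hε (norm_nonneg z)
  have hC : (1 : ℝ) ≤ n.factorial * Real.exp 1 := by
    have h1 : (1 : ℝ) ≤ n.factorial := by exact_mod_cast n.factorial_pos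
    have h2 : (1 : ℝ) ≤ Real.exp 1 := Real.one_le_exp zero_le_one
    nlinarith
  rcases le_total 1 (s * ‖z‖) with hX | hX
  · have h1 : powWeight ε p q (1 / s) ≤ powWeight ε p q ‖z‖ :=
      powWeight_mono hε hp hq (by positivity) (by rwa [div_le_iff₀' hs])
    have h2 := norm_bandPass_le n hs.le hs1 hz
    calc _ ≤ powWeight ε p q ‖z‖ * (n.factorial * Real.exp 1 * Real.exp (2 * B ^ 2)) := by gcongr
      _ = _ := by ring
  · have hX0 : 0 < s * ‖z‖ := by positivity
    have h1 := powWeight_mul_le (p := p) (q := q) (r := ‖z‖) (a := 1 / (s * ‖z‖)) hε hq hz1.le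
      (by rwa [le_div_iff₀ hX0, one_mul])
    have e : 1 / (s * ‖z‖) * ‖z‖ = 1 / s := by field_simp
    rw [e] at h1
    have h2 : ‖bandPass n s z‖ ≤ (s * ‖z‖) ^ n * Real.exp (2 * B ^ 2) := by
      rw [norm_bandPass n hs.le]
      have h2 : Real.exp (2 * (s * z.re) ^ 2) ≤ Real.exp (2 * B ^ 2) := by
        refine (exp_re_sq_le hz).trans (Real.exp_le_exp.2 ?_)
        gcongr
        exact mul_le_of_le_one_left hB hs1
      have h3 : Real.exp (-(s * ‖z‖) ^ 2) ≤ 1 := Real.exp_le_one_iff.2 (by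
        have := sq_nonneg (s * ‖z‖); linarith)
      have : (s * ‖z‖) ^ n * Real.exp (-(s * ‖z‖) ^ 2) ≤ (s * ‖z‖) ^ n :=
        mul_le_of_le_one_right (by positivity) h3
      gcongr
    have h3 : (1 / (s * ‖z‖)) ^ (p + q) * (s * ‖z‖) ^ n ≤ 1 := by
      rw [one_div, Real.inv_rpow hX0.le, ← Real.rpow_neg hX0.le, ← Real.rpow_natCast,
        ← Real.rpow_add hX0]
      exact Real.rpow_le_one hX0.le hX (by linarith)
    calc _ ≤ ((1 / (s * ‖z‖)) ^ (p + q) * powWeight ε p q ‖z‖)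
          * ((s * ‖z‖) ^ n * Real.exp (2 * B ^ 2)) := by
          have : 0 ≤ (1 / (s * ‖z‖)) ^ (p + q) := by positivity
          gcongr
      _ = ((1 / (s * ‖z‖)) ^ (p + q) * (s * ‖z‖) ^ n) * (Real.exp (2 * B ^ 2)
          * powWeight ε p q ‖z‖) := by ring
      _ ≤ 1 * (Real.exp (2 * B ^ 2) * powWeight ε p q ‖z‖) := by gcongr
      _ ≤ (n.factorial * Real.exp 1) * (Real.exp (2 * B ^ 2) * powWeight ε p q ‖z‖) := by gcongr
      _ = _ := by ring

/-- The index is the one with 2^i ≤ |z| < 2^{i+1}. Then 2^{-i}|z| lies between 1 and 2, so the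
multiplier is at least e^{-4}, and the weight changes by at most the factor 2^{p+q}. -/
theorem exists_dyadic_bandPass {ε p q t δ : ℝ} (n : ℕ) (hε : 0 < ε) (hp : 0 ≤ p) (hq : 0 ≤ q)
    (ht : 0 ≤ t) (ht1 : t ≤ 1) (hδ : 0 ≤ δ) {z : ℂ} (hz : 1 ≤ ‖z‖) :
    ∃ i : ℕ, ‖z‖ ^ (-δ) * powWeight ε p q ‖z‖ ^ t ≤ Real.exp 4 * 2 ^ (p + q) *
      ((2 ^ i : ℝ) ^ (-δ) * powWeight ε p q (2 ^ i) ^ t * ‖bandPass n (1 / 2 ^ i) z‖) := by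
  obtain ⟨i, hi1, hi2⟩ := exists_nat_pow_near hz (one_lt_two : (1 : ℝ) < 2)
  refine ⟨i, ?_⟩
  have h2i : (0 : ℝ) < 2 ^ i := by positivity
  have hz0 : 0 < ‖z‖ := by linarith
  have hX1 : 1 ≤ 1 / 2 ^ i * ‖z‖ := by rw [one_div_mul_eq_div, one_le_div h2i]; exact hi1
  have hX2 : 1 / 2 ^ i * ‖z‖ ≤ 2 := by
    rw [one_div_mul_eq_div, div_le_iff₀ h2i]; rw [pow_succ] at hi2; linarith
  have hb : Real.exp (-4) ≤ ‖bandPass n (1 / 2 ^ i) z‖ := by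
    rw [norm_bandPass n (by positivity)]
    have h1 : (1 : ℝ) ≤ (1 / 2 ^ i * ‖z‖) ^ n := one_le_pow₀ hX1
    have h2 : Real.exp (-4) ≤ Real.exp (-(1 / 2 ^ i * ‖z‖) ^ 2) := by
      rw [Real.exp_le_exp]; nlinarith
    have h3 : (1 : ℝ) ≤ Real.exp (2 * (1 / 2 ^ i * z.re) ^ 2) := Real.one_le_exp (by positivity)
    calc Real.exp (-4) = 1 * Real.exp (-4) * 1 := by ring
      _ ≤ _ := by gcongr
  have h1 : ‖z‖ ^ (-δ) ≤ (2 ^ i : ℝ) ^ (-δ) :=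
    Real.rpow_le_rpow_of_nonpos h2i hi1 (by linarith)
  have hw := powWeight_nonneg (p := p) (q := q) hε h2i.le
  have h3 : powWeight ε p q ‖z‖ ≤ 2 ^ (p + q) * powWeight ε p q (2 ^ i) := by
    refine (powWeight_mono hε hp hq hz0.le hi2.le).trans ?_
    rw [pow_succ, mul_comm ((2 : ℝ) ^ i)]
    exact powWeight_mul_le hε hq h2i.le one_le_two
  have h4 : powWeight ε p q ‖z‖ ^ t ≤ 2 ^ (p + q) * powWeight ε p q (2 ^ i) ^ t := by
    refine (Real.rpow_le_rpow (powWeight_nonneg hε hz0.le) h3 ht).trans ?_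
    rw [Real.mul_rpow (by positivity) hw]
    gcongr
    have : (1 : ℝ) ≤ 2 ^ (p + q) := Real.one_le_rpow one_le_two (by linarith)
    calc ((2 : ℝ) ^ (p + q)) ^ t ≤ ((2 : ℝ) ^ (p + q)) ^ (1 : ℝ) :=
        Real.rpow_le_rpow_of_exponent_le this ht1
      _ = _ := Real.rpow_one _
  have h5 : 1 ≤ Real.exp 4 * ‖bandPass n (1 / 2 ^ i) z‖ := by
    calc (1 : ℝ) = Real.exp 4 * Real.exp (-4) := by rw [← Real.exp_add]; simp
      _ ≤ _ := by gcongr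
  have h6 : 0 ≤ (2 ^ i : ℝ) ^ (-δ) * (2 ^ (p + q) * powWeight ε p q (2 ^ i) ^ t) := by positivity
  calc _ ≤ (2 ^ i : ℝ) ^ (-δ) * (2 ^ (p + q) * powWeight ε p q (2 ^ i) ^ t) := by
        have := Real.rpow_nonneg (powWeight_nonneg (p := p) (q := q) hε hz0.le) t
        gcongr
    _ ≤ (2 ^ i : ℝ) ^ (-δ) * (2 ^ (p + q) * powWeight ε p q (2 ^ i) ^ t)
        * (Real.exp 4 * ‖bandPass n (1 / 2 ^ i) z‖) := le_mul_of_one_le_right h6 h5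
    _ = _ := by ring

/-- An intermediate exponential is dominated by the lower one for u ≥ 0 and by the upper one for u ≤
0. -/
theorem memLp_expWeight_between {βa βb β : ℝ} {v : ℝ → ℝ} (ha : MemLp (expWeight βa v) 2 volume)
    (hb : MemLp (expWeight βb v) 2 volume) (h1 : βa ≤ β) (h2 : β ≤ βb) :
    MemLp (expWeight β v) 2 volume := by
  have hm : AEStronglyMeasurable (expWeight β v) volume := by
    have : expWeight β v = fun u => ((Real.exp ((βa - β) * u) : ℝ) : ℂ) * expWeight βa v u := by
      funext u
      rw [expWeight, expWeight, ← Complex.ofReal_mul, ← mul_assoc, ← Real.exp_add]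
      congr 3; ring_nf
    rw [this]
    exact (Continuous.aestronglyMeasurable (by fun_prop)).mul ha.1
  refine (ha.norm.add hb.norm).mono' hm (.of_forall fun u => ?_)
  simp only [expWeight, Complex.norm_real, norm_mul, Real.norm_of_nonneg (Real.exp_pos _).le,
    Pi.add_apply]
  rw [← add_mul]
  gcongr
  rcases le_total 0 u with hu | hu
  · have : Real.exp (-β * u) ≤ Real.exp (-βa * u) := Real.exp_le_exp.2 (by nlinarith)
    linarith [Real.exp_pos (-βb * u)]
  · have : Real.exp (-β * u) ≤ Real.exp (-βb * u) := Real.exp_le_exp.2 (by nlinarith)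
    linarith [Real.exp_pos (-βa * u)]

theorem aestronglyMeasurable_bandConv {β : ℝ} {v : ℝ → ℝ} {h : ℝ → ℂ} (H : IsFT (expWeight β v) h)
    (n : ℕ) {s : ℝ} (hs : 0 < s) : AEStronglyMeasurable (bandConv n s v) volume := by
  have e : bandConv n s v = fun u : ℝ => ∫ ξ, (fun p : ℝ × ℝ => h p.2
      * (bandPass n s (linePt β p.2) * Complex.exp (linePt β p.2 * p.1))) (u, ξ) :=
    funext fun u => (bandConv_eq H n hs u).symm
  rw [e]
  refine AEStronglyMeasurable.integral_prod_right' (f := fun p : ℝ × ℝ => h p.2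
      * (bandPass n s (linePt β p.2) * Complex.exp (linePt β p.2 * p.1))) ?_
  refine AEStronglyMeasurable.mul (f := fun p : ℝ × ℝ => h p.2) H.memLp_right.1.comp_snd
    (Continuous.aestronglyMeasurable ?_)
  have h3 : Continuous fun p : ℝ × ℝ => linePt β p.2 := by
    unfold linePt; fun_prop
  have h2 := (differentiable_bandPass n s).continuous.comp h3
  simp only [Function.comp_def] at h2
  exact h2.mul (Complex.continuous_exp.comp (h3.mul (by fun_prop)))

/-- Hölder's inequality in u, since the weight e^{-2βu} is the geometric mean of the two end weights
and `bandConv` does not depend on the line. -/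
theorem lintegral_bandPass_le_rpow {βa βb t : ℝ} (ht : 0 ≤ t) (ht1 : t ≤ 1) {v : ℝ → ℝ}
    {ha hb h : ℝ → ℂ} (Ha : IsFT (expWeight βa v) ha) (Hb : IsFT (expWeight βb v) hb)
    (H : IsFT (expWeight ((1 - t) * βa + t * βb) v) h) (n : ℕ) {s : ℝ} (hs : 0 < s) :
    ∫⁻ ξ, ‖bandPass n s (linePt ((1 - t) * βa + t * βb) ξ) * h ξ‖ₑ ^ (2 : ℝ)
      ≤ (∫⁻ ξ, ‖bandPass n s (linePt βa ξ) * ha ξ‖ₑ ^ (2 : ℝ)) ^ (1 - t)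
        * (∫⁻ ξ, ‖bandPass n s (linePt βb ξ) * hb ξ‖ₑ ^ (2 : ℝ)) ^ t := by
  rw [lintegral_bandPass Ha n hs, lintegral_bandPass Hb n hs, lintegral_bandPass H n hs]
  have hm := (aestronglyMeasurable_bandConv H n hs).enorm.pow_const (2 : ℝ)
  refine le_trans (le_of_eq ?_) (ENNReal.lintegral_mul_norm_pow_le
    (AEMeasurable.mul ?_ hm) (AEMeasurable.mul ?_ hm) (sub_nonneg.2 ht1) ht (by ring))
  · congr 1; funext u
    have ht' := sub_nonneg.2 ht1
    simp only [Pi.mul_apply]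
    rw [ENNReal.mul_rpow_of_nonneg _ _ ht', ENNReal.mul_rpow_of_nonneg _ _ ht, mul_mul_mul_comm,
      ← ENNReal.rpow_add_of_nonneg _ _ ht' ht, sub_add_cancel, ENNReal.rpow_one]
    congr 1
    rw [ENNReal.ofReal_rpow_of_pos (Real.exp_pos _), ENNReal.ofReal_rpow_of_pos (Real.exp_pos _),
      ENNReal.ofReal_rpow_of_pos (Real.exp_pos _), ENNReal.ofReal_rpow_of_pos (by positivity),
      ENNReal.ofReal_rpow_of_pos (by positivity), ← ENNReal.ofReal_mul (by positivity)]
    simp only [← Real.exp_mul, ← Real.exp_add]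
    congr 2; ring
  · exact (ENNReal.measurable_ofReal.comp (by fun_prop)).aemeasurable.pow_const _
  · exact (ENNReal.measurable_ofReal.comp (by fun_prop)).aemeasurable.pow_const _

/-- Interpolation of weighted `L²` norms of Mellin transforms between two vertical lines. -/
theorem exists_interpolation {βa βb t p q δ : ℝ} (hab : βa ≤ βb) (ht : 0 ≤ t) (ht1 : t ≤ 1)
    (hβ : 1 ≤ (1 - t) * βa + t * βb) (hp : 0 ≤ p) (hq : 0 ≤ q) (hδ : 0 < δ) :
    ∃ C : ℝ≥0, ∀ ε : ℝ, 0 < ε → ∀ (v : ℝ → ℝ) (hb : ℝ → ℂ), MemLp (expWeight βa v) 2 volume →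
      IsFT (expWeight βb v) hb → ∃ h, IsFT (expWeight ((1 - t) * βa + t * βb) v) h ∧
        ∫⁻ ξ, ENNReal.ofReal (‖linePt ((1 - t) * βa + t * βb) ξ‖ ^ (-δ)
            * powWeight ε p q ‖linePt ((1 - t) * βa + t * βb) ξ‖ ^ t * ‖h ξ‖) ^ (2 : ℝ)
          ≤ C * ((∫⁻ u, ‖expWeight βa v u‖ₑ ^ (2 : ℝ))
            + ∫⁻ ξ, ENNReal.ofReal (powWeight ε p q ‖linePt βb ξ‖ * ‖hb ξ‖) ^ (2 : ℝ)) := by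
  set β := (1 - t) * βa + t * βb with hβdef
  have hβ1 : βa ≤ β := by nlinarith
  have hβ2 : β ≤ βb := by nlinarith
  obtain ⟨n, hn⟩ := exists_nat_ge (p + q)
  set B := |βa| + |βb| with hB
  set K : ℝ := n.factorial * Real.exp 1 * Real.exp (2 * B ^ 2) with hK
  have hK0 : 0 ≤ K := by positivity
  -- The ratio of the geometric series over the dyadic frequencies. The loss δ > 0 serves only to
  -- make it less than 1.
  set r : ℝ≥0∞ := ENNReal.ofReal ((2 : ℝ) ^ (-δ)) ^ (2 : ℝ) with hr
  have hr1 : r < 1 := by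
    rw [hr]
    refine ENNReal.rpow_lt_one ?_ (by norm_num)
    rw [← ENNReal.ofReal_one, ENNReal.ofReal_lt_ofReal_iff one_pos]
    exact Real.rpow_lt_one_of_one_lt_of_neg one_lt_two (by linarith)
  set L : ℝ≥0∞ := ENNReal.ofReal (Real.exp 4 * 2 ^ (p + q)) ^ (2 : ℝ) * (1 - r)⁻¹
    * ENNReal.ofReal K ^ (2 : ℝ) with hL
  have hLtop : L ≠ ⊤ := by
    refine ENNReal.mul_ne_top (ENNReal.mul_ne_top ?_ ?_) ?_
    · exact ENNReal.rpow_ne_top_of_nonneg (by norm_num) ENNReal.ofReal_ne_top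
    · rw [ENNReal.inv_ne_top]; exact (tsub_pos_of_lt hr1).ne'
    · exact ENNReal.rpow_ne_top_of_nonneg (by norm_num) ENNReal.ofReal_ne_top
  refine ⟨L.toNNReal, fun ε hε v hb ha Hb => ?_⟩
  rw [ENNReal.coe_toNNReal hLtop]
  obtain ⟨ha', Ha⟩ := IsFT.exists_right ha
  obtain ⟨h, H⟩ := IsFT.exists_right (memLp_expWeight_between ha Hb.memLp_left hβ1 hβ2)
  refine ⟨h, H, ?_⟩
  set S := (∫⁻ u, ‖expWeight βa v u‖ₑ ^ (2 : ℝ))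
    + ∫⁻ ξ, ENNReal.ofReal (powWeight ε p q ‖linePt βb ξ‖ * ‖hb ξ‖) ^ (2 : ℝ) with hS
  have enorm_eq : ∀ z : ℂ, ‖z‖ₑ = ENNReal.ofReal ‖z‖ := fun z => (ofReal_norm z).symm
  have hrpow : ∀ {T : ℝ → ℂ}, ∫⁻ ξ, ‖T ξ‖ₑ ^ (2 : ℝ) = (eLpNorm T 2 volume) ^ (2 : ℝ) := fun {T} => by
    rw [eLpNorm_eq_lintegral_rpow_enorm_toReal (by simp) (by simp)]
    simp only [ENNReal.toReal_ofNat]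
    rw [← ENNReal.rpow_mul]; norm_num
  have hBa : |βa| ≤ B := by simp [hB]
  have hBb : |βb| ≤ B := by simp [hB]
  -- At a single frequency the weight is a constant W, and W^t can be absorbed in the factor of the
  -- upper line; the lower line carries no weight.
  have hband : ∀ i : ℕ, ENNReal.ofReal (powWeight ε p q (2 ^ i) ^ t) ^ (2 : ℝ)
      * ∫⁻ ξ, ‖bandPass n (1 / 2 ^ i) (linePt β ξ) * h ξ‖ₑ ^ (2 : ℝ) ≤ ENNReal.ofReal K ^ (2 : ℝ) * S := by
    intro i
    have hs : (0 : ℝ) < 1 / 2 ^ i := by positivity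
    have hs1 : (1 : ℝ) / 2 ^ i ≤ 1 := by
      rw [div_le_one (by positivity)]; exact one_le_pow₀ one_le_two
    set W := powWeight ε p q (2 ^ i) with hW
    have hW0 : 0 ≤ W := powWeight_nonneg hε (by positivity)
    have hA : ∫⁻ ξ, ‖bandPass n (1 / 2 ^ i) (linePt βa ξ) * ha' ξ‖ₑ ^ (2 : ℝ)
        ≤ ENNReal.ofReal K ^ (2 : ℝ) * S := by
      have h1 : ∫⁻ ξ, ‖ha' ξ‖ₑ ^ (2 : ℝ) ≤ S := by
        rw [hrpow, Ha.eLpNorm_eq, ← hrpow, hS]; exact self_le_add_right _ _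
      refine le_trans ?_ (mul_le_mul_right h1 _)
      rw [← lintegral_const_mul' _ _ (ENNReal.rpow_ne_top_of_nonneg (by norm_num) ENNReal.ofReal_ne_top)]
      refine lintegral_mono fun ξ => ?_
      rw [← ENNReal.mul_rpow_of_nonneg _ _ (by norm_num), enorm_mul, enorm_eq (bandPass _ _ _)]
      gcongr
      exact norm_bandPass_le n hs.le hs1 (by simpa using hBa)
    have hBq : ENNReal.ofReal W ^ (2 : ℝ)
        * ∫⁻ ξ, ‖bandPass n (1 / 2 ^ i) (linePt βb ξ) * hb ξ‖ₑ ^ (2 : ℝ)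
        ≤ ENNReal.ofReal K ^ (2 : ℝ) * S := by
      refine le_trans ?_ (mul_le_mul_right (le_of_le_of_eq (self_le_add_left _ _) hS.symm) (ENNReal.ofReal K ^ (2 : ℝ)))
      rw [← lintegral_const_mul' _ _ (ENNReal.rpow_ne_top_of_nonneg (by norm_num) ENNReal.ofReal_ne_top),
        ← lintegral_const_mul' _ _ (ENNReal.rpow_ne_top_of_nonneg (by norm_num) ENNReal.ofReal_ne_top)]
      refine lintegral_mono fun ξ => ?_
      simp only
      rw [← ENNReal.mul_rpow_of_nonneg _ _ (by norm_num), ← ENNReal.mul_rpow_of_nonneg _ _ (by norm_num),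
        enorm_eq, ← ENNReal.ofReal_mul hW0, ← ENNReal.ofReal_mul hK0, norm_mul]
      refine ENNReal.rpow_le_rpow (ENNReal.ofReal_le_ofReal ?_) (by norm_num)
      rw [← mul_assoc, ← mul_assoc]
      refine mul_le_mul_of_nonneg_right ?_ (norm_nonneg _)
      have hz0 : linePt βb ξ ≠ 0 := by
        rw [← norm_pos_iff]
        have := abs_le_norm_linePt βb ξ
        have h1 : 1 ≤ βb := by linarith
        linarith [le_abs_self βb]
      have := powWeight_mul_norm_bandPass_le (n := n) (B := B) hε hp hq hn hs hs1
        (z := linePt βb ξ) (by simpa using hBb) hz0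
      simpa only [one_div_one_div] using this
    calc _ ≤ ENNReal.ofReal (W ^ t) ^ (2 : ℝ)
          * ((∫⁻ ξ, ‖bandPass n (1 / 2 ^ i) (linePt βa ξ) * ha' ξ‖ₑ ^ (2 : ℝ)) ^ (1 - t)
          * (∫⁻ ξ, ‖bandPass n (1 / 2 ^ i) (linePt βb ξ) * hb ξ‖ₑ ^ (2 : ℝ)) ^ t) := by
          gcongr
          exact lintegral_bandPass_le_rpow ht ht1 Ha Hb H n hs
      _ = (∫⁻ ξ, ‖bandPass n (1 / 2 ^ i) (linePt βa ξ) * ha' ξ‖ₑ ^ (2 : ℝ)) ^ (1 - t)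
          * (ENNReal.ofReal W ^ (2 : ℝ)
            * ∫⁻ ξ, ‖bandPass n (1 / 2 ^ i) (linePt βb ξ) * hb ξ‖ₑ ^ (2 : ℝ)) ^ t := by
          rw [ENNReal.mul_rpow_of_nonneg _ _ ht, ← ENNReal.rpow_mul, mul_comm (2 : ℝ) t,
            ENNReal.rpow_mul, ENNReal.ofReal_rpow_of_nonneg hW0 ht]
          ring
      _ ≤ (ENNReal.ofReal K ^ (2 : ℝ) * S) ^ (1 - t) * (ENNReal.ofReal K ^ (2 : ℝ) * S) ^ t := by
          have := sub_nonneg.2 ht1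
          gcongr
      _ = _ := by
          rw [← ENNReal.rpow_add_of_nonneg _ _ (sub_nonneg.2 ht1) ht, sub_add_cancel, ENNReal.rpow_one]
  have hmeas : ∀ i : ℕ, AEMeasurable
      (fun ξ => ‖bandPass n (1 / 2 ^ i) (linePt β ξ) * h ξ‖ₑ ^ (2 : ℝ)) volume := fun i => by
    have h1 : Continuous fun ξ => bandPass n (1 / 2 ^ i) (linePt β ξ) := by
      have := (differentiable_bandPass n (1 / 2 ^ i)).continuous.comp (continuous_linePt β)
      simpa only [Function.comp_def] using this
    exact (h1.aestronglyMeasurable.mul H.memLp_right.1).enorm.pow_const _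
  -- At each ξ a single dyadic frequency controls the integrand; it is replaced by the sum over all
  -- frequencies.
  calc _ ≤ ∫⁻ ξ, ENNReal.ofReal (Real.exp 4 * 2 ^ (p + q)) ^ (2 : ℝ) *
        ∑' i : ℕ, r ^ i * ENNReal.ofReal (powWeight ε p q (2 ^ i) ^ t) ^ (2 : ℝ)
          * ‖bandPass n (1 / 2 ^ i) (linePt β ξ) * h ξ‖ₑ ^ (2 : ℝ) := by
        refine lintegral_mono fun ξ => ?_
        obtain ⟨i, hi⟩ := exists_dyadic_bandPass n hε hp hq ht ht1 hδ.le (z := linePt β ξ)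
          ((hβ.trans (le_abs_self _)).trans (abs_le_norm_linePt β ξ))
        refine le_trans ?_ (mul_le_mul_right (ENNReal.le_tsum i) _)
        have e : r ^ i = ENNReal.ofReal ((2 ^ i : ℝ) ^ (-δ)) ^ (2 : ℝ) := by
          rw [hr, ← ENNReal.rpow_natCast, ← ENNReal.rpow_mul, mul_comm, ENNReal.rpow_mul,
            ENNReal.rpow_natCast, ← ENNReal.ofReal_pow (by positivity)]
          congr 2
          rw [← Real.rpow_natCast, ← Real.rpow_mul (by norm_num), mul_comm, Real.rpow_mul (by norm_num),
            Real.rpow_natCast]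
        have hw := Real.rpow_nonneg (powWeight_nonneg (p := p) (q := q) hε
          (by positivity : (0 : ℝ) ≤ 2 ^ i)) t
        simp only
        rw [e, enorm_eq, ← ENNReal.mul_rpow_of_nonneg _ _ (by norm_num),
          ← ENNReal.mul_rpow_of_nonneg _ _ (by norm_num), ← ENNReal.mul_rpow_of_nonneg _ _ (by norm_num),
          ← ENNReal.ofReal_mul (by positivity), ← ENNReal.ofReal_mul (by positivity),
          ← ENNReal.ofReal_mul (by positivity), norm_mul]
        refine ENNReal.rpow_le_rpow (ENNReal.ofReal_le_ofReal ?_) (by norm_num)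
        calc _ ≤ _ := mul_le_mul_of_nonneg_right hi (norm_nonneg (h ξ))
          _ = _ := by ring
    _ = ENNReal.ofReal (Real.exp 4 * 2 ^ (p + q)) ^ (2 : ℝ) *
        ∑' i : ℕ, r ^ i * (ENNReal.ofReal (powWeight ε p q (2 ^ i) ^ t) ^ (2 : ℝ)
          * ∫⁻ ξ, ‖bandPass n (1 / 2 ^ i) (linePt β ξ) * h ξ‖ₑ ^ (2 : ℝ)) := by
        rw [lintegral_const_mul' _ _ (ENNReal.rpow_ne_top_of_nonneg (by norm_num) ENNReal.ofReal_ne_top),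
          lintegral_tsum fun i => (hmeas i).const_mul _]
        congr 2; funext i
        rw [lintegral_const_mul'' _ (hmeas i), mul_assoc]
    _ ≤ ENNReal.ofReal (Real.exp 4 * 2 ^ (p + q)) ^ (2 : ℝ) *
        ∑' i : ℕ, r ^ i * (ENNReal.ofReal K ^ (2 : ℝ) * S) := by
        exact mul_le_mul_right (ENNReal.tsum_le_tsum fun i => mul_le_mul_right (hband i) _) _
    _ = L * S := by
        rw [ENNReal.tsum_mul_right, ENNReal.tsum_geometric, hL]; ring

/-! ### Bivariate polynomials given by their coefficients -/

/-- The polynomial function with coefficients `c a b`, `a, b < N`. -/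
def biPoly (N : ℕ) (c : ℕ → ℕ → ℝ) (z : ℝ × ℝ) : ℝ :=
  ∑ a ∈ Finset.range N, ∑ b ∈ Finset.range N, c a b * z.1 ^ a * z.2 ^ b

/-- The coefficients of `∂_x`. -/
def coeffX (c : ℕ → ℕ → ℝ) (a b : ℕ) : ℝ := (a + 1) * c (a + 1) b

/-- The coefficients of `∂_y`. -/
def coeffY (c : ℕ → ℕ → ℝ) (a b : ℕ) : ℝ := (b + 1) * c a (b + 1)

/-- There are no terms of degree `N` or more. -/
def DegBelow (N : ℕ) (c : ℕ → ℕ → ℝ) : Prop := ∀ a b, N ≤ a + b → c a b = 0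

theorem DegBelow.coeffX {N : ℕ} {c : ℕ → ℕ → ℝ} (h : DegBelow N c) : DegBelow N (coeffX c) :=
  fun a b hab => by rw [_root_.coeffX, h _ _ (by omega), mul_zero]

theorem DegBelow.coeffY {N : ℕ} {c : ℕ → ℕ → ℝ} (h : DegBelow N c) : DegBelow N (coeffY c) :=
  fun a b hab => by rw [_root_.coeffY, h _ _ (by omega), mul_zero]

theorem contDiff_biPoly (N : ℕ) (c : ℕ → ℕ → ℝ) : ContDiff ℝ ∞ (biPoly N c) := by
  unfold biPoly
  fun_prop

theorem sum_range_derivative_shift {N : ℕ} {u : ℕ → ℝ} (hu : u N = 0) (x : ℝ) :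
    ∑ a ∈ Finset.range N, u a * (a * x ^ (a - 1)) = ∑ a ∈ Finset.range N, (a + 1) * u (a + 1) * x ^ a := by
  have h1 : ∑ a ∈ Finset.range (N + 1), u a * (a * x ^ (a - 1))
      = ∑ a ∈ Finset.range N, u a * (a * x ^ (a - 1)) := by
    rw [Finset.sum_range_succ, hu]; simp
  rw [← h1, Finset.sum_range_succ']
  simp only [Nat.cast_zero, zero_mul, mul_zero, add_zero]
  refine Finset.sum_congr rfl fun a _ => ?_
  rw [Nat.add_sub_cancel]; push_cast; ring

theorem hasFDerivAt_biPoly {N : ℕ} {c : ℕ → ℕ → ℝ} (h : DegBelow N c) (z : ℝ × ℝ) :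
    HasFDerivAt (biPoly N c) (biPoly N (coeffX c) z • ContinuousLinearMap.fst ℝ ℝ ℝ
      + biPoly N (coeffY c) z • ContinuousLinearMap.snd ℝ ℝ ℝ) z := by
  have key : HasFDerivAt (biPoly N c) (∑ a ∈ Finset.range N, ∑ b ∈ Finset.range N,
      ((c a b * (a * z.1 ^ (a - 1)) * z.2 ^ b) • ContinuousLinearMap.fst ℝ ℝ ℝ
        + (c a b * z.1 ^ a * (b * z.2 ^ (b - 1))) • ContinuousLinearMap.snd ℝ ℝ ℝ)) z := by
    refine HasFDerivAt.fun_sum fun a _ => HasFDerivAt.fun_sum fun b _ => ?_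
    have h1 := ((hasFDerivAt_fst (𝕜 := ℝ) (p := z)).pow a).const_mul (c a b)
    have h2 := h1.mul ((hasFDerivAt_snd (𝕜 := ℝ) (p := z)).pow b)
    refine h2.congr_fderiv ?_
    ext <;> simp <;> ring
  refine key.congr_fderiv ?_
  have e1 : ∑ a ∈ Finset.range N, ∑ b ∈ Finset.range N, c a b * (a * z.1 ^ (a - 1)) * z.2 ^ b
      = biPoly N (coeffX c) z := by
    rw [Finset.sum_comm, biPoly]
    conv_rhs => rw [Finset.sum_comm]
    refine Finset.sum_congr rfl fun b _ => ?_
    rw [← Finset.sum_mul, ← Finset.sum_mul, sum_range_derivative_shift (u := fun a => c a b) (h _ _ (by omega))]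
    rfl
  have e2 : ∑ a ∈ Finset.range N, ∑ b ∈ Finset.range N, c a b * z.1 ^ a * (b * z.2 ^ (b - 1))
      = biPoly N (coeffY c) z := by
    refine Finset.sum_congr rfl fun a _ => ?_
    rw [sum_range_derivative_shift (u := fun b => c a b * z.1 ^ a)
      (mul_eq_zero_of_left (h _ _ (by omega)) _)]
    exact Finset.sum_congr rfl fun b _ => by rw [coeffY]; ring
  simp only [Finset.sum_add_distrib, ← Finset.sum_smul]
  rw [e1, e2]

theorem biPoly_diag {N : ℕ} {c : ℕ → ℕ → ℝ} (h : DegBelow N c) (x : ℝ) :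
    biPoly N c (x, x)
      = ∑ n ∈ Finset.range N, (∑ d ∈ Finset.HasAntidiagonal.antidiagonal n, c d.1 d.2) * x ^ n := by
  have e1 : biPoly N c (x, x)
      = ∑ d ∈ Finset.range N ×ˢ Finset.range N, c d.1 d.2 * x ^ (d.1 + d.2) := by
    rw [biPoly, Finset.sum_product]
    refine Finset.sum_congr rfl fun a _ => Finset.sum_congr rfl fun b _ => ?_
    rw [pow_add, mul_assoc]
  have e2 : ∑ n ∈ Finset.range N, (∑ d ∈ Finset.HasAntidiagonal.antidiagonal n, c d.1 d.2) * x ^ n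
      = ∑ d ∈ (Finset.range N).sigma Finset.HasAntidiagonal.antidiagonal, c d.2.1 d.2.2 * x ^ d.1 := by
    rw [Finset.sum_sigma]
    exact Finset.sum_congr rfl fun n _ => Finset.sum_mul _ _ _
  rw [e1, e2]
  rw [← Finset.sum_filter_of_ne (p := fun d : ℕ × ℕ => d.1 + d.2 < N)]
  · refine Finset.sum_bij' (fun d _ => ⟨d.1 + d.2, d⟩) (fun d _ => d.2) ?_ ?_ ?_ ?_ ?_
    · intro d hd
      simp only [Finset.mem_filter] at hd
      simp [hd.2]
    · intro d hd
      simp only [Finset.mem_sigma, Finset.mem_range, Finset.HasAntidiagonal.mem_antidiagonal] at hd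
      simp only [Finset.mem_filter, Finset.mem_product, Finset.mem_range]
      omega
    · intro d _; rfl
    · rintro ⟨n, d⟩ hd
      simp only [Finset.mem_sigma, Finset.mem_range, Finset.HasAntidiagonal.mem_antidiagonal] at hd
      simp [hd.2]
    · intro d _; rfl
  · intro d _ hd
    by_contra hlt
    exact hd (by rw [h _ _ (not_lt.1 hlt), zero_mul])

/-- Coefficients of a particular solution of `P_xx + ε⁻² P_yy = R` with `P = P_y = 0` on `y = 0`. -/
def partCoeff (ε : ℝ) (R : ℕ → ℕ → ℝ) : ℕ → ℕ → ℝ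
  | 0, _ => 0
  | 1, _ => 0
  | b + 2, a => ε ^ 2 / ((b + 1) * (b + 2)) * (R a b - (a + 2) * (a + 1) * partCoeff ε R b (a + 2))

theorem partCoeff_eq_zero {ε : ℝ} {R : ℕ → ℕ → ℝ} {N : ℕ} (hR : ∀ a b, N ≤ a + b + 2 → R a b = 0) :
    ∀ b a, N ≤ a + b → partCoeff ε R b a = 0
  | 0, _, _ => by simp [partCoeff]
  | 1, _, _ => by simp [partCoeff]
  | b + 2, a, h => by
    rw [partCoeff, hR a b (by omega), partCoeff_eq_zero hR b (a + 2) (by omega)]; simp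

/-- Every coefficient keeps one factor ε², because the recursion multiplies by ε² and ε ≤ 1. This
factor later cancels the ε⁻² in front of p_y. The powers of 1 + N² are a crude bound for the factors
(a+2)(a+1) of the recursion. -/
theorem abs_partCoeff_le {ε M : ℝ} {R : ℕ → ℕ → ℝ} {N : ℕ} (hε : 0 ≤ ε) (hε1 : ε ≤ 1) (hM : 0 ≤ M)
    (hR : ∀ a b, N ≤ a + b + 2 → R a b = 0) (hRM : ∀ a b, |R a b| ≤ M) :
    ∀ b a, |partCoeff ε R b a| ≤ ε ^ 2 * ((1 + N ^ 2) ^ b * M)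
  | 0, _ => by simp [partCoeff]; positivity
  | 1, _ => by simp [partCoeff]; positivity
  | b + 2, a => by
    by_cases hN : N ≤ a + 2
    · rw [partCoeff]
      rw [partCoeff_eq_zero hR b (a + 2) (by omega), mul_zero, sub_zero, abs_mul, abs_of_nonneg (by positivity)]
      have h1 : (1 : ℝ) ≤ (b + 1) * (b + 2) := by
        have : (0 : ℝ) ≤ b := b.cast_nonneg
        nlinarith
      have h2 : (1 : ℝ) ≤ (1 + N ^ 2) ^ (b + 2) := one_le_pow₀ (le_add_of_nonneg_right (by positivity))
      have h3 : ε ^ 2 / ((b + 1) * (b + 2)) ≤ ε ^ 2 := div_le_self (by positivity) h1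
      have h4 : |R a b| ≤ (1 + N ^ 2) ^ (b + 2) * M :=
        (hRM a b).trans (le_mul_of_one_le_left hM h2)
      gcongr
    · have ih := abs_partCoeff_le hε hε1 hM hR hRM b (a + 2)
      rw [partCoeff, abs_mul, abs_of_nonneg (by positivity)]
      have h1 : (1 : ℝ) ≤ (b + 1) * (b + 2) := by
        have : (0 : ℝ) ≤ b := b.cast_nonneg
        nlinarith
      have h3 : ε ^ 2 / ((b + 1) * (b + 2)) ≤ ε ^ 2 := div_le_self (by positivity) h1
      have hε2 : ε ^ 2 ≤ 1 := pow_le_one₀ hε hε1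
      have haN : (a : ℝ) + 2 ≤ N := by exact_mod_cast (by omega : a + 2 ≤ N)
      have ha0 : (0 : ℝ) ≤ a := a.cast_nonneg
      set X : ℝ := (1 + (N : ℝ) ^ 2) ^ b * M with hX
      have hX0 : M ≤ X := le_mul_of_one_le_left hM (one_le_pow₀ (le_add_of_nonneg_right (by positivity)))
      have ih' : |partCoeff ε R b (a + 2)| ≤ X :=
        ih.trans (mul_le_of_le_one_left (hM.trans hX0) hε2)
      have h5 : ((a : ℝ) + 2) * (a + 1) ≤ N ^ 2 := by nlinarith
      have h4 : |R a b - (a + 2) * (a + 1) * partCoeff ε R b (a + 2)|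
          ≤ (1 + N ^ 2) ^ (b + 2) * M := by
        calc _ ≤ |R a b| + |(a + 2) * (a + 1) * partCoeff ε R b (a + 2)| := abs_sub _ _
          _ ≤ X + N ^ 2 * X := by
            rw [abs_mul, abs_of_nonneg (by positivity : (0 : ℝ) ≤ (a + 2) * (a + 1))]
            have := (hRM a b).trans hX0
            gcongr
          _ = (1 + N ^ 2) * X := by ring
          _ ≤ (1 + N ^ 2) * ((1 + N ^ 2) * X) := by
            have : X ≤ (1 + (N : ℝ) ^ 2) * X := le_mul_of_one_le_left (hM.trans hX0) (le_add_of_nonneg_right (by positivity))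
            gcongr
          _ = _ := by rw [hX]; ring
      gcongr

/-- The complex number 1 + iε has argument θ = arctan ε and modulus 1/cos θ. -/
theorem one_add_I_mul_pow_re (ε : ℝ) (n : ℕ) :
    ((1 + Complex.I * ε) ^ n).re
      = Real.cos (n * Real.arctan ε) / Real.cos (Real.arctan ε) ^ n := by
  have hc : Real.cos (Real.arctan ε) ≠ 0 := (Real.cos_arctan_pos ε).ne'
  have h1 : (1 + Complex.I * ε : ℂ)
      = ((Real.cos (Real.arctan ε))⁻¹ : ℝ) * Complex.exp (Real.arctan ε * Complex.I) := by
    have hs : Real.sin (Real.arctan ε) = ε * Real.cos (Real.arctan ε) := by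
      rw [← div_eq_iff hc, ← Real.tan_eq_sin_div_cos, Real.tan_arctan]
    apply Complex.ext
    · rw [Complex.re_ofReal_mul, Complex.exp_ofReal_mul_I_re, inv_mul_cancel₀ hc]; simp
    · rw [Complex.im_ofReal_mul, Complex.exp_ofReal_mul_I_im, hs]
      simp; field_simp
  rw [h1, mul_pow, ← Complex.exp_nat_mul, ← Complex.ofReal_pow, Complex.re_ofReal_mul, inv_pow,
    ← mul_assoc]
  have : (n : ℂ) * (Real.arctan ε : ℂ) = ((n * Real.arctan ε : ℝ) : ℂ) := by push_cast; rfl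
  rw [this, Complex.exp_ofReal_mul_I_re, mul_comm, div_eq_mul_inv]

/-- Nonresonance: the harmonic polynomial Re (x + iεy)^n restricted to y = x is this multiple of
x^n, so it can be used to prescribe Dirichlet data as long as nθ stays away from π/2. -/
theorem cos_le_one_add_I_mul_pow_re {ε c : ℝ} (hε : 0 ≤ ε) (hc : c ≤ Real.pi) {n : ℕ}
    (hc0 : 0 ≤ Real.cos c) (hn : n * Real.arctan ε ≤ c) :
    Real.cos c ≤ ((1 + Complex.I * ε) ^ n).re := by
  rw [one_add_I_mul_pow_re]
  have h0 : 0 ≤ Real.arctan ε := Real.arctan_nonneg.2 hε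
  have h1 : Real.cos c ≤ Real.cos (n * Real.arctan ε) :=
    Real.cos_le_cos_of_nonneg_of_le_pi (by positivity) hc hn
  refine h1.trans ((le_div_iff₀ (pow_pos (Real.cos_arctan_pos ε) n)).2 ?_)
  exact mul_le_of_le_one_right (hc0.trans h1)
    (pow_le_one₀ (Real.cos_arctan_pos ε).le (Real.cos_le_one _))

/-- Coefficients of `∑ γ_n Re (x + iεy)^n`. -/
def harmCoeff (ε : ℝ) (γ : ℕ → ℝ) (a b : ℕ) : ℝ :=
  γ (a + b) * (a + b).choose b * ((Complex.I * ε) ^ b).re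

theorem sum_harmCoeff (ε : ℝ) (γ : ℕ → ℝ) (n : ℕ) :
    ∑ d ∈ Finset.HasAntidiagonal.antidiagonal n, harmCoeff ε γ d.1 d.2 = γ n * ((1 + Complex.I * ε) ^ n).re := by
  have h := Finset.Nat.sum_antidiagonal_eq_sum_range_succ (fun a b => harmCoeff ε γ b a) n
  rw [← Finset.Nat.sum_antidiagonal_swap]
  simp only [Prod.fst_swap, Prod.snd_swap]
  rw [h, add_comm (1 : ℂ), add_pow, Complex.re_sum, Finset.mul_sum]
  refine Finset.sum_congr rfl fun b hb => ?_
  have : n - b + b = n := by have := Finset.mem_range.1 hb; omega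
  rw [harmCoeff, this, one_pow, mul_one, ← Complex.ofReal_natCast, Complex.re_mul_ofReal]
  ring

/-- The equation P_xx + ε⁻² P_yy = 0 in terms of coefficients. -/
theorem harmCoeff_step (ε : ℝ) (γ : ℕ → ℝ) (a b : ℕ) :
    (b + 2) * (b + 1) * harmCoeff ε γ a (b + 2)
      = -(ε ^ 2 * ((a + 2) * (a + 1) * harmCoeff ε γ (a + 2) b)) := by
  have h1 : ((a + (b + 2)).choose (b + 2) : ℝ) * ((b + 2) * (b + 1))
      = (a + (b + 2)).choose b * ((a + 2) * (a + 1)) := by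
    have e1 := Nat.choose_succ_right_eq (a + (b + 2)) (b + 1)
    have e2 := Nat.choose_succ_right_eq (a + (b + 2)) b
    have e3 : a + (b + 2) - (b + 1) = a + 1 := by omega
    have e4 : a + (b + 2) - b = a + 2 := by omega
    rw [e3] at e1; rw [e4] at e2
    have e1' : ((a + (b + 2)).choose (b + 2) : ℝ) * (b + 2) = (a + (b + 2)).choose (b + 1) * (a + 1) := by
      exact_mod_cast e1
    have e2' : ((a + (b + 2)).choose (b + 1) : ℝ) * (b + 1) = (a + (b + 2)).choose b * (a + 2) := by
      exact_mod_cast e2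
    linear_combination ((b : ℝ) + 1) * e1' + ((a : ℝ) + 1) * e2'
  have h2 : ((Complex.I * ε) ^ (b + 2)).re = -(ε ^ 2 * ((Complex.I * ε) ^ b).re) := by
    have : (Complex.I * (ε : ℂ)) ^ (b + 2) = ((-ε ^ 2 : ℝ) : ℂ) * (Complex.I * ε) ^ b := by
      rw [pow_add, mul_pow Complex.I _ 2, Complex.I_sq]; push_cast; ring
    rw [this, Complex.re_ofReal_mul]; ring
  have e : a + 2 + b = a + (b + 2) := by ring
  rw [harmCoeff, harmCoeff, h2, e]
  linear_combination (-γ (a + (b + 2)) * (ε ^ 2 * ((Complex.I * ε) ^ b).re)) * h1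

/-- The particular solution with zero Cauchy data on y = 0 takes care of the source, and harmonic
polynomials even in y correct the trace on y = x degree by degree. The bound for the coefficients
with b ≥ 1 carries the factor ε². -/
theorem exists_biPoly_solution (N : ℕ) {c₀ : ℝ} (hc₀ : 0 < Real.cos c₀) (hcπ : c₀ ≤ Real.pi) :
    ∃ C : ℝ, 0 ≤ C ∧ ∀ ε : ℝ, 0 < ε → ε ≤ 1 → (∀ n < N, n * Real.arctan ε ≤ c₀) →
      ∀ (M : ℝ) (q : ℕ → ℝ) (R : ℕ → ℕ → ℝ), (∀ n, |q n| ≤ M) → (∀ a b, |R a b| ≤ M) →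
        (∀ n, N ≤ n → q n = 0) → (∀ a b, N ≤ a + b + 2 → R a b = 0) →
        ∃ c : ℕ → ℕ → ℝ, DegBelow N c ∧ (∀ a b, |c a b| ≤ C * M) ∧
          (∀ a b, |c a (b + 1)| ≤ ε ^ 2 * (C * M)) ∧ (∀ a, c a 1 = 0) ∧
          (∀ a b, coeffX (coeffX c) a b + (1 / ε) ^ 2 * coeffY (coeffY c) a b = R a b) ∧
          ∀ n, ∑ d ∈ Finset.HasAntidiagonal.antidiagonal n, c d.1 d.2 = q n := by
  set K : ℝ := (1 + (N : ℝ) ^ 2) ^ N with hK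
  have hK1 : 1 ≤ K := one_le_pow₀ (le_add_of_nonneg_right (by positivity))
  set G : ℝ := (1 + (N + 1) * K) / Real.cos c₀ with hG
  have hG0 : 0 ≤ G := by positivity
  refine ⟨K + G * 2 ^ N, by positivity, fun ε hε hε1 hn M q R hq hR hq0 hR0 => ?_⟩
  have hM : 0 ≤ M := (abs_nonneg _).trans (hq 0)
  set s : ℕ → ℕ → ℝ := fun a b => partCoeff ε R b a with hs
  have hs0 : DegBelow N s := fun a b hab => partCoeff_eq_zero hR0 b a hab
  have hε2 : ε ^ 2 ≤ 1 := pow_le_one₀ hε.le hε1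
  have hsM : ∀ a b, |s a b| ≤ ε ^ 2 * (K * M) := fun a b => by
    by_cases hb : N ≤ b
    · rw [hs0 a b (by omega), abs_zero]; positivity
    · refine (abs_partCoeff_le hε.le hε1 hM hR0 hR b a).trans ?_
      have : (1 + (N : ℝ) ^ 2) ^ b ≤ K := pow_le_pow_right₀ (le_add_of_nonneg_right (by positivity)) (by omega)
      gcongr
  have hsM' : ∀ a b, |s a b| ≤ K * M := fun a b =>
    (hsM a b).trans (mul_le_of_le_one_left (by positivity) hε2)
  -- What is missing in the coefficient of x^n on the diagonal, divided by the diagonal coefficient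
  -- of the harmonic polynomial of degree n.
  set γ : ℕ → ℝ := fun n =>
    (q n - ∑ d ∈ Finset.HasAntidiagonal.antidiagonal n, s d.1 d.2) / ((1 + Complex.I * ε) ^ n).re with hγ
  have hH : ∀ n < N, Real.cos c₀ ≤ ((1 + Complex.I * (ε : ℂ)) ^ n).re := fun n h =>
    cos_le_one_add_I_mul_pow_re hε.le hcπ hc₀.le (hn n h)
  have hs_sum0 : ∀ n, N ≤ n → ∑ d ∈ Finset.HasAntidiagonal.antidiagonal n, s d.1 d.2 = 0 := fun n h =>
    Finset.sum_eq_zero fun d hd => hs0 _ _ (by rw [Finset.HasAntidiagonal.mem_antidiagonal.1 hd]; exact h)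
  have hγ0 : ∀ n, N ≤ n → γ n = 0 := fun n h => by simp only [hγ]; rw [hq0 n h, hs_sum0 n h]; simp
  have hγM : ∀ n, |γ n| ≤ G * M := fun n => by
    rcases le_or_gt N n with h | h
    · rw [hγ0 n h, abs_zero]; positivity
    · have h1 : |q n - ∑ d ∈ Finset.HasAntidiagonal.antidiagonal n, s d.1 d.2| ≤ (1 + (N + 1) * K) * M := by
        calc _ ≤ |q n| + |∑ d ∈ Finset.HasAntidiagonal.antidiagonal n, s d.1 d.2| := abs_sub _ _
          _ ≤ M + ∑ d ∈ Finset.HasAntidiagonal.antidiagonal n, K * M :=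
            add_le_add (hq n) ((Finset.abs_sum_le_sum_abs _ _).trans
              (Finset.sum_le_sum fun d _ => hsM' _ _))
          _ ≤ M + (N + 1) * (K * M) := by
            rw [Finset.sum_const, Finset.Nat.card_antidiagonal, nsmul_eq_mul]
            have : ((n + 1 : ℕ) : ℝ) ≤ N + 1 := by exact_mod_cast (by omega : n + 1 ≤ N + 1)
            gcongr
          _ = _ := by ring
      simp only [hγ]
      rw [abs_div, hG, div_mul_eq_mul_div]
      refine div_le_div₀ (by positivity) h1 hc₀ ((hH n h).trans (le_abs_self _))
  have hh0 : DegBelow N (harmCoeff ε γ) := fun a b hab => by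
    rw [harmCoeff, hγ0 _ hab, zero_mul, zero_mul]
  have hhM : ∀ a b (E : ℝ), 0 ≤ E → |((Complex.I * (ε : ℂ)) ^ b).re| ≤ E →
      |harmCoeff ε γ a b| ≤ E * (G * 2 ^ N * M) := fun a b E hE hb => by
    rcases le_or_gt N (a + b) with h | h
    · rw [hh0 a b h, abs_zero]; positivity
    · rw [harmCoeff, abs_mul, abs_mul, Nat.abs_cast]
      have h1 : ((a + b).choose b : ℝ) ≤ 2 ^ N := by
        calc ((a + b).choose b : ℝ) ≤ 2 ^ (a + b) := by exact_mod_cast Nat.choose_le_two_pow _ _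
          _ ≤ _ := pow_le_pow_right₀ one_le_two h.le
      have h2 := hγM (a + b)
      calc _ ≤ (G * M) * 2 ^ N * E := by gcongr
        _ = _ := by ring
  have hre : ∀ b, |((Complex.I * (ε : ℂ)) ^ b).re| ≤ ε ^ b := fun b => by
    refine (Complex.abs_re_le_norm _).trans ?_
    rw [norm_pow, norm_mul, Complex.norm_I, one_mul, Complex.norm_real, Real.norm_of_nonneg hε.le]
  -- The first power is purely imaginary, so the bound ε² holds for it as well.
  have hre' : ∀ b, |((Complex.I * (ε : ℂ)) ^ (b + 1)).re| ≤ ε ^ 2 := fun b => by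
    rcases b with _ | b
    · simp; positivity
    · exact (hre _).trans (pow_le_pow_of_le_one hε.le hε1 (by omega))
  refine ⟨fun a b => s a b + harmCoeff ε γ a b, ?_, ?_, ?_, ?_, ?_, ?_⟩
  · intro a b hab
    simp only
    rw [hs0 a b hab, hh0 a b hab, add_zero]
  · intro a b
    calc _ ≤ |s a b| + |harmCoeff ε γ a b| := abs_add_le _ _
      _ ≤ K * M + 1 * (G * 2 ^ N * M) :=
        add_le_add (hsM' a b) (hhM a b 1 zero_le_one ((hre b).trans (pow_le_one₀ hε.le hε1)))
      _ = _ := by ring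
  · intro a b
    calc _ ≤ |s a (b + 1)| + |harmCoeff ε γ a (b + 1)| := abs_add_le _ _
      _ ≤ ε ^ 2 * (K * M) + ε ^ 2 * (G * 2 ^ N * M) :=
        add_le_add (hsM a _) (hhM a _ _ (by positivity) (hre' b))
      _ = _ := by ring
  · intro a
    simp [hs, partCoeff, harmCoeff]
  · intro a b
    have e1 : s a (b + 2) = ε ^ 2 / ((b + 1) * (b + 2)) * (R a b - (a + 2) * (a + 1) * s (a + 2) b) := by
      simp only [hs]; rw [partCoeff]
    have e1' : (b + 2) * (b + 1) * s a (b + 2) = ε ^ 2 * (R a b - (a + 2) * (a + 1) * s (a + 2) b) := by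
      rw [e1]; field_simp
    have e2 := harmCoeff_step ε γ a b
    have e3 : (1 / ε) ^ 2 * ε ^ 2 = 1 := by field_simp
    simp only [coeffX, coeffY]
    push_cast
    linear_combination (1 / ε) ^ 2 * e1' + (1 / ε) ^ 2 * e2
      + (R a b - (a + 2) * (a + 1) * s (a + 2) b - (a + 2) * (a + 1) * harmCoeff ε γ (a + 2) b) * e3
  · intro n
    rw [Finset.sum_add_distrib, sum_harmCoeff]
    rcases le_or_gt N n with h | h
    · rw [hs_sum0 n h, hγ0 n h, hq0 n h]; simp
    · have := (hc₀.trans_le (hH n h)).ne'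
      simp only [hγ]
      field_simp
      ring

/-! ### Polar coordinates in the wedge -/

theorem isOpen_wedge : IsOpen wedge :=
  (isOpen_lt continuous_const continuous_snd).inter (isOpen_lt continuous_snd continuous_fst)

theorem wedge_subset_wedgeBar : wedge ⊆ wedgeBar := fun _ hz => ⟨hz.1.trans hz.2, hz.1.le, hz.2.le⟩

theorem uniqueDiffOn_wedgeBar : UniqueDiffOn ℝ wedgeBar := by
  refine uniqueDiffOn_convex ?_ ⟨(2, 1), ?_⟩
  · rintro ⟨x, y⟩ ⟨h1, h2, h3⟩ ⟨x', y'⟩ ⟨h1', h2', h3'⟩ a b ha hb hab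
    simp only at h1 h2 h3 h1' h2' h3'
    refine ⟨?_, ?_, ?_⟩ <;> simp only [Prod.smul_mk, Prod.mk_add_mk, smul_eq_mul]
    · rcases ha.eq_or_lt with rfl | ha
      · have : b = 1 := by linarith
        subst this; linarith
      · have := mul_pos ha h1
        have := mul_nonneg hb h1'.le
        linarith
    · have := mul_nonneg ha h2
      have := mul_nonneg hb h2'
      linarith
    · have := mul_le_mul_of_nonneg_left h3 ha
      have := mul_le_mul_of_nonneg_left h3' hb
      linarith
  · exact interior_maximal wedge_subset_wedgeBar isOpen_wedge ⟨by norm_num, by norm_num⟩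

theorem clm_prod_eq (L : ℝ × ℝ →L[ℝ] ℝ) :
    L = L (1, 0) • ContinuousLinearMap.fst ℝ ℝ ℝ + L (0, 1) • ContinuousLinearMap.snd ℝ ℝ ℝ := by
  ext <;> simp

theorem hasFDerivWithinAt_wedgeBar {q : ℝ × ℝ → ℝ} {n : WithTop ℕ∞} (hq : ContDiffOn ℝ n q wedgeBar)
    (hn : n ≠ 0) {z : ℝ × ℝ} (hz : z ∈ wedgeBar) :
    HasFDerivWithinAt q (dX q z • ContinuousLinearMap.fst ℝ ℝ ℝ
      + dY q z • ContinuousLinearMap.snd ℝ ℝ ℝ) wedgeBar z := by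
  have h := ((hq.differentiableOn hn) z hz).hasFDerivWithinAt
  rwa [clm_prod_eq (fderivWithin ℝ q wedgeBar z)] at h

theorem dX_eq_of_hasFDerivWithinAt {q : ℝ × ℝ → ℝ} {a b : ℝ} {z : ℝ × ℝ}
    (h : HasFDerivWithinAt q (a • ContinuousLinearMap.fst ℝ ℝ ℝ
      + b • ContinuousLinearMap.snd ℝ ℝ ℝ) wedgeBar z) (hz : z ∈ wedgeBar) : dX q z = a := by
  rw [dX, h.fderivWithin (uniqueDiffOn_wedgeBar z hz)]; simp

theorem dY_eq_of_hasFDerivWithinAt {q : ℝ × ℝ → ℝ} {a b : ℝ} {z : ℝ × ℝ}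
    (h : HasFDerivWithinAt q (a • ContinuousLinearMap.fst ℝ ℝ ℝ
      + b • ContinuousLinearMap.snd ℝ ℝ ℝ) wedgeBar z) (hz : z ∈ wedgeBar) : dY q z = b := by
  rw [dY, h.fderivWithin (uniqueDiffOn_wedgeBar z hz)]; simp

theorem contDiffOn_dX {q : ℝ × ℝ → ℝ} {m n : WithTop ℕ∞} (hq : ContDiffOn ℝ n q wedgeBar)
    (hmn : m + 1 ≤ n) : ContDiffOn ℝ m (dX q) wedgeBar :=
  (hq.fderivWithin uniqueDiffOn_wedgeBar hmn).clm_apply contDiffOn_const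

theorem contDiffOn_dY {q : ℝ × ℝ → ℝ} {m n : WithTop ℕ∞} (hq : ContDiffOn ℝ n q wedgeBar)
    (hmn : m + 1 ≤ n) : ContDiffOn ℝ m (dY q) wedgeBar :=
  (hq.fderivWithin uniqueDiffOn_wedgeBar hmn).clm_apply contDiffOn_const

theorem hasDerivAt_diag {q : ℝ × ℝ → ℝ} {n : WithTop ℕ∞} (hq : ContDiffOn ℝ n q wedgeBar)
    (hn : n ≠ 0) {x : ℝ} (hx : 0 < x) :
    HasDerivAt (fun x => q (x, x)) (dX q (x, x) + dY q (x, x)) x := by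
  have h := HasFDerivWithinAt.comp_hasDerivAt (f := fun x : ℝ => (x, x)) x
    (hasFDerivWithinAt_wedgeBar hq hn (z := (x, x)) ⟨hx, hx.le, le_rfl⟩)
    ((hasDerivAt_id x).prodMk (hasDerivAt_id x)) (by
      filter_upwards [lt_mem_nhds hx] with y hy using ⟨hy, hy.le, le_rfl⟩)
  refine h.congr_deriv ?_
  simp

/-- The point with logarithmic polar coordinates `(u + s, φ)`. -/
def polarPt (ε s u φ : ℝ) : ℝ × ℝ :=
  (Real.exp (u + s) * Real.cos φ, ε⁻¹ * (Real.exp (u + s) * Real.sin φ))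

theorem continuous_polarPt (ε s : ℝ) : Continuous fun p : ℝ × ℝ => polarPt ε s p.1 p.2 := by
  unfold polarPt; fun_prop

theorem polarPt_mem_wedgeBar {ε s u φ : ℝ} (hε : 0 < ε) (hφ : φ ∈ Icc 0 (Real.arctan ε)) :
    polarPt ε s u φ ∈ wedgeBar := by
  have h2 := Real.arctan_lt_pi_div_two ε
  have hc : 0 < Real.cos φ := Real.cos_pos_of_mem_Ioo ⟨by linarith [hφ.1, Real.pi_pos], by linarith [hφ.2]⟩
  have hs : 0 ≤ Real.sin φ := Real.sin_nonneg_of_nonneg_of_le_pi hφ.1 (by linarith [hφ.2, Real.pi_pos])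
  have ht : Real.tan φ ≤ ε := by
    rw [← Real.tan_arctan ε]
    exact Real.strictMonoOn_tan.monotoneOn ⟨by linarith [hφ.1, Real.pi_pos], by linarith [hφ.2]⟩
      (Real.arctan_mem_Ioo ε) hφ.2
  rw [Real.tan_eq_sin_div_cos, div_le_iff₀ hc] at ht
  have he := Real.exp_pos (u + s)
  refine ⟨by simp only [polarPt]; positivity, by simp only [polarPt]; positivity, ?_⟩
  simp only [polarPt]
  rw [inv_mul_le_iff₀ hε]
  nlinarith

theorem polarPt_mem_wedge {ε s u φ : ℝ} (hε : 0 < ε) (hφ : φ ∈ Ioo 0 (Real.arctan ε)) :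
    polarPt ε s u φ ∈ wedge := by
  have h2 := Real.arctan_lt_pi_div_two ε
  have hc : 0 < Real.cos φ := Real.cos_pos_of_mem_Ioo ⟨by linarith [hφ.1, Real.pi_pos], by linarith [hφ.2]⟩
  have hs : 0 < Real.sin φ := Real.sin_pos_of_pos_of_lt_pi hφ.1 (by linarith [hφ.2, Real.pi_pos])
  have ht : Real.tan φ < ε := by
    rw [← Real.tan_arctan ε]
    exact Real.strictMonoOn_tan ⟨by linarith [hφ.1, Real.pi_pos], by linarith [hφ.2]⟩
      (Real.arctan_mem_Ioo ε) hφ.2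
  rw [Real.tan_eq_sin_div_cos, div_lt_iff₀ hc] at ht
  have he := Real.exp_pos (u + s)
  refine ⟨by simp only [polarPt]; positivity, ?_⟩
  simp only [polarPt]
  rw [inv_mul_lt_iff₀ hε]
  nlinarith

theorem polarPt_zero (ε s u : ℝ) : polarPt ε s u 0 = (Real.exp (u + s), 0) := by simp [polarPt]

/-- The shift by s = -log cos θ makes the variable u on the side φ = θ equal to log x instead of log
r, so the traces there are functions of x = e^u. -/
theorem polarPt_arctan {ε : ℝ} (hε : 0 < ε) (u : ℝ) :
    polarPt ε (-Real.log (Real.cos (Real.arctan ε))) u (Real.arctan ε) = (Real.exp u, Real.exp u) := by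
  have hc := Real.cos_arctan_pos ε
  have hs : Real.sin (Real.arctan ε) = ε * Real.cos (Real.arctan ε) := by
    rw [← div_eq_iff hc.ne', ← Real.tan_eq_sin_div_cos, Real.tan_arctan]
  have e : Real.exp (u + -Real.log (Real.cos (Real.arctan ε))) * Real.cos (Real.arctan ε) = Real.exp u := by
    rw [Real.exp_add, Real.exp_neg, Real.exp_log hc, mul_assoc, inv_mul_cancel₀ hc.ne', mul_one]
  rw [polarPt, hs]
  ext
  · exact e
  · simp only
    rw [← e]; field_simp

theorem hasDerivAt_polarPt_left (ε s u φ : ℝ) :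
    HasDerivAt (fun u => polarPt ε s u φ) (polarPt ε s u φ) u := by
  have h : HasDerivAt (fun u => Real.exp (u + s)) (Real.exp (u + s)) u := by
    simpa using ((hasDerivAt_id u).add_const s).exp
  exact (h.mul_const _).prodMk ((h.mul_const _).const_mul _)

theorem hasDerivAt_polarPt_right {ε : ℝ} (hε : 0 < ε) (s u φ : ℝ) :
    HasDerivAt (fun φ => polarPt ε s u φ)
      (-(ε * (polarPt ε s u φ).2), ε⁻¹ * (polarPt ε s u φ).1) φ := by
  have h1 := (Real.hasDerivAt_cos φ).const_mul (Real.exp (u + s))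
  have h2 := ((Real.hasDerivAt_sin φ).const_mul (Real.exp (u + s))).const_mul ε⁻¹
  refine (h1.prodMk h2).congr_deriv ?_
  ext
  · simp only [polarPt]; field_simp
  · simp only [polarPt]

theorem hasDerivAt_comp_polarPt_left {ε s u φ : ℝ} (hε : 0 < ε) (hφ : φ ∈ Ioo 0 (Real.arctan ε))
    {q : ℝ × ℝ → ℝ} {n : WithTop ℕ∞} (hq : ContDiffOn ℝ n q wedgeBar) (hn : n ≠ 0) :
    HasDerivAt (fun u => q (polarPt ε s u φ)) (dX q (polarPt ε s u φ) * (polarPt ε s u φ).1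
      + dY q (polarPt ε s u φ) * (polarPt ε s u φ).2) u := by
  have hz := polarPt_mem_wedge (s := s) (u := u) hε hφ
  have h1 := (hasFDerivWithinAt_wedgeBar hq hn (wedge_subset_wedgeBar hz)).hasFDerivAt
    (Filter.mem_of_superset (isOpen_wedge.mem_nhds hz) wedge_subset_wedgeBar)
  exact h1.comp_hasDerivAt u (hasDerivAt_polarPt_left ε s u φ)

theorem hasDerivAt_comp_polarPt_right {ε s u φ : ℝ} (hε : 0 < ε) (hφ : φ ∈ Ioo 0 (Real.arctan ε))
    {q : ℝ × ℝ → ℝ} {n : WithTop ℕ∞} (hq : ContDiffOn ℝ n q wedgeBar) (hn : n ≠ 0) :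
    HasDerivAt (fun φ => q (polarPt ε s u φ)) (dX q (polarPt ε s u φ) * (-(ε * (polarPt ε s u φ).2))
      + dY q (polarPt ε s u φ) * (ε⁻¹ * (polarPt ε s u φ).1)) φ := by
  have hz := polarPt_mem_wedge (s := s) (u := u) hε hφ
  have h1 := (hasFDerivWithinAt_wedgeBar hq hn (wedge_subset_wedgeBar hz)).hasFDerivAt
    (Filter.mem_of_superset (isOpen_wedge.mem_nhds hz) wedge_subset_wedgeBar)
  exact h1.comp_hasDerivAt φ (hasDerivAt_polarPt_right hε s u φ)

theorem continuousOn_comp_polarPt {ε : ℝ} (hε : 0 < ε) (s : ℝ) {q : ℝ × ℝ → ℝ}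
    (hq : ContinuousOn q wedgeBar) :
    ContinuousOn (fun p : ℝ × ℝ => q (polarPt ε s p.1 p.2)) (univ ×ˢ Icc 0 (Real.arctan ε)) :=
  hq.comp (continuous_polarPt ε s).continuousOn fun _ hp => polarPt_mem_wedgeBar hε hp.2

/-- A `C²` function on the wedge with vanishing normal derivative at `y = 0`, in logarithmic polar
coordinates. -/
theorem exists_isStripC2 {ε : ℝ} (hε : 0 < ε) (s : ℝ) {q : ℝ × ℝ → ℝ}
    (hq : ContDiffOn ℝ 2 q wedgeBar) (hN : ∀ x, 0 < x → dY q (x, 0) = 0) :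
    ∃ Uu Uuu Uφφ : ℝ → ℝ → ℝ, IsStripC2 (Real.arctan ε) (fun u φ => q (polarPt ε s u φ)) Uu
      (fun u φ => dX q (polarPt ε s u φ) * (-(ε * (polarPt ε s u φ).2))
        + dY q (polarPt ε s u φ) * (ε⁻¹ * (polarPt ε s u φ).1)) Uuu Uφφ ∧
      ∀ u φ, Uuu u φ + Uφφ u φ = Real.exp (2 * (u + s)) *
        (dX (dX q) (polarPt ε s u φ) + (1 / ε) ^ 2 * dY (dY q) (polarPt ε s u φ)) := by
  have h1 : ContDiffOn ℝ 1 (dX q) wedgeBar := contDiffOn_dX hq (by norm_num)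
  have h2 : ContDiffOn ℝ 1 (dY q) wedgeBar := contDiffOn_dY hq (by norm_num)
  have c1 := continuousOn_comp_polarPt hε s h1.continuousOn
  have c2 := continuousOn_comp_polarPt hε s h2.continuousOn
  have c3 := continuousOn_comp_polarPt hε s (contDiffOn_dX (m := 0) h1 (by norm_num)).continuousOn
  have c4 := continuousOn_comp_polarPt hε s (contDiffOn_dY (m := 0) h1 (by norm_num)).continuousOn
  have c5 := continuousOn_comp_polarPt hε s (contDiffOn_dX (m := 0) h2 (by norm_num)).continuousOn
  have c6 := continuousOn_comp_polarPt hε s (contDiffOn_dY (m := 0) h2 (by norm_num)).continuousOn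
  have cx : ContinuousOn (fun p : ℝ × ℝ => (polarPt ε s p.1 p.2).1)
    (univ ×ˢ Icc 0 (Real.arctan ε)) := (continuous_fst.comp (continuous_polarPt ε s)).continuousOn
  have cy : ContinuousOn (fun p : ℝ × ℝ => (polarPt ε s p.1 p.2).2)
    (univ ×ˢ Icc 0 (Real.arctan ε)) := (continuous_snd.comp (continuous_polarPt ε s)).continuousOn
  have d1 : ∀ u φ, HasDerivAt (fun u => (polarPt ε s u φ).1) (polarPt ε s u φ).1 u := fun u φ =>
    (hasDerivAt_polarPt_left ε s u φ).fst
  have d2 : ∀ u φ, HasDerivAt (fun u => (polarPt ε s u φ).2) (polarPt ε s u φ).2 u := fun u φ =>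
    (hasDerivAt_polarPt_left ε s u φ).snd
  have d3 : ∀ u φ, HasDerivAt (fun φ => (polarPt ε s u φ).1) (-(ε * (polarPt ε s u φ).2)) φ :=
    fun u φ => (hasDerivAt_polarPt_right hε s u φ).fst
  have d4 : ∀ u φ, HasDerivAt (fun φ => (polarPt ε s u φ).2) (ε⁻¹ * (polarPt ε s u φ).1) φ :=
    fun u φ => (hasDerivAt_polarPt_right hε s u φ).snd
  refine ⟨fun u φ => dX q (polarPt ε s u φ) * (polarPt ε s u φ).1
      + dY q (polarPt ε s u φ) * (polarPt ε s u φ).2,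
    fun u φ => ((dX (dX q) (polarPt ε s u φ) * (polarPt ε s u φ).1
        + dY (dX q) (polarPt ε s u φ) * (polarPt ε s u φ).2) * (polarPt ε s u φ).1
        + dX q (polarPt ε s u φ) * (polarPt ε s u φ).1)
      + ((dX (dY q) (polarPt ε s u φ) * (polarPt ε s u φ).1
        + dY (dY q) (polarPt ε s u φ) * (polarPt ε s u φ).2) * (polarPt ε s u φ).2
        + dY q (polarPt ε s u φ) * (polarPt ε s u φ).2),
    fun u φ => ((dX (dX q) (polarPt ε s u φ) * (-(ε * (polarPt ε s u φ).2))
        + dY (dX q) (polarPt ε s u φ) * (ε⁻¹ * (polarPt ε s u φ).1)) * (-(ε * (polarPt ε s u φ).2))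
        + dX q (polarPt ε s u φ) * (-(ε * (ε⁻¹ * (polarPt ε s u φ).1))))
      + ((dX (dY q) (polarPt ε s u φ) * (-(ε * (polarPt ε s u φ).2))
        + dY (dY q) (polarPt ε s u φ) * (ε⁻¹ * (polarPt ε s u φ).1)) * (ε⁻¹ * (polarPt ε s u φ).1)
        + dY q (polarPt ε s u φ) * (ε⁻¹ * (-(ε * (polarPt ε s u φ).2)))),
    ⟨continuousOn_comp_polarPt hε s hq.continuousOn, by fun_prop, by fun_prop, by fun_prop,
      by fun_prop, fun u φ hφ => hasDerivAt_comp_polarPt_left hε hφ hq two_ne_zero,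
      fun u φ hφ => ?_, fun u φ hφ => hasDerivAt_comp_polarPt_right hε hφ hq two_ne_zero,
      fun u φ hφ => ?_, fun u => ?_⟩, fun u φ => ?_⟩
  · exact ((hasDerivAt_comp_polarPt_left hε hφ h1 one_ne_zero).mul (d1 u φ)).add
      ((hasDerivAt_comp_polarPt_left hε hφ h2 one_ne_zero).mul (d2 u φ))
  · exact ((hasDerivAt_comp_polarPt_right hε hφ h1 one_ne_zero).mul ((d4 u φ).const_mul ε).neg).add
      ((hasDerivAt_comp_polarPt_right hε hφ h2 one_ne_zero).mul ((d3 u φ).const_mul ε⁻¹))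
  · simp only [polarPt_zero]
    rw [hN _ (Real.exp_pos _)]; simp
  · have e : Real.exp (2 * (u + s)) = (polarPt ε s u φ).1 ^ 2 + (ε * (polarPt ε s u φ).2) ^ 2 := by
      rw [two_mul, Real.exp_add]
      simp only [polarPt]
      rw [mul_inv_cancel_left₀ hε.ne']
      linear_combination (-Real.exp (u + s) ^ 2) * Real.sin_sq_add_cos_sq φ
    rw [e]
    simp only
    have h := mul_inv_cancel₀ hε.ne'
    field_simp
    ring

/-! ### Weighted norms on vertical lines -/

theorem lineL2_mono {F G : ℝ → ℝ≥0∞} (h : ∀ ξ, F ξ ≤ G ξ) : lineL2 F ≤ lineL2 G := by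
  unfold lineL2
  gcongr with ξ
  exact h ξ

theorem lineL2_const_mul {c : ℝ≥0∞} (hc : c ≠ ⊤) (F : ℝ → ℝ≥0∞) :
    lineL2 (fun ξ => c * F ξ) = c * lineL2 F := by
  unfold lineL2
  simp_rw [ENNReal.mul_rpow_of_nonneg _ _ (by norm_num : (0 : ℝ) ≤ 2)]
  rw [lintegral_const_mul' _ _ (ENNReal.rpow_ne_top_of_nonneg (by norm_num) hc),
    ENNReal.mul_rpow_of_nonneg _ _ (by norm_num), ← ENNReal.rpow_mul]
  norm_num

/-- With the factor 2 only one of the functions has to be measurable. The other one will be a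
supremum over all angles, whose measurability is not available. -/
theorem lineL2_add_le {F G : ℝ → ℝ≥0∞} (hF : AEMeasurable F volume) :
    lineL2 (fun ξ => F ξ + G ξ) ≤ 2 * (lineL2 F + lineL2 G) := by
  have h1 : ∫⁻ ξ, (F ξ + G ξ) ^ (2 : ℝ) ≤ 2 * ((∫⁻ ξ, F ξ ^ (2 : ℝ)) + ∫⁻ ξ, G ξ ^ (2 : ℝ)) := by
    rw [← lintegral_add_left' (hF.pow_const _), ← lintegral_const_mul' _ _ (by simp)]
    refine lintegral_mono fun ξ => ?_
    have := ENNReal.rpow_add_le_mul_rpow_add_rpow (F ξ) (G ξ) (p := 2) (by norm_num)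
    norm_num at this ⊢
    exact this
  unfold lineL2
  calc _ ≤ (2 * ((∫⁻ ξ, F ξ ^ (2 : ℝ)) + ∫⁻ ξ, G ξ ^ (2 : ℝ))) ^ (1 / 2 : ℝ) := by gcongr
    _ = 2 ^ (1 / 2 : ℝ) * ((∫⁻ ξ, F ξ ^ (2 : ℝ)) + ∫⁻ ξ, G ξ ^ (2 : ℝ)) ^ (1 / 2 : ℝ) :=
      ENNReal.mul_rpow_of_nonneg _ _ (by norm_num)
    _ ≤ 2 * _ := by
      refine mul_le_mul' ?_ (ENNReal.rpow_add_le_add_rpow _ _ (by norm_num) (by norm_num))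
      calc (2 : ℝ≥0∞) ^ (1 / 2 : ℝ) ≤ 2 ^ (1 : ℝ) :=
          ENNReal.rpow_le_rpow_of_exponent_le (by norm_num) (by norm_num)
        _ = 2 := ENNReal.rpow_one _

theorem lineL2_enorm (T : ℝ → ℂ) : lineL2 (fun ξ => ‖T ξ‖ₑ) = eLpNorm T 2 volume := by
  rw [eLpNorm_eq_lintegral_rpow_enorm_toReal (by simp) (by simp)]
  simp [lineL2]

theorem lintegral_mul_le_lineL2_mul {F G : ℝ → ℝ≥0∞} (hF : AEMeasurable F volume)
    (hG : AEMeasurable G volume) : ∫⁻ ξ, F ξ * G ξ ≤ lineL2 F * lineL2 G := by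
  have := ENNReal.lintegral_mul_le_Lp_mul_Lq volume Real.HolderConjugate.two_two hF hG
  simpa [lineL2] using this

/-- The norm of `|λ|^e μ^m T` in `L²(Re λ = β)`. -/
def lineNorm (ε e m β : ℝ) (T : ℝ → ℂ) : ℝ≥0∞ :=
  lineL2 fun ξ => ENNReal.ofReal (powWeight ε e m ‖linePt β ξ‖ * ‖T ξ‖)

theorem continuous_powWeight_linePt {ε e m β : ℝ} (he : 0 ≤ e ∨ β ≠ 0) (hm : 0 ≤ m) :
    Continuous fun ξ => powWeight ε e m ‖linePt β ξ‖ := by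
  unfold powWeight
  have h1 := (continuous_linePt β).norm
  refine Continuous.mul ?_ ?_
  · refine h1.rpow_const fun ξ => ?_
    rcases he with he | hβ
    · exact Or.inr he
    · left
      have := abs_le_norm_linePt β ξ
      have : 0 < |β| := abs_pos.2 hβ
      linarith
  · exact (h1.min continuous_const).rpow_const fun _ => Or.inr hm

theorem lineNorm_add_le {ε e m β : ℝ} (hε : 0 < ε) (he : 0 ≤ e ∨ β ≠ 0) (hm : 0 ≤ m) {S T : ℝ → ℂ}
    (hS : AEStronglyMeasurable S volume) :
    lineNorm ε e m β (fun ξ => S ξ + T ξ) ≤ 2 * (lineNorm ε e m β S + lineNorm ε e m β T) := by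
  have hc := continuous_powWeight_linePt (ε := ε) he hm
  refine le_trans (lineL2_mono fun ξ => ?_) (lineL2_add_le
    (ENNReal.measurable_ofReal.comp_aemeasurable (hc.aestronglyMeasurable.mul hS.norm).aemeasurable))
  have hw := powWeight_nonneg (p := e) (q := m) hε (norm_nonneg (linePt β ξ))
  simp only
  rw [← ENNReal.ofReal_add (by positivity) (by positivity), ← mul_add]
  gcongr
  exact norm_add_le _ _

theorem lineNorm_le_of_norm_le {ε e m β e' m' β' c : ℝ} {S T : ℝ → ℂ} (hc : 0 ≤ c)
    (h : ∀ ξ, powWeight ε e m ‖linePt β ξ‖ * ‖S ξ‖ ≤ c * (powWeight ε e' m' ‖linePt β' ξ‖ * ‖T ξ‖)) :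
    lineNorm ε e m β S ≤ ENNReal.ofReal c * lineNorm ε e' m' β' T := by
  unfold lineNorm
  rw [← lineL2_const_mul ENNReal.ofReal_ne_top]
  refine lineL2_mono fun ξ => ?_
  rw [← ENNReal.ofReal_mul hc]
  exact ENNReal.ofReal_le_ofReal (h ξ)

theorem one_le_norm_linePt {β : ℝ} (hβ : 1 ≤ β) (ξ : ℝ) : 1 ≤ ‖linePt β ξ‖ :=
  (hβ.trans (le_abs_self β)).trans (abs_le_norm_linePt β ξ)

theorem one_add_sq_le_norm_linePt_sq {β : ℝ} (hβ : 1 ≤ β) (ξ : ℝ) : 1 + ξ ^ 2 ≤ ‖linePt β ξ‖ ^ 2 := by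
  rw [← Complex.normSq_eq_norm_sq, Complex.normSq_apply, linePt_re]
  have := sq_le_linePt_im_sq β ξ
  nlinarith

theorem powWeight_le_rpow {ε e m r : ℝ} (hε : 0 < ε) (hm : 0 ≤ m) (hr : 0 < r) :
    powWeight ε e m r ≤ r ^ (e + m) := by
  have h1 : 0 ≤ min r (1 / ε) := le_min hr.le (by positivity)
  rw [powWeight, Real.rpow_add hr]
  gcongr
  exact min_le_left _ _

theorem one_le_powWeight {ε e m r : ℝ} (hε : 0 < ε) (hε1 : ε ≤ 1) (he : 0 ≤ e) (hm : 0 ≤ m)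
    (hr : 1 ≤ r) : 1 ≤ powWeight ε e m r := by
  have h1 : 1 ≤ min r (1 / ε) := le_min hr (by rwa [le_div_iff₀ hε, one_mul])
  exact one_le_mul_of_one_le_of_one_le (Real.one_le_rpow hr he) (Real.one_le_rpow h1 hm)

/-- The weight is at most |λ|^{e+m} for every ε, and two further powers of decay are square
integrable on the line. -/
theorem exists_lineNorm_le_of_decay : ∃ c : ℝ, 0 ≤ c ∧ ∀ {ε e m β D : ℝ} {n : ℕ} {T : ℝ → ℂ}, 0 < ε →
    0 ≤ m → e + m + 2 ≤ n → 1 ≤ β → 0 ≤ D → (∀ ξ, ‖linePt β ξ‖ ^ n * ‖T ξ‖ ≤ D) →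
    lineNorm ε e m β T ≤ ENNReal.ofReal (c * D) := by
  have hfin := (memLp_inv_one_add_sq 1).2.ne
  set c₀ : ℝ≥0∞ := lineL2 fun ξ => ENNReal.ofReal ((1 + ξ ^ 2)⁻¹) with hc₀
  have hc₀top : c₀ ≠ ⊤ := by
    have : c₀ = eLpNorm (fun ξ : ℝ => (((1 + ξ ^ 2)⁻¹ : ℝ) : ℂ)) 2 volume := by
      rw [← lineL2_enorm, hc₀]
      congr 1; funext ξ
      rw [← ofReal_norm, Complex.norm_real, Real.norm_of_nonneg (by positivity)]
    rw [this]
    exact ((memLp_inv_one_add_sq 1).ofReal (K := ℂ)).congr_norm (by fun_prop) (.of_forall fun ξ => by simp) |>.2.ne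
  refine ⟨c₀.toReal, ENNReal.toReal_nonneg, fun {ε e m β D n T} hε hm hn hβ hD h => ?_⟩
  rw [mul_comm, ENNReal.ofReal_mul hD, ENNReal.ofReal_toReal hc₀top, hc₀, ← lineL2_const_mul ENNReal.ofReal_ne_top]
  refine lineL2_mono fun ξ => ?_
  rw [← ENNReal.ofReal_mul hD]
  refine ENNReal.ofReal_le_ofReal ?_
  have hz := one_le_norm_linePt hβ ξ
  have h0 : 0 < ‖linePt β ξ‖ := by linarith
  have h2 : ‖linePt β ξ‖ ^ (e + m) * ‖linePt β ξ‖ ^ 2 ≤ ‖linePt β ξ‖ ^ n := by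
    rw [← Real.rpow_natCast, ← Real.rpow_natCast, ← Real.rpow_add h0]
    exact Real.rpow_le_rpow_of_exponent_le hz (by push_cast; linarith)
  have h3 := one_add_sq_le_norm_linePt_sq hβ ξ
  rw [← div_eq_mul_inv, le_div_iff₀ (by positivity)]
  calc _ ≤ ‖linePt β ξ‖ ^ (e + m) * ‖T ξ‖ * ‖linePt β ξ‖ ^ 2 := by
        have := powWeight_le_rpow (e := e) hε hm h0
        gcongr
    _ = ‖linePt β ξ‖ ^ (e + m) * ‖linePt β ξ‖ ^ 2 * ‖T ξ‖ := by ring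
    _ ≤ ‖linePt β ξ‖ ^ n * ‖T ξ‖ := by gcongr
    _ ≤ D := h ξ

theorem memLp_of_lineNorm {ε e m β c : ℝ} {T : ℝ → ℂ} (hT : AEStronglyMeasurable T volume) (hc : 0 < c)
    (h : ∀ ξ, c ≤ powWeight ε e m ‖linePt β ξ‖) (hfin : lineNorm ε e m β T ≠ ⊤) : MemLp T 2 volume := by
  refine ⟨hT, ?_⟩
  rw [← lineL2_enorm]
  refine lt_of_le_of_lt (b := ENNReal.ofReal c⁻¹ * lineNorm ε e m β T) ?_
    (ENNReal.mul_lt_top ENNReal.ofReal_lt_top hfin.lt_top)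
  unfold lineNorm
  rw [← lineL2_const_mul ENNReal.ofReal_ne_top]
  refine lineL2_mono fun ξ => ?_
  rw [← ENNReal.ofReal_mul (by positivity), ← ofReal_norm]
  refine ENNReal.ofReal_le_ofReal ?_
  rw [← mul_assoc]
  refine le_mul_of_one_le_left (norm_nonneg _) ?_
  rw [← div_eq_inv_mul, one_le_div hc]
  exact h ξ

/-- Cauchy–Schwarz against |λ|^{-e}, which is square integrable on the line because e > 1/2. -/
theorem exists_integral_norm_le {e β : ℝ} (he : 1 / 2 < e) (hβ : 1 ≤ β) : ∃ C : ℝ, 0 ≤ C ∧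
    ∀ {ε M : ℝ} {T : ℝ → ℂ}, 0 < ε → 0 ≤ M → AEStronglyMeasurable T volume →
      lineNorm ε e 0 β T ≤ ENNReal.ofReal M → Integrable T ∧ ∫ ξ, ‖T ξ‖ ≤ C * M := by
  have hpos : ∀ ξ, 0 < ‖linePt β ξ‖ := fun ξ => by have := one_le_norm_linePt hβ ξ; linarith
  set c₀ : ℝ≥0∞ := lineL2 fun ξ => ENNReal.ofReal (‖linePt β ξ‖ ^ (-e)) with hc₀
  have hc₀top : c₀ ≠ ⊤ := by
    have hI : Integrable (fun ξ : ℝ => (1 + ‖ξ‖ ^ 2) ^ (-(2 * e) / 2)) :=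
      integrable_rpow_neg_one_add_norm_sq (by simp; linarith)
    have h2 : ∫⁻ ξ, ENNReal.ofReal (‖linePt β ξ‖ ^ (-e)) ^ (2 : ℝ) ≠ ⊤ := by
      refine ne_top_of_le_ne_top hI.lintegral_lt_top.ne (lintegral_mono fun ξ => ?_)
      rw [ENNReal.ofReal_rpow_of_nonneg (by positivity) (by norm_num)]
      refine ENNReal.ofReal_le_ofReal ?_
      have e1 : (‖linePt β ξ‖ ^ (-e)) ^ (2 : ℝ) = (‖linePt β ξ‖ ^ 2) ^ (-(2 * e) / 2) := by
        rw [← Real.rpow_mul (norm_nonneg _), ← Real.rpow_natCast, ← Real.rpow_mul (norm_nonneg _)]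
        congr 1; push_cast; ring
      rw [e1, Real.norm_eq_abs, sq_abs]
      exact Real.rpow_le_rpow_of_nonpos (by positivity) (one_add_sq_le_norm_linePt_sq hβ ξ) (by linarith)
    rw [hc₀, lineL2]
    exact ENNReal.rpow_ne_top_of_nonneg (by norm_num) h2
  refine ⟨c₀.toReal, ENNReal.toReal_nonneg, fun {ε M T} hε hM hT h => ?_⟩
  have key : ∫⁻ ξ, ‖T ξ‖ₑ ≤ ENNReal.ofReal (c₀.toReal * M) := by
    rw [ENNReal.ofReal_mul ENNReal.toReal_nonneg, ENNReal.ofReal_toReal hc₀top]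
    refine le_trans (le_trans (lintegral_mono fun ξ => ?_) (lintegral_mul_le_lineL2_mul
      (F := fun ξ => ENNReal.ofReal (‖linePt β ξ‖ ^ (-e)))
      (G := fun ξ => ENNReal.ofReal (powWeight ε e 0 ‖linePt β ξ‖ * ‖T ξ‖)) ?_ ?_)) (mul_le_mul_right h _)
    · simp only
      rw [← ENNReal.ofReal_mul (by positivity), ← ofReal_norm, powWeight, Real.rpow_zero, mul_one,
        ← mul_assoc, ← Real.rpow_add (hpos ξ), neg_add_cancel, Real.rpow_zero, one_mul]
    · exact ENNReal.measurable_ofReal.comp_aemeasurable (((continuous_linePt β).norm.rpow_const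
        fun ξ => Or.inl (hpos ξ).ne').measurable.aemeasurable)
    · exact ENNReal.measurable_ofReal.comp_aemeasurable
        ((continuous_powWeight_linePt (Or.inl (by linarith)) le_rfl).aestronglyMeasurable.mul
          hT.norm).aemeasurable
  have hI : Integrable T := ⟨hT, key.trans_lt ENNReal.ofReal_lt_top⟩
  refine ⟨hI, ?_⟩
  rw [integral_norm_eq_lintegral_enorm hT]
  exact ENNReal.toReal_le_of_le_ofReal (by positivity) key

/-! ### Transforms of compactly supported families -/

theorem isFT_expTransform {ψ : ℝ → ℝ} (hψ : Continuous ψ) (hc : HasCompactSupport ψ) (β : ℝ) :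
    IsFT (expWeight β ψ) (fun ξ => expTransform ψ (-linePt β ξ)) := by
  have h1 : HasCompactSupport (expWeight β ψ) :=
    (hc.mul_left (f := fun u => Real.exp (-β * u))).comp_left (g := Complex.ofReal) rfl
  have h2 := continuous_expWeight (β := β) hψ
  refine (isFT_of_integrable (h2.integrable_of_hasCompactSupport h1)
    (h2.memLp_of_hasCompactSupport h1)).congr .rfl (.of_forall fun ξ => ?_)
  simp only
  rw [fourier_real_eq', expTransform]
  congr 1; funext u
  rw [expWeight, Complex.ofReal_mul, Complex.ofReal_exp, mul_comm (Complex.exp _) (ψ u : ℂ), mul_assoc,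
    ← Complex.exp_add, linePt]
  congr 2; push_cast; ring

theorem hasCompactSupport_of_abs {ψ : ℝ → ℝ} {M : ℝ} (h : ∀ u, M < |u| → ψ u = 0) :
    HasCompactSupport ψ := by
  refine HasCompactSupport.of_support_subset_isCompact (isCompact_Icc (a := -M) (b := M)) fun u hu => ?_
  by_contra hn
  exact hu (h u (by rwa [mem_Icc, ← abs_le, not_le] at hn))

/-- The transform is linear in the coefficients, so the constant depends only on the finitely many
basic families and not on the polynomials that occur later. -/
theorem exists_expTransform_sum_bound {ι E : Type*} [NormedAddCommGroup E] [NormedSpace ℝ E]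
    (s : Finset ι) {K : Set E} (hK : IsCompact K) (M B : ℝ) (m : ℕ) (F : ι → E × ℝ → ℝ)
    (hF : ∀ i, ContDiff ℝ ∞ (F i)) (hs : ∀ i, ∀ e ∈ K, ∀ u, M < |u| → F i (e, u) = 0) :
    ∃ C : ℝ, 0 ≤ C ∧ ∀ (q : ι → ℝ) (A : ℝ), (∀ i ∈ s, |q i| ≤ A) → ∀ e ∈ K, ∀ z : ℂ, |z.re| ≤ B →
      ‖z‖ ^ m * ‖expTransform (fun u => ∑ i ∈ s, q i * F i (e, u)) z‖ ≤ C * A := by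
  choose C hC0 hC using fun i => exists_expTransform_bound hK M B m (F i) (hF i) (hs i)
  refine ⟨∑ i ∈ s, C i, Finset.sum_nonneg fun i _ => hC0 i, fun q A hq e he z hz => ?_⟩
  have hint : ∀ i, Integrable fun u : ℝ => (F i (e, u) : ℂ) * Complex.exp (z * u) := fun i => by
    have hc : Continuous fun u : ℝ => F i (e, u) := (hF i).continuous.comp (by fun_prop)
    refine Continuous.integrable_of_hasCompactSupport (by fun_prop) ?_
    exact ((hasCompactSupport_of_abs (hs i e he)).comp_left (g := Complex.ofReal) rfl).mul_right
  have e1 : expTransform (fun u => ∑ i ∈ s, q i * F i (e, u)) z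
      = ∑ i ∈ s, (q i : ℂ) * expTransform (fun u => F i (e, u)) z := by
    simp only [expTransform]
    rw [show (fun u : ℝ => ((∑ i ∈ s, q i * F i (e, u) : ℝ) : ℂ) * Complex.exp (z * u))
      = fun u : ℝ => ∑ i ∈ s, (q i : ℂ) * ((F i (e, u) : ℂ) * Complex.exp (z * u)) from funext fun u => by
        push_cast; rw [Finset.sum_mul]; exact Finset.sum_congr rfl fun _ _ => by ring,
      integral_finsetSum _ fun i _ => (hint i).const_mul _]
    exact Finset.sum_congr rfl fun i _ => integral_const_mul _ _
  rw [e1, Finset.sum_mul]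
  calc _ ≤ ‖z‖ ^ m * ∑ i ∈ s, |q i| * ‖expTransform (fun u => F i (e, u)) z‖ := by
        gcongr
        refine (norm_sum_le _ _).trans_eq (Finset.sum_congr rfl fun i _ => ?_)
        rw [norm_mul, Complex.norm_real, Real.norm_eq_abs]
    _ = ∑ i ∈ s, |q i| * (‖z‖ ^ m * ‖expTransform (fun u => F i (e, u)) z‖) := by
        rw [Finset.mul_sum]; exact Finset.sum_congr rfl fun _ _ => by ring
    _ ≤ ∑ i ∈ s, C i * A := Finset.sum_le_sum fun i hi => by
        rw [mul_comm (C i)]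
        exact mul_le_mul (hq i hi) (hC i e he z hz) (by positivity) ((abs_nonneg _).trans (hq i hi))

/-! ### Logarithmic change of variables -/

/-- With x = e^u the measure dx is e^u du; thus plain L² on the half line is the line Re λ = -1/2.
-/
theorem eLpNorm_Ioi_eq (F : ℝ → ℝ) :
    eLpNorm F 2 (volume.restrict (Ioi 0)) = eLpNorm (logWeight (-1 / 2) F) 2 volume := by
  rw [eLpNorm_eq_lintegral_rpow_enorm_toReal (by simp) (by simp),
    eLpNorm_eq_lintegral_rpow_enorm_toReal (by simp) (by simp)]
  have h := lintegral_image_eq_lintegral_abs_deriv_mul (s := univ) (f := Real.exp) MeasurableSet.univ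
    (fun x _ => (Real.hasDerivAt_exp x).hasDerivWithinAt) Real.exp_injective.injOn
    (fun x => ‖F x‖ₑ ^ (2 : ℝ))
  rw [image_univ, Real.range_exp, Measure.restrict_univ] at h
  simp only [ENNReal.toReal_ofNat]
  rw [h]
  congr 2; funext u
  rw [logWeight, ← ofReal_norm, ← ofReal_norm, Complex.norm_real, norm_mul,
    Real.norm_of_nonneg (Real.exp_pos _).le, abs_of_pos (Real.exp_pos _),
    ENNReal.ofReal_mul (Real.exp_pos _).le, ENNReal.mul_rpow_of_nonneg _ _ (by norm_num),
    ENNReal.ofReal_rpow_of_pos (Real.exp_pos _), ← Real.exp_mul]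
  congr 3; ring

/-! ### Cut-offs -/

namespace IsCutoff

variable {a b : ℝ} {ζ : ℝ → ℝ}

theorem contDiff_deriv (h : IsCutoff a b ζ) : ContDiff ℝ ∞ (deriv ζ) :=
  (contDiff_infty_iff_deriv.1 h.smooth).2

theorem contDiff_deriv_deriv (h : IsCutoff a b ζ) : ContDiff ℝ ∞ (deriv (deriv ζ)) :=
  (contDiff_infty_iff_deriv.1 h.contDiff_deriv).2

theorem deriv_eq_zero (h : IsCutoff a b ζ) {r : ℝ} (hr : r < a ∨ b < r) : deriv ζ r = 0 := by
  rcases hr with hr | hr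
  · have : ζ =ᶠ[nhds r] fun _ => 1 := by
      filter_upwards [gt_mem_nhds hr] with x hx using h.eq_one x hx.le
    rw [this.deriv_eq]; simp
  · have : ζ =ᶠ[nhds r] fun _ => 0 := by
      filter_upwards [lt_mem_nhds hr] with x hx using h.eq_zero x hx.le
    rw [this.deriv_eq]; simp

theorem deriv_deriv_eq_zero (h : IsCutoff a b ζ) {r : ℝ} (hr : r < a ∨ b < r) :
    deriv (deriv ζ) r = 0 := by
  have : deriv ζ =ᶠ[nhds r] fun _ => 0 := by
    rcases hr with hr | hr
    · filter_upwards [gt_mem_nhds hr] with x hx using h.deriv_eq_zero (Or.inl hx)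
    · filter_upwards [lt_mem_nhds hr] with x hx using h.deriv_eq_zero (Or.inr hx)
  rw [this.deriv_eq]; simp

theorem exists_bound (h : IsCutoff a b ζ) : ∃ Z, 0 ≤ Z ∧ ∀ r, |ζ r| ≤ Z := by
  obtain ⟨Z, hZ⟩ := (isCompact_Icc (a := a) (b := b)).exists_bound_of_continuousOn
    h.smooth.continuous.continuousOn
  refine ⟨max Z 1, by positivity, fun r => ?_⟩
  rcases le_total r a with h1 | h1
  · rw [h.eq_one r h1]; simp
  · rcases le_total r b with h2 | h2
    · exact (hZ r ⟨h1, h2⟩).trans (le_max_left _ _)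
    · rw [h.eq_zero r h2]; simp

end IsCutoff

theorem exp_neg_three_lt : Real.exp (-3) < 1 / 8 := by
  rw [Real.exp_neg, one_div]
  have h1 := Real.exp_one_gt_d9
  have h3 : Real.exp 3 = Real.exp 1 ^ 3 := by rw [← Real.exp_nat_mul]; norm_num
  refine inv_strictAnti₀ (by norm_num) ?_
  rw [h3]
  calc (8 : ℝ) = 2 ^ 3 := by norm_num
    _ < _ := by gcongr; linarith

theorem comp_exp_eq_zero {χ : ℝ → ℝ} (hs : ∀ r, r < 1 / 8 ∨ 1 / 4 < r → χ r = 0) {u : ℝ}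
    (hu : 3 < |u|) : χ (Real.exp u) = 0 := by
  refine hs _ ?_
  rcases lt_abs.1 hu with h | h
  · right
    have : 1 ≤ Real.exp u := Real.one_le_exp (by linarith)
    linarith
  · left
    exact (Real.exp_lt_exp.2 (by linarith)).trans exp_neg_three_lt

/-- `∑ q_n χ(e^u) e^{nu}`. -/
def expSum (χ : ℝ → ℝ) (N : ℕ) (q : ℕ → ℝ) (u : ℝ) : ℝ :=
  ∑ n ∈ Finset.range N, q n * (χ (Real.exp u) * Real.exp u ^ n)

theorem expSum_eq (χ : ℝ → ℝ) (N : ℕ) (q : ℕ → ℝ) (u : ℝ) :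
    expSum χ N q u = χ (Real.exp u) * ∑ n ∈ Finset.range N, q n * Real.exp u ^ n := by
  rw [expSum, Finset.mul_sum]
  exact Finset.sum_congr rfl fun _ _ => by ring

theorem continuous_expSum {χ : ℝ → ℝ} (hχ : ContDiff ℝ ∞ χ) (N : ℕ) (q : ℕ → ℝ) :
    Continuous (expSum χ N q) := by
  have := hχ.continuous
  unfold expSum
  fun_prop

theorem hasCompactSupport_expSum {χ : ℝ → ℝ} (hs : ∀ r, r < 1 / 8 ∨ 1 / 4 < r → χ r = 0) (N : ℕ)
    (q : ℕ → ℝ) : HasCompactSupport (expSum χ N q) :=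
  hasCompactSupport_of_abs (M := 3) fun u hu => by rw [expSum_eq, comp_exp_eq_zero hs hu, zero_mul]

theorem exists_expTransform_expSum_bound {χ : ℝ → ℝ} (hχ : ContDiff ℝ ∞ χ)
    (hs : ∀ r, r < 1 / 8 ∨ 1 / 4 < r → χ r = 0) (N : ℕ) (B : ℝ) (m : ℕ) : ∃ C : ℝ, 0 ≤ C ∧
      ∀ (q : ℕ → ℝ) (A : ℝ), (∀ n < N, |q n| ≤ A) → ∀ z : ℂ, |z.re| ≤ B →
        ‖z‖ ^ m * ‖expTransform (expSum χ N q) z‖ ≤ C * A := by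
  obtain ⟨C, hC0, hC⟩ := exists_expTransform_sum_bound (E := ℝ) (Finset.range N)
    (isCompact_singleton (x := (0 : ℝ))) 3 B m
    (fun n p => χ (Real.exp p.2) * Real.exp p.2 ^ n) (fun n => by fun_prop)
    (fun n e _ u hu => by simp only; rw [comp_exp_eq_zero hs hu, zero_mul])
  exact ⟨C, hC0, fun q A hq z hz => hC q A (fun i hi => hq i (Finset.mem_range.1 hi)) 0 rfl z hz⟩

/-- Norms on vertical lines of `∑ q_n χ(e^u) e^{nu}`. -/
theorem exists_lineNorm_expSum_le {χ : ℝ → ℝ} (hχ : ContDiff ℝ ∞ χ)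
    (hs : ∀ r, r < 1 / 8 ∨ 1 / 4 < r → χ r = 0) (N : ℕ) {e m : ℝ} (hm : 0 ≤ m) (B : ℝ) : ∃ C : ℝ, 0 ≤ C ∧
      ∀ {ε β A : ℝ} {q : ℕ → ℝ}, 0 < ε → 1 ≤ β → β ≤ B → 0 ≤ A → (∀ n < N, |q n| ≤ A) →
        lineNorm ε e m β (fun ξ => expTransform (expSum χ N q) (-linePt β ξ)) ≤ ENNReal.ofReal (C * A) := by
  obtain ⟨n, hn⟩ := exists_nat_ge (e + m + 2)
  obtain ⟨C, hC0, hC⟩ := exists_expTransform_expSum_bound hχ hs N B n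
  obtain ⟨c, hc0, hc⟩ := exists_lineNorm_le_of_decay
  refine ⟨c * C, by positivity, fun {ε β A q} hε hβ hβB hA hq => ?_⟩
  rw [mul_assoc]
  refine hc hε hm hn hβ (by positivity) fun ξ => ?_
  have := hC q A hq (-linePt β ξ) (by simp [abs_of_nonneg (by linarith : 0 ≤ β), hβB])
  rwa [norm_neg] at this

theorem aestronglyMeasurable_expTransform_line {ψ : ℝ → ℝ} (hψ : Continuous ψ)
    (hc : HasCompactSupport ψ) (β : ℝ) :
    AEStronglyMeasurable (fun ξ => expTransform ψ (-linePt β ξ)) volume :=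
  (isFT_expTransform hψ hc β).memLp_right.1

theorem norm_linePt_mono {β γ : ℝ} (hβ : 0 ≤ β) (h : β ≤ γ) (ξ : ℝ) : ‖linePt β ξ‖ ≤ ‖linePt γ ξ‖ := by
  rw [← sq_le_sq₀ (norm_nonneg _) (norm_nonneg _), ← Complex.normSq_eq_norm_sq,
    ← Complex.normSq_eq_norm_sq, Complex.normSq_apply, Complex.normSq_apply]
  simp only [linePt_re, linePt_im]
  nlinarith

theorem lineNorm_zero_zero (ε β : ℝ) (T : ℝ → ℂ) : lineNorm ε 0 0 β T = eLpNorm T 2 volume := by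
  rw [← lineL2_enorm, lineNorm]
  congr 1; funext ξ
  rw [powWeight, Real.rpow_zero, Real.rpow_zero, one_mul, one_mul, ofReal_norm]

/-! ### The norm of a derivative on the half line -/

theorem powWeight_mul_self {ε e m r : ℝ} (hr : 0 < r) :
    powWeight ε e m r * r = powWeight ε (e + 1) m r := by
  rw [powWeight, powWeight, Real.rpow_add hr, Real.rpow_one]; ring

theorem polyNorm_le {P : Polynomial ℝ} {L : ℕ} {A : ℝ} (hA : 0 ≤ A) (hs : P.support ⊆ Finset.range L)
    (h : ∀ n, |P.coeff n| ≤ A) : polyNorm P ≤ L * A := by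
  rw [polyNorm, Real.sqrt_le_left (by positivity)]
  calc ∑ i ∈ P.support, P.coeff i ^ 2 ≤ ∑ i ∈ Finset.range L, A ^ 2 :=
        (Finset.sum_le_sum fun i _ => by rw [← sq_abs]; gcongr; exact h i).trans
          (Finset.sum_le_sum_of_subset_of_nonneg hs fun _ _ _ => by positivity)
    _ = L * A ^ 2 := by rw [Finset.sum_const, Finset.card_range, nsmul_eq_mul]
    _ ≤ L ^ 2 * A ^ 2 := by
        gcongr
        rcases L.eq_zero_or_pos with rfl | hL
        · simp
        · have : (1 : ℝ) ≤ L := by exact_mod_cast hL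
          nlinarith
    _ = _ := by ring

theorem abs_coeff_le_polyNorm (P : Polynomial ℝ) (n : ℕ) : |P.coeff n| ≤ polyNorm P := by
  by_cases h : n ∈ P.support
  · rw [polyNorm, ← Real.sqrt_sq_eq_abs]
    exact Real.sqrt_le_sqrt (Finset.single_le_sum (f := fun i => P.coeff i ^ 2)
      (fun i _ => sq_nonneg _) h)
  · rw [Polynomial.notMem_support_iff.1 h, abs_zero]; exact Real.sqrt_nonneg _

theorem IsFT.sub_self_deriv {β : ℝ} {G G' : ℝ → ℝ} {T : ℝ → ℂ} (H : IsFT (expWeight β G) T)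
    (hG : ∀ u, HasDerivAt G (G' u) u) (hG' : Continuous G')
    (hT : MemLp (fun ξ => linePt β ξ * T ξ) 2 volume) :
    IsFT (expWeight β (fun u => G' u - G u)) (fun ξ => (linePt β ξ - 1) * T ξ) := by
  refine ((H.hasDeriv hG hG' hT).sub H).congr (.of_forall fun u => ?_) (.of_forall fun ξ => by ring)
  simp only [expWeight]; push_cast; ring

theorem memLp_linePt_mul {ε e m β : ℝ} {T : ℝ → ℂ} (hε : 0 < ε) (hε1 : ε ≤ 1) (he : 1 ≤ e) (hm : 0 ≤ m)
    (hβ : 1 ≤ β) (hT : AEStronglyMeasurable T volume) (hfin : lineNorm ε e m β T ≠ ⊤) :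
    MemLp (fun ξ => linePt β ξ * T ξ) 2 volume := by
  refine memLp_of_lineNorm (ε := ε) (e := e - 1) (m := m) (β := β) (c := 1)
    ((continuous_linePt β).aestronglyMeasurable.mul hT) one_pos
    (fun ξ => one_le_powWeight hε hε1 (by linarith) hm (one_le_norm_linePt hβ ξ))
    (ne_top_of_le_ne_top hfin ?_)
  refine lineL2_mono fun ξ => ENNReal.ofReal_le_ofReal ?_
  have h0 : 0 < ‖linePt β ξ‖ := by have := one_le_norm_linePt hβ ξ; linarith
  rw [norm_mul, ← mul_assoc, powWeight_mul_self h0, sub_add_cancel]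

theorem deriv_sum_range (L : ℕ) (a : ℕ → ℝ) (x : ℝ) :
    HasDerivAt (fun x => ∑ n ∈ Finset.range (L + 1), a n * x ^ n)
      (∑ n ∈ Finset.range L, (n + 1) * a (n + 1) * x ^ n) x := by
  have h : HasDerivAt (fun x => ∑ n ∈ Finset.range (L + 1), a n * x ^ n)
      (∑ n ∈ Finset.range (L + 1), a n * (n * x ^ (n - 1))) x :=
    HasDerivAt.fun_sum fun n _ => (hasDerivAt_pow n x).const_mul (a n)
  refine h.congr_deriv ?_
  rw [Finset.sum_range_succ']
  simp only [Nat.cast_zero, zero_mul, mul_zero, add_zero, Nat.add_sub_cancel]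
  exact Finset.sum_congr rfl fun n _ => by push_cast; ring

theorem exists_xNorm_deriv_le {ζ : ℝ → ℝ} (hζ : IsCutoff (1 / 8) (1 / 4) ζ) {k : ℝ} (hk : 1 ≤ k) :
    ∃ C : ℝ, 0 ≤ C ∧ ∀ {ε M : ℝ} {b G G' : ℝ → ℝ} {T₁ T₂ : ℝ → ℂ} {a κ : ℕ → ℝ}, 0 < ε → ε ≤ 1 →
      (∀ n, |a n| ≤ M) → (∀ n, |κ n| ≤ M) →
      (∀ x, 0 < x → b x = G (Real.log x) / x
        + deriv ζ x * ∑ n ∈ Finset.range (⌈3 * k - 1 / 2⌉₊ + 2), κ n * x ^ n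
        + ζ x * ∑ n ∈ Finset.range (⌈3 * k - 1 / 2⌉₊ + 1), a n * x ^ n) →
      (∀ u, HasDerivAt G (G' u) u) → Continuous G' →
      IsFT (expWeight (3 / 2) G) T₁ → lineNorm ε 1 0 (3 / 2) T₁ ≤ ENNReal.ofReal M →
      IsFT (expWeight (3 * k + 3 / 2) G) T₂ →
      lineNorm ε (3 * k + 2) k (3 * k + 3 / 2) T₂ ≤ ENNReal.ofReal M →
      xNorm ζ ε k (deriv b) ≤ ENNReal.ofReal (C * M) := by
  set L := ⌈3 * k - 1 / 2⌉₊ with hL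
  have hs1 : ∀ r, r < 1 / 8 ∨ 1 / 4 < r → deriv ζ r = 0 := fun r hr => hζ.deriv_eq_zero hr
  have hs2 : ∀ r, r < 1 / 8 ∨ 1 / 4 < r → deriv (deriv ζ) r = 0 := fun r hr => hζ.deriv_deriv_eq_zero hr
  obtain ⟨C₁, hC₁, h₁⟩ := exists_lineNorm_expSum_le hζ.contDiff_deriv hs1 (L + 1) (e := 0) le_rfl 1
  obtain ⟨C₂, hC₂, h₂⟩ := exists_lineNorm_expSum_le hζ.contDiff_deriv_deriv hs2 (L + 2) (e := 0) le_rfl 1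
  obtain ⟨C₃, hC₃, h₃⟩ := exists_lineNorm_expSum_le hζ.contDiff_deriv hs1 (L + 1) (e := 3 * k + 1)
    (m := k) (by linarith) (3 * k - 1 / 2)
  obtain ⟨C₄, hC₄, h₄⟩ := exists_lineNorm_expSum_le hζ.contDiff_deriv_deriv hs2 (L + 2) (e := 3 * k + 1)
    (m := k) (by linarith) (3 * k - 1 / 2)
  refine ⟨L * (L + 1) + (2 + 2 * (C₁ * (L + 3) + C₂)) + 2 * (2 * (C₃ * (L + 3) + C₄) + 2), by positivity,
    fun {ε M b G G' T₁ T₂ a κ} hε hε1 ha hκ hb hG hG' H₁ hT₁ H₂ hT₂ => ?_⟩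
  have hM : 0 ≤ M := (abs_nonneg _).trans (ha 0)
  set q₁ : ℕ → ℝ := fun n => (n + 1) * κ (n + 1) + a n with hq₁
  have hq₁M : ∀ n < L + 1, |q₁ n| ≤ (L + 3) * M := fun n hn => by
    have hn' : (n : ℝ) + 1 ≤ L + 1 := by exact_mod_cast hn
    calc _ ≤ |((n : ℝ) + 1) * κ (n + 1)| + |a n| := abs_add_le _ _
      _ ≤ (L + 1) * M + M := by
        rw [abs_mul, abs_of_nonneg (by positivity : (0 : ℝ) ≤ n + 1)]
        have := hκ (n + 1)
        have := ha n
        gcongr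
      _ ≤ _ := by linarith
  have hL3 : 0 ≤ ((L : ℝ) + 3) * M := by positivity
  set K₁ := expSum (deriv ζ) (L + 1) q₁ with hK₁
  set K₂ := expSum (deriv (deriv ζ)) (L + 2) κ with hK₂
  have cK₁ : Continuous K₁ := continuous_expSum hζ.contDiff_deriv _ _
  have cK₂ : Continuous K₂ := continuous_expSum hζ.contDiff_deriv_deriv _ _
  have sK₁ : HasCompactSupport K₁ := hasCompactSupport_expSum hs1 _ _
  have sK₂ : HasCompactSupport K₂ := hasCompactSupport_expSum hs2 _ _
  -- The degree drops from at most L to less than L, as required of the polynomial part.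
  set P : Polynomial ℝ := ∑ n ∈ Finset.range L, Polynomial.C ((n + 1) * a (n + 1)) * Polynomial.X ^ n with hP
  have hPe : ∀ x, P.eval x = ∑ n ∈ Finset.range L, (n + 1) * a (n + 1) * x ^ n := fun x => by
    rw [hP, Polynomial.eval_finsetSum]
    exact Finset.sum_congr rfl fun n _ => by simp
  have hPd : P ∈ Polynomial.degreeLT ℝ L := by
    rw [hP]
    refine Submodule.sum_mem _ fun n hn => ?_
    rw [Polynomial.mem_degreeLT]
    exact (Polynomial.degree_C_mul_X_pow_le _ _).trans_lt (by exact_mod_cast Finset.mem_range.1 hn)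
  have hPc : ∀ n, |P.coeff n| ≤ (L + 1) * M := fun n => by
    rw [hP, Polynomial.finsetSum_coeff]
    simp only [Polynomial.coeff_C_mul_X_pow]
    rw [Finset.sum_ite_eq]
    split_ifs with h
    · have hn' : (n : ℝ) + 1 ≤ L + 1 := by
        have := Finset.mem_range.1 h
        exact_mod_cast (by omega : n + 1 ≤ L + 1)
      rw [abs_mul, abs_of_nonneg (by positivity : (0 : ℝ) ≤ n + 1)]
      have := ha (n + 1)
      gcongr
    · rw [abs_zero]; positivity
  have hPs : P.support ⊆ Finset.range L := fun n hn => by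
    rw [Finset.mem_range]
    by_contra h
    have h1 := Polynomial.mem_degreeLT.1 hPd
    exact Polynomial.mem_support_iff.1 hn (Polynomial.coeff_eq_zero_of_degree_lt
      (h1.trans_le (by exact_mod_cast not_lt.1 h)))
  have hder : ∀ u, deriv b (Real.exp u) - ζ (Real.exp u) * P.eval (Real.exp u)
      = Real.exp (-(2 * u)) * (G' u - G u) + (K₁ u + K₂ u) := fun u => by
    have hx := Real.exp_pos u
    set x := Real.exp u with hxdef
    have d1 : HasDerivAt (fun y => G (Real.log y) / y)
        ((G' (Real.log x) * x⁻¹ * x - G (Real.log x) * 1) / x ^ 2) x :=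
      ((hG _).comp x (Real.hasDerivAt_log hx.ne')).div (hasDerivAt_id x) hx.ne'
    have d2 := (((contDiff_infty_iff_deriv.1 hζ.contDiff_deriv).1 x).hasDerivAt).mul
      (deriv_sum_range (L + 1) κ x)
    have d3 := ((contDiff_infty_iff_deriv.1 hζ.smooth).1 x).hasDerivAt.mul (deriv_sum_range L a x)
    have d4 := ((d1.add d2).add d3).congr_of_eventuallyEq (f₁ := b) (by
      filter_upwards [lt_mem_nhds hx] with y hy using hb y hy)
    rw [d4.deriv, hPe, hK₁, hK₂, expSum_eq, expSum_eq, hxdef, Real.log_exp]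
    have e1 : Real.exp (-(2 * u)) = (Real.exp u ^ 2)⁻¹ := by
      rw [Real.exp_neg, ← Real.exp_nat_mul]; norm_num
    have e2 : ∑ n ∈ Finset.range (L + 1), q₁ n * Real.exp u ^ n
        = ∑ n ∈ Finset.range (L + 1), (n + 1) * κ (n + 1) * Real.exp u ^ n
          + ∑ n ∈ Finset.range (L + 1), a n * Real.exp u ^ n := by
      rw [← Finset.sum_add_distrib]
      exact Finset.sum_congr rfl fun n _ => by simp only [hq₁]; ring
    rw [e1, e2]
    have hx' := (Real.exp_pos u).ne'
    field_simp
    ring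
  have hlog : ∀ γ, logWeight γ (fun x => deriv b x - ζ x * P.eval x)
      = fun u => expWeight (γ + 2) (fun u => G' u - G u) u + expWeight γ (fun u => K₁ u + K₂ u) u :=
    fun γ => funext fun u => by
      simp only [logWeight, expWeight]
      rw [hder u, ← Complex.ofReal_add, mul_add, ← mul_assoc, ← Real.exp_add]
      congr 4; ring
  have hm₁ := memLp_linePt_mul hε hε1 le_rfl le_rfl (by norm_num) H₁.memLp_right.1
    (ne_top_of_le_ne_top ENNReal.ofReal_ne_top hT₁)
  have hm₂ := memLp_linePt_mul hε hε1 (by linarith) (by linarith) (by linarith) H₂.memLp_right.1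
    (ne_top_of_le_ne_top ENNReal.ofReal_ne_top hT₂)
  have W₁ := H₁.sub_self_deriv hG hG' hm₁
  have W₂ := H₂.sub_self_deriv hG hG' hm₂
  have hsub : ∀ {β : ℝ}, 1 ≤ β → ∀ ξ, ‖linePt β ξ - 1‖ ≤ 2 * ‖linePt β ξ‖ := fun {β} hβ ξ => by
    have h1 := one_le_norm_linePt hβ ξ
    have h2 := norm_sub_le (linePt β ξ) 1
    rw [norm_one] at h2
    linarith
  have FK : ∀ β, IsFT (expWeight β (fun u => K₁ u + K₂ u))
      (fun ξ => expTransform K₁ (-linePt β ξ) + expTransform K₂ (-linePt β ξ)) := fun β => by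
    refine ((isFT_expTransform cK₁ sK₁ β).add (isFT_expTransform cK₂ sK₂ β)).congr
      (.of_forall fun u => ?_) .rfl
    simp only [expWeight]; push_cast; ring
  have mK₁ : ∀ β, AEStronglyMeasurable (fun ξ => expTransform K₁ (-linePt β ξ)) volume :=
    aestronglyMeasurable_expTransform_line cK₁ sK₁
  have mK₂ : ∀ β, AEStronglyMeasurable (fun ξ => expTransform K₂ (-linePt β ξ)) volume :=
    aestronglyMeasurable_expTransform_line cK₂ sK₂
  have hL2 : eLpNorm (fun x => deriv b x - ζ x * P.eval x) 2 (volume.restrict (Ioi 0))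
      ≤ ENNReal.ofReal ((2 + 2 * (C₁ * (L + 3) + C₂)) * M) := by
    rw [eLpNorm_Ioi_eq, hlog]
    have e32 : (-1 / 2 + 2 : ℝ) = 3 / 2 := by norm_num
    rw [e32]
    refine (eLpNorm_add_le W₁.memLp_left.1 (FK (-1 / 2)).memLp_left.1 (by norm_num)).trans ?_
    have b1 : eLpNorm (expWeight (3 / 2) fun u => G' u - G u) 2 volume ≤ ENNReal.ofReal (2 * M) := by
      rw [← W₁.eLpNorm_eq, ← lineNorm_zero_zero ε (3 / 2), ENNReal.ofReal_mul (by norm_num)]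
      refine (lineNorm_le_of_norm_le (e' := 1) (m' := 0) (β' := 3 / 2) (T := T₁) (c := 2) (by norm_num)
        fun ξ => ?_).trans (mul_le_mul_right hT₁ _)
      rw [powWeight, powWeight, norm_mul]
      simp only [Real.rpow_zero, Real.rpow_one, one_mul, mul_one]
      rw [← mul_assoc]
      exact mul_le_mul_of_nonneg_right (hsub (by norm_num) ξ) (norm_nonneg _)
    have b2 : eLpNorm (expWeight (-1 / 2) fun u => K₁ u + K₂ u) 2 volume
        ≤ ENNReal.ofReal (2 * (C₁ * (L + 3) + C₂) * M) := by
      have hle : eLpNorm (expWeight (-1 / 2) fun u => K₁ u + K₂ u) 2 volume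
          ≤ eLpNorm (expWeight 1 fun u => K₁ u + K₂ u) 2 volume := by
        refine eLpNorm_mono fun u => ?_
        simp only [expWeight, Complex.norm_real, norm_mul, Real.norm_of_nonneg (Real.exp_pos _).le]
        rcases le_total u 0 with hu | hu
        · exact mul_le_mul_of_nonneg_right (Real.exp_le_exp.2 (by linarith)) (norm_nonneg _)
        · have h1 : 1 / 4 < Real.exp u := by have := Real.one_le_exp hu; linarith
          rw [hK₁, hK₂, expSum_eq, expSum_eq, hs1 _ (Or.inr h1), hs2 _ (Or.inr h1)]
          simp
      refine hle.trans ?_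
      rw [← (FK 1).eLpNorm_eq, ← lineNorm_zero_zero ε 1]
      refine (lineNorm_add_le hε (Or.inl le_rfl) le_rfl (mK₁ 1)).trans ?_
      have c1 := h₁ (ε := ε) (q := q₁) hε le_rfl le_rfl hL3 hq₁M
      have c2 := h₂ (ε := ε) (q := κ) hε le_rfl le_rfl hM (fun n _ => hκ n)
      calc _ ≤ 2 * (ENNReal.ofReal (C₁ * ((L + 3) * M)) + ENNReal.ofReal (C₂ * M)) := by gcongr
        _ = _ := by
          rw [← ENNReal.ofReal_add (by positivity) (by positivity), ← ENNReal.ofReal_ofNat,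
            ← ENNReal.ofReal_mul (by norm_num)]
          congr 1; ring
    refine (add_le_add b1 b2).trans_eq ?_
    rw [← ENNReal.ofReal_add (by positivity) (by positivity)]
    congr 1; ring
  have hhom : xHom ε k (fun x => deriv b x - ζ x * P.eval x)
      ≤ ENNReal.ofReal (2 * (2 * (C₃ * (L + 3) + C₄) + 2) * M) := by
    have eB : (3 * k - 1 / 2 + 2 : ℝ) = 3 * k + 3 / 2 := by ring
    have hmel : IsMellinOn (3 * k - 1 / 2) (fun x => deriv b x - ζ x * P.eval x)
        (fun ξ => (expTransform K₁ (-linePt (3 * k - 1 / 2) ξ) + expTransform K₂ (-linePt (3 * k - 1 / 2) ξ))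
          + (linePt (3 * k + 3 / 2) ξ - 1) * T₂ ξ) := by
      rw [isMellinOn_iff, hlog, eB]
      exact ((FK _).add W₂).congr (.of_forall fun u => by ring) .rfl
    rw [xHom]
    refine iInf₂_le_of_le _ hmel ?_
    change lineNorm ε (3 * k + 1) k (3 * k - 1 / 2) _ ≤ _
    refine (lineNorm_add_le hε (Or.inl (by linarith)) (by linarith) ((mK₁ _).add (mK₂ _))).trans ?_
    have c1 := h₃ (ε := ε) (β := 3 * k - 1 / 2) (q := q₁) hε (by linarith) le_rfl hL3 hq₁M
    have c2 := h₄ (ε := ε) (β := 3 * k - 1 / 2) (q := κ) hε (by linarith) le_rfl hM (fun n _ => hκ n)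
    have c3 : lineNorm ε (3 * k + 1) k (3 * k - 1 / 2) (fun ξ => (linePt (3 * k + 3 / 2) ξ - 1) * T₂ ξ)
        ≤ ENNReal.ofReal (2 * M) := by
      rw [ENNReal.ofReal_mul (by norm_num)]
      refine (lineNorm_le_of_norm_le (e' := 3 * k + 2) (m' := k) (β' := 3 * k + 3 / 2) (T := T₂) (c := 2)
        (by norm_num) fun ξ => ?_).trans (mul_le_mul_right hT₂ _)
      have hz1 := one_le_norm_linePt (β := 3 * k + 3 / 2) (by linarith) ξ
      have hle : ‖linePt (3 * k - 1 / 2) ξ‖ ≤ ‖linePt (3 * k + 3 / 2) ξ‖ :=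
        norm_linePt_mono (by linarith) (by linarith) ξ
      have hw := powWeight_mono (p := 3 * k + 1) (q := k) hε (by linarith) (by linarith) (norm_nonneg _) hle
      have hw0 := powWeight_nonneg (p := 3 * k + 1) (q := k) hε (norm_nonneg (linePt (3 * k + 3 / 2) ξ))
      have e := powWeight_mul_self (ε := ε) (e := 3 * k + 1) (m := k) (zero_lt_one.trans_le hz1)
      have e' : (3 * k + 1 + 1 : ℝ) = 3 * k + 2 := by ring
      rw [e'] at e
      rw [norm_mul, ← e]
      calc _ ≤ powWeight ε (3 * k + 1) k ‖linePt (3 * k + 3 / 2) ξ‖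
            * ((2 * ‖linePt (3 * k + 3 / 2) ξ‖) * ‖T₂ ξ‖) := by
            have := hsub (β := 3 * k + 3 / 2) (by linarith) ξ
            gcongr
        _ = _ := by ring
    have c12 := lineNorm_add_le (ε := ε) (e := 3 * k + 1) (m := k) (β := 3 * k - 1 / 2)
      (T := fun ξ => expTransform K₂ (-linePt (3 * k - 1 / 2) ξ)) hε
      (Or.inl (by linarith)) (by linarith) (mK₁ (3 * k - 1 / 2))
    calc _ ≤ 2 * (2 * (ENNReal.ofReal (C₃ * ((L + 3) * M)) + ENNReal.ofReal (C₄ * M))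
          + ENNReal.ofReal (2 * M)) := by
          refine mul_le_mul_right (add_le_add (c12.trans ?_) c3) _
          exact mul_le_mul_right (add_le_add c1 c2) _
      _ = _ := by
          rw [← ENNReal.ofReal_add (by positivity) (by positivity), ← ENNReal.ofReal_ofNat,
            ← ENNReal.ofReal_mul (by norm_num), ← ENNReal.ofReal_add (by positivity) (by positivity),
            ← ENNReal.ofReal_mul (by norm_num)]
          congr 1; ring
  rw [xNorm]
  refine iInf₂_le_of_le P hPd ?_
  calc _ ≤ ENNReal.ofReal (L * ((L + 1) * M)) + ENNReal.ofReal ((2 + 2 * (C₁ * (L + 3) + C₂)) * M)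
        + ENNReal.ofReal (2 * (2 * (C₃ * (L + 3) + C₄) + 2) * M) :=
        add_le_add (add_le_add (ENNReal.ofReal_le_ofReal (polyNorm_le (by positivity) hPs hPc)) hL2) hhom
    _ = _ := by
        rw [← ENNReal.ofReal_add (by positivity) (by positivity),
          ← ENNReal.ofReal_add (by positivity) (by positivity)]
        congr 1; ring

theorem xNorm_const_mul_le {ζ : ℝ → ℝ} {ε k c : ℝ} (hc : 0 < c) (f : ℝ → ℝ) :
    xNorm ζ ε k (fun x => c * f x) ≤ ENNReal.ofReal c * xNorm ζ ε k f := by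
  have hc0 : ENNReal.ofReal c ≠ 0 := by simpa using hc
  have hn : ‖c‖ = c := Real.norm_of_nonneg hc.le
  rw [xNorm, xNorm, ENNReal.mul_iInf_of_ne hc0 ENNReal.ofReal_ne_top]
  refine le_iInf fun P => ?_
  rw [ENNReal.mul_iInf_of_ne hc0 ENNReal.ofReal_ne_top]
  refine le_iInf fun hP => ?_
  refine iInf₂_le_of_le (c • P) (Submodule.smul_mem _ c hP) ?_
  have e : (fun x => c * f x - ζ x * (c • P).eval x) = fun x => c * (f x - ζ x * P.eval x) := by
    funext x; rw [Polynomial.eval_smul, smul_eq_mul]; ring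
  rw [e, mul_add, mul_add]
  refine add_le_add (add_le_add ?_ ?_) ?_
  · rw [← ENNReal.ofReal_mul hc.le]
    refine ENNReal.ofReal_le_ofReal (le_of_eq ?_)
    have hsupp : (c • P).support = P.support := by
      ext n; simp [hc.ne']
    rw [polyNorm, polyNorm, hsupp]
    simp only [Polynomial.coeff_smul, smul_eq_mul, mul_pow]
    rw [← Finset.mul_sum, Real.sqrt_mul (sq_nonneg c), Real.sqrt_sq hc.le]
  · have := eLpNorm_const_smul c (fun x => f x - ζ x * P.eval x) 2 (volume.restrict (Ioi (0 : ℝ)))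
    rw [← ofReal_norm, hn] at this
    exact this.le
  · rw [xHom, xHom, ENNReal.mul_iInf_of_ne hc0 ENNReal.ofReal_ne_top]
    refine le_iInf fun h => ?_
    rw [ENNReal.mul_iInf_of_ne hc0 ENNReal.ofReal_ne_top]
    refine le_iInf fun H => ?_
    refine iInf₂_le_of_le (fun ξ => (c : ℂ) * h ξ) ?_ ?_
    · exact ((isMellinOn_iff.1 H).const_mul (c : ℂ)).congr (.of_forall fun u => by
        simp only [logWeight]; push_cast; ring) .rfl
    · refine lineNorm_le_of_norm_le hc.le fun ξ => le_of_eq ?_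
      rw [norm_mul, Complex.norm_real, hn]; ring

/-! ### Data on the side `y = x` -/

/-- Interpolation produces μ^{qt} with qt ≤ 1, whereas one full power of μ is wanted; the missing
part is bounded by the same power of |λ|. -/
theorem powWeight_le_rpow_mul {ε E p q t δ r : ℝ} (hε : 0 < ε) (hr : 1 ≤ r)
    (hqt : q * t ≤ 1) (hE : E + 1 ≤ (p + q) * t - δ) :
    powWeight ε E 1 r ≤ r ^ (-δ) * powWeight ε p q r ^ t := by
  have hr0 : 0 < r := by linarith
  have hm : 0 < min r (1 / ε) := lt_min hr0 (by positivity)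
  have e1 : r ^ (-δ) * powWeight ε p q r ^ t = r ^ (p * t - δ) * min r (1 / ε) ^ (q * t) := by
    rw [powWeight, Real.mul_rpow (by positivity) (by positivity), ← Real.rpow_mul hr0.le,
      ← Real.rpow_mul hm.le, ← mul_assoc, ← Real.rpow_add hr0]
    congr 2; ring
  have e2 : min r (1 / ε) ^ (1 : ℝ) = min r (1 / ε) ^ (1 - q * t) * min r (1 / ε) ^ (q * t) := by
    rw [← Real.rpow_add hm]; congr 1; ring
  rw [e1, powWeight, e2, ← mul_assoc]
  refine mul_le_mul_of_nonneg_right ?_ (by positivity)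
  calc r ^ E * min r (1 / ε) ^ (1 - q * t) ≤ r ^ E * r ^ (1 - q * t) := by
        have : 0 ≤ 1 - q * t := by linarith
        gcongr
        exact min_le_left _ _
    _ = r ^ (E + (1 - q * t)) := (Real.rpow_add hr0 _ _).symm
    _ ≤ _ := Real.rpow_le_rpow_of_exponent_le hr (by linarith)

/-- `exists_interpolation` bounds a square; here the weight is brought to the form with exactly one
power of μ, and the square root is taken. -/
theorem exists_lineNorm_interpolation {βa βb t p q δ E : ℝ} (hab : βa ≤ βb) (ht : 0 ≤ t) (ht1 : t ≤ 1)
    (hβ : 1 ≤ (1 - t) * βa + t * βb) (hp : 0 ≤ p) (hq : 0 ≤ q) (hδ : 0 < δ) (hqt : q * t ≤ 1)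
    (hE : E + 1 ≤ (p + q) * t - δ) :
    ∃ C : ℝ, 0 ≤ C ∧ ∀ {ε M : ℝ} {v : ℝ → ℝ} {hb : ℝ → ℂ}, 0 < ε → 0 ≤ M →
      AEStronglyMeasurable (expWeight βa v) volume →
      eLpNorm (expWeight βa v) 2 volume ≤ ENNReal.ofReal M → IsFT (expWeight βb v) hb →
      lineNorm ε p q βb hb ≤ ENNReal.ofReal M →
      ∃ h, IsFT (expWeight ((1 - t) * βa + t * βb) v) h ∧
        lineNorm ε E 1 ((1 - t) * βa + t * βb) h ≤ ENNReal.ofReal (C * M) := by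
  obtain ⟨C, hC⟩ := exists_interpolation hab ht ht1 hβ hp hq hδ
  refine ⟨2 * C + 1, by positivity, fun {ε M v hb} hε hM hvm hv Hb hbM => ?_⟩
  obtain ⟨h, H, hle⟩ := hC ε hε v hb ⟨hvm, hv.trans_lt ENNReal.ofReal_lt_top⟩ Hb
  refine ⟨h, H, ?_⟩
  have hsq : ∀ {F : ℝ → ℝ≥0∞}, lineL2 F ≤ ENNReal.ofReal M →
      ∫⁻ ξ, F ξ ^ (2 : ℝ) ≤ ENNReal.ofReal (M ^ 2) := fun {F} hF => by
    have h1 : ∫⁻ ξ, F ξ ^ (2 : ℝ) = lineL2 F ^ (2 : ℝ) := by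
      rw [lineL2, ← ENNReal.rpow_mul]; norm_num
    rw [h1, ← Real.rpow_two, ← ENNReal.ofReal_rpow_of_nonneg hM (by norm_num)]
    gcongr
  have b1 := hsq (F := fun u => ‖expWeight βa v u‖ₑ) (by rw [lineL2_enorm]; exact hv)
  have b2 := hsq hbM
  have b3 := hle.trans (mul_le_mul_right (add_le_add b1 b2) _)
  have e : (C : ℝ≥0∞) * (ENNReal.ofReal (M ^ 2) + ENNReal.ofReal (M ^ 2)) = ENNReal.ofReal (2 * C * M ^ 2) := by
    rw [← ENNReal.ofReal_add (by positivity) (by positivity), ← ENNReal.ofReal_coe_nnreal,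
      ← ENNReal.ofReal_mul (by positivity)]
    congr 1; ring
  rw [e] at b3
  have b4 : lineNorm ε E 1 ((1 - t) * βa + t * βb) h ≤ (ENNReal.ofReal (2 * C * M ^ 2)) ^ (1 / 2 : ℝ) := by
    refine le_trans (lineL2_mono fun ξ => ?_) (ENNReal.rpow_le_rpow b3 (by norm_num))
    refine ENNReal.ofReal_le_ofReal ?_
    gcongr
    exact powWeight_le_rpow_mul hε (one_le_norm_linePt hβ ξ) hqt hE
  refine b4.trans ?_
  rw [ENNReal.ofReal_rpow_of_nonneg (by positivity) (by norm_num), ← Real.sqrt_eq_rpow]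
  refine ENNReal.ofReal_le_ofReal (Real.sqrt_le_iff.2 ⟨by positivity, ?_⟩)
  rw [mul_pow]
  gcongr
  nlinarith [C.coe_nonneg]

/-- If f = ζQ + v with v a function of u = log x, then f_x - ζQ' is e^{-u} v'(u) + ζ'Q. The first
term lowers the line by one and costs one power of |λ|, the second is compactly supported. -/
theorem exists_lineNorm_dirichlet {ζ : ℝ → ℝ} (hζ : IsCutoff (1 / 8) (1 / 4) ζ) (N : ℕ) {e m : ℝ}
    (he : 0 ≤ e) (hm : 0 ≤ m) {β : ℝ} (hβ : 1 ≤ β) :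
    ∃ C : ℝ, 0 ≤ C ∧ ∀ {ε M : ℝ} {v v' : ℝ → ℝ} {h : ℝ → ℂ} {q : ℕ → ℝ}, 0 < ε → ε ≤ 1 → 0 ≤ M →
      (∀ n, |q n| ≤ M) → (∀ u, HasDerivAt v (v' u) u) → Continuous v' →
      IsFT (expWeight (β + 1) v) h → lineNorm ε (e + 2) (m + 1) (β + 1) h ≤ ENNReal.ofReal M →
      ∃ Dh, IsFT (expWeight β (fun u => Real.exp (-u) * v' u + expSum (deriv ζ) N q u)) Dh ∧
        lineNorm ε (e + 1) (m + 1) β Dh ≤ ENNReal.ofReal (C * M) := by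
  have hs1 : ∀ r, r < 1 / 8 ∨ 1 / 4 < r → deriv ζ r = 0 := fun r hr => hζ.deriv_eq_zero hr
  obtain ⟨C₁, hC₁, h₁⟩ := exists_lineNorm_expSum_le hζ.contDiff_deriv hs1 N (e := e + 1) (m := m + 1)
    (by linarith) β
  refine ⟨2 * (C₁ + 1), by positivity, fun {ε M v v' h q} hε hε1 hM hq hv hv' H hh => ?_⟩
  set K := expSum (deriv ζ) N q with hK
  have cK : Continuous K := continuous_expSum hζ.contDiff_deriv _ _
  have sK : HasCompactSupport K := hasCompactSupport_expSum hs1 _ _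
  have hm1 := memLp_linePt_mul hε hε1 (by linarith) (by linarith) (by linarith) H.memLp_right.1
    (ne_top_of_le_ne_top ENNReal.ofReal_ne_top hh)
  have W := H.hasDeriv hv hv' hm1
  refine ⟨fun ξ => expTransform K (-linePt β ξ) + linePt (β + 1) ξ * h ξ, ?_, ?_⟩
  · refine ((isFT_expTransform cK sK β).add W).congr (.of_forall fun u => ?_) .rfl
    simp only [expWeight]
    rw [← Complex.ofReal_add, mul_add, ← mul_assoc, ← Real.exp_add]
    rw [add_comm]
    congr 4; ring
  · refine (lineNorm_add_le hε (Or.inl (by linarith)) (by linarith)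
      (aestronglyMeasurable_expTransform_line cK sK β)).trans ?_
    have c1 := h₁ (ε := ε) (q := q) hε hβ le_rfl hM (fun n _ => hq n)
    have c2 : lineNorm ε (e + 1) (m + 1) β (fun ξ => linePt (β + 1) ξ * h ξ) ≤ ENNReal.ofReal M := by
      refine le_trans (lineL2_mono fun ξ => ENNReal.ofReal_le_ofReal ?_) hh
      have hz1 := one_le_norm_linePt (β := β + 1) (by linarith) ξ
      have hle : ‖linePt β ξ‖ ≤ ‖linePt (β + 1) ξ‖ := norm_linePt_mono (by linarith) (by linarith) ξ
      have hw := powWeight_mono (p := e + 1) (q := m + 1) hε (by linarith) (by linarith) (norm_nonneg _) hle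
      have e0 := powWeight_mul_self (ε := ε) (e := e + 1) (m := m + 1) (zero_lt_one.trans_le hz1)
      rw [show e + 1 + 1 = e + 2 by ring] at e0
      rw [norm_mul, ← e0, mul_assoc]
      gcongr
    calc _ ≤ 2 * (ENNReal.ofReal (C₁ * M) + ENNReal.ofReal M) := by gcongr
      _ = _ := by
        rw [← ENNReal.ofReal_add (by positivity) (by positivity), ← ENNReal.ofReal_ofNat,
          ← ENNReal.ofReal_mul (by norm_num)]
        congr 1; ring

/-! ### The normal derivative -/

theorem aestronglyMeasurable_normal {θ β : ℝ} {Dh : ℝ → ℂ} {hh : ℝ → ℝ → ℂ}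
    (hD : AEStronglyMeasurable Dh volume)
    (hm : AEStronglyMeasurable (fun p : ℝ × ℝ => hh p.1 p.2)
      ((volume : Measure ℝ).prod (volume.restrict (Ioo 0 θ)))) :
    AEStronglyMeasurable (fun ξ => -(linePt β ξ * (Complex.sin (linePt β ξ * θ)
      / Complex.cos (linePt β ξ * θ)) * Dh ξ) + ∫ φ in Ioo 0 θ,
        Complex.cos (linePt β ξ * φ) / Complex.cos (linePt β ξ * θ) * hh ξ φ) volume := by
  have hc := continuous_linePt β
  refine AEStronglyMeasurable.add (AEStronglyMeasurable.neg (AEStronglyMeasurable.mul ?_ hD)) ?_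
  · have h1 : Measurable fun ξ => Complex.sin (linePt β ξ * θ) := (Continuous.measurable (by fun_prop))
    have h2 : Measurable fun ξ => Complex.cos (linePt β ξ * θ) := (Continuous.measurable (by fun_prop))
    exact (hc.measurable.mul (h1.div h2)).aestronglyMeasurable
  · refine AEStronglyMeasurable.integral_prod_right' (f := fun p : ℝ × ℝ =>
      Complex.cos (linePt β p.1 * p.2) / Complex.cos (linePt β p.1 * θ) * hh p.1 p.2) ?_
    have hc1 : Continuous fun p : ℝ × ℝ => linePt β p.1 := by unfold linePt; fun_prop
    have h1 : Measurable fun p : ℝ × ℝ => Complex.cos (linePt β p.1 * p.2) :=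
      (Continuous.measurable (by fun_prop))
    have h2 : Measurable fun p : ℝ × ℝ => Complex.cos (linePt β p.1 * θ) :=
      (Continuous.measurable (by fun_prop))
    exact (h1.div h2).aestronglyMeasurable.mul hm

theorem min_one_mul_le {ε r : ℝ} (hε : 0 < ε) : min 1 (r * ε) = ε * min r (1 / ε) := by
  rw [mul_min_of_nonneg _ _ hε.le, min_comm, mul_comm]
  congr 1; field_simp

/-- Both multipliers of the representation are estimated by ε times a power of |λ| times μ. The
source is bounded by its supremum over the angle, so only the L¹ norm in φ of the quotient of
cosines matters. -/
theorem enorm_normal_le {ε c β B : ℝ} (hε : 0 < ε) (hc : c < Real.pi / 2) (hB : B * Real.arctan ε ≤ c)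
    (hβ : 1 ≤ β) (hβB : β ≤ B) (Dh : ℝ → ℂ) (hh : ℝ → ℝ → ℂ) (ξ : ℝ) :
    ‖-(linePt β ξ * (Complex.sin (linePt β ξ * Real.arctan ε)
      / Complex.cos (linePt β ξ * Real.arctan ε)) * Dh ξ) + ∫ φ in Ioo 0 (Real.arctan ε),
        Complex.cos (linePt β ξ * φ) / Complex.cos (linePt β ξ * Real.arctan ε) * hh ξ φ‖ₑ
      ≤ ENNReal.ofReal (ε * (8 / Real.cos c) * (powWeight ε 1 1 ‖linePt β ξ‖ * ‖Dh ξ‖))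
        + ENNReal.ofReal (ε * (8 / Real.cos c) * powWeight ε (-1) 1 ‖linePt β ξ‖)
          * ⨆ φ ∈ Ioo 0 (Real.arctan ε), ‖hh ξ φ‖ₑ := by
  set θ := Real.arctan ε with hθ
  have hθ0 : 0 < θ := Real.arctan_pos.2 hε
  have hθε : θ ≤ ε := by
    have := Real.le_tan hθ0.le (Real.arctan_lt_pi_div_two ε)
    rwa [hθ, Real.tan_arctan] at this
  set z := linePt β ξ with hz
  have hz1 : 1 ≤ ‖z‖ := one_le_norm_linePt hβ ξ
  have hz0 : 0 < ‖z‖ := by linarith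
  have hre : |z.re| ≤ B := by simp [hz, abs_of_nonneg (by linarith : 0 ≤ β), hβB]
  have hcos := cos_pos_of_strip hθ0 hc hB hre
  have hmin : 0 ≤ min ‖z‖ (1 / ε) := le_min hz0.le (by positivity)
  refine (enorm_add_le _ _).trans (add_le_add ?_ ?_)
  · rw [enorm_neg, ← ofReal_norm]
    refine ENNReal.ofReal_le_ofReal ?_
    rw [norm_mul, norm_mul, powWeight, Real.rpow_one, Real.rpow_one]
    have h1 := norm_tan_le hθ0 hc hB hre
    have h2 : min 1 (‖z‖ * θ) ≤ ε * min ‖z‖ (1 / ε) := by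
      rw [← min_one_mul_le hε]
      exact min_le_min le_rfl (by gcongr)
    calc _ ≤ ‖z‖ * (ε * min ‖z‖ (1 / ε) / Real.cos c) * ‖Dh ξ‖ := by
          gcongr
          exact h1.trans (by gcongr)
      _ = ε * (1 / Real.cos c) * (‖z‖ * min ‖z‖ (1 / ε) * ‖Dh ξ‖) := by ring
      _ ≤ _ := by gcongr; norm_num
  · refine (enorm_integral_le_lintegral_enorm _).trans ?_
    have hcont : Continuous fun φ : ℝ => Complex.cos (z * φ) / Complex.cos (z * θ) := by fun_prop
    have hint : IntegrableOn (fun φ : ℝ => Complex.cos (z * φ) / Complex.cos (z * θ)) (Ioo 0 θ) :=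
      (hcont.continuousOn.integrableOn_compact isCompact_Icc).mono_set Ioo_subset_Icc_self
    calc _ ≤ ∫⁻ φ in Ioo 0 θ, ‖Complex.cos (z * φ) / Complex.cos (z * θ)‖ₑ
          * ⨆ φ ∈ Ioo 0 θ, ‖hh ξ φ‖ₑ := by
          refine setLIntegral_mono' measurableSet_Ioo fun φ hφ => ?_
          rw [enorm_mul]
          gcongr
          exact le_iSup₂ (f := fun φ (_ : φ ∈ Ioo 0 θ) => ‖hh ξ φ‖ₑ) φ hφ
      _ = (∫⁻ φ in Ioo 0 θ, ‖Complex.cos (z * φ) / Complex.cos (z * θ)‖ₑ)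
          * ⨆ φ ∈ Ioo 0 θ, ‖hh ξ φ‖ₑ := by
          rw [lintegral_mul_const]
          exact hcont.enorm.measurable
      _ ≤ _ := by
          gcongr
          rw [← ofReal_integral_norm_eq_lintegral_enorm hint]
          refine ENNReal.ofReal_le_ofReal
            ((integral_norm_cos_div_cos_le hθ0 hc hB hre (norm_pos_iff.1 hz0)).trans ?_)
          rw [powWeight, Real.rpow_neg_one, Real.rpow_one]
          have h3 : min θ (1 / ‖z‖) ≤ ε * (‖z‖⁻¹ * min ‖z‖ (1 / ε)) := by
            have : ε * (‖z‖⁻¹ * min ‖z‖ (1 / ε)) = ‖z‖⁻¹ * min 1 (‖z‖ * ε) := by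
              rw [min_one_mul_le hε]; ring
            rw [this, mul_min_of_nonneg _ _ (by positivity), inv_mul_cancel_left₀ hz0.ne', min_comm]
            refine min_le_min (by simp) hθε
          calc _ ≤ 8 / Real.cos c * (ε * (‖z‖⁻¹ * min ‖z‖ (1 / ε))) := by gcongr
            _ = _ := by ring

theorem powWeight_mul_powWeight {ε e m e' m' r : ℝ} (hε : 0 < ε) (hr : 0 < r) :
    powWeight ε e m r * powWeight ε e' m' r = powWeight ε (e + e') (m + m') r := by
  have hm : 0 < min r (1 / ε) := lt_min hr (by positivity)
  simp only [powWeight]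
  rw [Real.rpow_add hr, Real.rpow_add hm]; ring

/-- The norm of `|λ|^e μ^m sup_φ |h|` in `L²(Re λ = β)`. -/
def lineSupNorm (ε θ e m β : ℝ) (hh : ℝ → ℝ → ℂ) : ℝ≥0∞ :=
  lineL2 fun ξ => ENNReal.ofReal (powWeight ε e m ‖linePt β ξ‖) * ⨆ φ ∈ Ioo 0 θ, ‖hh ξ φ‖ₑ

theorem lineNorm_normal_le {ε c β B e m : ℝ} (hε : 0 < ε) (hc : c < Real.pi / 2)
    (hB : B * Real.arctan ε ≤ c) (hβ : 1 ≤ β) (hβB : β ≤ B) (he : 0 ≤ e) (hm : 0 ≤ m)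
    {Dh : ℝ → ℂ} (hD : AEStronglyMeasurable Dh volume) (hh : ℝ → ℝ → ℂ) :
    lineNorm ε e m β (fun ξ => -(linePt β ξ * (Complex.sin (linePt β ξ * Real.arctan ε)
      / Complex.cos (linePt β ξ * Real.arctan ε)) * Dh ξ) + ∫ φ in Ioo 0 (Real.arctan ε),
        Complex.cos (linePt β ξ * φ) / Complex.cos (linePt β ξ * Real.arctan ε) * hh ξ φ)
      ≤ ENNReal.ofReal (ε * (16 / Real.cos c)) * (lineNorm ε (e + 1) (m + 1) β Dh
        + lineSupNorm ε (Real.arctan ε) (e - 1) (m + 1) β hh) := by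
  have hcos := cos_pos_of_strip (Real.arctan_pos.2 hε) hc hB (z := linePt β 0)
    (by simp [abs_of_nonneg (by linarith : 0 ≤ β), hβB])
  have hA : 0 ≤ ε * (8 / Real.cos c) := by positivity
  have hw := continuous_powWeight_linePt (ε := ε) (e := e + 1) (m := m + 1) (β := β)
    (Or.inl (by linarith)) (by linarith)
  have h1 : lineNorm ε e m β (fun ξ => -(linePt β ξ * (Complex.sin (linePt β ξ * Real.arctan ε)
      / Complex.cos (linePt β ξ * Real.arctan ε)) * Dh ξ) + ∫ φ in Ioo 0 (Real.arctan ε),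
        Complex.cos (linePt β ξ * φ) / Complex.cos (linePt β ξ * Real.arctan ε) * hh ξ φ)
      ≤ ENNReal.ofReal (ε * (8 / Real.cos c)) * lineL2 (fun ξ =>
        ENNReal.ofReal (powWeight ε (e + 1) (m + 1) ‖linePt β ξ‖ * ‖Dh ξ‖)
        + ENNReal.ofReal (powWeight ε (e - 1) (m + 1) ‖linePt β ξ‖)
          * ⨆ φ ∈ Ioo 0 (Real.arctan ε), ‖hh ξ φ‖ₑ) := by
    rw [← lineL2_const_mul ENNReal.ofReal_ne_top]
    refine lineL2_mono fun ξ => ?_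
    have hz0 : 0 < ‖linePt β ξ‖ := by have := one_le_norm_linePt hβ ξ; linarith
    have hp := powWeight_nonneg (p := e) (q := m) hε hz0.le
    rw [ENNReal.ofReal_mul hp, ofReal_norm]
    refine (mul_le_mul_right (enorm_normal_le hε hc hB hβ hβB Dh hh ξ) _).trans_eq ?_
    rw [mul_add, mul_add]
    congr 1
    · rw [← ENNReal.ofReal_mul hp, ← ENNReal.ofReal_mul hA, ← powWeight_mul_powWeight hε hz0]
      congr 1; ring
    · rw [← mul_assoc, ← mul_assoc, ← ENNReal.ofReal_mul hp, ← ENNReal.ofReal_mul hA, sub_eq_add_neg,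
        ← powWeight_mul_powWeight hε hz0]
      congr 2; ring
  refine h1.trans ?_
  have e16 : ENNReal.ofReal (ε * (16 / Real.cos c)) = ENNReal.ofReal (ε * (8 / Real.cos c)) * 2 := by
    rw [← ENNReal.ofReal_ofNat, ← ENNReal.ofReal_mul hA]; congr 1; ring
  rw [e16, mul_assoc]
  exact mul_le_mul_right (lineL2_add_le (ENNReal.measurable_ofReal.comp_aemeasurable
    (hw.aestronglyMeasurable.mul hD.norm).aemeasurable)) _

/-! ### Joint measurability -/

/-- The left part of the cell of size `θ / n` with number `t` is represented by its midpoint. -/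
def cellPt (θ : ℝ) (n t : ℕ) : ℝ := θ * ((t + 1 / 2) / n)

theorem cellPt_mem {θ : ℝ} (hθ : 0 < θ) {n t : ℕ} (h : t < n) : cellPt θ n t ∈ Ioo 0 θ := by
  have hn : (0 : ℝ) < n := by exact_mod_cast (by omega : 0 < n)
  have ht : (t : ℝ) + 1 ≤ n := by exact_mod_cast h
  refine ⟨by unfold cellPt; positivity, ?_⟩
  unfold cellPt
  refine mul_lt_of_lt_one_right hθ ?_
  rw [div_lt_one hn]; linarith

theorem cell_lt {θ φ : ℝ} (hφ : φ ∈ Ioo 0 θ) {n : ℕ} (hn : 0 < n) : ⌊n * (φ / θ)⌋₊ < n := by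
  have hθ : 0 < θ := hφ.1.trans hφ.2
  have hn' : (0 : ℝ) < n := by exact_mod_cast hn
  rw [Nat.floor_lt (by have := hφ.1; positivity)]
  exact mul_lt_of_lt_one_right hn' ((div_lt_one hθ).2 hφ.2)

theorem tendsto_cellPt {θ φ : ℝ} (hφ : φ ∈ Ioo 0 θ) :
    Filter.Tendsto (fun n : ℕ => cellPt θ n ⌊n * (φ / θ)⌋₊) Filter.atTop (nhds φ) := by
  have hθ : 0 < θ := hφ.1.trans hφ.2
  rw [tendsto_iff_dist_tendsto_zero]
  have h0 : Filter.Tendsto (fun n : ℕ => θ / n) Filter.atTop (nhds 0) :=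
    tendsto_const_div_atTop_nhds_zero_nat θ
  refine squeeze_zero' (.of_forall fun _ => dist_nonneg) ?_ h0
  filter_upwards [Filter.eventually_gt_atTop 0] with n hn
  have hn' : (0 : ℝ) < n := by exact_mod_cast hn
  have hφ0 := hφ.1
  have h1 := Nat.floor_le (a := n * (φ / θ)) (by positivity)
  have h2 := Nat.lt_floor_add_one (n * (φ / θ))
  set t : ℝ := (⌊n * (φ / θ)⌋₊ : ℝ) with ht
  have e : cellPt θ n ⌊n * (φ / θ)⌋₊ - φ = θ / n * (t + 1 / 2 - n * (φ / θ)) := by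
    rw [cellPt, ← ht]; field_simp
  rw [Real.dist_eq, e, abs_mul, abs_of_pos (by positivity)]
  refine mul_le_of_le_one_right (by positivity) ?_
  rw [abs_le]
  constructor <;> linarith

/-- A function which is measurable in the first variable and continuous in the second one is
jointly measurable. -/
theorem aestronglyMeasurable_of_continuousOn {θ : ℝ} (hθ : 0 < θ) {H : ℝ → ℝ → ℂ}
    (h1 : ∀ φ ∈ Ioo 0 θ, AEStronglyMeasurable (fun ξ => H ξ φ) volume)
    (h2 : ∀ᵐ ξ ∂(volume : Measure ℝ), ContinuousOn (H ξ) (Ioo 0 θ)) :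
    AEStronglyMeasurable (fun p : ℝ × ℝ => H p.1 p.2)
      ((volume : Measure ℝ).prod (volume.restrict (Ioo 0 θ))) := by
  set G : ℕ → ℕ → ℝ → ℂ := fun n t ξ => if t < n then H ξ (cellPt θ n t) else 0 with hG
  have hGm : ∀ n t, AEStronglyMeasurable (G n t) volume := fun n t => by
    by_cases h : t < n
    · simp only [hG, if_pos h]
      exact h1 _ (cellPt_mem hθ h)
    · simp only [hG, if_neg h]
      exact aestronglyMeasurable_const
  have hfst : Measure.QuasiMeasurePreserving Prod.fst
      ((volume : Measure ℝ).prod (volume.restrict (Ioo 0 θ))) volume :=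
    Measure.quasiMeasurePreserving_fst
  have hsnd : Measure.QuasiMeasurePreserving Prod.snd
      ((volume : Measure ℝ).prod (volume.restrict (Ioo 0 θ))) (volume.restrict (Ioo 0 θ)) :=
    Measure.quasiMeasurePreserving_snd
  have hae : ∀ᵐ p ∂((volume : Measure ℝ).prod (volume.restrict (Ioo 0 θ))), p.2 ∈ Ioo 0 θ :=
    hsnd.ae (ae_restrict_mem measurableSet_Ioo)
  -- Approximation by functions that are constant in φ on the n cells; the values at the midpoints
  -- converge by continuity.
  refine aestronglyMeasurable_of_tendsto_ae Filter.atTop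
    (f := fun n (p : ℝ × ℝ) => G n ⌊n * (p.2 / θ)⌋₊ p.1) (fun n => ?_) ?_
  · refine ⟨fun p => (hGm n ⌊n * (p.2 / θ)⌋₊).mk _ p.1, ?_, ?_⟩
    · have hm : Measurable fun r : ℕ × ℝ => (hGm n r.1).mk _ r.2 :=
        measurable_from_prod_countable_right fun t => (hGm n t).stronglyMeasurable_mk.measurable
      have hf : Measurable fun p : ℝ × ℝ => (⌊(n : ℝ) * (p.2 / θ)⌋₊, p.1) := by fun_prop
      exact (hm.comp hf).stronglyMeasurable
    · have : ∀ᵐ ξ ∂(volume : Measure ℝ), ∀ t, G n t ξ = (hGm n t).mk _ ξ :=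
        ae_all_iff.2 fun t => (hGm n t).ae_eq_mk
      filter_upwards [hfst.ae this] with p hp using hp _
  · filter_upwards [hfst.ae h2, hae] with p hp hp2
    have hc := (hp p.2 hp2).continuousAt (isOpen_Ioo.mem_nhds hp2)
    refine (hc.tendsto.comp (tendsto_cellPt hp2)).congr' ?_
    filter_upwards [Filter.eventually_gt_atTop 0] with n hn
    simp only [hG, Function.comp_apply, if_pos (cell_lt hp2 hn)]

/-! ### Compactly supported sources -/

/-- `∑_j χ_j(e,u) P_j(αe^u, be^u)` for `e = (α, b, ρ)`. -/
def sourceSum (χ : Fin 3 → (ℝ × ℝ × ℝ) × ℝ → ℝ) (N : ℕ) (q : Fin 3 → ℕ → ℕ → ℝ) (e : ℝ × ℝ × ℝ)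
    (u : ℝ) : ℝ :=
  ∑ j, χ j (e, u) * biPoly N (q j) (e.1 * Real.exp u, e.2.1 * Real.exp u)

theorem contDiff_sourceSum {χ : Fin 3 → (ℝ × ℝ × ℝ) × ℝ → ℝ} (hχ : ∀ j, ContDiff ℝ ∞ (χ j)) (N : ℕ)
    (q : Fin 3 → ℕ → ℕ → ℝ) :
    ContDiff ℝ ∞ fun p : (ℝ × ℝ × ℝ) × ℝ => sourceSum χ N q p.1 p.2 := by
  unfold sourceSum
  refine ContDiff.sum fun j _ => (hχ j).mul ((contDiff_biPoly N (q j)).comp ?_)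
  fun_prop

/-- The angle and ε enter only through the parameter e. Over a compact set of parameters smooth
dependence gives one constant, hence uniformity in both. -/
theorem exists_sourceSum_bound {χ : Fin 3 → (ℝ × ℝ × ℝ) × ℝ → ℝ} (hχ : ∀ j, ContDiff ℝ ∞ (χ j))
    {K : Set (ℝ × ℝ × ℝ)} (hK : IsCompact K) {L : ℝ} (hs : ∀ j, ∀ e ∈ K, ∀ u, L < |u| → χ j (e, u) = 0)
    (N : ℕ) (B : ℝ) (m : ℕ) : ∃ C : ℝ, 0 ≤ C ∧ ∀ (q : Fin 3 → ℕ → ℕ → ℝ) (A : ℝ),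
      (∀ j a b, |q j a b| ≤ A) → ∀ e ∈ K, ∀ z : ℂ, |z.re| ≤ B →
        ‖z‖ ^ m * ‖expTransform (sourceSum χ N q e) z‖ ≤ C * A := by
  obtain ⟨C, hC0, hC⟩ := exists_expTransform_sum_bound
    (ι := Fin 3 × ℕ × ℕ) (Finset.univ ×ˢ Finset.range N ×ˢ Finset.range N) hK L B m
    (fun i p => χ i.1 p * (p.1.1 * Real.exp p.2) ^ i.2.1 * (p.1.2.1 * Real.exp p.2) ^ i.2.2)
    (fun i => by have := hχ i.1; fun_prop)
    (fun i e he u hu => by simp only; rw [hs i.1 e he u hu, zero_mul, zero_mul])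
  refine ⟨C, hC0, fun q A hq e he z hz => ?_⟩
  have := hC (fun i => q i.1 i.2.1 i.2.2) A (fun i _ => hq _ _ _) e he z hz
  convert! this using 4
  funext u
  rw [sourceSum, Finset.sum_product]
  refine Finset.sum_congr rfl fun j _ => ?_
  rw [biPoly, Finset.sum_product, Finset.mul_sum]
  refine Finset.sum_congr rfl fun a _ => ?_
  rw [Finset.mul_sum]
  exact Finset.sum_congr rfl fun b _ => by ring

theorem hasCompactSupport_sourceSum {χ : Fin 3 → (ℝ × ℝ × ℝ) × ℝ → ℝ} {e : ℝ × ℝ × ℝ} {L : ℝ}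
    (hs : ∀ j u, L < |u| → χ j (e, u) = 0) (N : ℕ) (q : Fin 3 → ℕ → ℕ → ℝ) :
    HasCompactSupport (sourceSum χ N q e) :=
  hasCompactSupport_of_abs (M := L) fun u hu =>
    Finset.sum_eq_zero fun j _ => by rw [hs j u hu, zero_mul]

/-- The factors of the three polynomials in the source of `p - ζ(x) P(x,y)`. -/
def sourceFactor (ζ η : ℝ → ℝ) : Fin 3 → (ℝ × ℝ × ℝ) × ℝ → ℝ :=
  ![fun p => (p.1.2.2 * Real.exp p.2) ^ 2 * (η (p.1.2.2 * Real.exp p.2) - ζ (p.1.1 * Real.exp p.2)),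
    fun p => -((p.1.2.2 * Real.exp p.2) ^ 2 * (2 * deriv ζ (p.1.1 * Real.exp p.2))),
    fun p => -((p.1.2.2 * Real.exp p.2) ^ 2 * deriv (deriv ζ) (p.1.1 * Real.exp p.2))]

theorem contDiff_sourceFactor {ζ η : ℝ → ℝ} (hζ : IsCutoff (1 / 8) (1 / 4) ζ) (hη : IsCutoff 1 2 η)
    (j : Fin 3) : ContDiff ℝ ∞ (sourceFactor ζ η j) := by
  have h1 := hζ.smooth
  have h2 := hη.smooth
  have h3 := hζ.contDiff_deriv
  have h4 := hζ.contDiff_deriv_deriv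
  fin_cases j <;> simp only [sourceFactor] <;> simp <;> fun_prop

/-- For large u every cut-off and derivative vanishes. For very negative u both ζ and η are 1 and
cancel, and their derivatives vanish. Thus the different cut-offs of the two decompositions cause
only compactly supported errors. -/
theorem sourceFactor_eq_zero {ζ η : ℝ → ℝ} (hζ : IsCutoff (1 / 8) (1 / 4) ζ) (hη : IsCutoff 1 2 η)
    (j : Fin 3) {e : ℝ × ℝ × ℝ} (h1 : 1 ≤ e.1) (h2 : e.1 ≤ 2) (h3 : 1 ≤ e.2.2) (h4 : e.2.2 ≤ 2) {u : ℝ}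
    (hu : 4 < |u|) : sourceFactor ζ η j (e, u) = 0 := by
  have hu0 := Real.exp_pos u
  rcases lt_abs.1 hu with h | h
  · have hu1 : 2 < Real.exp u := by have := Real.add_one_le_exp u; linarith
    have hx : 2 < e.1 * Real.exp u := by nlinarith
    have hr : 2 < e.2.2 * Real.exp u := by nlinarith
    have z1 := hζ.eq_zero (e.1 * Real.exp u) (by linarith)
    have z2 := hη.eq_zero (e.2.2 * Real.exp u) hr.le
    have z3 := hζ.deriv_eq_zero (r := e.1 * Real.exp u) (Or.inr (by linarith))
    have z4 := hζ.deriv_deriv_eq_zero (r := e.1 * Real.exp u) (Or.inr (by linarith))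
    fin_cases j <;> simp [sourceFactor, z1, z2, z3, z4]
  · have hu1 : Real.exp u < 1 / 16 := by
      have h1 : Real.exp u ≤ Real.exp (-3) * Real.exp (-1) := by
        rw [← Real.exp_add]; exact Real.exp_le_exp.2 (by linarith)
      have h2 : Real.exp (-1) ≤ 1 / 2 := by
        rw [Real.exp_neg, one_div]
        exact inv_anti₀ (by norm_num) (by linarith [Real.exp_one_gt_d9])
      have h3 := exp_neg_three_lt
      have h4 := Real.exp_pos (-3)
      have h5 := Real.exp_pos (-1)
      nlinarith
    have hx : e.1 * Real.exp u < 1 / 8 := by nlinarith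
    have hr : e.2.2 * Real.exp u < 1 / 8 := by nlinarith
    have z1 := hζ.eq_one (e.1 * Real.exp u) hx.le
    have z2 := hη.eq_one (e.2.2 * Real.exp u) (by linarith)
    have z3 := hζ.deriv_eq_zero (r := e.1 * Real.exp u) (Or.inl hx)
    have z4 := hζ.deriv_deriv_eq_zero (r := e.1 * Real.exp u) (Or.inl hx)
    fin_cases j <;> simp [sourceFactor, z1, z2, z3, z4]

/-- The parameters `(α, b, ρ)` of the angle `φ`. -/
def anglePar (ε s φ : ℝ) : ℝ × ℝ × ℝ :=
  (Real.exp s * Real.cos φ, ε⁻¹ * (Real.exp s * Real.sin φ), Real.exp s)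

theorem exp_neg_log_cos {ε : ℝ} (hε : 0 ≤ ε) (hε1 : ε ≤ 1) :
    1 ≤ Real.exp (-Real.log (Real.cos (Real.arctan ε)))
      ∧ Real.exp (-Real.log (Real.cos (Real.arctan ε))) ≤ 2
      ∧ Real.exp (-Real.log (Real.cos (Real.arctan ε))) * Real.cos (Real.arctan ε) = 1 := by
  have hc := Real.cos_arctan_pos ε
  rw [Real.exp_neg, Real.exp_log hc]
  refine ⟨one_le_inv₀ hc |>.2 (Real.cos_le_one _), ?_, inv_mul_cancel₀ hc.ne'⟩
  rw [Real.cos_arctan, one_div, inv_inv]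
  rw [Real.sqrt_le_left (by norm_num)]
  nlinarith

/-- The parameters stay in a fixed compact set as ε tends to 0: the angle is at most arctan ε, so
ε⁻¹ sin φ remains bounded. -/
theorem anglePar_mem {ε φ : ℝ} (hε : 0 < ε) (hε1 : ε ≤ 1) (hφ : φ ∈ Ioo 0 (Real.arctan ε)) :
    anglePar ε (-Real.log (Real.cos (Real.arctan ε))) φ ∈
      Icc (1 : ℝ) 2 ×ˢ Icc (0 : ℝ) 2 ×ˢ Icc (1 : ℝ) 2 := by
  obtain ⟨h1, h2, h3⟩ := exp_neg_log_cos hε.le hε1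
  have hπ := Real.arctan_lt_pi_div_two ε
  set ρ := Real.exp (-Real.log (Real.cos (Real.arctan ε)))
  have hc : Real.cos (Real.arctan ε) ≤ Real.cos φ :=
    Real.cos_le_cos_of_nonneg_of_le_pi hφ.1.le (by linarith [Real.pi_pos]) hφ.2.le
  have hs : Real.sin φ ≤ Real.sin (Real.arctan ε) :=
    Real.sin_le_sin_of_le_of_le_pi_div_two (by linarith [Real.pi_pos, hφ.1]) hπ.le hφ.2.le
  have hs0 : 0 ≤ Real.sin φ := Real.sin_nonneg_of_nonneg_of_le_pi hφ.1.le (by linarith [hφ.2, Real.pi_pos])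
  have hsε : Real.sin (Real.arctan ε) = ε * Real.cos (Real.arctan ε) := by
    rw [← div_eq_iff (Real.cos_arctan_pos ε).ne', ← Real.tan_eq_sin_div_cos, Real.tan_arctan]
  have hc1 := Real.cos_le_one φ
  refine ⟨⟨?_, ?_⟩, ⟨?_, ?_⟩, ⟨h1, h2⟩⟩
  · change 1 ≤ ρ * Real.cos φ
    rw [← h3]; gcongr
  · change ρ * Real.cos φ ≤ 2
    nlinarith
  · change 0 ≤ ε⁻¹ * (ρ * Real.sin φ)
    positivity
  · change ε⁻¹ * (ρ * Real.sin φ) ≤ 2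
    rw [inv_mul_le_iff₀ hε]
    calc ρ * Real.sin φ ≤ ρ * Real.sin (Real.arctan ε) := by gcongr
      _ = ε * (ρ * Real.cos (Real.arctan ε)) := by rw [hsε]; ring
      _ ≤ ε * 2 := by rw [h3]; gcongr; norm_num

theorem continuousOn_expTransform_sourceSum {χ : Fin 3 → (ℝ × ℝ × ℝ) × ℝ → ℝ}
    (hχ : ∀ j, ContDiff ℝ ∞ (χ j)) {γ : ℝ → ℝ × ℝ × ℝ} (hγ : Continuous γ) {L : ℝ} {S : Set ℝ}
    (hs : ∀ φ ∈ S, ∀ j u, L < |u| → χ j (γ φ, u) = 0) (N : ℕ) (q : Fin 3 → ℕ → ℕ → ℝ) (z : ℂ) :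
    ContinuousOn (fun φ => expTransform (sourceSum χ N q (γ φ)) z) S := by
  have hc : Continuous (Function.uncurry fun (φ u : ℝ) =>
      (sourceSum χ N q (γ φ) u : ℂ) * Complex.exp (z * u)) := by
    have h1 := (contDiff_sourceSum hχ N q).continuous.comp
      (by fun_prop : Continuous fun p : ℝ × ℝ => (γ p.1, p.2))
    simp only [Function.comp_def] at h1
    exact (Complex.continuous_ofReal.comp h1).mul (by fun_prop)
  have h := continuous_parametric_integral_of_continuous (μ := (volume : Measure ℝ)) hc
    (isCompact_Icc (a := -L) (b := L))
  refine h.continuousOn.congr fun φ hφ => ?_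
  refine (setIntegral_eq_integral_of_forall_compl_eq_zero fun u hu => ?_).symm
  change (sourceSum χ N q (γ φ) u : ℂ) * Complex.exp (z * u) = 0
  rw [mem_Icc, ← abs_le, not_le] at hu
  have : sourceSum χ N q (γ φ) u = 0 :=
    Finset.sum_eq_zero fun j _ => by rw [hs φ hφ j u hu, zero_mul]
  rw [this]; simp

/-! ### The source on a vertical line -/

theorem lineSupNorm_le_of_le : ∃ c : ℝ, 0 ≤ c ∧ ∀ {ε θ E F a ℓ β β' c₀ c₁ D : ℝ} {n : ℕ}
    {hh H : ℝ → ℝ → ℂ}, 0 < ε → 0 ≤ F → E + F + 2 ≤ n → 1 ≤ β → 0 ≤ c₀ → 0 ≤ c₁ → 0 ≤ D →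
    (∀ ξ, powWeight ε E F ‖linePt β ξ‖ ≤ c₁ * powWeight ε a ℓ ‖linePt β' ξ‖) →
    (∀ ξ, ∀ φ ∈ Ioo 0 θ, ‖hh ξ φ‖ ≤ c₀ * ‖H ξ φ‖ + D / ‖linePt β ξ‖ ^ n) →
    lineSupNorm ε θ E F β hh
      ≤ 2 * (ENNReal.ofReal (c * D) + ENNReal.ofReal (c₁ * c₀) * lineSupNorm ε θ a ℓ β' H) := by
  obtain ⟨c, hc0, hc⟩ := exists_lineNorm_le_of_decay
  refine ⟨c, hc0, fun {ε θ E F a ℓ β β' c₀ c₁ D n hh H} hε hF hn hβ hc₀ hc₁ hD hw hb => ?_⟩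
  have hpos : ∀ ξ, 0 < ‖linePt β ξ‖ := fun ξ => by have := one_le_norm_linePt hβ ξ; linarith
  have hwc := continuous_powWeight_linePt (ε := ε) (e := E) (m := F) (β := β) (Or.inr (by linarith)) hF
  have hT := hc (T := fun ξ => ((D / ‖linePt β ξ‖ ^ n : ℝ) : ℂ)) hε hF hn hβ hD fun ξ => by
    rw [Complex.norm_real, Real.norm_of_nonneg (by positivity), mul_div_cancel₀ _ (pow_pos (hpos ξ) n).ne']
  refine le_trans (lineL2_mono (G := fun ξ => ENNReal.ofReal (powWeight ε E F ‖linePt β ξ‖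
      * ‖((D / ‖linePt β ξ‖ ^ n : ℝ) : ℂ)‖) + ENNReal.ofReal (c₁ * c₀) *
        (ENNReal.ofReal (powWeight ε a ℓ ‖linePt β' ξ‖) * ⨆ φ ∈ Ioo 0 θ, ‖H ξ φ‖ₑ)) fun ξ => ?_)
    (le_trans (lineL2_add_le ?_) ?_)
  · have hw0 := powWeight_nonneg (p := E) (q := F) hε (norm_nonneg (linePt β ξ))
    have h1 : ⨆ φ ∈ Ioo 0 θ, ‖hh ξ φ‖ₑ
        ≤ ENNReal.ofReal (D / ‖linePt β ξ‖ ^ n) + ENNReal.ofReal c₀ * ⨆ φ ∈ Ioo 0 θ, ‖H ξ φ‖ₑ := by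
      refine iSup₂_le fun φ hφ => ?_
      rw [← ofReal_norm]
      refine (ENNReal.ofReal_le_ofReal (hb ξ φ hφ)).trans ?_
      have := hpos ξ
      rw [add_comm, ENNReal.ofReal_add (by positivity) (by positivity), ENNReal.ofReal_mul hc₀, ofReal_norm]
      gcongr
      exact le_iSup₂ (f := fun φ (_ : φ ∈ Ioo 0 θ) => ‖H ξ φ‖ₑ) φ hφ
    calc ENNReal.ofReal (powWeight ε E F ‖linePt β ξ‖) * ⨆ φ ∈ Ioo 0 θ, ‖hh ξ φ‖ₑ
        ≤ ENNReal.ofReal (powWeight ε E F ‖linePt β ξ‖) * (ENNReal.ofReal (D / ‖linePt β ξ‖ ^ n)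
          + ENNReal.ofReal c₀ * ⨆ φ ∈ Ioo 0 θ, ‖H ξ φ‖ₑ) := mul_le_mul' le_rfl h1
      _ = ENNReal.ofReal (powWeight ε E F ‖linePt β ξ‖ * ‖((D / ‖linePt β ξ‖ ^ n : ℝ) : ℂ)‖)
          + ENNReal.ofReal (powWeight ε E F ‖linePt β ξ‖) * (ENNReal.ofReal c₀
            * ⨆ φ ∈ Ioo 0 θ, ‖H ξ φ‖ₑ) := by
        rw [mul_add, ENNReal.ofReal_mul hw0, Complex.norm_real, Real.norm_of_nonneg (by positivity)]
      _ ≤ ENNReal.ofReal (powWeight ε E F ‖linePt β ξ‖ * ‖((D / ‖linePt β ξ‖ ^ n : ℝ) : ℂ)‖)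
          + ENNReal.ofReal (c₁ * powWeight ε a ℓ ‖linePt β' ξ‖) * (ENNReal.ofReal c₀
            * ⨆ φ ∈ Ioo 0 θ, ‖H ξ φ‖ₑ) := by
        gcongr
        exact hw ξ
      _ = _ := by
        rw [ENNReal.ofReal_mul hc₁, ENNReal.ofReal_mul hc₁]
        ring
  · refine ENNReal.measurable_ofReal.comp_aemeasurable ?_
    refine (hwc.measurable.mul ?_).aemeasurable
    have := (continuous_linePt β).norm.measurable
    fun_prop
  · rw [lineL2_const_mul ENNReal.ofReal_ne_top]
    exact mul_le_mul' le_rfl (add_le_add hT le_rfl)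

/-- The line β - 2 may lie to the left of the origin; it only has to keep distance 1/2 from it, so
that 2 ≤ 4 |λ - 2|. -/
theorem norm_linePt_le {β : ℝ} (hβ : 1 / 2 ≤ |β - 2|) (ξ : ℝ) :
    ‖linePt β ξ‖ ≤ 5 * ‖linePt (β - 2) ξ‖ := by
  have h1 : linePt β ξ = linePt (β - 2) ξ + 2 := by simp only [linePt]; push_cast; ring
  have h2 := abs_le_norm_linePt (β - 2) ξ
  have h3 := norm_add_le (linePt (β - 2) ξ) 2
  rw [← h1] at h3
  have h4 : ‖(2 : ℂ)‖ = 2 := by simp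
  linarith

/-- Surplus powers of μ are traded for powers of |λ|, using μ ≤ |λ|. -/
theorem powWeight_le_powWeight {ε E F a ℓ r : ℝ} (hε : 0 < ε) (hr : 1 ≤ r) (hℓ : ℓ ≤ F)
    (h : E + F - ℓ ≤ a) : powWeight ε E F r ≤ powWeight ε a ℓ r := by
  have h0 : 0 < r := by linarith
  have hm : 0 < min r (1 / ε) := lt_min h0 (by positivity)
  unfold powWeight
  calc r ^ E * min r (1 / ε) ^ F = r ^ E * (min r (1 / ε) ^ (F - ℓ) * min r (1 / ε) ^ ℓ) := by
        rw [← Real.rpow_add hm]; congr 2; ring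
    _ ≤ r ^ E * (r ^ (F - ℓ) * min r (1 / ε) ^ ℓ) := by
        have := Real.rpow_le_rpow hm.le (min_le_left r (1 / ε)) (sub_nonneg.2 hℓ)
        gcongr
    _ = r ^ (E + F - ℓ) * min r (1 / ε) ^ ℓ := by
        rw [← mul_assoc, ← Real.rpow_add h0]; congr 2; ring
    _ ≤ _ := by
        have := Real.rpow_le_rpow_of_exponent_le hr h
        gcongr

theorem powWeight_linePt_le {ε E F a ℓ β : ℝ} (hε : 0 < ε) (hβ1 : 1 ≤ β) (hβ : 1 / 2 ≤ |β - 2|)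
    (ha : 0 ≤ a) (hℓ0 : 0 ≤ ℓ) (hℓ : ℓ ≤ F) (h : E + F - ℓ ≤ a) (ξ : ℝ) :
    powWeight ε E F ‖linePt β ξ‖ ≤ 5 ^ (a + ℓ) * powWeight ε a ℓ ‖linePt (β - 2) ξ‖ :=
  (powWeight_le_powWeight hε (one_le_norm_linePt hβ1 ξ) hℓ h).trans
    ((powWeight_mono hε ha hℓ0 (norm_nonneg _) (norm_linePt_le hβ ξ)).trans
      (powWeight_mul_le hε hℓ0 (norm_nonneg _) (by norm_num)))

/-- The factor r² of the right-hand side in polar coordinates moves the line β - 2 to β. -/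
theorem IsFT.shift_two {β : ℝ} {v : ℝ → ℝ} {T : ℝ → ℂ} (H : IsFT (expWeight (β - 2) v) T) (s : ℝ) :
    IsFT (expWeight β (fun u => Real.exp (2 * (u + s)) * v (u + s)))
      (fun ξ => (Real.exp (2 * s) : ℂ) * (Complex.exp (linePt (β - 2) ξ * s) * T ξ)) := by
  have h := (H.translate s).const_mul (Real.exp (2 * s) : ℂ)
  refine h.congr ?_ ?_
  · refine .of_forall fun u => ?_
    simp only [expWeight]
    rw [← Complex.ofReal_mul, ← mul_assoc, ← mul_assoc, ← Real.exp_add, ← Real.exp_add]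
    congr 3; ring
  · exact .rfl

/-- The Mellin transform of the source `r² g₀ + ∑_j χ_j P_j`. -/
theorem exists_source {ζ η : ℝ → ℝ} (hζ : IsCutoff (1 / 8) (1 / 4) ζ) (hη : IsCutoff 1 2 η) (N : ℕ)
    {β a ℓ E F : ℝ} (hβ : 1 ≤ β) (hβ2 : 1 / 2 ≤ |β - 2|) (ha : 0 ≤ a) (hℓ0 : 0 ≤ ℓ) (hℓ : ℓ ≤ F)
    (hE : E + F - ℓ ≤ a) :
    ∃ C : ℝ, 0 ≤ C ∧ ∀ {ε M : ℝ} {q : Fin 3 → ℕ → ℕ → ℝ} {g : ℝ × ℝ → ℝ} {H : ℝ → ℝ → ℂ} {n : ℕ},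
      0 < ε → ε ≤ 1 → 0 ≤ M → (∀ j a b, |q j a b| ≤ M) → IsWedgeMellin ε n (β - 2) g H →
      lineSupNorm ε (Real.arctan ε) a ℓ (β - 2) H ≤ ENNReal.ofReal M →
      ∃ hh : ℝ → ℝ → ℂ,
        (∀ φ ∈ Ioo 0 (Real.arctan ε), IsFT (expWeight β fun u =>
          Real.exp (2 * (u + -Real.log (Real.cos (Real.arctan ε))))
            * g (polarPt ε (-Real.log (Real.cos (Real.arctan ε))) u φ)
          + sourceSum (sourceFactor ζ η) N q
            (anglePar ε (-Real.log (Real.cos (Real.arctan ε))) φ) u) fun ξ => hh ξ φ) ∧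
        AEStronglyMeasurable (fun p : ℝ × ℝ => hh p.1 p.2)
          ((volume : Measure ℝ).prod (volume.restrict (Ioo 0 (Real.arctan ε)))) ∧
        (∃ a : ℝ≥0∞, a ≠ ⊤ ∧ ∀ φ ∈ Ioo 0 (Real.arctan ε), eLpNorm (fun ξ => hh ξ φ) 2 volume ≤ a) ∧
        lineSupNorm ε (Real.arctan ε) E F β hh ≤ ENNReal.ofReal (C * M) := by
  obtain ⟨n₁, hn₁⟩ := exists_nat_ge (max (E + F + 2) 2)
  obtain ⟨c, hc0, hc⟩ := lineSupNorm_le_of_le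
  obtain ⟨C₁, hC₁0, hC₁⟩ := exists_sourceSum_bound (contDiff_sourceFactor hζ hη)
    ((isCompact_Icc (a := (1 : ℝ)) (b := 2)).prod
      ((isCompact_Icc (a := (0 : ℝ)) (b := 2)).prod (isCompact_Icc (a := (1 : ℝ)) (b := 2)))) (L := 4)
    (fun j e he u hu => sourceFactor_eq_zero hζ hη j he.1.1 he.1.2 he.2.2.1 he.2.2.2 hu) N β n₁
  refine ⟨2 * (c * C₁ + 5 ^ (a + ℓ) * (4 * 2 ^ |β - 2|)), by positivity,
    fun {ε M q g H n} hε hε1 hM hq hH hHM => ?_⟩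
  obtain ⟨hs1, hs2, -⟩ := exp_neg_log_cos hε.le hε1
  have hmem : ∀ φ ∈ Ioo 0 (Real.arctan ε), _ := fun φ hφ => anglePar_mem hε hε1 hφ
  set s := -Real.log (Real.cos (Real.arctan ε)) with hs
  have hs0 : 0 ≤ s := by rwa [Real.one_le_exp_iff] at hs1
  have hvan : ∀ φ ∈ Ioo 0 (Real.arctan ε), ∀ j u, 4 < |u| →
      sourceFactor ζ η j (anglePar ε s φ, u) = 0 := fun φ hφ j u hu =>
    sourceFactor_eq_zero hζ hη j (hmem φ hφ).1.1 (hmem φ hφ).1.2 (hmem φ hφ).2.2.1 (hmem φ hφ).2.2.2 hu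
  have hanglec : Continuous (anglePar ε s) := by unfold anglePar; fun_prop
  set S : ℝ → ℝ → ℂ := fun ξ φ => expTransform (sourceSum (sourceFactor ζ η) N q (anglePar ε s φ))
    (-linePt β ξ) with hSdef
  have hcont : ∀ e, Continuous (sourceSum (sourceFactor ζ η) N q e) := fun e => by
    have := (contDiff_sourceSum (contDiff_sourceFactor hζ hη) N q).continuous.comp
      (by fun_prop : Continuous fun u : ℝ => (e, u))
    simp only [Function.comp_def] at this
    exact this
  have hSft : ∀ φ ∈ Ioo 0 (Real.arctan ε), IsFT (expWeight β
      (sourceSum (sourceFactor ζ η) N q (anglePar ε s φ))) fun ξ => S ξ φ := fun φ hφ =>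
    isFT_expTransform (hcont _) (hasCompactSupport_sourceSum (hvan φ hφ) N q) β
  set hh : ℝ → ℝ → ℂ := fun ξ φ =>
    (Real.exp (2 * s) : ℂ) * (Complex.exp (linePt (β - 2) ξ * s) * H ξ φ) + S ξ φ with hhdef
  have hft : ∀ φ ∈ Ioo 0 (Real.arctan ε), IsFT (expWeight β fun u =>
      Real.exp (2 * (u + s)) * g (polarPt ε s u φ)
        + sourceSum (sourceFactor ζ η) N q (anglePar ε s φ) u) fun ξ => hh ξ φ := fun φ hφ => by
    have h1 := (isMellinOn_iff.1 (hH.1 φ hφ))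
    rw [logWeight_eq] at h1
    refine ((h1.shift_two s).add (hSft φ hφ)).congr (.of_forall fun u => ?_) .rfl
    simp only [expWeight, polarSlice, polarPt]
    push_cast; ring
  have hβ0 : 0 < ‖linePt β 0‖ := by have := one_le_norm_linePt hβ 0; linarith
  have hbound : ∀ ξ, ∀ φ ∈ Ioo 0 (Real.arctan ε),
      ‖hh ξ φ‖ ≤ 4 * 2 ^ |β - 2| * ‖H ξ φ‖ + C₁ * M / ‖linePt β ξ‖ ^ n₁ := fun ξ φ hφ => by
    have hp : 0 < ‖linePt β ξ‖ := by have := one_le_norm_linePt hβ ξ; linarith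
    refine (norm_add_le _ _).trans (add_le_add ?_ ?_)
    · rw [norm_mul, norm_mul, norm_exp_mul_ofReal, linePt_re, Complex.norm_real,
        Real.norm_of_nonneg (Real.exp_pos _).le, ← mul_assoc]
      have e1 : Real.exp (2 * s) ≤ 4 := by
        rw [two_mul, Real.exp_add]; nlinarith
      have e2 : Real.exp ((β - 2) * s) ≤ 2 ^ |β - 2| := by
        calc Real.exp ((β - 2) * s) ≤ Real.exp (s * |β - 2|) := by
              rw [mul_comm]; gcongr; exact le_abs_self _
          _ = Real.exp s ^ |β - 2| := Real.exp_mul _ _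
          _ ≤ 2 ^ |β - 2| := by gcongr
      gcongr
    · rw [le_div_iff₀ (by positivity), mul_comm]
      have := hC₁ q M hq _ (hmem φ hφ) (-linePt β ξ) (by simp [abs_of_nonneg (by linarith : 0 ≤ β)])
      rwa [norm_neg] at this
  have hn2 : (2 : ℝ) ≤ n₁ := (le_max_right _ _).trans hn₁
  refine ⟨hh, hft, ?_, ?_, ?_⟩
  · refine aestronglyMeasurable_of_continuousOn (Real.arctan_pos.2 hε)
      (fun φ hφ => (hft φ hφ).memLp_right.1) ?_
    filter_upwards [hH.2] with ξ hξ
    exact (continuousOn_const.mul (continuousOn_const.mul hξ.continuousOn)).add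
      (continuousOn_expTransform_sourceSum (contDiff_sourceFactor hζ hη) hanglec hvan N q _)
  · have hw : 0 < powWeight ε a ℓ (1 / 2) := by unfold powWeight; positivity
    have h0 := hc (E := 0) (F := 0) (a := a) (ℓ := ℓ) (β' := β - 2) (H := H) (hh := hh)
      (c₁ := (powWeight ε a ℓ (1 / 2))⁻¹) (θ := Real.arctan ε) (D := C₁ * M) hε le_rfl
      (by linarith) hβ (by positivity) (by positivity) (by positivity)
      (fun ξ => by
        have h1 := powWeight_mono hε ha hℓ0 (by norm_num) (hβ2.trans (abs_le_norm_linePt (β - 2) ξ))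
        rw [← div_eq_inv_mul, le_div_iff₀ hw]
        simpa [powWeight] using h1) hbound
    refine ⟨_, ne_top_of_le_ne_top ?_ h0, fun φ hφ => ?_⟩
    · exact ENNReal.mul_ne_top (by simp) (ENNReal.add_ne_top.2 ⟨ENNReal.ofReal_ne_top,
        ENNReal.mul_ne_top ENNReal.ofReal_ne_top (ne_top_of_le_ne_top ENNReal.ofReal_ne_top hHM)⟩)
    · rw [← lineL2_enorm]
      refine lineL2_mono fun ξ => ?_
      simp only [powWeight, Real.rpow_zero, mul_one, ENNReal.ofReal_one, one_mul]
      exact le_iSup₂ (f := fun φ (_ : φ ∈ Ioo 0 (Real.arctan ε)) => ‖hh ξ φ‖ₑ) φ hφ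
  · refine (hc (c₁ := 5 ^ (a + ℓ)) hε (hℓ0.trans hℓ) ((le_max_left _ _).trans hn₁) hβ (by positivity)
      (by positivity) (by positivity) (powWeight_linePt_le hε hβ hβ2 ha hℓ0 hℓ hE) hbound).trans ?_
    refine (mul_le_mul' le_rfl (add_le_add le_rfl (mul_le_mul' le_rfl hHM))).trans ?_
    rw [← ENNReal.ofReal_mul (by positivity), ← ENNReal.ofReal_add (by positivity) (by positivity)]
    rw [show (2 : ℝ≥0∞) = ENNReal.ofReal 2 by simp, ← ENNReal.ofReal_mul (by norm_num)]
    exact ENNReal.ofReal_le_ofReal (le_of_eq (by ring))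

/-- A representative for the homogeneous norm of the wedge, without angular derivatives. -/
theorem exists_lineSupNorm_le_of_wedgeHom_lt {ε w a ℓ β : ℝ} {q : ℝ × ℝ → ℝ} {X : ℝ≥0∞} (hε : 0 < ε)
    (hw : 0 ≤ w) (h : wedgeHom ε w a ℓ β q < X) : ∃ H, IsWedgeMellin ε ⌊a⌋₊ β q H ∧
      lineSupNorm ε (Real.arctan ε) a ℓ β H ≤ X := by
  unfold wedgeHom at h
  simp only [iInf_lt_iff] at h
  obtain ⟨H, hH, hlt⟩ := h
  refine ⟨H, hH, le_trans ?_ hlt.le⟩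
  -- Only the summand j = 0 is kept, and the angular weight e^{w|λ|(θ-φ)} ≥ 1 is dropped.
  refine le_trans ?_ (Finset.single_le_sum (fun _ _ => zero_le) (Finset.mem_range.2 (Nat.succ_pos _)))
  refine lineL2_mono fun ξ => ?_
  simp only [ENNReal.mul_iSup]
  refine iSup₂_mono fun φ hφ => ?_
  have h1 := powWeight_nonneg (p := a) (q := ℓ) hε (norm_nonneg (linePt β ξ))
  rw [← ofReal_norm, ← ENNReal.ofReal_mul h1]
  refine ENNReal.ofReal_le_ofReal ?_
  simp only [iteratedDeriv_zero, Nat.cast_zero, sub_zero]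
  refine mul_le_mul_of_nonneg_right ?_ (norm_nonneg _)
  rw [mul_assoc]
  refine le_mul_of_one_le_left h1 (Real.one_le_exp ?_)
  have := hφ.2
  have : 0 ≤ Real.arctan ε - φ := by linarith
  positivity

/-! ### Subtracting the polynomial part -/

/-- `p - χ(x) P(x,y)`. -/
def subBiPoly (χ : ℝ → ℝ) (N : ℕ) (c : ℕ → ℕ → ℝ) (p : ℝ × ℝ → ℝ) (z : ℝ × ℝ) : ℝ :=
  p z - χ z.1 * biPoly N c z

theorem contDiffOn_subBiPoly {χ : ℝ → ℝ} (hχ : ContDiff ℝ ∞ χ) (N : ℕ) (c : ℕ → ℕ → ℝ)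
    {p : ℝ × ℝ → ℝ} (hp : ContDiffOn ℝ 2 p wedgeBar) : ContDiffOn ℝ 2 (subBiPoly χ N c p) wedgeBar := by
  have h1 : ContDiff ℝ 2 χ := by exact_mod_cast contDiff_infty.1 hχ 2
  have h2 : ContDiff ℝ 2 (biPoly N c) := by
    exact_mod_cast contDiff_infty.1 (contDiff_biPoly N c) 2
  exact hp.sub ((h1.comp contDiff_fst).mul h2).contDiffOn

theorem hasFDerivAt_mul_biPoly {χ : ℝ → ℝ} (hχ : ContDiff ℝ ∞ χ) {N : ℕ} {c : ℕ → ℕ → ℝ}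
    (hc : DegBelow N c) (z : ℝ × ℝ) :
    HasFDerivAt (fun z : ℝ × ℝ => χ z.1 * biPoly N c z)
      ((deriv χ z.1 * biPoly N c z + χ z.1 * biPoly N (coeffX c) z) • ContinuousLinearMap.fst ℝ ℝ ℝ
        + (χ z.1 * biPoly N (coeffY c) z) • ContinuousLinearMap.snd ℝ ℝ ℝ) z := by
  have h1 := ((hχ.differentiable (by simp)) z.1).hasDerivAt.comp_hasFDerivAt z
    (hasFDerivAt_fst (𝕜 := ℝ) (p := z))
  refine (h1.mul (hasFDerivAt_biPoly hc z)).congr_fderiv ?_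
  ext
  · simp; ring
  · simp

section

variable {ζ : ℝ → ℝ} {N : ℕ} {c : ℕ → ℕ → ℝ} {p : ℝ × ℝ → ℝ} {z : ℝ × ℝ}

theorem hasFDerivWithinAt_subBiPoly (hζ : ContDiff ℝ ∞ ζ) (hc : DegBelow N c) {n : WithTop ℕ∞}
    (hp : ContDiffOn ℝ n p wedgeBar) (hn : n ≠ 0) (hz : z ∈ wedgeBar) :
    HasFDerivWithinAt (subBiPoly ζ N c p)
      ((dX p z - (deriv ζ z.1 * biPoly N c z + ζ z.1 * biPoly N (coeffX c) z)) •
          ContinuousLinearMap.fst ℝ ℝ ℝ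
        + (dY p z - ζ z.1 * biPoly N (coeffY c) z) • ContinuousLinearMap.snd ℝ ℝ ℝ) wedgeBar z := by
  refine ((hasFDerivWithinAt_wedgeBar hp hn hz).sub
    (hasFDerivAt_mul_biPoly hζ hc z).hasFDerivWithinAt).congr_fderiv ?_
  ext <;> simp

theorem dX_subBiPoly (hζ : ContDiff ℝ ∞ ζ) (hc : DegBelow N c) (hp : ContDiffOn ℝ 2 p wedgeBar)
    (hz : z ∈ wedgeBar) : dX (subBiPoly ζ N c p) z
      = dX p z - (deriv ζ z.1 * biPoly N c z + ζ z.1 * biPoly N (coeffX c) z) :=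
  dX_eq_of_hasFDerivWithinAt (hasFDerivWithinAt_subBiPoly hζ hc hp (by norm_num) hz) hz

theorem dY_subBiPoly (hζ : ContDiff ℝ ∞ ζ) (hc : DegBelow N c) (hp : ContDiffOn ℝ 2 p wedgeBar)
    (hz : z ∈ wedgeBar) : dY (subBiPoly ζ N c p) z = dY p z - ζ z.1 * biPoly N (coeffY c) z :=
  dY_eq_of_hasFDerivWithinAt (hasFDerivWithinAt_subBiPoly hζ hc hp (by norm_num) hz) hz

theorem dX_dX_subBiPoly (hζ : ContDiff ℝ ∞ ζ) (hc : DegBelow N c) (hp : ContDiffOn ℝ 2 p wedgeBar)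
    (hz : z ∈ wedgeBar) : dX (dX (subBiPoly ζ N c p)) z
      = dX (dX p) z - (deriv (deriv ζ) z.1 * biPoly N c z + 2 * deriv ζ z.1 * biPoly N (coeffX c) z
        + ζ z.1 * biPoly N (coeffX (coeffX c)) z) := by
  have hζ' : ContDiff ℝ ∞ (deriv ζ) := (contDiff_infty_iff_deriv.1 hζ).2
  have h1 := (hasFDerivWithinAt_wedgeBar (contDiffOn_dX (m := 1) hp (by norm_num)) (by norm_num) hz).sub
    ((hasFDerivAt_mul_biPoly hζ' hc z).add (hasFDerivAt_mul_biPoly hζ hc.coeffX z)).hasFDerivWithinAt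
  have h2 := h1.congr (f₁ := dX (subBiPoly ζ N c p)) (fun y hy => dX_subBiPoly hζ hc hp hy)
    (dX_subBiPoly hζ hc hp hz)
  rw [dX, h2.fderivWithin (uniqueDiffOn_wedgeBar z hz)]
  simp
  ring

/-- The cut-off is a function of x alone, so derivatives in y see only the polynomial; all
commutators come from the derivatives in x. -/
theorem dY_dY_subBiPoly (hζ : ContDiff ℝ ∞ ζ) (hc : DegBelow N c) (hp : ContDiffOn ℝ 2 p wedgeBar)
    (hz : z ∈ wedgeBar) : dY (dY (subBiPoly ζ N c p)) z
      = dY (dY p) z - ζ z.1 * biPoly N (coeffY (coeffY c)) z := by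
  have h1 := (hasFDerivWithinAt_wedgeBar (contDiffOn_dY (m := 1) hp (by norm_num)) (by norm_num) hz).sub
    (hasFDerivAt_mul_biPoly hζ hc.coeffY z).hasFDerivWithinAt
  have h2 := h1.congr (f₁ := dY (subBiPoly ζ N c p)) (fun y hy => dY_subBiPoly hζ hc hp hy)
    (dY_subBiPoly hζ hc hp hz)
  rw [dY, h2.fderivWithin (uniqueDiffOn_wedgeBar z hz)]
  simp

theorem biPoly_right_zero (N : ℕ) (c : ℕ → ℕ → ℝ) (h : ∀ a, c a 0 = 0) (x : ℝ) :
    biPoly N c (x, 0) = 0 := by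
  refine Finset.sum_eq_zero fun a _ => Finset.sum_eq_zero fun b _ => ?_
  rcases Nat.eq_zero_or_pos b with rfl | hb
  · simp [h a]
  · simp [hb.ne']

end

/-! ### Coefficients of polynomials in two variables -/

/-- `P(x,y)` as a double sum. -/
def mvCoeff (P : MvPolynomial (Fin 2) ℝ) (a b : ℕ) : ℝ :=
  P.coeff (Finsupp.single 0 a + Finsupp.single 1 b)

theorem degree_single_add (a b : ℕ) :
    (Finsupp.single (0 : Fin 2) a + Finsupp.single 1 b).degree = a + b := by
  rw [Finsupp.degree_eq_sum, Fin.sum_univ_two]; simp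

theorem DegLT.mvCoeff_eq_zero {L : ℕ} {P : MvPolynomial (Fin 2) ℝ} (h : DegLT L P) {a b : ℕ}
    (hab : L ≤ a + b) : mvCoeff P a b = 0 := by
  by_contra hne
  have := h _ (MvPolynomial.mem_support_iff.2 hne)
  rw [degree_single_add] at this
  omega

theorem abs_mvCoeff_le (P : MvPolynomial (Fin 2) ℝ) (a b : ℕ) : |mvCoeff P a b| ≤ polyNorm₂ P := by
  unfold mvCoeff
  set d := Finsupp.single (0 : Fin 2) a + Finsupp.single 1 b
  by_cases h : d ∈ P.support
  · rw [polyNorm₂, ← Real.sqrt_sq_eq_abs]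
    exact Real.sqrt_le_sqrt (Finset.single_le_sum (f := fun i => P.coeff i ^ 2)
      (fun i _ => sq_nonneg _) h)
  · rw [MvPolynomial.notMem_support_iff.1 h, abs_zero]; exact Real.sqrt_nonneg _

theorem DegLT.eval_eq {L N : ℕ} {P : MvPolynomial (Fin 2) ℝ} (h : DegLT L P) (hN : L ≤ N)
    (z : ℝ × ℝ) : MvPolynomial.eval ![z.1, z.2] P = biPoly N (mvCoeff P) z := by
  have hd : ∀ d : Fin 2 →₀ ℕ, Finsupp.single 0 (d 0) + Finsupp.single 1 (d 1) = d := fun d => by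
    ext i; fin_cases i <;> simp
  rw [MvPolynomial.eval_eq', biPoly, ← Finset.sum_product']
  refine Finset.sum_of_injOn (fun d : Fin 2 →₀ ℕ => (d 0, d 1)) ?_ ?_ ?_ ?_
  · intro d _ d' _ hdd
    rw [Prod.mk.injEq] at hdd
    rw [← hd d, ← hd d', hdd.1, hdd.2]
  · intro d hdP
    have h1 := h d hdP
    rw [Finsupp.degree_eq_sum, Fin.sum_univ_two] at h1
    simp only [Finset.coe_product, mem_prod, Finset.coe_range, mem_Iio]
    omega
  · rintro ⟨a, b⟩ _ hab
    have : mvCoeff P a b = 0 := by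
      by_contra hne
      exact hab ⟨_, MvPolynomial.mem_support_iff.2 hne, by simp⟩
    simp only [this, zero_mul]
  · intro d _
    simp only [mvCoeff, hd, Fin.prod_univ_two]
    simp [mul_assoc]

theorem biPoly_abs_le (N : ℕ) (c : ℕ → ℕ → ℝ) {z : ℝ × ℝ} (h1 : z.1 ∈ Icc 0 1) (h2 : z.2 ∈ Icc 0 1) :
    |biPoly N c z| ≤ ∑ a ∈ Finset.range N, ∑ b ∈ Finset.range N, |c a b| := by
  refine (Finset.abs_sum_le_sum_abs _ _).trans (Finset.sum_le_sum fun a _ =>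
    (Finset.abs_sum_le_sum_abs _ _).trans (Finset.sum_le_sum fun b _ => ?_))
  rw [abs_mul, abs_mul, abs_of_nonneg (pow_nonneg h1.1 a), abs_of_nonneg (pow_nonneg h2.1 b), mul_assoc]
  exact mul_le_of_le_one_right (abs_nonneg _)
    (mul_le_one₀ (pow_le_one₀ h1.1 h1.2) (pow_nonneg h2.1 b) (pow_le_one₀ h2.1 h2.2))

/-! ### The growth of the solution -/

theorem lintegral_exp_ne_top : ∫⁻ u : ℝ, ENNReal.ofReal (Real.exp (-|u|)) ≠ ⊤ := by
  have h : Integrable fun u : ℝ => Real.exp (-|u|) := by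
    rw [← integrableOn_univ, ← Iic_union_Ioi (a := (0 : ℝ))]
    refine IntegrableOn.union ?_ ?_
    · refine (integrableOn_exp_Iic 0).congr_fun (fun u hu => ?_) measurableSet_Iic
      simp only [abs_of_nonpos (mem_Iic.1 hu), neg_neg]
    · refine (integrableOn_exp_neg_Ioi 0).congr_fun (fun u hu => ?_) measurableSet_Ioi
      simp only [abs_of_pos (mem_Ioi.1 hu)]
  exact h.lintegral_lt_top.ne

/-- Cauchy–Schwarz after splitting off e^{-u/2}: the remaining factor e^{u/2 - |u|} has square at
most e^{-|u|}. -/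
theorem lintegral_abs_mul_exp_le {v : ℝ → ℝ} (hv : AEStronglyMeasurable (expWeight (1 / 2) v) volume) :
    ∫⁻ u, ENNReal.ofReal (|v u| * Real.exp (-|u|))
      ≤ (∫⁻ u : ℝ, ENNReal.ofReal (Real.exp (-|u|))) ^ (1 / 2 : ℝ)
        * eLpNorm (expWeight (1 / 2) v) 2 volume := by
  rw [← lineL2_enorm]
  refine le_trans (lintegral_mono fun u => ?_) (le_trans (lintegral_mul_le_lineL2_mul
    (F := fun u => ENNReal.ofReal (Real.exp (u / 2 - |u|))) (G := fun u => ‖expWeight (1 / 2) v u‖ₑ)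
    ?_ hv.enorm) (mul_le_mul' ?_ le_rfl))
  · simp only
    rw [← ofReal_norm, ← ENNReal.ofReal_mul (Real.exp_pos _).le, expWeight, Complex.norm_real,
      Real.norm_eq_abs, abs_mul, Real.abs_exp, ← mul_assoc, ← Real.exp_add, mul_comm]
    refine ENNReal.ofReal_le_ofReal (le_of_eq ?_)
    congr 2; ring
  · have : Continuous fun u : ℝ => Real.exp (u / 2 - |u|) := by fun_prop
    exact (ENNReal.measurable_ofReal.comp this.measurable).aemeasurable
  · unfold lineL2
    gcongr with u
    rw [ENNReal.ofReal_rpow_of_nonneg (Real.exp_pos _).le (by norm_num), ← Real.exp_mul]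
    refine ENNReal.ofReal_le_ofReal (Real.exp_le_exp.2 ?_)
    have := le_abs_self u
    linarith

theorem eLpNorm_slice_le {ε θ a ℓ β : ℝ} (hε : 0 < ε) (ha : 0 ≤ a) (hℓ : 0 ≤ ℓ) (hβ : 1 / 2 ≤ |β|)
    (H : ℝ → ℝ → ℂ) {φ : ℝ} (hφ : φ ∈ Ioo 0 θ) :
    eLpNorm (fun ξ => H ξ φ) 2 volume
      ≤ ENNReal.ofReal (powWeight ε a ℓ (1 / 2))⁻¹ * lineSupNorm ε θ a ℓ β H := by
  have hw : 0 < powWeight ε a ℓ (1 / 2) := by unfold powWeight; positivity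
  rw [← lineL2_enorm, lineSupNorm, ← lineL2_const_mul ENNReal.ofReal_ne_top]
  refine lineL2_mono fun ξ => ?_
  rw [← mul_assoc, ← ENNReal.ofReal_mul (by positivity)]
  have h1 : 1 ≤ ENNReal.ofReal ((powWeight ε a ℓ (1 / 2))⁻¹ * powWeight ε a ℓ ‖linePt β ξ‖) := by
    rw [ENNReal.one_le_ofReal, ← div_eq_inv_mul, one_le_div hw]
    exact powWeight_mono hε ha hℓ (by norm_num) (hβ.trans (abs_le_norm_linePt β ξ))
  calc ‖H ξ φ‖ₑ ≤ ⨆ φ ∈ Ioo 0 θ, ‖H ξ φ‖ₑ :=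
        le_iSup₂ (f := fun φ (_ : φ ∈ Ioo 0 θ) => ‖H ξ φ‖ₑ) φ hφ
    _ ≤ _ := le_mul_of_one_le_left' h1

/-- The decomposition in the Y-norm uses ζ(r) and its own polynomial, the correction uses ζ(x) and
another one. In the wedge both products vanish for x > 1 and are bounded for x ≤ 1, so passing from
one to the other does not affect the growth condition. -/
theorem abs_cutoff_sub_le {ζ : ℝ → ℝ} (hζ : IsCutoff (1 / 8) (1 / 4) ζ) (N N' : ℕ)
    (c c' : ℕ → ℕ → ℝ) : ∃ K : ℝ, 0 ≤ K ∧ ∀ (ε : ℝ), ∀ z ∈ wedge,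
      |ζ (wedgeRadius ε z.1 z.2) * biPoly N' c' z - ζ z.1 * biPoly N c z| ≤ K := by
  obtain ⟨Z, hZ0, hZ⟩ := hζ.exists_bound
  refine ⟨Z * (∑ a ∈ Finset.range N', ∑ b ∈ Finset.range N', |c' a b|)
    + Z * (∑ a ∈ Finset.range N, ∑ b ∈ Finset.range N, |c a b|), by positivity, fun ε z hz => ?_⟩
  have hx : 0 < z.1 := hz.1.trans hz.2
  have hr : z.1 ≤ wedgeRadius ε z.1 z.2 := by
    rw [wedgeRadius]
    exact Real.le_sqrt_of_sq_le (le_add_of_nonneg_right (sq_nonneg _))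
  rcases le_or_gt z.1 1 with h | h
  · have m1 : z.1 ∈ Icc (0 : ℝ) 1 := ⟨hx.le, h⟩
    have m2 : z.2 ∈ Icc (0 : ℝ) 1 := ⟨hz.1.le, hz.2.le.trans h⟩
    refine (abs_sub _ _).trans (add_le_add ?_ ?_)
    · rw [abs_mul]
      exact mul_le_mul (hZ _) (biPoly_abs_le N' c' m1 m2) (abs_nonneg _) hZ0
    · rw [abs_mul]
      exact mul_le_mul (hZ _) (biPoly_abs_le N c m1 m2) (abs_nonneg _) hZ0
  · rw [hζ.eq_zero _ (by linarith), hζ.eq_zero z.1 (by linarith)]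
    simp only [zero_mul, sub_zero, abs_zero]
    positivity

/-- A function of finite `Y` norm does not grow faster than `e^{|u|}` in logarithmic coordinates, in
the mean. -/
theorem exists_growth_bound {ζ : ℝ → ℝ} (hζ : IsCutoff (1 / 8) (1 / 4) ζ) {ε w k : ℝ} (hε : 0 < ε)
    (hw : 0 ≤ w) (hk : 1 ≤ k) {p : ℝ × ℝ → ℝ} (hp : yNorm ζ ε w k p < ⊤) (N : ℕ) (c : ℕ → ℕ → ℝ)
    (s : ℝ) : ∃ A : ℝ≥0∞, A ≠ ⊤ ∧ ∀ φ ∈ Ioo 0 (Real.arctan ε),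
      ∫⁻ u, ENNReal.ofReal (|subBiPoly ζ N c p (polarPt ε s u φ)| * Real.exp (-|u|)) ≤ A := by
  unfold yNorm at hp
  simp only [iInf_lt_iff] at hp
  obtain ⟨P, hP, hlt⟩ := hp
  -- The smallest admissible index ℓ = 2/3 belongs to the line Re λ = 1/2, which is slow enough for
  -- the weight e^{-|u|}.
  have h1 : wedgeHom ε w (3 * (2 / 3)) (2 / 3) (3 * (2 / 3) - 3 / 2) (subPoly ζ ε P p) < ⊤ :=
    lt_of_le_of_lt ((le_iSup₂ (f := fun ℓ (_ : ℓ ∈ Icc (2 / 3) k) =>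
      wedgeHom ε w (3 * ℓ) ℓ (3 * ℓ - 3 / 2) (subPoly ζ ε P p)) (2 / 3) ⟨le_rfl, by linarith⟩).trans
        le_add_self) hlt
  obtain ⟨X, hX, hXt⟩ := exists_between h1
  obtain ⟨H, hH, hHX⟩ := exists_lineSupNorm_le_of_wedgeHom_lt hε hw hX
  rw [show (3 * (2 / 3) - 3 / 2 : ℝ) = 1 / 2 by norm_num] at hH hHX
  obtain ⟨K, hK0, hK⟩ := abs_cutoff_sub_le hζ N ⌈3 * k - 3 / 2⌉₊ c (mvCoeff P)
  set I := ∫⁻ u : ℝ, ENNReal.ofReal (Real.exp (-|u|)) with hI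
  have hItop : I ≠ ⊤ := lintegral_exp_ne_top
  refine ⟨I ^ (1 / 2 : ℝ) * (ENNReal.ofReal (Real.exp (s / 2)) *
    (ENNReal.ofReal (powWeight ε (3 * (2 / 3)) (2 / 3) (1 / 2))⁻¹ * X)) + ENNReal.ofReal K * I,
    ?_, fun φ hφ => ?_⟩
  · refine ENNReal.add_ne_top.2 ⟨ENNReal.mul_ne_top (ENNReal.rpow_ne_top_of_nonneg (by norm_num) hItop)
      (ENNReal.mul_ne_top ENNReal.ofReal_ne_top (ENNReal.mul_ne_top ENNReal.ofReal_ne_top hXt.ne)),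
      ENNReal.mul_ne_top ENNReal.ofReal_ne_top hItop⟩
  · have h2 := isMellinOn_iff.1 (hH.1 φ hφ)
    rw [logWeight_eq] at h2
    have h3 := h2.translate s
    have h4 : eLpNorm (expWeight (1 / 2) fun u => subPoly ζ ε P p (polarPt ε s u φ)) 2 volume
        ≤ ENNReal.ofReal (Real.exp (s / 2)) *
          (ENNReal.ofReal (powWeight ε (3 * (2 / 3)) (2 / 3) (1 / 2))⁻¹ * X) := by
      refine h3.eLpNorm_eq.symm.trans_le ((eLpNorm_le_mul_eLpNorm_of_ae_le_mul (c := Real.exp (s / 2))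
        (g := fun ξ => H ξ φ) (.of_forall fun ξ => ?_) 2).trans ?_)
      · rw [norm_mul, norm_exp_mul_ofReal, linePt_re]
        exact le_of_eq (by congr 2; ring)
      · gcongr
        refine (eLpNorm_slice_le (a := 3 * (2 / 3)) (ℓ := 2 / 3) (β := 1 / 2) hε (by norm_num) (by norm_num)
          (by norm_num) H hφ).trans ?_
        gcongr
    have h5 := lintegral_abs_mul_exp_le (v := fun u => subPoly ζ ε P p (polarPt ε s u φ))
      h3.memLp_left.1
    have hpt : ∀ u, |subBiPoly ζ N c p (polarPt ε s u φ)|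
        ≤ |subPoly ζ ε P p (polarPt ε s u φ)| + K := fun u => by
      have h6 := hK ε _ (polarPt_mem_wedge (s := s) (u := u) hε hφ)
      rw [← hP.eval_eq le_rfl] at h6
      refine le_trans (le_of_eq ?_) ((abs_add_le _ _).trans (add_le_add le_rfl h6))
      rw [subBiPoly, subPoly]
      congr 1; ring
    calc ∫⁻ u, ENNReal.ofReal (|subBiPoly ζ N c p (polarPt ε s u φ)| * Real.exp (-|u|))
        ≤ ∫⁻ u, (ENNReal.ofReal (|subPoly ζ ε P p (polarPt ε s u φ)| * Real.exp (-|u|))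
          + ENNReal.ofReal K * ENNReal.ofReal (Real.exp (-|u|))) := by
          refine lintegral_mono fun u => ?_
          rw [← ENNReal.ofReal_mul hK0, ← ENNReal.ofReal_add (by positivity) (by positivity), ← add_mul]
          exact ENNReal.ofReal_le_ofReal (mul_le_mul_of_nonneg_right (hpt u) (Real.exp_pos _).le)
      _ = (∫⁻ u, ENNReal.ofReal (|subPoly ζ ε P p (polarPt ε s u φ)| * Real.exp (-|u|)))
          + ENNReal.ofReal K * I := by
          rw [lintegral_add_right, lintegral_const_mul' _ _ ENNReal.ofReal_ne_top]
          have : Continuous fun u : ℝ => Real.exp (-|u|) := by fun_prop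
          exact (ENNReal.measurable_ofReal.comp this.measurable).const_mul _
      _ ≤ _ := add_le_add (h5.trans (mul_le_mul' le_rfl h4)) le_rfl

/-! ### The derivatives of the corrected solution on the side `y = x` -/

theorem lineNorm_const_mul_le {ε e m β r : ℝ} (hr : 0 ≤ r) (T : ℝ → ℂ) :
    lineNorm ε e m β (fun ξ => (r : ℂ) * T ξ) ≤ ENNReal.ofReal r * lineNorm ε e m β T :=
  lineNorm_le_of_norm_le hr fun ξ => by
    rw [norm_mul, Complex.norm_real, Real.norm_of_nonneg hr]
    exact le_of_eq (by ring)

/-- The extra power of μ on the right is at least 1, because |λ| ≥ 1 and ε ≤ 1. -/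
theorem lineNorm_linePt_mul_le {ε e m β : ℝ} (hε : 0 < ε) (hε1 : ε ≤ 1) (hβ : 1 ≤ β) (T : ℝ → ℂ) :
    lineNorm ε e m β (fun ξ => linePt β ξ * T ξ) ≤ lineNorm ε (e + 1) (m + 1) β T := by
  refine lineL2_mono fun ξ => ENNReal.ofReal_le_ofReal ?_
  have h1 := one_le_norm_linePt hβ ξ
  have h0 : 0 < ‖linePt β ξ‖ := by linarith
  rw [norm_mul, ← mul_assoc, powWeight_mul_self h0]
  refine mul_le_mul_of_nonneg_right ?_ (norm_nonneg _)
  have h2 : 1 ≤ min ‖linePt β ξ‖ (1 / ε) := le_min h1 (by rwa [le_div_iff₀ hε, one_mul])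
  unfold powWeight
  exact mul_le_mul_of_nonneg_left (Real.rpow_le_rpow_of_exponent_le h2 (by linarith)) (by positivity)

/-- S is the transform of the tangential derivative of the trace, which is just λ times that of the
data. T combines it with the normal derivative given by `IsStripC2.isFT_normal_deriv`, whose bound
contains the factor ε that is needed. -/
theorem exists_lineNorm_boundary (ζ η : ℝ → ℝ) (hζ : IsCutoff (1 / 8) (1 / 4) ζ) (hη : IsCutoff 1 2 η)
    (N : ℕ) {B c₀ β e m a ℓ : ℝ} (hc0 : 0 ≤ c₀) (hc : c₀ < Real.pi / 2) (hβ : 1 ≤ β) (hβB : β ≤ B)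
    (hβ2 : 1 / 2 ≤ |β - 2|) (he : 0 ≤ e) (hm : 0 ≤ m) (ha : 0 ≤ a) (hℓ0 : 0 ≤ ℓ) (hℓ : ℓ ≤ m + 1)
    (hE : e - 1 + (m + 1) - ℓ ≤ a) :
    ∃ C : ℝ, 0 ≤ C ∧ ∀ {ε M : ℝ} {P g : ℝ × ℝ → ℝ} {q : Fin 3 → ℕ → ℕ → ℝ} {H : ℝ → ℝ → ℂ} {n : ℕ}
      {A : ℝ≥0∞} {Dh : ℝ → ℂ}, 0 < ε → ε ≤ 1 → 0 ≤ M → B * Real.arctan ε ≤ c₀ →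
      ContDiffOn ℝ 2 P wedgeBar → (∀ x, 0 < x → dY P (x, 0) = 0) → A ≠ ⊤ →
      (∀ φ ∈ Ioo 0 (Real.arctan ε), ∫⁻ u, ENNReal.ofReal
        (|P (polarPt ε (-Real.log (Real.cos (Real.arctan ε))) u φ)| * Real.exp (-|u|)) ≤ A) →
      (∀ u, ∀ φ ∈ Ioo 0 (Real.arctan ε),
        Real.exp (2 * (u + -Real.log (Real.cos (Real.arctan ε)))) *
          (dX (dX P) (polarPt ε (-Real.log (Real.cos (Real.arctan ε))) u φ)
          + (1 / ε) ^ 2 * dY (dY P) (polarPt ε (-Real.log (Real.cos (Real.arctan ε))) u φ))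
        = Real.exp (2 * (u + -Real.log (Real.cos (Real.arctan ε))))
            * g (polarPt ε (-Real.log (Real.cos (Real.arctan ε))) u φ)
          + sourceSum (sourceFactor ζ η) N q
            (anglePar ε (-Real.log (Real.cos (Real.arctan ε))) φ) u) →
      (∀ j a b, |q j a b| ≤ M) → IsWedgeMellin ε n (β - 2) g H →
      lineSupNorm ε (Real.arctan ε) a ℓ (β - 2) H ≤ ENNReal.ofReal M →
      IsFT (expWeight β fun u => P (Real.exp u, Real.exp u)) Dh →
      lineNorm ε (e + 1) (m + 1) β Dh ≤ ENNReal.ofReal M →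
      ∃ S T, IsFT (expWeight β fun u => Real.exp u *
          (dX P (Real.exp u, Real.exp u) + dY P (Real.exp u, Real.exp u))) S ∧
        lineNorm ε e m β S ≤ ENNReal.ofReal (C * M) ∧
        IsFT (expWeight β fun u => Real.exp u * ((1 / ε) ^ 2 * dY P (Real.exp u, Real.exp u))) T ∧
        lineNorm ε e m β T ≤ ENNReal.ofReal (C * M) := by
  obtain ⟨C₁, hC₁0, hC₁⟩ := exists_source hζ hη N hβ hβ2 ha hℓ0 hℓ hE
  have hcos : 0 < Real.cos c₀ := Real.cos_pos_of_mem_Ioo ⟨by linarith [Real.pi_pos], hc⟩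
  refine ⟨2 * (16 / Real.cos c₀ * (1 + C₁) + 1), by positivity,
    fun {ε M P g q H n A Dh} hε hε1 hM hBc hP hN hA hgrow hlap hq hH hHM hD hDM => ?_⟩
  obtain ⟨hh, hft, hmeas, ⟨a', ha', hslice⟩, hsup⟩ := hC₁ hε hε1 hM hq hH hHM
  obtain ⟨Uu, Uuu, Uφφ, hS, hsum⟩ := exists_isStripC2 hε (-Real.log (Real.cos (Real.arctan ε))) hP hN
  have hpa := polarPt_arctan hε
  set s := -Real.log (Real.cos (Real.arctan ε)) with hs
  have hθ := Real.arctan_pos.2 hε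
  set T₀ : ℝ → ℂ := fun ξ => -(linePt β ξ * (Complex.sin (linePt β ξ * Real.arctan ε)
      / Complex.cos (linePt β ξ * Real.arctan ε)) * Dh ξ) + ∫ φ in Ioo 0 (Real.arctan ε),
        Complex.cos (linePt β ξ * φ) / Complex.cos (linePt β ξ * Real.arctan ε) * hh ξ φ with hT₀
  have hT₀m : AEStronglyMeasurable T₀ volume := aestronglyMeasurable_normal hD.memLp_right.1 hmeas
  have hT₀M : lineNorm ε e m β T₀ ≤ ENNReal.ofReal (ε * (16 / Real.cos c₀ * (1 + C₁) * M)) := by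
    refine (lineNorm_normal_le hε hc hBc hβ hβB he hm hD.memLp_right.1 hh).trans ?_
    refine (mul_le_mul' le_rfl (add_le_add hDM hsup)).trans ?_
    rw [← ENNReal.ofReal_add (by positivity) (by positivity), ← ENNReal.ofReal_mul (by positivity)]
    exact ENNReal.ofReal_le_ofReal (le_of_eq (by ring))
  have hw1 : ∀ ξ, 1 ≤ powWeight ε e m ‖linePt β ξ‖ := fun ξ =>
    one_le_powWeight hε hε1 he hm (one_le_norm_linePt hβ ξ)
  have hT₀L := memLp_of_lineNorm hT₀m one_pos hw1 (ne_top_of_le_ne_top ENNReal.ofReal_ne_top hT₀M)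
  have hN' := hS.isFT_normal_deriv (β := β) hθ hc hBc (hβ.trans hβB)
    (by rwa [abs_of_nonneg (by linarith : 0 ≤ β)])
    hA hgrow (Dh := Dh) (by simp only [hpa]; exact hD) (hh := hh) ha' hmeas hslice
    (fun φ hφ => by
      have := hft φ hφ
      simp only [hsum]
      convert this using 3 with u
      exact hlap u φ hφ) hT₀L (fun ξ => rfl)
  simp only [hpa] at hN'
  set D' : ℝ → ℝ := fun u => Real.exp u *
    (dX P (Real.exp u, Real.exp u) + dY P (Real.exp u, Real.exp u)) with hD'
  have hmem : ∀ u : ℝ, ((Real.exp u, Real.exp u) : ℝ × ℝ) ∈ wedgeBar := fun u =>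
    ⟨Real.exp_pos u, (Real.exp_pos u).le, le_rfl⟩
  have hdiag : Continuous fun u : ℝ => ((Real.exp u, Real.exp u) : ℝ × ℝ) := by fun_prop
  have hcX : Continuous fun u : ℝ => dX P (Real.exp u, Real.exp u) :=
    (contDiffOn_dX (m := 1) hP (by norm_num)).continuousOn.comp_continuous hdiag hmem
  have hcY : Continuous fun u : ℝ => dY P (Real.exp u, Real.exp u) :=
    (contDiffOn_dY (m := 1) hP (by norm_num)).continuousOn.comp_continuous hdiag hmem
  have hDd : ∀ u, HasDerivAt (fun u => P (Real.exp u, Real.exp u)) (D' u) u := fun u => by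
    have := (hasDerivAt_diag hP (by norm_num) (Real.exp_pos u)).comp u (Real.hasDerivAt_exp u)
    refine this.congr_deriv ?_
    rw [hD']; ring
  have hS1 := hD.hasDeriv hDd (by rw [hD']; fun_prop) (memLp_linePt_mul hε hε1 (by linarith) (by linarith) hβ
    hD.memLp_right.1 (ne_top_of_le_ne_top ENNReal.ofReal_ne_top hDM))
  have hS1M : lineNorm ε e m β (fun ξ => linePt β ξ * Dh ξ) ≤ ENNReal.ofReal M :=
    (lineNorm_linePt_mul_le hε hε1 hβ Dh).trans hDM
  -- On x = y the angular derivative is x (ε⁻¹ p_y - ε p_x) and the tangential one is x (p_x + p_y).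
  -- Adding ε⁻¹ times the first to the second eliminates p_x and leaves (1 + ε²) ε⁻² x p_y.
  refine ⟨_, fun ξ => (((1 + ε ^ 2)⁻¹ * ε⁻¹ : ℝ) : ℂ) * T₀ ξ
    + (((1 + ε ^ 2)⁻¹ : ℝ) : ℂ) * (linePt β ξ * Dh ξ), hS1, hS1M.trans (ENNReal.ofReal_le_ofReal ?_),
    ?_, ?_⟩
  · refine le_mul_of_one_le_left hM ?_
    have : 0 ≤ 16 / Real.cos c₀ * (1 + C₁) := by positivity
    linarith
  · refine ((hN'.const_mul _).add (hS1.const_mul _)).congr (.of_forall fun u => ?_) .rfl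
    simp only [expWeight, ← Complex.ofReal_mul, ← Complex.ofReal_add]
    congr 1
    rw [hD']
    field_simp
    ring
  · refine (lineNorm_add_le hε (Or.inl he) hm (hT₀m.const_mul _)).trans ?_
    have hi : (1 + ε ^ 2)⁻¹ ≤ 1 := inv_le_one_of_one_le₀ (by nlinarith)
    have k1 := (lineNorm_const_mul_le (ε := ε) (e := e) (m := m) (β := β) (r := (1 + ε ^ 2)⁻¹ * ε⁻¹)
      (by positivity) T₀).trans (mul_le_mul' le_rfl hT₀M)
    have k2 := (lineNorm_const_mul_le (ε := ε) (e := e) (m := m) (β := β) (r := (1 + ε ^ 2)⁻¹)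
      (by positivity) (fun ξ => linePt β ξ * Dh ξ)).trans (mul_le_mul' le_rfl hS1M)
    refine (mul_le_mul' le_rfl (add_le_add k1 k2)).trans ?_
    rw [← ENNReal.ofReal_mul (by positivity), ← ENNReal.ofReal_mul (by positivity),
      ← ENNReal.ofReal_add (by positivity) (by positivity),
      show (2 : ℝ≥0∞) = ENNReal.ofReal 2 by simp, ← ENNReal.ofReal_mul (by norm_num)]
    refine ENNReal.ofReal_le_ofReal ?_
    have e1 : (1 + ε ^ 2)⁻¹ * ε⁻¹ * (ε * (16 / Real.cos c₀ * (1 + C₁) * M))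
        = (1 + ε ^ 2)⁻¹ * (16 / Real.cos c₀ * (1 + C₁) * M) := by field_simp
    have e2 : (1 + ε ^ 2)⁻¹ * (16 / Real.cos c₀ * (1 + C₁) * M) ≤ 16 / Real.cos c₀ * (1 + C₁) * M :=
      mul_le_of_le_one_left (by positivity) hi
    have e3 : (1 + ε ^ 2)⁻¹ * M ≤ M := mul_le_of_le_one_left hM hi
    rw [e1]; linarith

/-! ### The correction of a solution by a polynomial -/

theorem biPoly_add_mul (N : ℕ) (c d : ℕ → ℕ → ℝ) (r : ℝ) (z : ℝ × ℝ) :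
    biPoly N c z + r * biPoly N d z = biPoly N (fun a b => c a b + r * d a b) z := by
  simp only [biPoly, Finset.mul_sum, ← Finset.sum_add_distrib]
  exact Finset.sum_congr rfl fun a _ => Finset.sum_congr rfl fun b _ => by ring

theorem abs_sum_antidiagonal_le {N : ℕ} {d : ℕ → ℕ → ℝ} {A : ℝ} (hd : DegBelow N d) (hA : 0 ≤ A)
    (h : ∀ a b, |d a b| ≤ A) (n : ℕ) :
    |∑ x ∈ Finset.HasAntidiagonal.antidiagonal n, d x.1 x.2| ≤ N * A := by
  rcases lt_or_ge n N with hn | hn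
  · refine (Finset.abs_sum_le_sum_abs _ _).trans ((Finset.sum_le_card_nsmul _ _ A fun x _ => h _ _).trans ?_)
    rw [Finset.Nat.card_antidiagonal, nsmul_eq_mul]
    gcongr
    exact_mod_cast hn
  · rw [Finset.sum_eq_zero, abs_zero]
    · positivity
    · intro x hx
      exact hd _ _ (by rw [Finset.HasAntidiagonal.mem_antidiagonal.1 hx]; exact hn)

theorem DegBelow.coeffX_pred {N : ℕ} {c : ℕ → ℕ → ℝ} (h : DegBelow (N + 1) c) : DegBelow N (_root_.coeffX c) :=
  fun a b hab => by rw [_root_.coeffX, h _ _ (by omega), mul_zero]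

theorem DegBelow.coeffY_pred {N : ℕ} {c : ℕ → ℕ → ℝ} (h : DegBelow (N + 1) c) : DegBelow N (_root_.coeffY c) :=
  fun a b hab => by rw [_root_.coeffY, h _ _ (by omega), mul_zero]

theorem DegBelow.abs_coeffX_le {N : ℕ} {c : ℕ → ℕ → ℝ} {A : ℝ} (hc : DegBelow N c) (hA : 0 ≤ A)
    (h : ∀ a b, |c a b| ≤ A) (a b : ℕ) : |_root_.coeffX c a b| ≤ N * A := by
  unfold _root_.coeffX
  rcases lt_or_ge (a + 1) N with hn | hn
  · rw [abs_mul, abs_of_nonneg (by positivity)]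
    have : ((a : ℝ) + 1) ≤ N := by exact_mod_cast hn.le
    exact mul_le_mul this (h _ _) (abs_nonneg _) (by positivity)
  · rw [hc _ _ (by omega), mul_zero, abs_zero]; positivity

theorem DegBelow.abs_coeffY_le {N : ℕ} {c : ℕ → ℕ → ℝ} {A : ℝ} (hc : DegBelow N c) (hA : 0 ≤ A)
    (h : ∀ a b, |c a (b + 1)| ≤ A) (a b : ℕ) : |_root_.coeffY c a b| ≤ N * A := by
  unfold _root_.coeffY
  rcases lt_or_ge (b + 1) N with hn | hn
  · rw [abs_mul, abs_of_nonneg (by positivity)]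
    have : ((b : ℝ) + 1) ≤ N := by exact_mod_cast hn.le
    exact mul_le_mul this (h _ _) (abs_nonneg _) (by positivity)
  · rw [hc _ _ (by omega), mul_zero, abs_zero]; positivity

theorem biPoly_diag_pred {N : ℕ} {c : ℕ → ℕ → ℝ} (h : DegBelow N c) (x : ℝ) :
    biPoly (N + 1) c (x, x)
      = ∑ n ∈ Finset.range N, (∑ d ∈ Finset.HasAntidiagonal.antidiagonal n, c d.1 d.2) * x ^ n := by
  have h' : DegBelow (N + 1) c := fun a b hab => h a b (by omega)
  rw [biPoly_diag h', Finset.sum_range_succ, Finset.sum_eq_zero (s := Finset.HasAntidiagonal.antidiagonal N)]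
  · simp
  · exact fun d hd => h _ _ (by rw [Finset.HasAntidiagonal.mem_antidiagonal.1 hd])

theorem wedgeRadius_polarPt {ε : ℝ} (hε : 0 < ε) (s u φ : ℝ) :
    wedgeRadius ε (polarPt ε s u φ).1 (polarPt ε s u φ).2 = Real.exp (u + s) := by
  unfold wedgeRadius polarPt
  simp only [mul_inv_cancel_left₀ hε.ne']
  rw [mul_pow, mul_pow, ← mul_add, Real.cos_sq_add_sin_sq, mul_one, Real.sqrt_sq (Real.exp_pos _).le]

theorem sourceSum_anglePar (ζ η : ℝ → ℝ) (N : ℕ) (q : Fin 3 → ℕ → ℕ → ℝ) (ε s φ u : ℝ) :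
    sourceSum (sourceFactor ζ η) N q (anglePar ε s φ) u = Real.exp (2 * (u + s)) *
      ((η (Real.exp (u + s)) - ζ (polarPt ε s u φ).1) * biPoly N (q 0) (polarPt ε s u φ)
        - 2 * deriv ζ (polarPt ε s u φ).1 * biPoly N (q 1) (polarPt ε s u φ)
        - deriv (deriv ζ) (polarPt ε s u φ).1 * biPoly N (q 2) (polarPt ε s u φ)) := by
  have e1 : (anglePar ε s φ).1 * Real.exp u = (polarPt ε s u φ).1 := by
    simp only [anglePar, polarPt, Real.exp_add]; ring
  have e2 : (anglePar ε s φ).2.1 * Real.exp u = (polarPt ε s u φ).2 := by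
    simp only [anglePar, polarPt, Real.exp_add]; ring
  have e3 : (anglePar ε s φ).2.2 * Real.exp u = Real.exp (u + s) := by
    simp only [anglePar, Real.exp_add]; ring
  have e4 : Real.exp (2 * (u + s)) = Real.exp (u + s) ^ 2 := by
    rw [← Real.exp_nat_mul]; norm_num
  rw [sourceSum, Fin.sum_univ_three, e1, e2]
  simp only [sourceFactor, Matrix.cons_val_zero, Matrix.cons_val_one, Matrix.cons_val]
  rw [e1, e3, e4]
  ring

/-- The polynomial satisfies the equation with source R exactly, so what remains is g minus its own
polynomial part, the mismatch (η - ζ) R of the cut-offs, and the commutator of the equation with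
ζ(x). -/
theorem lap_subBiPoly {ζ η : ℝ → ℝ} (hζ : ContDiff ℝ ∞ ζ) {N L : ℕ} {c : ℕ → ℕ → ℝ}
    (hc : DegBelow N c) {ε : ℝ} (hε : 0 < ε) {f : ℝ → ℝ} {g p : ℝ × ℝ → ℝ}
    (hp : IsWedgeSolution ε f g p) {R : MvPolynomial (Fin 2) ℝ} (hR : DegLT L R) (hL : L ≤ N)
    (hcR : ∀ a b, coeffX (coeffX c) a b + (1 / ε) ^ 2 * coeffY (coeffY c) a b = mvCoeff R a b)
    (s u : ℝ) {φ : ℝ} (hφ : φ ∈ Ioo 0 (Real.arctan ε)) :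
    Real.exp (2 * (u + s)) * (dX (dX (subBiPoly ζ N c p)) (polarPt ε s u φ)
        + (1 / ε) ^ 2 * dY (dY (subBiPoly ζ N c p)) (polarPt ε s u φ))
      = Real.exp (2 * (u + s)) * subPoly η ε R g (polarPt ε s u φ)
        + sourceSum (sourceFactor ζ η) N ![mvCoeff R, coeffX c, c] (anglePar ε s φ) u := by
  have hz := polarPt_mem_wedge (s := s) (u := u) hε hφ
  rw [sourceSum_anglePar, ← mul_add]
  congr 1
  simp only [Matrix.cons_val_zero, Matrix.cons_val_one, Matrix.cons_val]
  have e := biPoly_add_mul N (coeffX (coeffX c)) (coeffY (coeffY c)) ((1 / ε) ^ 2) (polarPt ε s u φ)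
  simp only [hcR] at e
  rw [dX_dX_subBiPoly hζ hc hp.regular (wedge_subset_wedgeBar hz),
    dY_dY_subBiPoly hζ hc hp.regular (wedge_subset_wedgeBar hz), subPoly, wedgeRadius_polarPt hε,
    hR.eval_eq hL, ← hp.equation _ hz]
  have e' : biPoly N (mvCoeff R) (polarPt ε s u φ) = biPoly N (coeffX (coeffX c)) (polarPt ε s u φ)
    + (1 / ε) ^ 2 * biPoly N (coeffY (coeffY c)) (polarPt ε s u φ) := e.symm
  rw [e']
  ring

theorem eval_eq_sum_of_coeff {N : ℕ} (hN : 0 < N) {Q : Polynomial ℝ} (h : ∀ n, N ≤ n → Q.coeff n = 0)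
    (x : ℝ) : Q.eval x = ∑ n ∈ Finset.range N, Q.coeff n * x ^ n := by
  refine Polynomial.eval_eq_sum_range' ?_ x
  have : Q.natDegree ≤ N - 1 := Polynomial.natDegree_le_iff_coeff_eq_zero.2 fun n hn => h n (by omega)
  omega

/-- The data of the problem for the corrected solution. -/
theorem exists_correction {ζ : ℝ → ℝ} (η : ℝ → ℝ) (hζ : ContDiff ℝ ∞ ζ) (N : ℕ) {c₀ : ℝ}
    (hc₀ : c₀ < Real.pi / 2) (hc₀' : 0 ≤ c₀) : ∃ C : ℝ, 1 ≤ C ∧ ∀ {ε M : ℝ} {f : ℝ → ℝ} {g p : ℝ × ℝ → ℝ}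
      {Q : Polynomial ℝ} {R : MvPolynomial (Fin 2) ℝ}, 0 < ε → ε ≤ 1 →
      (∀ n < N + 2, n * Real.arctan ε ≤ c₀) → 0 ≤ M → IsWedgeSolution ε f g p →
      (∀ n, N + 3 ≤ n → Q.coeff n = 0) → polyNorm Q ≤ M → DegLT N R → polyNorm₂ R ≤ M →
      ∃ (c : ℕ → ℕ → ℝ) (v' : ℝ → ℝ), DegBelow (N + 2) c ∧ (∀ a b, |c a b| ≤ C * M) ∧
        (∀ a b, |coeffX c a b| ≤ C * M) ∧ (∀ a b, |(1 / ε) ^ 2 * coeffY c a b| ≤ C * M) ∧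
        (∀ a, coeffY c a 0 = 0) ∧
        (∀ n, |∑ d ∈ Finset.HasAntidiagonal.antidiagonal n, c d.1 d.2| ≤ C * M) ∧
        (∀ x, 0 < x → dY (subBiPoly ζ (N + 2) c p) (x, 0) = 0) ∧
        (∀ s u, ∀ φ ∈ Ioo 0 (Real.arctan ε),
          Real.exp (2 * (u + s)) * (dX (dX (subBiPoly ζ (N + 2) c p)) (polarPt ε s u φ)
            + (1 / ε) ^ 2 * dY (dY (subBiPoly ζ (N + 2) c p)) (polarPt ε s u φ))
          = Real.exp (2 * (u + s)) * subPoly η ε R g (polarPt ε s u φ)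
            + sourceSum (sourceFactor ζ η) (N + 2) ![mvCoeff R, coeffX c, c] (anglePar ε s φ) u) ∧
        (∀ u, HasDerivAt (fun u => f (Real.exp u) - ζ (Real.exp u) * Q.eval (Real.exp u)) (v' u) u) ∧
        Continuous v' ∧
        ∀ u, subBiPoly ζ (N + 2) c p (Real.exp u, Real.exp u)
          = Real.exp (-u) * v' u + expSum (deriv ζ) (N + 3) Q.coeff u := by
  have hcos : 0 < Real.cos c₀ := Real.cos_pos_of_mem_Ioo ⟨by linarith [Real.pi_pos], hc₀⟩
  obtain ⟨C₀, hC₀, hsol⟩ := exists_biPoly_solution (N + 2) hcos (by linarith [Real.pi_pos])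
  set K : ℝ := N + 3 with hK
  have hK1 : 1 ≤ K := by rw [hK]; have : (0 : ℝ) ≤ N := by positivity
                         linarith
  refine ⟨K + K * (C₀ * K), by have : 0 ≤ K * (C₀ * K) := by positivity
                               linarith,
    fun {ε M f g p Q R} hε hε1 hang hM hp hQ hQM hR hRM => ?_⟩
  have hqb : ∀ n, |Q.derivative.coeff n| ≤ K * M := fun n => by
    rw [Polynomial.coeff_derivative]
    rcases lt_or_ge (n + 1) (N + 3) with hn | hn
    · have : ((n : ℝ) + 1) ≤ K := by rw [hK]; exact_mod_cast hn.le
      rw [mul_comm, abs_mul, abs_of_nonneg (by positivity : (0 : ℝ) ≤ (n : ℝ) + 1)]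
      exact mul_le_mul this ((abs_coeff_le_polyNorm Q _).trans hQM) (abs_nonneg _) (by positivity)
    · rw [hQ _ hn, zero_mul, abs_zero]; positivity
  have hRb : ∀ a b, |mvCoeff R a b| ≤ K * M := fun a b =>
    ((abs_mvCoeff_le R a b).trans hRM).trans (le_mul_of_one_le_left hM hK1)
  obtain ⟨c, hc, hcb, hcy, hc1, hcR, hcd⟩ := hsol ε hε hε1 hang (K * M) Q.derivative.coeff (mvCoeff R)
    hqb hRb (fun n hn => by rw [Polynomial.coeff_derivative, hQ _ (by omega), zero_mul])
    (fun a b hab => hR.mvCoeff_eq_zero (by omega))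
  have hA : 0 ≤ C₀ * (K * M) := by positivity
  have hN2 : ((N + 2 : ℕ) : ℝ) ≤ K := by rw [hK]; push_cast; linarith
  have b0 : ∀ {x : ℝ}, x ≤ K * (C₀ * (K * M)) → x ≤ (K + K * (C₀ * K)) * M := fun {x} hx => by
    have : 0 ≤ K * M := by positivity
    calc x ≤ K * (C₀ * (K * M)) := hx
      _ ≤ _ := by nlinarith
  have hcY0 : ∀ a, coeffY c a 0 = 0 := fun a => by rw [coeffY, zero_add, hc1, mul_zero]
  -- The derivative of f - ζQ, written with the Dirichlet condition f' = p. It is continuous because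
  -- p is, although f is only assumed differentiable.
  set x' : ℝ → ℝ := fun x => p (x, x) - (deriv ζ x * Q.eval x + ζ x * Q.derivative.eval x) with hx'
  have hdiag : Continuous fun u : ℝ => ((Real.exp u, Real.exp u) : ℝ × ℝ) := by fun_prop
  have hpc : Continuous fun u : ℝ => p (Real.exp u, Real.exp u) :=
    hp.regular.continuousOn.comp_continuous hdiag
      fun u => ⟨Real.exp_pos u, (Real.exp_pos u).le, le_rfl⟩
  have hζ1 : Continuous (deriv ζ) := (contDiff_infty_iff_deriv.1 hζ).2.continuous
  have hζ0 := hζ.continuous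
  refine ⟨c, fun u => x' (Real.exp u) * Real.exp u, hc, fun a b => b0 ((hcb a b).trans
    (le_mul_of_one_le_left hA hK1)), fun a b => b0 ?_, fun a b => b0 ?_, hcY0, fun n => ?_, fun x hx => ?_,
    fun s u φ hφ => lap_subBiPoly hζ hc hε hp hR (by omega) hcR s u hφ, fun u => ?_, ?_, fun u => ?_⟩
  · exact (hc.abs_coeffX_le hA hcb a b).trans (mul_le_mul_of_nonneg_right hN2 hA)
  · have h1 := hc.abs_coeffY_le (A := ε ^ 2 * (C₀ * (K * M))) (by positivity) hcy a b
    rw [abs_mul, abs_of_nonneg (by positivity)]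
    calc (1 / ε) ^ 2 * |coeffY c a b| ≤ (1 / ε) ^ 2 * ((N + 2 : ℕ) * (ε ^ 2 * (C₀ * (K * M)))) := by gcongr
      _ = (N + 2 : ℕ) * (C₀ * (K * M)) := by field_simp
      _ ≤ _ := mul_le_mul_of_nonneg_right hN2 hA
  · rw [hcd]
    refine (hqb n).trans (mul_le_mul_of_nonneg_right ?_ hM)
    have : 0 ≤ K * (C₀ * K) := by positivity
    linarith
  · rw [dY_subBiPoly hζ hc hp.regular ⟨hx, le_rfl, hx.le⟩, hp.neumann x hx,
      biPoly_right_zero _ _ hcY0, mul_zero, sub_zero]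
  · have h1 := ((hp.dirichlet _ (Real.exp_pos u)).sub (((hζ.differentiable (by simp) _).hasDerivAt).mul
      (Q.hasDerivAt (Real.exp u)))).comp u (Real.hasDerivAt_exp u)
    exact h1
  · have : Continuous fun u : ℝ => x' (Real.exp u) := by
      rw [hx']
      exact hpc.sub (((hζ1.comp Real.continuous_exp).mul (Q.continuous.comp Real.continuous_exp)).add
        ((hζ0.comp Real.continuous_exp).mul (Q.derivative.continuous.comp Real.continuous_exp)))
    exact this.mul Real.continuous_exp
  · have e1 : Real.exp (-u) * (x' (Real.exp u) * Real.exp u) = x' (Real.exp u) := by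
      rw [mul_comm, mul_assoc, ← Real.exp_add, add_neg_cancel, Real.exp_zero, mul_one]
    rw [e1, expSum_eq, ← eval_eq_sum_of_coeff (by omega) hQ, subBiPoly, biPoly_diag hc, hx']
    simp only [hcd]
    rw [← eval_eq_sum_of_coeff (by omega) fun n hn => by
      rw [Polynomial.coeff_derivative, hQ _ (by omega), zero_mul]]
    ring

/-- The Dirichlet estimate and the estimate of the boundary derivatives are combined on one line,
starting from a bound of f - ζQ one line higher. -/
theorem exists_line_bound {ζ η : ℝ → ℝ} (hζ : IsCutoff (1 / 8) (1 / 4) ζ) (hη : IsCutoff 1 2 η)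
    (N N₁ : ℕ) {B c₀ β e m a ℓ : ℝ} (hc0 : 0 ≤ c₀) (hc : c₀ < Real.pi / 2) (hβ : 1 ≤ β) (hβB : β ≤ B)
    (hβ2 : 1 / 2 ≤ |β - 2|) (he : 0 ≤ e) (hm : 0 ≤ m) (ha : 0 ≤ a) (hℓ0 : 0 ≤ ℓ) (hℓ : ℓ ≤ m + 1)
    (hE : e - 1 + (m + 1) - ℓ ≤ a) :
    ∃ C : ℝ, 0 ≤ C ∧ ∀ {ε w M : ℝ} {P g : ℝ × ℝ → ℝ} {q : Fin 3 → ℕ → ℕ → ℝ} {v v' : ℝ → ℝ}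
      {κ : ℕ → ℝ} {h : ℝ → ℂ} {A : ℝ≥0∞}, 0 < ε → ε ≤ 1 → 0 ≤ w → 0 ≤ M → B * Real.arctan ε ≤ c₀ →
      ContDiffOn ℝ 2 P wedgeBar → (∀ x, 0 < x → dY P (x, 0) = 0) → A ≠ ⊤ →
      (∀ φ ∈ Ioo 0 (Real.arctan ε), ∫⁻ u, ENNReal.ofReal
        (|P (polarPt ε (-Real.log (Real.cos (Real.arctan ε))) u φ)| * Real.exp (-|u|)) ≤ A) →
      (∀ s u, ∀ φ ∈ Ioo 0 (Real.arctan ε), Real.exp (2 * (u + s)) *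
          (dX (dX P) (polarPt ε s u φ) + (1 / ε) ^ 2 * dY (dY P) (polarPt ε s u φ))
        = Real.exp (2 * (u + s)) * g (polarPt ε s u φ)
          + sourceSum (sourceFactor ζ η) N q (anglePar ε s φ) u) →
      (∀ j a b, |q j a b| ≤ M) → (∀ n, |κ n| ≤ M) → (∀ u, HasDerivAt v (v' u) u) → Continuous v' →
      (∀ u, P (Real.exp u, Real.exp u) = Real.exp (-u) * v' u + expSum (deriv ζ) N₁ κ u) →
      wedgeHom ε w a ℓ (β - 2) g < ENNReal.ofReal M →
      IsFT (expWeight (β + 1) v) h → lineNorm ε (e + 2) (m + 1) (β + 1) h ≤ ENNReal.ofReal M →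
      ∃ S T, IsFT (expWeight β fun u => Real.exp u *
          (dX P (Real.exp u, Real.exp u) + dY P (Real.exp u, Real.exp u))) S ∧
        lineNorm ε e m β S ≤ ENNReal.ofReal (C * M) ∧
        IsFT (expWeight β fun u => Real.exp u * ((1 / ε) ^ 2 * dY P (Real.exp u, Real.exp u))) T ∧
        lineNorm ε e m β T ≤ ENNReal.ofReal (C * M) := by
  obtain ⟨C₁, hC₁0, h₁⟩ := exists_lineNorm_boundary ζ η hζ hη N hc0 hc hβ hβB hβ2 he hm ha hℓ0 hℓ hE
  obtain ⟨C₂, hC₂0, h₂⟩ := exists_lineNorm_dirichlet hζ N₁ he hm hβ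
  refine ⟨C₁ * (C₂ + 1), by positivity, fun {ε w M P g q v v' κ h A} hε hε1 hw hM hB hP hN hA hgrow hlap
    hq hκ hv hv' hdiag hg hh hhM => ?_⟩
  obtain ⟨H, hH, hHM⟩ := exists_lineSupNorm_le_of_wedgeHom_lt hε hw hg
  obtain ⟨Dh, hD, hDM⟩ := h₂ hε hε1 hM hκ hv hv' hh hhM
  have hMM : M ≤ (C₂ + 1) * M := le_mul_of_one_le_left hM (by linarith)
  have hDM' : lineNorm ε (e + 1) (m + 1) β Dh ≤ ENNReal.ofReal ((C₂ + 1) * M) :=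
    hDM.trans (ENNReal.ofReal_le_ofReal (by linarith))
  simp only [← hdiag] at hD
  have := h₁ (M := (C₂ + 1) * M) hε hε1 (by positivity) hB hP hN hA hgrow (hlap _)
    (fun j a b => (hq j a b).trans hMM) hH (hHM.trans (ENNReal.ofReal_le_ofReal hMM)) hD hDM'
  simpa only [← mul_assoc] using this

/-! ### Decompositions -/

/-- The norm is an infimum over polynomials and representatives, so a strict upper bound is what
allows one of each to be selected. Raising the index by one adds 3 to the degree bound. -/
theorem exists_of_xNorm_lt {ζ f : ℝ → ℝ} {ε k M : ℝ} (hk : 1 ≤ k) (hM : 0 ≤ M)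
    (hf : xNorm ζ ε (k + 1) f < ENNReal.ofReal M) : ∃ (Q : Polynomial ℝ) (h : ℝ → ℂ),
      (∀ n, ⌈3 * k - 1 / 2⌉₊ + 3 ≤ n → Q.coeff n = 0) ∧ polyNorm Q ≤ M ∧
      eLpNorm (expWeight (-1 / 2) fun u => f (Real.exp u) - ζ (Real.exp u) * Q.eval (Real.exp u)) 2
        volume ≤ ENNReal.ofReal M ∧
      IsFT (expWeight (3 * k + 5 / 2) fun u => f (Real.exp u) - ζ (Real.exp u) * Q.eval (Real.exp u)) h ∧
      lineNorm ε (3 * k + 4) (k + 1) (3 * k + 5 / 2) h ≤ ENNReal.ofReal M := by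
  unfold xNorm at hf
  simp only [iInf_lt_iff] at hf
  obtain ⟨Q, hQ, hlt⟩ := hf
  have hX : xHom ε (k + 1) (fun x => f x - ζ x * Q.eval x) < ENNReal.ofReal M :=
    lt_of_le_of_lt le_add_self hlt
  unfold xHom at hX
  simp only [iInf_lt_iff] at hX
  obtain ⟨h, hh, hlth⟩ := hX
  have e1 : 3 * (k + 1) - 1 / 2 = 3 * k + 5 / 2 := by ring
  have e2 : 3 * (k + 1) + 1 = 3 * k + 4 := by ring
  rw [e1, e2] at hlth
  rw [e1] at hh
  have hceil : ⌈3 * (k + 1) - 1 / 2⌉₊ = ⌈3 * k - 1 / 2⌉₊ + 3 := by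
    rw [show 3 * (k + 1) - 1 / 2 = 3 * k - 1 / 2 + (3 : ℕ) by push_cast; ring,
      Nat.ceil_add_natCast (by linarith)]
  rw [hceil] at hQ
  refine ⟨Q, h, fun n hn => ?_, ?_, ?_, isMellinOn_iff.1 hh, hlth.le⟩
  · exact Polynomial.coeff_eq_zero_of_degree_lt
      ((Polynomial.mem_degreeLT.1 hQ).trans_le (by exact_mod_cast hn))
  · exact (ENNReal.ofReal_le_ofReal_iff hM).1 ((le_self_add.trans le_self_add).trans hlt.le)
  · have h1 := eLpNorm_Ioi_eq fun x => f x - ζ x * Q.eval x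
    rw [logWeight_eq] at h1
    rw [← h1]
    exact (le_add_self.trans le_self_add).trans hlt.le

theorem exists_of_zNorm_lt {η : ℝ → ℝ} {g : ℝ × ℝ → ℝ} {ε w k M : ℝ} (hM : 0 ≤ M)
    (hg : zNorm η ε w (k + 1) g < ENNReal.ofReal M) : ∃ R : MvPolynomial (Fin 2) ℝ,
      DegLT ⌈3 * k - 1 / 2⌉₊ R ∧ polyNorm₂ R ≤ M ∧ ∀ ℓ ∈ Icc (2 / 3) (k + 1),
        wedgeHom ε w (3 * ℓ - 2) ℓ (3 * ℓ - 7 / 2) (subPoly η ε R g) < ENNReal.ofReal M := by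
  unfold zNorm at hg
  simp only [iInf_lt_iff] at hg
  obtain ⟨R, hR, hlt⟩ := hg
  rw [show 3 * (k + 1) - 7 / 2 = 3 * k - 1 / 2 by ring] at hR
  refine ⟨R, hR, (ENNReal.ofReal_le_ofReal_iff hM).1 (le_self_add.trans hlt.le), fun ℓ hℓ => ?_⟩
  exact lt_of_le_of_lt ((le_iSup₂ (f := fun ℓ (_ : ℓ ∈ Icc (2 / 3) (k + 1)) =>
    wedgeHom ε w (3 * ℓ - 2) ℓ (3 * ℓ - 7 / 2) (subPoly η ε R g)) ℓ hℓ).trans le_add_self) hlt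

/-- The angle of the strip, for the parameters of the theorem. -/
theorem exists_angle_bound {k : ℝ} (hk : 1 ≤ k) : ∃ c₀ : ℝ, 0 ≤ c₀ ∧ c₀ < Real.pi / 2 ∧
    ∀ ε ∈ Ioo 0 (Real.pi / (3 * (2 * k + 1))), ε ≤ 1 ∧ (3 * k + 3 / 2) * Real.arctan ε ≤ c₀ ∧
      ∀ n < ⌈3 * k - 1 / 2⌉₊ + 2, n * Real.arctan ε ≤ c₀ := by
  have hpos : 0 < Real.pi / (3 * (2 * k + 1)) := by have := Real.pi_pos; positivity
  -- The largest line times the angle at the end of the range of ε. It is below π/2 because arctan t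
  -- < t and (3k + 3/2) π / (3(2k+1)) = π/2.
  refine ⟨(3 * k + 3 / 2) * Real.arctan (Real.pi / (3 * (2 * k + 1))),
    mul_nonneg (by linarith) (Real.arctan_pos.2 hpos).le, ?_, fun ε hε => ?_⟩
  · calc (3 * k + 3 / 2) * Real.arctan (Real.pi / (3 * (2 * k + 1)))
        < (3 * k + 3 / 2) * (Real.pi / (3 * (2 * k + 1))) := by
          gcongr
          exact (Real.lt_tan (Real.arctan_pos.2 hpos) (Real.arctan_lt_pi_div_two _)).trans_eq
            (Real.tan_arctan _)
      _ = Real.pi / 2 := by field_simp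
  · have h1 := Real.arctan_pos.2 hε.1
    have h2 : Real.arctan ε ≤ Real.arctan (Real.pi / (3 * (2 * k + 1))) :=
      Real.arctan_strictMono.monotone hε.2.le
    refine ⟨hε.2.le.trans ?_, by gcongr, fun n hn => ?_⟩
    · rw [div_le_one (by positivity)]
      linarith [Real.pi_lt_four]
    -- The largest degree ⌈3k - 1/2⌉ + 1 is less than 3k + 3/2, so the polynomial problem needs no
    -- further restriction of the angle.
    · have h3 : (n : ℝ) ≤ ⌈3 * k - 1 / 2⌉₊ + 1 := by exact_mod_cast Nat.lt_succ_iff.1 hn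
      have h4 := Nat.ceil_lt_add_one (a := 3 * k - 1 / 2) (by linarith)
      have h5 : (n : ℝ) ≤ 3 * k + 3 / 2 := by linarith
      gcongr

/-- The derivatives on the side `y = x` of a solution corrected by a polynomial. -/
theorem exists_boundary_bounds {ζ η : ℝ → ℝ} (hζ : IsCutoff (1 / 8) (1 / 4) ζ) (hη : IsCutoff 1 2 η)
    {k ℓ e δ : ℝ} (hk : 1 ≤ k) (hℓ : 5 / 6 ≤ ℓ) (hℓ1 : ℓ ≤ 1) (he : 0 ≤ e) (heℓ : e ≤ 4 * ℓ - 2)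
    (hδ : 0 < δ) (hE : e + 3 + δ ≤ (4 * k + 5) * (ℓ / (k + 1))) :
    ∃ C : ℝ, 0 ≤ C ∧ ∀ {ε w M : ℝ} {f : ℝ → ℝ} {g p : ℝ × ℝ → ℝ},
      ε ∈ Ioo 0 (Real.pi / (3 * (2 * k + 1))) → w ∈ Icc (0 : ℝ) (1 / 2) → 0 ≤ M →
      IsWedgeSolution ε f g p → yNorm ζ ε w k p < ⊤ → xNorm ζ ε (k + 1) f < ENNReal.ofReal M →
      zNorm η ε w (k + 1) g < ENNReal.ofReal M →
      ∃ (c : ℕ → ℕ → ℝ) (E F : ℝ → ℝ) (S₁ T₁ S₂ T₂ : ℝ → ℂ),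
        DegBelow (⌈3 * k - 1 / 2⌉₊ + 2) c ∧
        (∀ n, |∑ d ∈ Finset.HasAntidiagonal.antidiagonal n, c d.1 d.2| ≤ C * M) ∧
        (∀ a b, |coeffX c a b| ≤ C * M) ∧ (∀ a b, |(1 / ε) ^ 2 * coeffY c a b| ≤ C * M) ∧
        (∀ a, coeffY c a 0 = 0) ∧
        (E = fun u => Real.exp u *
          ((1 / ε) ^ 2 * dY (subBiPoly ζ (⌈3 * k - 1 / 2⌉₊ + 2) c p) (Real.exp u, Real.exp u))) ∧
        (F = fun u => Real.exp u * (dX (subBiPoly ζ (⌈3 * k - 1 / 2⌉₊ + 2) c p) (Real.exp u, Real.exp u)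
          + dY (subBiPoly ζ (⌈3 * k - 1 / 2⌉₊ + 2) c p) (Real.exp u, Real.exp u))) ∧
        IsFT (expWeight (3 * ℓ - 3 / 2) F) S₁ ∧
        lineNorm ε e 0 (3 * ℓ - 3 / 2) S₁ ≤ ENNReal.ofReal (C * M) ∧
        IsFT (expWeight (3 * ℓ - 3 / 2) E) T₁ ∧
        lineNorm ε e 0 (3 * ℓ - 3 / 2) T₁ ≤ ENNReal.ofReal (C * M) ∧
        IsFT (expWeight (3 * k + 3 / 2) F) S₂ ∧
        lineNorm ε (3 * k + 2) k (3 * k + 3 / 2) S₂ ≤ ENNReal.ofReal (C * M) ∧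
        IsFT (expWeight (3 * k + 3 / 2) E) T₂ ∧
        lineNorm ε (3 * k + 2) k (3 * k + 3 / 2) T₂ ≤ ENNReal.ofReal (C * M) := by
  obtain ⟨c₀, hc0, hc, hang⟩ := exists_angle_bound hk
  set N := ⌈3 * k - 1 / 2⌉₊ with hN
  obtain ⟨K, hK1, hcorr⟩ := exists_correction η hζ.smooth N hc hc0
  have hk1 : 0 < k + 1 := by linarith
  have ht0 : 0 ≤ ℓ / (k + 1) := by positivity
  have ht1 : ℓ / (k + 1) ≤ 1 := by rw [div_le_one hk1]; linarith
  have htk : (k + 1) * (ℓ / (k + 1)) = ℓ := by field_simp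
  -- With t = ℓ/(k+1) the line between -1/2 and 3k + 5/2 is 3ℓ - 1/2, one above the line on which
  -- the boundary derivatives are wanted; the power μ^{k+1} becomes μ^ℓ with ℓ ≤ 1.
  have hline : (1 - ℓ / (k + 1)) * (-1 / 2) + ℓ / (k + 1) * (3 * k + 5 / 2) = 3 * ℓ - 3 / 2 + 1 := by
    linear_combination 3 * htk
  obtain ⟨K₁, hK₁0, hint⟩ := exists_lineNorm_interpolation (βa := -1 / 2) (βb := 3 * k + 5 / 2)
    (t := ℓ / (k + 1)) (p := 3 * k + 4) (q := k + 1) (δ := δ) (E := e + 2) (by linarith) ht0 ht1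
    (by rw [hline]; linarith) (by linarith) hk1.le hδ (by rw [htk]; exact hℓ1)
    (by linear_combination hE)
  rw [hline] at hint
  -- The range 5/6 ≤ ℓ ≤ 1 is dictated by this line: β = 3ℓ - 3/2 must be at least 1 and β - 2 at
  -- most -1/2. The source allows e ≤ 4ℓ - 2.
  obtain ⟨L₁, hL₁0, hlow⟩ := exists_line_bound hζ hη (N + 2) (N + 3) (B := 3 * k + 3 / 2) (β := 3 * ℓ - 3 / 2)
    (e := e) (m := 0) (a := 3 * ℓ - 2) (ℓ := ℓ) hc0 hc (by linarith) (by linarith)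
    (by rw [abs_of_nonpos (by linarith)]; linarith) he le_rfl (by linarith) (by linarith) (by linarith)
    (by linarith)
  -- On the upper line the exponents fit without loss: the top norms of f and g, with index k + 1,
  -- are used directly.
  obtain ⟨L₂, hL₂0, hhigh⟩ := exists_line_bound hζ hη (N + 2) (N + 3) (B := 3 * k + 3 / 2)
    (β := 3 * k + 3 / 2) (e := 3 * k + 2) (m := k) (a := 3 * (k + 1) - 2) (ℓ := k + 1) hc0 hc
    (by linarith) le_rfl (by rw [abs_of_nonneg (by linarith)]; linarith) (by linarith) (by linarith)
    (by linarith) (by linarith) le_rfl (by linarith)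
  refine ⟨K + (L₁ + L₂) * (K + K₁), by positivity,
    fun {ε w M f g p} hε hw hM hp hpY hf hg => ?_⟩
  obtain ⟨hε1, hB, hnang⟩ := hang ε hε
  obtain ⟨Q, h, hQ, hQM, hL2, hft, hhM⟩ := exists_of_xNorm_lt hk hM hf
  obtain ⟨R, hR, hRM, hRg⟩ := exists_of_zNorm_lt hM hg
  obtain ⟨c, v', hcd, hcb, hcx, hcy, hcy0, hcq, hNeu, hlap, hv, hv', hdiag⟩ :=
    hcorr hε.1 hε1 hnang hM hp hQ hQM hR hRM
  obtain ⟨A, hA, hgrow⟩ := exists_growth_bound hζ hε.1 hw.1 hk hpY (N + 2) c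
    (-Real.log (Real.cos (Real.arctan ε)))
  have hvc : Continuous fun u => f (Real.exp u) - ζ (Real.exp u) * Q.eval (Real.exp u) :=
    continuous_iff_continuousAt.2 fun u => (hv u).continuousAt
  obtain ⟨h₁, hft₁, hh₁M⟩ := hint hε.1 hM (continuous_expWeight hvc).aestronglyMeasurable hL2 hft hhM
  have hMK : M ≤ (K + K₁) * M := le_mul_of_one_le_left hM (by linarith)
  have hKM : K * M ≤ (K + K₁) * M := by gcongr; linarith
  have hq : ∀ j a b, |(![mvCoeff R, coeffX c, c] : Fin 3 → ℕ → ℕ → ℝ) j a b| ≤ (K + K₁) * M :=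
    fun j a b => by
      fin_cases j
      · exact ((abs_mvCoeff_le R a b).trans hRM).trans hMK
      · exact (hcx a b).trans hKM
      · exact (hcb a b).trans hKM
  have hκ : ∀ n, |Q.coeff n| ≤ (K + K₁) * M := fun n =>
    ((abs_coeff_le_polyNorm Q n).trans hQM).trans hMK
  have hP := contDiffOn_subBiPoly hζ.smooth (N + 2) c hp.regular
  have hM' : 0 ≤ (K + K₁) * M := by positivity
  obtain ⟨S₁, T₁, hS₁, hS₁M, hT₁, hT₁M⟩ := hlow (w := w) hε.1 hε1 hw.1 hM' hB hP hNeu hA hgrow hlap hq hκ hv hv'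
    hdiag (by
      rw [show 3 * ℓ - 3 / 2 - 2 = 3 * ℓ - 7 / 2 by ring]
      exact (hRg ℓ ⟨by linarith, by linarith⟩).trans_le (ENNReal.ofReal_le_ofReal hMK)) hft₁
    (by rw [zero_add]; exact hh₁M.trans (ENNReal.ofReal_le_ofReal (by gcongr; linarith)))
  obtain ⟨S₂, T₂, hS₂, hS₂M, hT₂, hT₂M⟩ := hhigh (w := w) hε.1 hε1 hw.1 hM' hB hP hNeu hA hgrow hlap hq hκ hv hv'
    hdiag (by
      rw [show 3 * k + 3 / 2 - 2 = 3 * (k + 1) - 7 / 2 by ring]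
      exact (hRg (k + 1) ⟨by linarith, le_rfl⟩).trans_le (ENNReal.ofReal_le_ofReal hMK))
    (by rw [show 3 * k + 3 / 2 + 1 = 3 * k + 5 / 2 by ring]; exact hft)
    (by
      rw [show 3 * k + 3 / 2 + 1 = 3 * k + 5 / 2 by ring, show 3 * k + 2 + 2 = 3 * k + 4 by ring]
      exact hhM.trans (ENNReal.ofReal_le_ofReal hMK))
  have hx : K * M ≤ (K + (L₁ + L₂) * (K + K₁)) * M := by
    gcongr
    exact le_add_of_nonneg_right (by positivity)
  have hx₁ : ENNReal.ofReal (L₁ * ((K + K₁) * M)) ≤ ENNReal.ofReal ((K + (L₁ + L₂) * (K + K₁)) * M) := by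
    refine ENNReal.ofReal_le_ofReal ?_
    have : 0 ≤ K * M := by positivity
    have : 0 ≤ L₂ * ((K + K₁) * M) := by positivity
    linarith
  have hx₂ : ENNReal.ofReal (L₂ * ((K + K₁) * M)) ≤ ENNReal.ofReal ((K + (L₁ + L₂) * (K + K₁)) * M) := by
    refine ENNReal.ofReal_le_ofReal ?_
    have : 0 ≤ K * M := by positivity
    have : 0 ≤ L₁ * ((K + K₁) * M) := by positivity
    linarith
  exact ⟨c, _, _, S₁, T₁, S₂, T₂, hcd, fun n => (hcq n).trans hx, fun a b => (hcx a b).trans hx,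
    fun a b => (hcy a b).trans hx, hcy0, rfl, rfl, hS₁, hS₁M.trans hx₁, hT₁, hT₁M.trans hx₁,
    hS₂, hS₂M.trans hx₂, hT₂, hT₂M.trans hx₂⟩

/-! ### The traces of the derivatives -/

theorem exists_hasDerivAt_exp_mul_diag {q : ℝ × ℝ → ℝ} (hq : ContDiffOn ℝ 1 q wedgeBar) :
    ∃ G' : ℝ → ℝ, (∀ u, HasDerivAt (fun u => Real.exp u * q (Real.exp u, Real.exp u)) (G' u) u) ∧
      Continuous G' := by
  have hmem : ∀ u : ℝ, ((Real.exp u, Real.exp u) : ℝ × ℝ) ∈ wedgeBar := fun u =>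
    ⟨Real.exp_pos u, (Real.exp_pos u).le, le_rfl⟩
  have hdiag : Continuous fun u : ℝ => ((Real.exp u, Real.exp u) : ℝ × ℝ) := by fun_prop
  have h0 := hq.continuousOn.comp_continuous hdiag hmem
  have h1 := (contDiffOn_dX (m := 0) hq (by norm_num)).continuousOn.comp_continuous hdiag hmem
  have h2 := (contDiffOn_dY (m := 0) hq (by norm_num)).continuousOn.comp_continuous hdiag hmem
  refine ⟨fun u => Real.exp u * q (Real.exp u, Real.exp u) + Real.exp u *
    ((dX q (Real.exp u, Real.exp u) + dY q (Real.exp u, Real.exp u)) * Real.exp u), fun u => ?_, ?_⟩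
  · exact (Real.hasDerivAt_exp u).mul
      ((hasDerivAt_diag hq (by norm_num) (Real.exp_pos u)).comp u (Real.hasDerivAt_exp u))
  · exact (Real.continuous_exp.mul h0).add
      (Real.continuous_exp.mul ((h1.add h2).mul Real.continuous_exp))

section

variable {ζ : ℝ → ℝ} {N : ℕ} {c : ℕ → ℕ → ℝ} {p : ℝ × ℝ → ℝ} {ε x : ℝ}

theorem dY_diag_eq (hζ : ContDiff ℝ ∞ ζ) (hc : DegBelow (N + 2) c) (hp : ContDiffOn ℝ 2 p wedgeBar)
    (hx : 0 < x) : (1 / ε) ^ 2 * dY p (x, x)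
      = (Real.exp (Real.log x) * ((1 / ε) ^ 2 * dY (subBiPoly ζ (N + 2) c p)
          (Real.exp (Real.log x), Real.exp (Real.log x)))) / x
        + ζ x * ∑ n ∈ Finset.range (N + 1),
          (∑ d ∈ Finset.HasAntidiagonal.antidiagonal n, (1 / ε) ^ 2 * coeffY c d.1 d.2) * x ^ n := by
  rw [Real.exp_log hx, dY_subBiPoly hζ hc hp ⟨hx, hx.le, le_rfl⟩]
  have h := biPoly_diag_pred (N := N + 1) hc.coeffY_pred x
  simp only [← Finset.mul_sum, mul_assoc] at h ⊢
  rw [← h]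
  field_simp
  ring

theorem dX_diag_eq (hζ : ContDiff ℝ ∞ ζ) (hc : DegBelow (N + 2) c) (hp : ContDiffOn ℝ 2 p wedgeBar)
    (hx : 0 < x) : dX p (x, x)
      = (Real.exp (Real.log x) * dX (subBiPoly ζ (N + 2) c p)
          (Real.exp (Real.log x), Real.exp (Real.log x))) / x
        + deriv ζ x * ∑ n ∈ Finset.range (N + 2),
          (∑ d ∈ Finset.HasAntidiagonal.antidiagonal n, c d.1 d.2) * x ^ n
        + ζ x * ∑ n ∈ Finset.range (N + 1),
          (∑ d ∈ Finset.HasAntidiagonal.antidiagonal n, coeffX c d.1 d.2) * x ^ n := by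
  rw [Real.exp_log hx, dX_subBiPoly hζ hc hp ⟨hx, hx.le, le_rfl⟩, ← biPoly_diag hc,
    ← biPoly_diag_pred (N := N + 1) hc.coeffX_pred]
  field_simp
  ring

end

/-- Without a constant term the polynomial is O(x) near 0, which is at most x^γ there; for x > 1 the
cut-off vanishes. -/
theorem abs_cutoff_mul_sum_le {ζ : ℝ → ℝ} (hζ : IsCutoff (1 / 8) (1 / 4) ζ) {Z A x γ : ℝ}
    (hZ0 : 0 ≤ Z) (hZ : ∀ r, |ζ r| ≤ Z) {N : ℕ} {a : ℕ → ℝ} (ha0 : a 0 = 0) (hA : 0 ≤ A)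
    (ha : ∀ n, |a n| ≤ A) (hx : 0 < x) (hγ : γ ≤ 1) :
    |ζ x * ∑ n ∈ Finset.range N, a n * x ^ n| ≤ Z * (N * A) * x ^ γ := by
  rcases le_or_gt x 1 with h | h
  · have hxγ : x ≤ x ^ γ := by
      calc x = x ^ (1 : ℝ) := (Real.rpow_one x).symm
        _ ≤ x ^ γ := Real.rpow_le_rpow_of_exponent_ge hx h hγ
    have hs : |∑ n ∈ Finset.range N, a n * x ^ n| ≤ N * (A * x ^ γ) := by
      refine (Finset.abs_sum_le_sum_abs _ _).trans ((Finset.sum_le_card_nsmul _ _ (A * x ^ γ) ?_).trans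
        (by rw [Finset.card_range, nsmul_eq_mul]))
      intro n _
      rw [abs_mul, abs_of_nonneg (pow_nonneg hx.le n)]
      rcases Nat.eq_zero_or_pos n with rfl | hn
      · rw [ha0, abs_zero, zero_mul]; positivity
      · exact mul_le_mul (ha n) ((pow_le_of_le_one hx.le h hn.ne').trans hxγ) (by positivity) hA
    rw [abs_mul]
    calc |ζ x| * |∑ n ∈ Finset.range N, a n * x ^ n| ≤ Z * (N * (A * x ^ γ)) :=
          mul_le_mul (hZ x) hs (abs_nonneg _) hZ0
      _ = _ := by ring
  · rw [hζ.eq_zero x (by linarith), zero_mul, abs_zero]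
    positivity

/-- For e > 1/2 the transform of ε⁻² x p_y, after correction, is integrable on Re λ = 3ℓ - 3/2, so
this function is O(x^{3ℓ - 3/2}); division by x gives the exponent 3ℓ - 5/2. The polynomial part has
no constant term since the coefficients of y vanish. -/
theorem exists_pointwise_bound {ζ η : ℝ → ℝ} (hζ : IsCutoff (1 / 8) (1 / 4) ζ) (hη : IsCutoff 1 2 η)
    {k ℓ e δ : ℝ} (hk : 1 ≤ k) (hℓ : 5 / 6 ≤ ℓ) (hℓ1 : ℓ ≤ 1) (he : 1 / 2 < e) (heℓ : e ≤ 4 * ℓ - 2)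
    (hδ : 0 < δ) (hE : e + 3 + δ ≤ (4 * k + 5) * (ℓ / (k + 1))) :
    ∃ C : ℝ, 0 ≤ C ∧ ∀ {ε w M : ℝ} {f : ℝ → ℝ} {g p : ℝ × ℝ → ℝ},
      ε ∈ Ioo 0 (Real.pi / (3 * (2 * k + 1))) → w ∈ Icc (0 : ℝ) (1 / 2) → 0 ≤ M →
      IsWedgeSolution ε f g p → yNorm ζ ε w k p < ⊤ → xNorm ζ ε (k + 1) f < ENNReal.ofReal M →
      zNorm η ε w (k + 1) g < ENNReal.ofReal M →
      ∀ x, 0 < x → (1 / ε) ^ 2 * |dY p (x, x)| ≤ C * x ^ (3 * ℓ - 5 / 2) * M := by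
  obtain ⟨C, hC0, hC⟩ := exists_boundary_bounds hζ hη hk hℓ hℓ1 (by linarith : 0 ≤ e) heℓ hδ hE
  obtain ⟨K, hK0, hK⟩ := exists_integral_norm_le (β := 3 * ℓ - 3 / 2) he (by linarith)
  obtain ⟨Z, hZ0, hZ⟩ := hζ.exists_bound
  set N := ⌈3 * k - 1 / 2⌉₊ with hN
  refine ⟨K * C + Z * ((N + 1 : ℕ) * ((N + 2 : ℕ) * C)), by positivity,
    fun {ε w M f g p} hε hw hM hp hpY hf hg x hx => ?_⟩
  obtain ⟨c, E, F, S₁, T₁, S₂, T₂, hc, -, -, hcy, hcy0, hEdef, -, -, -, hT₁, hT₁M, -⟩ :=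
    hC hε hw hM hp hpY hf hg
  obtain ⟨hI, hIle⟩ := hK hε.1 (by positivity) hT₁.memLp_right.1 hT₁M
  have hP := contDiffOn_subBiPoly hζ.smooth (N + 2) c hp.regular
  obtain ⟨G', hG', -⟩ := exists_hasDerivAt_exp_mul_diag
    (q := fun z => (1 / ε) ^ 2 * dY (subBiPoly ζ (N + 2) c p) z)
    (contDiffOn_const.mul (contDiffOn_dY (m := 1) hP (by norm_num)))
  have hEc : Continuous E := by
    rw [hEdef]; exact continuous_iff_continuousAt.2 fun u => (hG' u).continuousAt
  have h1 := (hT₁.continuous_bound (continuous_expWeight hEc) hI (Real.log x)).trans hIle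
  have h2 : |E (Real.log x) / x| ≤ K * (C * M) * x ^ (3 * ℓ - 5 / 2) := by
    rw [expWeight, Complex.norm_real, Real.norm_eq_abs, abs_mul, Real.abs_exp] at h1
    have e1 : Real.exp (-(3 * ℓ - 3 / 2) * Real.log x) = x ^ (-(3 * ℓ - 3 / 2)) := by
      rw [Real.rpow_def_of_pos hx]; congr 1; ring
    rw [e1] at h1
    rw [abs_div, abs_of_pos hx]
    have e2 : x ^ (3 * ℓ - 5 / 2) * x ^ (-(3 * ℓ - 3 / 2)) = x⁻¹ := by
      rw [← Real.rpow_add hx, ← Real.rpow_neg_one]; congr 1; ring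
    have hx0 := Real.rpow_nonneg hx.le (3 * ℓ - 5 / 2)
    calc |E (Real.log x)| / x
        = x ^ (3 * ℓ - 5 / 2) * (x ^ (-(3 * ℓ - 3 / 2)) * |E (Real.log x)|) := by
          rw [← mul_assoc, e2]; ring
      _ ≤ x ^ (3 * ℓ - 5 / 2) * (K * (C * M)) := mul_le_mul_of_nonneg_left h1 hx0
      _ = _ := by ring
  have hd : DegBelow (N + 2) fun a b => (1 / ε) ^ 2 * coeffY c a b := fun a b hab => by
    simp only [hc.coeffY a b hab, mul_zero]
  have h3 := abs_cutoff_mul_sum_le hζ hZ0 hZ (N := N + 1) (γ := 3 * ℓ - 5 / 2) (x := x)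
    (a := fun n => ∑ d ∈ Finset.HasAntidiagonal.antidiagonal n, (1 / ε) ^ 2 * coeffY c d.1 d.2)
    (by simp [hcy0]) (by positivity) (abs_sum_antidiagonal_le hd (by positivity) hcy) hx (by linarith)
  have h4 := dY_diag_eq (ε := ε) hζ.smooth hc hp.regular hx
  have h5 : E (Real.log x) = Real.exp (Real.log x) * ((1 / ε) ^ 2 * dY (subBiPoly ζ (N + 2) c p)
      (Real.exp (Real.log x), Real.exp (Real.log x))) := by rw [hEdef]
  rw [← h5] at h4
  calc (1 / ε) ^ 2 * |dY p (x, x)| = |(1 / ε) ^ 2 * dY p (x, x)| := by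
        rw [abs_mul, abs_of_nonneg (sq_nonneg (1 / ε))]
    _ ≤ _ := by rw [h4]; exact abs_add_le _ _
    _ ≤ _ := add_le_add h2 h3
    _ = _ := by ring

theorem exists_xNorm_bound {ζ η : ℝ → ℝ} (hζ : IsCutoff (1 / 8) (1 / 4) ζ) (hη : IsCutoff 1 2 η)
    {k : ℝ} (hk : 1 ≤ k) :
    ∃ C : ℝ, 0 ≤ C ∧ ∀ {ε w M : ℝ} {f : ℝ → ℝ} {g p : ℝ × ℝ → ℝ},
      ε ∈ Ioo 0 (Real.pi / (3 * (2 * k + 1))) → w ∈ Icc (0 : ℝ) (1 / 2) → 0 ≤ M →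
      IsWedgeSolution ε f g p → yNorm ζ ε w k p < ⊤ → xNorm ζ ε (k + 1) f < ENNReal.ofReal M →
      zNorm η ε w (k + 1) g < ENNReal.ofReal M →
      xNorm ζ ε k (deriv fun x => dX p (x, x))
        + ENNReal.ofReal ((1 / ε) ^ 2) * xNorm ζ ε k (deriv fun x => dY p (x, x))
          ≤ ENNReal.ofReal (C * M) := by
  have hk1 : 0 < k + 1 := by linarith
  -- Here (4k + 5)/(k + 1) = 4 + 1/(k + 1): after e + 3 = 4 exactly 1/(k + 1) is left for the loss
  -- δ. The line is 3/2.
  obtain ⟨C, hC0, hC⟩ := exists_boundary_bounds hζ hη (ℓ := 1) (e := 1) (δ := 1 / (k + 1)) hk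
    (by norm_num) le_rfl zero_le_one (by norm_num) (by positivity)
    (le_of_eq (by field_simp; ring))
  obtain ⟨X, hX0, hX⟩ := exists_xNorm_deriv_le hζ hk
  obtain ⟨_, -, hang⟩ := exists_angle_bound hk
  set N := ⌈3 * k - 1 / 2⌉₊ with hN
  have hN2 : (1 : ℝ) ≤ (N + 2 : ℕ) := by push_cast; linarith [Nat.cast_nonneg (α := ℝ) N]
  refine ⟨X * ((N + 6 : ℕ) * C) + X * ((N + 6 : ℕ) * C), by positivity,
    fun {ε w M f g p} hε hw hM hp hpY hf hg => ?_⟩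
  have hε1 := (hang.2 ε hε).1
  have hε0 := hε.1
  obtain ⟨c, E, F, S₁, T₁, S₂, T₂, hc, hκ, hcx, hcy, -, hEdef, hFdef, hS₁, hS₁M, hT₁, hT₁M, hS₂, hS₂M,
    hT₂, hT₂M⟩ := hC hε hw hM hp hpY hf hg
  rw [show (3 * 1 - 3 / 2 : ℝ) = 3 / 2 by norm_num] at hS₁ hS₁M hT₁ hT₁M
  have hCM : 0 ≤ C * M := by positivity
  set A : ℝ := (N + 6 : ℕ) * (C * M) with hA
  have hA1 : C * M ≤ A := le_mul_of_one_le_left hCM (by push_cast; linarith [Nat.cast_nonneg (α := ℝ) N])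
  have hA2 : (N + 2 : ℕ) * (C * M) ≤ A := by
    rw [hA]; gcongr; omega
  have hA4 : 4 * (C * M) ≤ A := by
    rw [hA]; gcongr; push_cast; linarith [Nat.cast_nonneg (α := ℝ) N]
  have hA1' := ENNReal.ofReal_le_ofReal hA1
  have hP := contDiffOn_subBiPoly hζ.smooth (N + 2) c hp.regular
  have hPx := contDiffOn_dX (m := 1) hP (by norm_num)
  have hPy := contDiffOn_dY (m := 1) hP (by norm_num)
  have hdx : DegBelow (N + 2) (coeffX c) := hc.coeffX
  have hdy : DegBelow (N + 2) fun a b => (1 / ε) ^ 2 * coeffY c a b := fun a b hab => by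
    simp only [hc.coeffY a b hab, mul_zero]
  have hx : xNorm ζ ε k (deriv fun x => dX p (x, x)) ≤ ENNReal.ofReal (X * A) := by
    obtain ⟨G', hG', hG'c⟩ := exists_hasDerivAt_exp_mul_diag hPx
    -- The trace of p_x needs no estimate of its own: it is the tangential derivative minus ε² times
    -- ε⁻² p_y.
    have hGeq : ∀ u, Real.exp u * dX (subBiPoly ζ (N + 2) c p) (Real.exp u, Real.exp u)
        = F u - ε ^ 2 * E u := fun u => by
      rw [hFdef, hEdef]; field_simp; ring
    have hcomb : ∀ {β e m : ℝ} {S T : ℝ → ℂ}, 0 ≤ e → 0 ≤ m → IsFT (expWeight β F) S →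
        lineNorm ε e m β S ≤ ENNReal.ofReal (C * M) → IsFT (expWeight β E) T →
        lineNorm ε e m β T ≤ ENNReal.ofReal (C * M) →
        IsFT (expWeight β fun u => Real.exp u * dX (subBiPoly ζ (N + 2) c p) (Real.exp u, Real.exp u))
          (fun ξ => S ξ + ((-1 : ℝ) : ℂ) * (((ε ^ 2 : ℝ) : ℂ) * T ξ)) ∧
        lineNorm ε e m β (fun ξ => S ξ + ((-1 : ℝ) : ℂ) * (((ε ^ 2 : ℝ) : ℂ) * T ξ))
          ≤ ENNReal.ofReal A := by
      intro β e m S T he hm hS hSM hT hTM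
      refine ⟨(hS.add ((hT.const_mul _).const_mul _)).congr (.of_forall fun u => ?_) .rfl, ?_⟩
      · simp only [expWeight, hGeq]
        push_cast; ring
      · refine (lineNorm_add_le hε0 (Or.inl he) hm hS.memLp_right.1).trans ?_
        have h1 : lineNorm ε e m β (fun ξ => ((-1 : ℝ) : ℂ) * (((ε ^ 2 : ℝ) : ℂ) * T ξ))
            ≤ ENNReal.ofReal 1 * lineNorm ε e m β T := by
          refine lineNorm_le_of_norm_le zero_le_one fun ξ => ?_
          have hw := powWeight_nonneg (p := e) (q := m) hε0 (norm_nonneg (linePt β ξ))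
          rw [one_mul, norm_mul, norm_mul, Complex.norm_real, Complex.norm_real,
            Real.norm_of_nonneg (by positivity : 0 ≤ ε ^ 2)]
          refine mul_le_mul_of_nonneg_left ?_ hw
          rw [norm_neg, norm_one, one_mul]
          exact mul_le_of_le_one_left (norm_nonneg _) (pow_le_one₀ hε0.le hε1)
        rw [ENNReal.ofReal_one, one_mul] at h1
        refine (mul_le_mul' le_rfl (add_le_add hSM (h1.trans hTM))).trans ?_
        rw [← ENNReal.ofReal_add hCM hCM, show (2 : ℝ≥0∞) = ENNReal.ofReal 2 by simp,
          ← ENNReal.ofReal_mul (by norm_num)]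
        exact ENNReal.ofReal_le_ofReal (by linarith)
    have l1 := hcomb zero_le_one le_rfl hS₁ hS₁M hT₁ hT₁M
    have l2 := hcomb (by linarith) (by linarith) hS₂ hS₂M hT₂ hT₂M
    exact hX (a := fun n => ∑ d ∈ Finset.HasAntidiagonal.antidiagonal n, coeffX c d.1 d.2) hε0 hε1
      (fun n => (abs_sum_antidiagonal_le hdx hCM hcx n).trans hA2) (fun n => (hκ n).trans hA1)
      (fun x hx => dX_diag_eq hζ.smooth hc hp.regular hx) hG' hG'c l1.1 l1.2 l2.1 l2.2
  have hy : xNorm ζ ε k (deriv fun x => (1 / ε) ^ 2 * dY p (x, x)) ≤ ENNReal.ofReal (X * A) := by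
    obtain ⟨G', hG', hG'c⟩ := exists_hasDerivAt_exp_mul_diag
      (q := fun z => (1 / ε) ^ 2 * dY (subBiPoly ζ (N + 2) c p) z) (contDiffOn_const.mul hPy)
    rw [hEdef] at hT₁ hT₂
    refine hX (a := fun n => ∑ d ∈ Finset.HasAntidiagonal.antidiagonal n, (1 / ε) ^ 2 * coeffY c d.1 d.2)
      (κ := 0) hε0 hε1 (fun n => (abs_sum_antidiagonal_le hdy hCM hcy n).trans hA2)
      (fun n => by simp only [Pi.zero_apply, abs_zero]; positivity) (fun x hx => ?_) hG' hG'c hT₁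
      (hT₁M.trans hA1') hT₂ (hT₂M.trans hA1')
    rw [dY_diag_eq hζ.smooth hc hp.regular hx]
    simp
  have hy' : ENNReal.ofReal ((1 / ε) ^ 2) * xNorm ζ ε k (deriv fun x => dY p (x, x))
      ≤ ENNReal.ofReal (X * A) := by
    have e1 : (deriv fun x => dY p (x, x)) = fun x => ε ^ 2 * deriv (fun x => (1 / ε) ^ 2 * dY p (x, x)) x := by
      funext x
      rw [deriv_const_mul_field]
      field_simp
    have h1 := xNorm_const_mul_le (ζ := ζ) (ε := ε) (k := k) (c := ε ^ 2) (by positivity)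
      (deriv fun x => (1 / ε) ^ 2 * dY p (x, x))
    rw [e1]
    refine (mul_le_mul' le_rfl h1).trans ?_
    rw [← mul_assoc, ← ENNReal.ofReal_mul (by positivity),
      show (1 / ε) ^ 2 * ε ^ 2 = 1 by field_simp, ENNReal.ofReal_one, one_mul]
    exact hy
  refine (add_le_add hx hy').trans ?_
  rw [← ENNReal.ofReal_add (by positivity) (by positivity)]
  exact ENNReal.ofReal_le_ofReal (le_of_eq (by rw [hA]; ring))

/-! ### Conclusion -/

/-- Passage from strict bounds by a real M to the norms themselves: M is taken slightly above the
sum of the two. If that sum is infinite, C > 0 makes the right side infinite. -/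
theorem le_ofReal_mul_add {X x z : ℝ≥0∞} {C : ℝ} (hC : 0 < C)
    (h : ∀ M : ℝ, 0 ≤ M → x < ENNReal.ofReal M → z < ENNReal.ofReal M → X ≤ ENNReal.ofReal (C * M)) :
    X ≤ ENNReal.ofReal C * (x + z) := by
  rcases eq_or_ne (x + z) ⊤ with hS | hS
  · rw [hS, ENNReal.mul_top (by simpa using hC)]; exact le_top
  · refine ENNReal.le_of_forall_pos_le_add fun δ hδ _ => ?_
    have hδC : 0 < (δ : ℝ) / C := by positivity
    have hlt : x + z < ENNReal.ofReal ((x + z).toReal + δ / C) := by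
      rw [ENNReal.lt_ofReal_iff_toReal_lt hS]; linarith
    refine (h ((x + z).toReal + δ / C) (by positivity) (le_self_add.trans_lt hlt)
      (le_add_self.trans_lt hlt)).trans ?_
    rw [mul_add, mul_div_cancel₀ _ hC.ne', ENNReal.ofReal_add (by positivity) (by positivity),
      ENNReal.ofReal_mul hC.le, ENNReal.ofReal_toReal hS, ENNReal.ofReal_coe_nnreal]

theorem lemma6p6 (ζ η : ℝ → ℝ) (hζ : IsCutoff (1 / 8) (1 / 4) ζ) (hη : IsCutoff 1 2 η)
    (k : ℝ) (hk : 1 ≤ k) :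
    ∃ C : ℝ≥0, ∀ ε ∈ Ioo 0 (Real.pi / (3 * (2 * k + 1))), ∀ w ∈ Icc (0 : ℝ) (1 / 2),
      ∀ (f : ℝ → ℝ) (g p : ℝ × ℝ → ℝ), IsWedgeSolution ε f g p → yNorm ζ ε w k p < ⊤ →
        (xNorm ζ ε k (deriv fun x => dX p (x, x))
            + ENNReal.ofReal ((1 / ε) ^ 2) * xNorm ζ ε k (deriv fun x => dY p (x, x))
          ≤ C * (xNorm ζ ε (k + 1) f + zNorm η ε w (k + 1) g)) ∧
        (∀ x, 0 < x → ENNReal.ofReal ((1 / ε) ^ 2 * |dY p (x, x)|)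
          ≤ C * ENNReal.ofReal (Real.sqrt x) * (xNorm ζ ε (k + 1) f + zNorm η ε w (k + 1) g)) ∧
        (k < 4 → ∀ x, 0 < x → ENNReal.ofReal ((1 / ε) ^ 2 * |dY p (x, x)|)
          ≤ C * (xNorm ζ ε (k + 1) f + zNorm η ε w (k + 1) g)) := by
  have hk1 : 0 < k + 1 := by linarith
  obtain ⟨C₁, hC₁0, h₁⟩ := exists_xNorm_bound hζ hη hk
  obtain ⟨C₂, hC₂0, h₂⟩ := exists_pointwise_bound hζ hη (ℓ := 1) (e := 1) (δ := 1 / (k + 1)) hk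
    (by norm_num) le_rfl (by norm_num) (by norm_num) (by positivity) (le_of_eq (by field_simp; ring))
  obtain ⟨C₃, hC₃0, h₃⟩ : ∃ C : ℝ, 0 ≤ C ∧ (k < 4 → ∀ {ε w M : ℝ} {f : ℝ → ℝ} {g p : ℝ × ℝ → ℝ},
      ε ∈ Ioo 0 (Real.pi / (3 * (2 * k + 1))) → w ∈ Icc (0 : ℝ) (1 / 2) → 0 ≤ M →
      IsWedgeSolution ε f g p → yNorm ζ ε w k p < ⊤ → xNorm ζ ε (k + 1) f < ENNReal.ofReal M →
      zNorm η ε w (k + 1) g < ENNReal.ofReal M →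
      ∀ x, 0 < x → (1 / ε) ^ 2 * |dY p (x, x)| ≤ C * M) := by
    by_cases hk4 : k < 4
    -- For ℓ = 5/6 the available power is 10/3 + (5/6)/(k+1), and e + 3 + δ with e > 1/2 must fit
    -- below it. This is possible if and only if (5/6)/(k+1) > 1/6, that is k < 4; half of the
    -- surplus goes to e and half to δ.
    · have hd : 1 / 6 < 5 / 6 / (k + 1) := by rw [lt_div_iff₀ hk1]; linarith
      have hd2 : 5 / 6 / (k + 1) ≤ 5 / 12 := by rw [div_le_iff₀ hk1]; linarith
      have hs : (4 * k + 5) * (5 / 6 / (k + 1)) = 10 / 3 + 5 / 6 / (k + 1) := by field_simp; ring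
      obtain ⟨C, hC0, h⟩ := exists_pointwise_bound hζ hη (ℓ := 5 / 6)
        (e := 1 / 2 + (5 / 6 / (k + 1) - 1 / 6) / 2) (δ := (5 / 6 / (k + 1) - 1 / 6) / 2) hk le_rfl
        (by norm_num) (by linarith) (by linarith) (by linarith) (by rw [hs]; linarith)
      refine ⟨C, hC0, fun _ {ε w M f g p} hε hw hM hp hpY hf hg x hx => ?_⟩
      have := h hε hw hM hp hpY hf hg x hx
      rwa [show (3 * (5 / 6) - 5 / 2 : ℝ) = 0 by norm_num, Real.rpow_zero, mul_one] at this
    · exact ⟨0, le_rfl, fun h => absurd h hk4⟩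
  set C : ℝ := C₁ + C₂ + C₃ + 1 with hC
  have hC0 : 0 < C := by positivity
  refine ⟨C.toNNReal, fun ε hε w hw f g p hp hpY => ⟨?_, fun x hx => ?_, fun hk4 x hx => ?_⟩⟩
  · refine le_ofReal_mul_add hC0 fun M hM hf hg => (h₁ hε hw hM hp hpY hf hg).trans ?_
    exact ENNReal.ofReal_le_ofReal (by gcongr; linarith)
  · have hs : 0 < Real.sqrt x := Real.sqrt_pos.2 hx
    have := le_ofReal_mul_add (X := ENNReal.ofReal ((1 / ε) ^ 2 * |dY p (x, x)|))
      (x := xNorm ζ ε (k + 1) f) (z := zNorm η ε w (k + 1) g) (C := C * Real.sqrt x) (by positivity)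
      fun M hM hf hg => by
        have h := h₂ hε hw hM hp hpY hf hg x hx
        rw [show (3 * 1 - 5 / 2 : ℝ) = 1 / 2 by norm_num, ← Real.sqrt_eq_rpow] at h
        refine ENNReal.ofReal_le_ofReal (h.trans ?_)
        gcongr; linarith
    rwa [ENNReal.ofReal_mul hC0.le] at this
  · refine le_ofReal_mul_add hC0 fun M hM hf hg => ENNReal.ofReal_le_ofReal
      ((h₃ hk4 hε hw hM hp hpY hf hg x hx).trans ?_)
    gcongr; linarith

end
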